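/- Let $S$ be a superscheme over $\mathbb C$ and let $0\to\mathcal O_S\to\mathcal H\to\mathcal V\to 0$ be a Heisenberg extension of a symplectic super vector bundle $\mathcal V$: $\mathcal H$ is a bundle of Lie superalgebras in which $\mathcal O_S$ is central and the commutator is induced by the symplectic form of $\mathcal V$. Let $U(\mathcal H)$ be the enveloping algebra of $\mathcal H$ over $\mathcal O_S$ modulo $1_{\mathcal H}=1$. Let $\nabla$ be a Heisenberg flat connection on $\mathcal H$, that is, a flat connection compatible with the bracket and restricting to the standard connection on $\mathcal O_S$. An isotropic subbundle of $\mathcal H$ is a graded submodule which projects isomorphically onto a subbundle of $\mathcal V$ and on which the bracket vanishes. For an isotropic subbundle $J\subset\mathcal H$ let $\mathfrak c(J)$ be its centralizer, $\overline{\mathcal H}_J=\mathfrak c(J)/J$, $M^r_{\mathcal H}(J)=U(\mathcal H)/J\,U(\mathcal H)$, $M_{\mathcal H}(J)=U(\mathcal H)/U(\mathcal H)J$, and let $\mathcal A_{\mathcal H,\nabla,J}$ be the Lie algebroid of first order differential operators $D$ on $M^r_{\mathcal H}(J)$ with symbol $\sigma(D)\in\mathcal T_S$ such that $D(mx)=D(m)x+(-1)^{\bar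 D\bar m}m\nabla_{\sigma(D)}(x)$ for $x\in\mathcal H$ and $[D,\mathfrak c(J)/J]\subset\mathfrak c(J)/J$, where $\mathfrak c(J)/J$ acts on $M^r_{\mathcal H}(J)$ by left multiplication. For a left $U(\mathcal H)$-module $M$ with a flat connection compatible with the action of $\mathcal H$, the derived coinvariants $C_J(M)=M^r_{\mathcal H}(J)\otimes^{L}_{U(\mathcal H)}M$ are computed by the Koszul complex $\Lambda^\bullet J\otimes M$, and they are lifted to the derived category of $\mathcal A_{\mathcal H,\nabla,J}$-modules by means of the bar resolution $B_\bullet\to M$, with $B_n=U(\mathcal H)^{\otimes_{\mathcal O}(n+1)}\otimes_{\mathcal O}M$ carrying the induced connections, and the action $D(m_1\otimes m_2)=D(m_1)\otimes m_2+(-1)^{\bar D\bar m_1}m_1\otimes\nabla_{\sigma(D)}(m_2)$ on $M^r_{\mathcal H}(J)\otimes_{U(\mathcal H)}B_n$. Let $I\subset\mathcal H$ be an isotropic subbundle preserved by $\nabla$, and equip $\overline{\mathcal H}_I=\mathfrak c(I)/I$ with the induced connection, again denoted by $\nabla$. Let $J\subset\mathcal H$ be an isotropic subbundle with $\mathfrak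 c(I)+J=\mathcal H$, and let $\overline J\subset\overline{\mathcal H}_I$ be the image of $J\cap\mathfrak c(I)$ (which maps isomorphically to it). (i) There is an isomorphism $M^r_{\overline{\mathcal H}_I}(\overline J)\simeq M^r_{\mathcal H}(J)\otimes_{U(\mathfrak c(I))}U(\overline{\mathcal H}_I)$, sending the class of $u$ to $1\otimes u$, and in terms of it the rule $$D\mapsto\bigl(m\otimes h\mapsto D(m)\otimes h+(-1)^{\bar D\bar m}m\otimes\nabla_{\sigma(D)}(h)\bigr)$$ defines an isomorphism of Lie algebroids $\mathcal A_{\mathcal H,\nabla,J}\to\mathcal A_{\overline{\mathcal H}_I,\nabla,\overline J}$. (ii) Let $M$ be a left $U(\mathcal H)$-module with a flat connection compatible with the action of $\mathcal H$, such that $I$ acts locally nilpotently on $M$. Then the map of Koszul complexes $\Lambda^\bullet(J\cap\mathfrak c(I))\otimes M^I\to\Lambda^\bullet J\otimes M$ induced by the inclusions gives an isomorphism $C_{\overline J}(M^I)\to C_J(M)$ in the derived category of $\mathcal O_S$-modules, and this isomorphism lifts to an isomorphism in the derived category of $\mathcal A_{\mathcal H,\nabla,J}$-modules, where $C_{\overline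 J}(M^I)$ is viewed as an object of this category through the isomorphism of (i). In particular, if $J'\supset I$ is an isotropic subbundle of $\mathcal H$ preserved by $\nabla$, then $I$ acts locally nilpotently on $M=M_{\mathcal H}(J')$ (so that the above applies), and there is an isomorphism $M_{\overline{\mathcal H}_I}(J'/I)\simeq M_{\mathcal H}(J')^I$ of $U(\overline{\mathcal H}_I)$-modules with connections, sending the class of $1$ to the class of $1$. -/

import Mathlib

open CategoryTheory AlgebraicGeometry
open scoped TensorProduct

universe u

noncomputable section

namespace SuperHeis

/-- The sign `(-1)^p` of a parity `p`. -/
def sg (p : ZMod 2) : ℤ := if p = 0 then 1 else -1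

theorem zmod2_cases (p : ZMod 2) : p = 0 ∨ p = 1 := by revert p; decide

@[simp] theorem sg_zero : sg 0 = 1 := by decide
@[simp] theorem sg_one : sg 1 = -1 := by decide

theorem sg_add (p q : ZMod 2) : sg (p + q) = sg p * sg q := by revert p q; decide
theorem sg_sq (p : ZMod 2) : sg p * sg p = 1 := by revert p; decide
theorem sg_comm (p q : ZMod 2) : sg (p * q) = sg (q * p) := by rw [mul_comm]

/-- `twist t p` is the `p`-th power of the parity involution `t`: on a homogeneous element `x`
it is multiplication by the Koszul sign `(-1)^(p * parity x)`. -/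
def twist {G : Type*} [AddCommGroup G] (t : G →+ G) (p : ZMod 2) : G →+ G :=
  if p = 0 then AddMonoidHom.id G else t

@[simp] theorem twist_zero {G : Type*} [AddCommGroup G] (t : G →+ G) :
    twist t 0 = AddMonoidHom.id G := by simp [twist]
@[simp] theorem twist_one {G : Type*} [AddCommGroup G] (t : G →+ G) :
    twist t 1 = t := by simp [twist]

/-- A superscheme over `ℂ`: a scheme `X` (the even part of the structure sheaf) together with a
quasi-coherent sheaf `O` of supercommutative `ℂ`-algebras on `X`, given on the affine opens,
whose even part is the structure sheaf of `X`. Throughout, a `ℤ/2`-grading is recorded by its parity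
involution `par` (`1` on even elements, `-1` on odd ones), which is equivalent as `2` is invertible. -/
structure SuperScheme where
  X : Scheme.{u}
  O : X.affineOpens → Type u
  [ring : ∀ U, Ring (O U)]
  [alg : ∀ U, Algebra ℂ (O U)]
  par : ∀ U, O U →ₐ[ℂ] O U
  par_par : ∀ U f, par U (par U f) = f
  supercomm : ∀ U (p q : ZMod 2) (f g : O U), par U f = sg p • f → par U g = sg q • g →
    f * g = sg (p * q) • (g * f)
  res : ∀ {U V : X.affineOpens}, V ≤ U → (O U →ₐ[ℂ] O V)
  res_id : ∀ U f, res (le_refl U) f = f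
  res_res : ∀ {U V W : X.affineOpens} (h : V ≤ U) (k : W ≤ V) f,
    res k (res h f) = res (k.trans h) f
  res_par : ∀ {U V : X.affineOpens} (h : V ≤ U) f, res h (par U f) = par V (res h f)
  even : ∀ U : X.affineOpens, Γ(X, U) →+* O U
  even_injective : ∀ U, Function.Injective (even U)
  even_range : ∀ U f, par U f = f ↔ f ∈ (even U).range
  res_even : ∀ {U V : X.affineOpens} (h : V ≤ U) (a : Γ(X, U)),
    res h (even U a) = even V (X.presheaf.map (homOfLE h).op a)
  loc_surj : ∀ (U : X.affineOpens) (a : Γ(X, U)) (g : O (X.affineBasicOpen a)),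
    ∃ (n : ℕ) (f : O U), res (X.affineBasicOpen_le a) (even U a ^ n) * g =
      res (X.affineBasicOpen_le a) f
  loc_inj : ∀ (U : X.affineOpens) (a : Γ(X, U)) (f : O U), res (X.affineBasicOpen_le a) f = 0 →
    ∃ n : ℕ, even U a ^ n * f = 0

attribute [instance] SuperScheme.ring SuperScheme.alg

namespace SuperScheme

variable (S : SuperScheme.{u})

/-- The affine open subsets, a basis of the topology. -/
abbrev Aff := S.X.affineOpens

abbrev tw {U : S.Aff} (p : ZMod 2) : S.O U →+ S.O U := twist (S.par U).toRingHom.toAddMonoidHom p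

/-- `f` is homogeneous of parity `p`. -/
abbrev Homog {U : S.Aff} (p : ZMod 2) (f : S.O U) : Prop := S.par U f = sg p • f

def half (U : S.Aff) : S.O U := algebraMap ℂ (S.O U) (1 / 2)

end SuperScheme

variable {S : SuperScheme.{u}}

@[simp] theorem par_half (U : S.Aff) : S.par U (S.half U) = S.half U := by
  simp [SuperScheme.half]
@[simp] theorem res_half {U V : S.Aff} (h : V ≤ U) : S.res h (S.half U) = S.half V := by
  simp only [SuperScheme.half, AlgHom.commutes]

theorem half_add_half (U : S.Aff) : S.half U + S.half U = 1 := by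
  rw [SuperScheme.half, ← map_add]; norm_num

@[simp] theorem tw_apply_one {U : S.Aff} (f : S.O U) : S.tw 1 f = S.par U f := by simp
@[simp] theorem tw_apply_zero {U : S.Aff} (f : S.O U) : S.tw 0 f = f := by simp

theorem tw_mul {U : S.Aff} (p : ZMod 2) (f g : S.O U) : S.tw p (f * g) = S.tw p f * S.tw p g := by
  rcases zmod2_cases p with rfl | rfl <;> simp

theorem SuperScheme.Homog.mul {U : S.Aff} {p q : ZMod 2} {f g : S.O U} (hf : S.Homog p f)
    (hg : S.Homog q g) : S.Homog (p + q) (f * g) := by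
  unfold SuperScheme.Homog at *
  rw [map_mul, hf, hg, sg_add, smul_mul_smul_comm]

theorem SuperScheme.Homog.tw {U : S.Aff} {p : ZMod 2} {f : S.O U} (hf : S.Homog p f)
    (q : ZMod 2) : S.tw q f = sg (q * p) • f := by
  rcases zmod2_cases q with rfl | rfl <;> simp_all [SuperScheme.Homog]

theorem SuperScheme.Homog.res {U V : S.Aff} {p : ZMod 2} {f : S.O U} (hf : S.Homog p f)
    (h : V ≤ U) : S.Homog p (S.res h f) := by
  unfold SuperScheme.Homog at *
  rw [← S.res_par, hf, map_zsmul]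

/-- Supermodules: presheaves, on the basis of affine opens, of `ℤ/2`-graded left `O`-modules. -/
structure SMod (S : SuperScheme.{u}) where
  C : S.Aff → Type u
  [grp : ∀ U, AddCommGroup (C U)]
  [mod : ∀ U, Module (S.O U) (C U)]
  par : ∀ U, C U →+ C U
  par_par : ∀ U m, par U (par U m) = m
  par_smul : ∀ U (f : S.O U) m, par U (f • m) = S.par U f • par U m
  res : ∀ {U V : S.Aff}, V ≤ U → (C U →+ C V)
  res_id : ∀ U m, res (le_refl U) m = m
  res_res : ∀ {U V W : S.Aff} (h : V ≤ U) (k : W ≤ V) m, res k (res h m) = res (k.trans h) m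
  res_par : ∀ {U V : S.Aff} (h : V ≤ U) m, res h (par U m) = par V (res h m)
  res_smul : ∀ {U V : S.Aff} (h : V ≤ U) (f : S.O U) m, res h (f • m) = S.res h f • res h m

attribute [instance] SMod.grp SMod.mod

namespace SMod

abbrev tw (M : SMod S) {U : S.Aff} (p : ZMod 2) : M.C U →+ M.C U := twist (M.par U) p

/-- `m` is homogeneous of parity `p`. -/
abbrev Homog (M : SMod S) {U : S.Aff} (p : ZMod 2) (m : M.C U) : Prop := M.par U m = sg p • m

/-- Quasi-coherence: sections over a basic affine open are the localization. -/
def QCoh (M : SMod S) : Prop := ∀ (U : S.Aff) (a : Γ(S.X, U)),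
  (∀ m : M.C (S.X.affineBasicOpen a), ∃ (n : ℕ) (m' : M.C U),
    S.res (S.X.affineBasicOpen_le a) (S.even U a ^ n) • m = M.res (S.X.affineBasicOpen_le a) m') ∧
  (∀ m : M.C U, M.res (S.X.affineBasicOpen_le a) m = 0 → ∃ n : ℕ, S.even U a ^ n • m = 0)

/-- The homogeneous component of parity `p`. -/
def pr (M : SMod S) {U : S.Aff} (p : ZMod 2) : M.C U →+ M.C U where
  toFun m := S.half U • (m + sg p • M.par U m)
  map_zero' := by simp
  map_add' a b := by simp only [map_add, smul_add]; abel

variable (M : SMod S) {U V : S.Aff}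

theorem pr_apply (p : ZMod 2) (m : M.C U) : M.pr p m = S.half U • (m + sg p • M.par U m) := rfl

theorem pr_add_pr (m : M.C U) : M.pr 0 m + M.pr 1 m = m := by
  simp only [pr_apply, ← smul_add, sg_zero, sg_one, one_smul, neg_smul]
  have : m + M.par U m + (m + -M.par U m) = m + m := by abel
  rw [this, smul_add, ← add_smul, half_add_half, one_smul]

theorem pr_homog (p : ZMod 2) (m : M.C U) : M.Homog p (M.pr p m) := by
  rcases zmod2_cases p with rfl | rfl <;>
  simp [Homog, pr_apply, M.par_smul, M.par_par, add_comm, ← smul_neg]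

theorem Homog.pr_eq {M : SMod S} {p : ZMod 2} {m : M.C U} (h : M.Homog p m) (q : ZMod 2) :
    M.pr q m = if q = p then m else 0 := by
  have h2 : S.half U • m + S.half U • m = m := by rw [← add_smul, half_add_half, one_smul]
  unfold Homog at h
  rcases zmod2_cases p with rfl | rfl <;> rcases zmod2_cases q with rfl | rfl <;>
    simp [pr_apply, h, h2]

theorem homog_ind {P : M.C U → Prop} (hadd : ∀ a b, P a → P b → P (a + b))
    (h : ∀ p m, M.Homog p m → P m) (m : M.C U) : P m := by
  rw [← M.pr_add_pr m]
  exact hadd _ _ (h 0 _ (M.pr_homog 0 m)) (h 1 _ (M.pr_homog 1 m))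

theorem tw_tw (p : ZMod 2) (m : M.C U) : M.tw p (M.tw p m) = m := by
  rcases zmod2_cases p with rfl | rfl <;> simp [M.par_par]

theorem tw_add (p q : ZMod 2) (m : M.C U) : M.tw (p + q) m = M.tw p (M.tw q m) := by
  rcases zmod2_cases p with rfl | rfl <;> rcases zmod2_cases q with rfl | rfl <;> simp
  have : (1 + 1 : ZMod 2) = 0 := by decide
  simp [this, M.par_par]

theorem tw_smul (p : ZMod 2) (f : S.O U) (m : M.C U) : M.tw p (f • m) = S.tw p f • M.tw p m := by
  rcases zmod2_cases p with rfl | rfl <;> simp [M.par_smul]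

theorem par_tw (p : ZMod 2) (m : M.C U) : M.par U (M.tw p m) = M.tw p (M.par U m) := by
  rcases zmod2_cases p with rfl | rfl <;> simp

theorem res_tw (h : V ≤ U) (p : ZMod 2) (m : M.C U) : M.res h (M.tw p m) = M.tw p (M.res h m) := by
  rcases zmod2_cases p with rfl | rfl <;> simp [M.res_par]

theorem Homog.tw {M : SMod S} {p : ZMod 2} {m : M.C U} (h : M.Homog p m) (q : ZMod 2) :
    M.tw q m = sg (q * p) • m := by
  rcases zmod2_cases q with rfl | rfl <;> simp_all [Homog]

theorem Homog.res {M : SMod S} {p : ZMod 2} {m : M.C U} (hm : M.Homog p m) (h : V ≤ U) :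
    M.Homog p (M.res h m) := by
  unfold Homog at *
  rw [← M.res_par, hm, map_zsmul]

theorem Homog.par {M : SMod S} {p : ZMod 2} {m : M.C U} (hm : M.Homog p m) :
    M.Homog p (M.par U m) := by
  unfold Homog at *
  rw [hm, map_zsmul, hm]

theorem Homog.smul {M : SMod S} {p q : ZMod 2} {f : S.O U} {m : M.C U} (hf : S.Homog p f)
    (hm : M.Homog q m) : M.Homog (p + q) (f • m) := by
  unfold Homog SuperScheme.Homog at *
  rw [M.par_smul, hf, hm, sg_add]
  rcases zmod2_cases p with rfl | rfl <;> rcases zmod2_cases q with rfl | rfl <;> simp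

theorem pr_par (p : ZMod 2) (m : M.C U) : M.pr p (M.par U m) = M.par U (M.pr p m) := by
  simp [pr_apply, M.par_smul, M.par_par]

theorem pr_res (h : V ≤ U) (p : ZMod 2) (m : M.C U) : M.pr p (M.res h m) = M.res h (M.pr p m) := by
  simp [pr_apply, M.res_smul, M.res_par]

/-- Morphisms: even `O`-linear maps compatible with restrictions. -/
def homs (M N : SMod S) : AddSubgroup (∀ U, M.C U →+ N.C U) where
  carrier := {φ | (∀ U (f : S.O U) m, φ U (f • m) = f • φ U m) ∧
    (∀ U m, φ U (M.par U m) = N.par U (φ U m)) ∧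
    (∀ U V (h : V ≤ U) m, φ V (M.res h m) = N.res h (φ U m))}
  zero_mem' := by simp
  add_mem' {a b} ha hb := by
    refine ⟨fun U f m => ?_, fun U m => ?_, fun U V h m => ?_⟩
    · simp [ha.1, hb.1]
    · simp [ha.2.1, hb.2.1]
    · simp [ha.2.2, hb.2.2]
  neg_mem' {a} ha := by
    refine ⟨fun U f m => ?_, fun U m => ?_, fun U V h m => ?_⟩
    · simp [ha.1]
    · simp [ha.2.1]
    · simp [ha.2.2]

instance : Category (SMod S) where
  Hom M N := homs M N
  id M := ⟨fun U => AddMonoidHom.id _, by simp [homs]⟩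
  comp f g := ⟨fun U => (g.1 U).comp (f.1 U), by
    refine ⟨fun U a m => ?_, fun U m => ?_, fun U V h m => ?_⟩
    · simp [f.2.1, g.2.1]
    · simp [f.2.2.1, g.2.2.1]
    · simp [f.2.2.2, g.2.2.2]⟩

instance (M N : SMod S) : AddCommGroup (M ⟶ N) := inferInstanceAs (AddCommGroup (homs M N))

/-- The component of a morphism over an affine open. -/
def ap {M N : SMod S} (f : M ⟶ N) (U : S.Aff) : M.C U →+ N.C U := f.1 U

theorem hom_ext {M N : SMod S} {f g : M ⟶ N} (h : ∀ U m, ap f U m = ap g U m) : f = g :=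
  Subtype.ext (funext fun U => AddMonoidHom.ext (h U))

@[simp] theorem ap_id (M : SMod S) (m : M.C U) : ap (𝟙 M) U m = m := rfl
@[simp] theorem ap_comp {M N K : SMod S} (f : M ⟶ N) (g : N ⟶ K) (m : M.C U) :
    ap (f ≫ g) U m = ap g U (ap f U m) := rfl
@[simp] theorem ap_add {M N : SMod S} (f g : M ⟶ N) (m : M.C U) :
    ap (f + g) U m = ap f U m + ap g U m := rfl
@[simp] theorem ap_sub {M N : SMod S} (f g : M ⟶ N) (m : M.C U) :
    ap (f - g) U m = ap f U m - ap g U m := by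
  change (f - g : homs M N).1 U m = _
  rw [AddSubgroup.coe_sub]; rfl
@[simp] theorem ap_neg {M N : SMod S} (f : M ⟶ N) (m : M.C U) : ap (-f) U m = -ap f U m := rfl
@[simp] theorem ap_zero {M N : SMod S} (m : M.C U) : ap (0 : M ⟶ N) U m = 0 := rfl
theorem ap_smul {M N : SMod S} (f : M ⟶ N) (a : S.O U) (m : M.C U) :
    ap f U (a • m) = a • ap f U m := f.2.1 U a m
theorem ap_par {M N : SMod S} (f : M ⟶ N) (m : M.C U) :
    ap f U (M.par U m) = N.par U (ap f U m) := f.2.2.1 U m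
theorem ap_res {M N : SMod S} (f : M ⟶ N) (h : V ≤ U) (m : M.C U) :
    ap f V (M.res h m) = N.res h (ap f U m) := f.2.2.2 U V h m
theorem ap_tw {M N : SMod S} (f : M ⟶ N) (p : ZMod 2) (m : M.C U) :
    ap f U (M.tw p m) = N.tw p (ap f U m) := by
  rcases zmod2_cases p with rfl | rfl <;> simp [ap_par]
theorem ap_homog {M N : SMod S} (f : M ⟶ N) {p : ZMod 2} {m : M.C U} (hm : M.Homog p m) :
    N.Homog p (ap f U m) := by
  unfold Homog at *; rw [← ap_par, hm, map_zsmul]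
theorem ap_pr {M N : SMod S} (f : M ⟶ N) (p : ZMod 2) (m : M.C U) :
    ap f U (M.pr p m) = N.pr p (ap f U m) := by
  simp [pr_apply, ap_smul, ap_par]

instance : Preadditive (SMod S) where
  add_comp _ _ _ _ _ _ := hom_ext fun U m => by simp
  comp_add _ _ _ _ _ _ := hom_ext fun U m => by simp

/-- Graded subsheaves of `O`-modules. -/
structure Sub (M : SMod S) where
  C : ∀ U, Submodule (S.O U) (M.C U)
  par_mem : ∀ U m, m ∈ C U → M.par U m ∈ C U
  res_mem : ∀ {U V : S.Aff} (h : V ≤ U) m, m ∈ C U → M.res h m ∈ C V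

namespace Sub

variable {M} (N : Sub M)

theorem tw_mem (p : ZMod 2) {m : M.C U} (hm : m ∈ N.C U) : M.tw p m ∈ N.C U := by
  rcases zmod2_cases p with rfl | rfl <;> simp [hm, N.par_mem]

theorem pr_mem (p : ZMod 2) {m : M.C U} (hm : m ∈ N.C U) : M.pr p m ∈ N.C U :=
  (N.C U).smul_mem _ ((N.C U).add_mem hm (zsmul_mem (N.par_mem U m hm) _))

/-- A graded submodule as a supermodule. -/
def toSMod : SMod S where
  C U := N.C U
  par U := ((M.par U).comp (N.C U).toAddSubgroup.subtype).codRestrict (N.C U)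
    fun m => N.par_mem U m.1 m.2
  par_par U m := Subtype.ext (M.par_par U m.1)
  par_smul U f m := Subtype.ext (M.par_smul U f m.1)
  res {U V} h := ((M.res h).comp (N.C U).toAddSubgroup.subtype).codRestrict (N.C V)
    fun m => N.res_mem h m.1 m.2
  res_id U m := Subtype.ext (M.res_id U m.1)
  res_res h k m := Subtype.ext (M.res_res h k m.1)
  res_par h m := Subtype.ext (M.res_par h m.1)
  res_smul h f m := Subtype.ext (M.res_smul h f m.1)

/-- The inclusion. -/
def incl : N.toSMod ⟶ M := ⟨fun U => (N.C U).toAddSubgroup.subtype,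
  fun _ _ _ => rfl, fun _ _ => rfl, fun _ _ _ _ => rfl⟩

@[simp] theorem incl_ap (m : N.toSMod.C U) : ap N.incl U m = m.1 := rfl

/-- Quasi-coherence of a graded submodule of a quasi-coherent module. -/
def QCoh : Prop := ∀ (U : S.Aff) (a : Γ(S.X, U)) (m : M.C (S.X.affineBasicOpen a)),
  m ∈ N.C (S.X.affineBasicOpen a) → ∃ (n : ℕ) (m' : M.C U), m' ∈ N.C U ∧
    S.res (S.X.affineBasicOpen_le a) (S.even U a ^ n) • m = M.res (S.X.affineBasicOpen_le a) m'

/-- The graded submodule generated by a family of sets stable under parity and restriction. -/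
def gen (s : ∀ U, Set (M.C U)) (hp : ∀ U, ∀ m ∈ s U, M.par U m ∈ s U)
    (hr : ∀ {U V : S.Aff} (h : V ≤ U), ∀ m ∈ s U, M.res h m ∈ s V) : Sub M where
  C U := Submodule.span (S.O U) (s U)
  par_mem U m hm := by
    induction hm using Submodule.span_induction with
    | mem x h => exact Submodule.subset_span (hp U x h)
    | zero => simp
    | add x y _ _ hx hy => rw [map_add]; exact add_mem hx hy
    | smul a x _ hx => rw [M.par_smul]; exact Submodule.smul_mem _ _ hx
  res_mem {U V} h m hm := by
    induction hm using Submodule.span_induction with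
    | mem x hx => exact Submodule.subset_span (hr h x hx)
    | zero => simp
    | add x y _ _ hx hy => rw [map_add]; exact add_mem hx hy
    | smul a x _ hx => rw [M.res_smul]; exact Submodule.smul_mem _ _ hx

end Sub

/-- Descent of additive maps to quotients. -/
def qlift {R A B : Type*} [Ring R] [AddCommGroup A] [Module R A] [AddCommGroup B]
    (N : Submodule R A) (f : A →+ B) (h : ∀ a ∈ N, f a = 0) : A ⧸ N →+ B :=
  QuotientAddGroup.lift N.toAddSubgroup f h

@[simp] theorem qlift_mk {R A B : Type*} [Ring R] [AddCommGroup A] [Module R A] [AddCommGroup B]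
    (N : Submodule R A) (f : A →+ B) (h : ∀ a ∈ N, f a = 0) (a : A) :
    qlift N f h (Submodule.Quotient.mk a) = f a := rfl

def qmap {R R' A B : Type*} [Ring R] [Ring R'] [AddCommGroup A] [Module R A] [AddCommGroup B]
    [Module R' B] (N : Submodule R A) (N' : Submodule R' B) (f : A →+ B)
    (h : ∀ a ∈ N, f a ∈ N') : A ⧸ N →+ B ⧸ N' :=
  qlift N (N'.mkQ.toAddMonoidHom.comp f) fun a ha => by simpa using h a ha

@[simp] theorem qmap_mk {R R' A B : Type*} [Ring R] [Ring R'] [AddCommGroup A] [Module R A]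
    [AddCommGroup B] [Module R' B] (N : Submodule R A) (N' : Submodule R' B) (f : A →+ B)
    (h : ∀ a ∈ N, f a ∈ N') (a : A) :
    qmap N N' f h (Submodule.Quotient.mk a) = Submodule.Quotient.mk (f a) := rfl

/-- The quotient supermodule. -/
def quot (N : Sub M) : SMod S where
  C U := M.C U ⧸ N.C U
  par U := qmap _ _ (M.par U) (N.par_mem U)
  par_par U m := by
    obtain ⟨m, rfl⟩ := Submodule.Quotient.mk_surjective _ m
    simp [M.par_par]
  par_smul U f m := by
    obtain ⟨m, rfl⟩ := Submodule.Quotient.mk_surjective _ m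
    rw [← Submodule.Quotient.mk_smul, qmap_mk, M.par_smul]; rfl
  res h := qmap _ _ (M.res h) (N.res_mem h)
  res_id U m := by
    obtain ⟨m, rfl⟩ := Submodule.Quotient.mk_surjective _ m
    simp [M.res_id]
  res_res h k m := by
    obtain ⟨m, rfl⟩ := Submodule.Quotient.mk_surjective _ m
    simp [M.res_res]
  res_par h m := by
    obtain ⟨m, rfl⟩ := Submodule.Quotient.mk_surjective _ m
    simp [M.res_par]
  res_smul h f m := by
    obtain ⟨m, rfl⟩ := Submodule.Quotient.mk_surjective _ m
    rw [← Submodule.Quotient.mk_smul, qmap_mk, M.res_smul]; rfl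

/-- The projection to the quotient. -/
def proj (N : Sub M) : M ⟶ M.quot N := ⟨fun U => (N.C U).mkQ.toAddMonoidHom,
  fun _ _ _ => rfl, fun _ _ => rfl, fun _ _ _ _ => rfl⟩

variable {M}

theorem proj_surj (N : Sub M) (m : (M.quot N).C U) : ∃ m', ap (M.proj N) U m' = m :=
  Submodule.Quotient.mk_surjective _ m

theorem proj_eq_zero (N : Sub M) {m : M.C U} : ap (M.proj N) U m = 0 ↔ m ∈ N.C U :=
  Submodule.Quotient.mk_eq_zero _

theorem proj_zero (N : Sub M) {m : M.C U} (h : m ∈ N.C U) : ap (M.proj N) U m = 0 :=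
  (proj_eq_zero N).2 h

/-- Descent of an additive operator over an affine open to the quotient. -/
def qop {N : Sub M} {K : SMod S} {N' : Sub K} (α : M.C U →+ K.C V)
    (h : ∀ m ∈ N.C U, α m ∈ N'.C V) : (M.quot N).C U →+ (K.quot N').C V :=
  qmap _ _ α h

@[simp] theorem qop_proj {N : Sub M} {K : SMod S} {N' : Sub K} (α : M.C U →+ K.C V)
    (h : ∀ m ∈ N.C U, α m ∈ N'.C V) (m : M.C U) :
    qop α h (ap (M.proj N) U m) = ap (K.proj N') V (α m) := rfl

/-- Morphisms out of the quotient. -/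
def desc (N : Sub M) {K : SMod S} (f : M ⟶ K) (h : ∀ U, ∀ m ∈ N.C U, ap f U m = 0) :
    M.quot N ⟶ K :=
  ⟨fun U => qlift _ (ap f U) (h U), by
    refine ⟨fun U a m => ?_, fun U m => ?_, fun U V h m => ?_⟩ <;>
    obtain ⟨m, rfl⟩ := proj_surj N m
    · rw [← ap_smul]; exact ap_smul f a m
    · exact ap_par f m
    · exact ap_res f h m⟩

@[simp] theorem desc_proj (N : Sub M) {K : SMod S} (f : M ⟶ K)
    (h : ∀ U, ∀ m ∈ N.C U, ap f U m = 0) (m : M.C U) :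
    ap (desc N f h) U (ap (M.proj N) U m) = ap f U m := rfl

/-- `P ⊗_ℤ Q` over each affine open, with `O` acting on the left factor; the tensor products
below are quotients of it. -/
def ztens (P Q : SMod S) : SMod S where
  C U := P.C U ⊗[ℤ] Q.C U
  par U := (TensorProduct.map (P.par U).toIntLinearMap (Q.par U).toIntLinearMap).toAddMonoidHom
  par_par U m := by
    induction m using TensorProduct.induction_on with
    | zero => simp
    | tmul x y => simp [P.par_par, Q.par_par]
    | add x y hx hy => rw [map_add, map_add, hx, hy]
  par_smul U f m := by
    induction m using TensorProduct.induction_on with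
    | zero => simp
    | tmul x y => simp [TensorProduct.smul_tmul', P.par_smul]
    | add x y hx hy => rw [smul_add, map_add, hx, hy, map_add, smul_add]
  res h := (TensorProduct.map (P.res h).toIntLinearMap (Q.res h).toIntLinearMap).toAddMonoidHom
  res_id U m := by
    induction m using TensorProduct.induction_on with
    | zero => simp
    | tmul x y => simp [P.res_id, Q.res_id]
    | add x y hx hy => rw [map_add, hx, hy]
  res_res h k m := by
    induction m using TensorProduct.induction_on with
    | zero => simp
    | tmul x y => simp [P.res_res, Q.res_res]
    | add x y hx hy => simp only [map_add, hx, hy]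
  res_par h m := by
    induction m using TensorProduct.induction_on with
    | zero => simp
    | tmul x y => simp [P.res_par, Q.res_par]
    | add x y hx hy => simp only [map_add, hx, hy]
  res_smul h f m := by
    induction m using TensorProduct.induction_on with
    | zero => simp
    | tmul x y => simp [TensorProduct.smul_tmul', P.res_smul]
    | add x y hx hy => simp only [smul_add, map_add, hx, hy]

section ztens

variable {P Q P' Q' : SMod S}

/-- The pure tensor. -/
def zt (x : P.C U) (y : Q.C U) : (ztens P Q).C U := TensorProduct.tmul ℤ x y

theorem zt_ind {R : (ztens P Q).C U → Prop} (h0 : R 0) (h : ∀ x y, R (zt x y))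
    (hadd : ∀ a b, R a → R b → R (a + b)) (z) : R z :=
  TensorProduct.induction_on z h0 h hadd

theorem zt_add (x : P.C U) (y y' : Q.C U) : zt x (y + y') = zt x y + zt x y' :=
  TensorProduct.tmul_add _ _ _
theorem add_zt (x x' : P.C U) (y : Q.C U) : zt (x + x') y = zt x y + zt x' y :=
  TensorProduct.add_tmul _ _ _
theorem zt_zsmul (n : ℤ) (x : P.C U) (y : Q.C U) : zt x (n • y) = n • zt x y :=
  TensorProduct.tmul_smul _ _ _
theorem zsmul_zt (n : ℤ) (x : P.C U) (y : Q.C U) : zt (n • x) y = n • zt x y :=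
  (TensorProduct.smul_tmul' _ _ _).symm
theorem smul_zt (f : S.O U) (x : P.C U) (y : Q.C U) : zt (f • x) y = f • zt x y :=
  (TensorProduct.smul_tmul' _ _ _).symm
theorem par_zt (x : P.C U) (y : Q.C U) :
    (ztens P Q).par U (zt x y) = zt (P.par U x) (Q.par U y) := rfl
theorem res_zt (h : V ≤ U) (x : P.C U) (y : Q.C U) :
    (ztens P Q).res h (zt x y) = zt (P.res h x) (Q.res h y) := rfl
theorem tw_zt (p : ZMod 2) (x : P.C U) (y : Q.C U) :
    (ztens P Q).tw p (zt x y) = zt (P.tw p x) (Q.tw p y) := by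
  rcases zmod2_cases p with rfl | rfl <;> simp [par_zt]

/-- The operator `α ⊗ β` over an affine open. -/
def zmap (α : P.C U →+ P'.C V) (β : Q.C U →+ Q'.C V) : (ztens P Q).C U →+ (ztens P' Q').C V :=
  (TensorProduct.map α.toIntLinearMap β.toIntLinearMap).toAddMonoidHom

@[simp] theorem zmap_zt (α : P.C U →+ P'.C V) (β : Q.C U →+ Q'.C V) (x : P.C U) (y : Q.C U) :
    zmap α β (zt x y) = zt (α x) (β y) := rfl

/-- A biadditive map as an additive map on `P ⊗_ℤ Q`. -/
def zlift {G : Type*} [AddCommGroup G] (b : P.C U →+ Q.C U →+ G) : (ztens P Q).C U →+ G :=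
  TensorProduct.liftAddHom b fun n x y => by simp

@[simp] theorem zlift_zt {G : Type*} [AddCommGroup G] (b : P.C U →+ Q.C U →+ G) (x : P.C U)
    (y : Q.C U) : zlift b (zt x y) = b x y := by
  rfl

end ztens

end SMod

theorem tw_tw' {U : S.Aff} (p q : ZMod 2) (g : S.O U) : S.tw (p + q) g = S.tw p (S.tw q g) := by
  rcases zmod2_cases p with rfl | rfl <;> rcases zmod2_cases q with rfl | rfl <;> simp
  have : (1 + 1 : ZMod 2) = 0 := by decide
  simp [this, S.par_par]

theorem O_homog_ind {U : S.Aff} {P : S.O U → Prop} (hadd : ∀ a b, P a → P b → P (a + b))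
    (h : ∀ p f, S.Homog p f → P f) (g : S.O U) : P g := by
  have h1 : g = S.half U * (g + S.par _ g) + S.half U * (g - S.par _ g) := by
    have : S.half U * (g + S.par _ g) + S.half U * (g - S.par _ g) =
      (S.half U + S.half U) * g := by noncomm_ring
    rw [this, half_add_half, one_mul]
  rw [h1]
  refine hadd _ _ (h 0 _ ?_) (h 1 _ ?_)
  · simp [SuperScheme.Homog, S.par_par, add_comm]
  · simp [SuperScheme.Homog, S.par_par, ← mul_neg]

theorem mul_comm_tw {U : S.Aff} {p q : ZMod 2} {f : S.O U} (hf : S.Homog q f) (g : S.O U) :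
    f * S.tw p g = S.tw (q + p) g * f := by
  induction g using O_homog_ind with
  | hadd a b ha hb => rw [map_add, map_add, mul_add, add_mul, ha, hb]
  | h r g hg =>
    rw [hg.tw, hg.tw, mul_smul_comm, smul_mul_assoc, S.supercomm _ _ _ _ _ hf hg,
      smul_smul, add_mul, sg_add, mul_comm]

/-- Sections over `U` of the tangent sheaf that are homogeneous of parity `p`: compatible families
of `ℂ`-linear superderivations of `O` over the affine opens contained in `U`. -/
def VFsub (S : SuperScheme.{u}) (U : S.Aff) (p : ZMod 2) :
    AddSubgroup (∀ V : {V : S.Aff // V ≤ U}, S.O V.1 →+ S.O V.1) where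
  carrier := {v | ∀ V h, (∀ f g, v ⟨V, h⟩ (f * g) = v ⟨V, h⟩ f * g + S.tw p f * v ⟨V, h⟩ g) ∧
    (∀ f, v ⟨V, h⟩ (S.par V f) = sg p • S.par V (v ⟨V, h⟩ f)) ∧
    (∀ c : ℂ, v ⟨V, h⟩ (algebraMap ℂ _ c) = 0) ∧
    (∀ W (k : W ≤ V) f, S.res k (v ⟨V, h⟩ f) = v ⟨W, k.trans h⟩ (S.res k f))}
  zero_mem' := by simp
  add_mem' {a b} ha hb V h := by
    refine ⟨fun f g => ?_, fun f => ?_, fun c => ?_, fun W k f => ?_⟩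
    · simp only [Pi.add_apply, AddMonoidHom.add_apply, (ha V h).1, (hb V h).1]; noncomm_ring
    · simp [(ha V h).2.1, (hb V h).2.1]
    · simp [(ha V h).2.2.1, (hb V h).2.2.1]
    · simp [(ha V h).2.2.2 W k, (hb V h).2.2.2 W k]
  neg_mem' {a} ha V h := by
    refine ⟨fun f g => ?_, fun f => ?_, fun c => ?_, fun W k f => ?_⟩
    · simp only [Pi.neg_apply, AddMonoidHom.neg_apply, (ha V h).1]; noncomm_ring
    · simp [(ha V h).2.1]
    · simp [(ha V h).2.2.1]
    · simp [(ha V h).2.2.2 W k]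

/-- The vector fields on `U` of parity `p`. -/
def VF (S : SuperScheme.{u}) (U : S.Aff) (p : ZMod 2) : Type u := VFsub S U p

instance (U : S.Aff) (p : ZMod 2) : AddCommGroup (VF S U p) :=
  inferInstanceAs (AddCommGroup (VFsub S U p))

namespace VF

variable {U V W : S.Aff} {p q : ZMod 2}

/-- The derivation of `O` over `V ⊆ U` given by a vector field on `U`. -/
def ap (v : VF S U p) (h : V ≤ U) : S.O V →+ S.O V := v.1 ⟨V, h⟩

/-- The derivation of `O` over `U` itself. -/
abbrev top (v : VF S U p) : S.O U →+ S.O U := v.ap le_rfl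

theorem leib (v : VF S U p) (h : V ≤ U) (f g : S.O V) :
    v.ap h (f * g) = v.ap h f * g + S.tw p f * v.ap h g := (v.2 V h).1 f g
theorem par (v : VF S U p) (h : V ≤ U) (f : S.O V) :
    v.ap h (S.par _ f) = sg p • S.par _ (v.ap h f) := (v.2 V h).2.1 f
theorem const (v : VF S U p) (h : V ≤ U) (c : ℂ) : v.ap h (algebraMap ℂ _ c) = 0 :=
  (v.2 V h).2.2.1 c
theorem res_ap (v : VF S U p) (h : V ≤ U) (k : W ≤ V) (f : S.O V) :
    S.res k (v.ap h f) = v.ap (k.trans h) (S.res k f) := (v.2 V h).2.2.2 W k f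

/-- Restriction of vector fields. -/
def res (h : V ≤ U) : VF S U p →+ VF S V p where
  toFun v := ⟨fun W => v.1 ⟨W.1, W.2.trans h⟩, fun _ k => v.2 _ (k.trans h)⟩
  map_zero' := rfl
  map_add' _ _ := rfl

@[simp] theorem ap_res (v : VF S U p) (h : V ≤ U) (k : W ≤ V) : (res h v).ap k = v.ap (k.trans h) :=
  rfl

theorem tw_ap (v : VF S U p) (h : V ≤ U) (f : S.O V) (r : ZMod 2) :
    v.ap h (S.tw r f) = sg (r * p) • S.tw r (v.ap h f) := by
  rcases zmod2_cases r with rfl | rfl <;> simp [v.par]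

/-- The product of a homogeneous function and a vector field. -/
def smul (f : S.O U) (hf : S.Homog q f) (v : VF S U p) : VF S U (q + p) :=
  ⟨fun V => (AddMonoidHom.mulLeft (S.res V.2 f)).comp (v.1 V), fun V h => by
    have e : ∀ (W : S.Aff) (k : W ≤ U) g, ((AddMonoidHom.mulLeft (S.res k f)).comp (v.1 ⟨W, k⟩)) g =
      S.res k f * v.ap k g := fun _ _ _ => rfl
    refine ⟨fun g g' => ?_, fun g => ?_, fun c => ?_, fun W k g => ?_⟩
    · rw [e, e, e, v.leib, mul_add, ← mul_assoc, ← mul_assoc, mul_comm_tw (hf.res h), mul_assoc]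
      simp only [mul_assoc]
    · rw [e, e, v.par, map_mul, hf.res h, sg_add, smul_mul_assoc, smul_smul, mul_smul_comm,
        mul_comm (sg q), mul_assoc, sg_sq, mul_one]
    · rw [e, v.const, mul_zero]
    · rw [e, e, map_mul, S.res_res, v.res_ap]⟩

@[simp] theorem smul_ap (f : S.O U) (hf : S.Homog q f) (v : VF S U p) (h : V ≤ U) (g : S.O V) :
    (smul f hf v).ap h g = S.res h f * v.ap h g := rfl

/-- The supercommutator of vector fields. -/
def br (v : VF S U p) (w : VF S U q) : VF S U (p + q) :=
  ⟨fun V => (v.1 V).comp (w.1 V) - sg (p * q) • (w.1 V).comp (v.1 V), fun V h => by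
    have e : ∀ (W : S.Aff) (k : W ≤ U) g,
      ((v.1 ⟨W, k⟩).comp (w.1 ⟨W, k⟩) - sg (p * q) • (w.1 ⟨W, k⟩).comp (v.1 ⟨W, k⟩)) g =
      v.ap k (w.ap k g) - sg (p * q) • w.ap k (v.ap k g) := fun _ _ _ => rfl
    refine ⟨fun g g' => ?_, fun g => ?_, fun c => ?_, fun W k g => ?_⟩
    · simp only [e, v.leib, w.leib, map_add, smul_add, v.tw_ap, w.tw_ap, mul_comm q p]
      rw [← tw_tw', ← tw_tw' q p, add_comm q p]
      rcases zmod2_cases p with rfl | rfl <;> rcases zmod2_cases q with rfl | rfl <;>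
        simp <;> noncomm_ring
    · rw [e, e, w.par, v.par, map_zsmul, map_zsmul, v.par, w.par, map_sub, map_zsmul, smul_sub,
        sg_add]
      simp only [smul_smul]
      congr 2 <;> ring
    · rw [e, v.const, w.const]; simp
    · rw [e, e, map_sub, map_zsmul, v.res_ap, w.res_ap, w.res_ap, v.res_ap]⟩

@[simp] theorem br_ap (v : VF S U p) (w : VF S U q) (h : V ≤ U) (g : S.O V) :
    (br v w).ap h g = v.ap h (w.ap h g) - sg (p * q) • w.ap h (v.ap h g) := rfl

end VF

/-- `α` is an operator on sections of `M` of parity `p`, of first order, with symbol `v`. -/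
def IsDop (M : SMod S) {U : S.Aff} (p : ZMod 2) (v : S.O U →+ S.O U) (α : M.C U →+ M.C U) : Prop :=
  (∀ m, α (M.par U m) = sg p • M.par U (α m)) ∧
  ∀ (f : S.O U) m, α (f • m) = v f • m + S.tw p f • α m

theorem IsDop.tw {M : SMod S} {U : S.Aff} {p : ZMod 2} {v : S.O U →+ S.O U} {α : M.C U →+ M.C U}
    (h : IsDop M p v α) (q : ZMod 2) (m : M.C U) : α (M.tw q m) = sg (p * q) • M.tw q (α m) := by
  rcases zmod2_cases q with rfl | rfl <;> simp [h.1]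

theorem IsDop.homog {M : SMod S} {U : S.Aff} {p q : ZMod 2} {v : S.O U →+ S.O U}
    {α : M.C U →+ M.C U} (h : IsDop M p v α) {m : M.C U} (hm : M.Homog q m) :
    M.Homog (p + q) (α m) := by
  have := h.1 m
  unfold SMod.Homog at *
  rw [hm, map_zsmul] at this
  rw [sg_add, mul_smul, this, smul_smul, sg_sq, one_smul]

theorem IsDop.span {M : SMod S} {U : S.Aff} {p : ZMod 2} {v : S.O U →+ S.O U}
    {α : M.C U →+ M.C U} (h : IsDop M p v α) {s : Set (M.C U)}
    (hs : ∀ m ∈ s, α m ∈ Submodule.span (S.O U) s) :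
    ∀ m ∈ Submodule.span (S.O U) s, α m ∈ Submodule.span (S.O U) s := fun m hm => by
  induction hm using Submodule.span_induction with
  | mem x hx => exact hs x hx
  | zero => simp
  | add x y _ _ hx hy => rw [map_add]; exact add_mem hx hy
  | smul a x hx' hx =>
    rw [h.2]; exact add_mem (Submodule.smul_mem _ _ hx') (Submodule.smul_mem _ _ hx)

theorem IsDop.quot {M : SMod S} {N : M.Sub} {U : S.Aff} {p : ZMod 2} {v : S.O U →+ S.O U}
    {α : M.C U →+ M.C U} (h : IsDop M p v α) (h' : ∀ m ∈ N.C U, α m ∈ N.C U) :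
    IsDop (M.quot N) p v (SMod.qop α h') := by
  refine ⟨fun m => ?_, fun f m => ?_⟩ <;> obtain ⟨m, rfl⟩ := SMod.proj_surj N m
  · rw [← SMod.ap_par, SMod.qop_proj, SMod.qop_proj, ← SMod.ap_par, h.1, map_zsmul]
  · rw [← SMod.ap_smul, SMod.qop_proj, h.2, map_add, SMod.ap_smul, SMod.ap_smul, SMod.qop_proj]

/-- The operator `α ⊗ 1 + 1 ⊗ β` (with Koszul signs) for `α`, `β` of parity `p`. -/
def zsum {P Q : SMod S} {U : S.Aff} (p : ZMod 2) (α : P.C U →+ P.C U) (β : Q.C U →+ Q.C U) :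
    (SMod.ztens P Q).C U →+ (SMod.ztens P Q).C U :=
  SMod.zmap α (AddMonoidHom.id _) + SMod.zmap (P.tw p) β

@[simp] theorem zsum_zt {P Q : SMod S} {U : S.Aff} (p : ZMod 2) (α : P.C U →+ P.C U)
    (β : Q.C U →+ Q.C U) (x : P.C U) (y : Q.C U) :
    zsum p α β (SMod.zt x y) = SMod.zt (α x) y + SMod.zt (P.tw p x) (β y) := rfl

theorem IsDop.zsum {P Q : SMod S} {U : S.Aff} {p : ZMod 2} {v : S.O U →+ S.O U}
    {α : P.C U →+ P.C U} {β : Q.C U →+ Q.C U} (hα : IsDop P p v α)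
    (hβ : ∀ m, β (Q.par U m) = sg p • Q.par U (β m)) :
    IsDop (SMod.ztens P Q) p v (zsum p α β) := by
  refine ⟨fun m => ?_, fun f m => ?_⟩
  · induction m using SMod.zt_ind with
    | h0 => simp
    | h x y =>
      simp only [SMod.par_zt, zsum_zt, hα.1, hβ, map_add, ← SMod.par_tw, SMod.zt_zsmul,
        SMod.zsmul_zt, smul_add]
    | hadd a b ha hb => simp only [map_add, smul_add, ha, hb]
  · induction m using SMod.zt_ind with
    | h0 => simp
    | h x y =>
      simp only [← SMod.smul_zt, zsum_zt, hα.2, SMod.add_zt, SMod.tw_smul, smul_add, add_assoc]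
    | hadd a b ha hb => simp only [map_add, smul_add, ha, hb]; abel

/-- The data of a Lie superalgebra over `O` with a central even section `one` such that all
brackets are multiples of `one` (so that the Jacobi identity is automatic). -/
structure PreHeis (S : SuperScheme.{u}) extends SMod S where
  one : ∀ U, C U
  par_one : ∀ U, par U (one U) = one U
  res_one : ∀ {U V : S.Aff} (h : V ≤ U), res h (one U) = one V
  br : ∀ U, C U →+ C U →+ C U
  par_br : ∀ U x y, par U (br U x y) = br U (par U x) (par U y)
  res_br : ∀ {U V : S.Aff} (h : V ≤ U) x y, res h (br U x y) = br V (res h x) (res h y)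
  br_smul : ∀ U (f : S.O U) x y, br U (f • x) y = f • br U x y
  br_skew : ∀ U (p q : ZMod 2) (x y : C U), par U x = sg p • x → par U y = sg q • y →
    br U x y = -(sg (p * q) • br U y x)
  one_br : ∀ U x, br U (one U) x = 0
  br_mem : ∀ U x y, ∃ f : S.O U, br U x y = f • one U

namespace PreHeis

/-- `H` is a Heisenberg Lie superalgebra: a vector bundle (finitely generated projective sections
over every affine open) which is an extension of `V = H / O` by `O`, such that the commutator pairing
induces an isomorphism from `V` to its dual. -/
structure IsHeisenberg (H : PreHeis S) : Prop where
  qcoh : H.toSMod.QCoh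
  one_inj : ∀ U (f : S.O U), f • H.one U = 0 → f = 0
  finite : ∀ U, Module.Finite (S.O U) (H.C U ⧸ Submodule.span (S.O U) {H.one U})
  projective : ∀ U, Module.Projective (S.O U) (H.C U ⧸ Submodule.span (S.O U) {H.one U})
  nondeg_inj : ∀ U x, (∀ y, H.br U y x = 0) → x ∈ Submodule.span (S.O U) {H.one U}
  nondeg_surj : ∀ U (l : H.C U →ₗ[S.O U] S.O U), l (H.one U) = 0 →
    ∃ x, ∀ y, H.br U y x = l y • H.one U

/-- `I ⊆ H` is an isotropic subbundle: it projects isomorphically onto a subbundle of `V = H / O`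
(a subsheaf with locally free quotient) on which the commutator pairing vanishes. -/
structure IsIsotropic (H : PreHeis S) (I : H.toSMod.Sub) : Prop where
  qcoh : I.QCoh
  disj : ∀ U, I.C U ⊓ Submodule.span (S.O U) {H.one U} = ⊥
  finite : ∀ U, Module.Finite (S.O U) (H.C U ⧸ (I.C U ⊔ Submodule.span (S.O U) {H.one U}))
  projective : ∀ U,
    Module.Projective (S.O U) (H.C U ⧸ (I.C U ⊔ Submodule.span (S.O U) {H.one U}))
  br_zero : ∀ U, ∀ x ∈ I.C U, ∀ y ∈ I.C U, H.br U x y = 0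

variable (H : PreHeis S) {U V : S.Aff}

theorem br_one (x : H.C U) : H.br U x (H.one U) = 0 := by
  induction x using H.toSMod.homog_ind with
  | hadd a b ha hb => simp [ha, hb]
  | h p m hm =>
    rw [H.br_skew U p 0 _ _ hm (by simp [H.par_one]), H.one_br]; simp

theorem br_smul_right (q : ZMod 2) (f : S.O U) (hf : S.Homog q f) (x y : H.C U) :
    H.br U x (f • y) = f • H.br U (H.tw q x) y := by
  induction x using H.toSMod.homog_ind with
  | hadd a b ha hb => simp only [map_add, AddMonoidHom.add_apply, ha, hb, smul_add]
  | h p x hx =>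
    induction y using H.toSMod.homog_ind with
    | hadd a b ha hb => simp only [map_add, smul_add, ha, hb]
    | h r y hy =>
      rw [H.br_skew U _ _ _ _ hx (SMod.Homog.smul hf hy), H.br_smul, SMod.Homog.tw hx,
        map_zsmul, AddMonoidHom.smul_apply, H.br_skew U _ _ _ _ hx hy]
      rcases zmod2_cases p with rfl | rfl <;> rcases zmod2_cases q with rfl | rfl <;>
        rcases zmod2_cases r with rfl | rfl <;> simp [show (1 + 1 : ZMod 2) = 0 by decide]

theorem br_smul_one (f : S.O U) (x : H.C U) : H.br U x (f • H.one U) = 0 := by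
  induction x using H.toSMod.homog_ind with
  | hadd a b ha hb => simp [ha, hb]
  | h p x hx =>
    have h1 : ∀ (q : ZMod 2) (z : H.C U), H.Homog q z → H.br U z x = 0 → H.br U x z = 0 :=
      fun q z hz h0 => by rw [H.br_skew U _ _ _ _ hx hz, h0]; simp
    have h2 : H.br U (f • H.one U) x = 0 := by rw [H.br_smul, H.one_br, smul_zero]
    rw [← H.pr_add_pr (f • H.one U), map_add]
    have h3 : ∀ q, H.br U (H.pr q (f • H.one U)) x = 0 := fun q => by
      rw [SMod.pr_apply, H.br_smul, map_add, map_zsmul, H.par_smul, H.par_one,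
        AddMonoidHom.add_apply, AddMonoidHom.smul_apply, H.br_smul, H.br_smul, H.one_br]; simp
    rw [h1 0 _ (H.pr_homog _ _) (h3 0), h1 1 _ (H.pr_homog _ _) (h3 1), add_zero]

/-- The centralizer `c(I)`. -/
def cent (I : H.toSMod.Sub) : H.toSMod.Sub where
  C U :=
    { carrier := {x | ∀ V (h : V ≤ U), ∀ y ∈ I.C V, H.br V (H.res h x) y = 0}
      zero_mem' := by simp
      add_mem' := fun {a b} ha hb V h y hy => by simp [ha V h y hy, hb V h y hy]
      smul_mem' := fun f x hx V h y hy => by rw [H.res_smul, H.br_smul, hx V h y hy, smul_zero] }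
  par_mem U x hx V h y hy := by
    have := hx V h _ (I.par_mem V y hy)
    rw [H.res_par, ← H.par_par V y, ← H.par_br, this, map_zero]
  res_mem h x hx V k y hy := by rw [H.res_res]; exact hx V _ y hy

variable {H} in
theorem cent_br {I : H.toSMod.Sub} {x y : H.C U} (hx : x ∈ (H.cent I).C U) (hy : y ∈ I.C U) :
    H.br U x y = 0 := by
  have := hx U le_rfl y hy
  rwa [H.res_id] at this

theorem one_mem_cent (I : H.toSMod.Sub) : H.one U ∈ (H.cent I).C U := fun V h y _ => by
  rw [H.res_one, H.one_br]

/-- `I ∩ c(I)` inside `c(I)`. -/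
def inCent (I : H.toSMod.Sub) : (H.cent I).toSMod.Sub where
  C U := (I.C U).comap ((H.cent I).C U).subtype
  par_mem U m hm := I.par_mem U m.1 hm
  res_mem h m hm := I.res_mem h m.1 hm

/-- The bracket of `c(I)`. -/
def centBr (I : H.toSMod.Sub) (U : S.Aff) :
    (H.cent I).toSMod.C U →+ (H.cent I).toSMod.C U →+ (H.cent I).toSMod.C U :=
  AddMonoidHom.mk' (fun x => AddMonoidHom.mk' (fun y => ⟨H.br U x.1 y.1, by
    obtain ⟨f, hf⟩ := H.br_mem U x.1 y.1
    rw [hf]; exact ((H.cent I).C U).smul_mem f (H.one_mem_cent I)⟩)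
    fun a b => Subtype.ext (map_add (H.br U x.1) a.1 b.1))
    fun a b => AddMonoidHom.ext fun y => Subtype.ext (by
      change H.br U (a.1 + b.1) y.1 = H.br U a.1 y.1 + H.br U b.1 y.1
      simp)

/-- The centralizer `c(I)` as a (degenerate) Heisenberg algebra. -/
abbrev centHeis (I : H.toSMod.Sub) : PreHeis S where
  toSMod := (H.cent I).toSMod
  one U := ⟨H.one U, H.one_mem_cent I⟩
  par_one U := Subtype.ext (H.par_one U)
  res_one h := Subtype.ext (H.res_one h)
  br := H.centBr I
  par_br U x y := Subtype.ext (H.par_br U x.1 y.1)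
  res_br h x y := Subtype.ext (H.res_br h x.1 y.1)
  br_smul U f x y := Subtype.ext (H.br_smul U f x.1 y.1)
  br_skew U p q x y hx hy := Subtype.ext (H.br_skew U p q x.1 y.1
    (congrArg Subtype.val hx) (congrArg Subtype.val hy))
  one_br U x := Subtype.ext (H.one_br U x.1)
  br_mem U x y := let ⟨f, hf⟩ := H.br_mem U x.1 y.1; ⟨f, Subtype.ext hf⟩

theorem centBr_right (I : H.toSMod.Sub) (x y : (H.cent I).toSMod.C U)
    (hy : y ∈ (H.inCent I).C U) : H.centBr I U x y = 0 :=
  Subtype.ext (cent_br x.2 hy)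

theorem centBr_left (I : H.toSMod.Sub) (x y : (H.cent I).toSMod.C U)
    (hx : x ∈ (H.inCent I).C U) : H.centBr I U x y = 0 := by
  have key : ∀ q, H.centBr I U ((H.cent I).toSMod.pr q x) y = 0 := fun q => by
    have hq : (H.cent I).toSMod.pr q x ∈ (H.inCent I).C U := (H.inCent I).pr_mem q hx
    induction y using (H.cent I).toSMod.homog_ind with
    | hadd a b ha hb => rw [map_add, ha, hb, add_zero]
    | h r y hy =>
      have := (H.centHeis I).br_skew U _ _ _ _ ((H.cent I).toSMod.pr_homog q x) hy
      refine this.trans ?_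
      have h0 : (H.centHeis I).br U y ((H.cent I).toSMod.pr q x) = 0 := H.centBr_right I _ _ hq
      rw [h0, smul_zero, neg_zero]
  rw [← (H.cent I).toSMod.pr_add_pr x, map_add, AddMonoidHom.add_apply, key, key, add_zero]

theorem quot_homog {M : SMod S} {N : M.Sub} {p : ZMod 2} {m : (M.quot N).C U}
    (hm : (M.quot N).Homog p m) : ∃ m', M.Homog p m' ∧ SMod.ap (M.proj N) U m' = m := by
  obtain ⟨m', rfl⟩ := SMod.proj_surj N m
  exact ⟨M.pr p m', M.pr_homog p m', by rw [SMod.ap_pr, hm.pr_eq, if_pos rfl]⟩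

/-- The underlying supermodule of `c(I) / I`. -/
abbrev redMod (I : H.toSMod.Sub) : SMod S := (H.cent I).toSMod.quot (H.inCent I)

/-- The projection `c(I) → c(I) / I`. -/
abbrev toRed (I : H.toSMod.Sub) : (H.cent I).toSMod ⟶ H.redMod I := SMod.proj _ (H.inCent I)

/-- The bracket of `c(I) / I`. -/
def redBr (I : H.toSMod.Sub) (U : S.Aff) :
    (H.redMod I).C U →+ (H.redMod I).C U →+ (H.redMod I).C U :=
  SMod.qlift _ (AddMonoidHom.mk' (fun x => SMod.qlift _
      ((SMod.ap (H.toRed I) U).comp (H.centBr I U x))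
      fun y hy => by rw [AddMonoidHom.comp_apply, H.centBr_right I x y hy, map_zero])
      fun a b => AddMonoidHom.ext fun y => by
        obtain ⟨y, rfl⟩ := SMod.proj_surj _ y
        change SMod.ap (H.toRed I) U (H.centBr I U (a + b) y) =
          SMod.ap (H.toRed I) U (H.centBr I U a y) + SMod.ap (H.toRed I) U (H.centBr I U b y)
        rw [map_add, AddMonoidHom.add_apply, map_add])
    fun x hx => AddMonoidHom.ext fun y => by
        obtain ⟨y, rfl⟩ := SMod.proj_surj _ y
        change SMod.ap (H.toRed I) U (H.centBr I U x y) = 0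
        rw [H.centBr_left I x y hx, map_zero]

theorem redBr_proj (I : H.toSMod.Sub) (x y : (H.cent I).toSMod.C U) :
    H.redBr I U (SMod.ap (H.toRed I) U x) (SMod.ap (H.toRed I) U y) =
      SMod.ap (H.toRed I) U (H.centBr I U x y) := rfl

/-- The reduced Heisenberg algebra `c(I) / I`. -/
@[reducible] def red (I : H.toSMod.Sub) : PreHeis S where
  toSMod := H.redMod I
  one U := SMod.ap (H.toRed I) U ((H.centHeis I).one U)
  par_one U := (SMod.ap_par (H.toRed I) _).symm.trans
    (congrArg (SMod.ap (H.toRed I) U) ((H.centHeis I).par_one U))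
  res_one {U V} h := (SMod.ap_res (H.toRed I) h _).symm.trans
    (congrArg (SMod.ap (H.toRed I) V) ((H.centHeis I).res_one h))
  br := H.redBr I
  par_br U x y := by
    obtain ⟨x, rfl⟩ := SMod.proj_surj _ x
    obtain ⟨y, rfl⟩ := SMod.proj_surj _ y
    simp only [redBr_proj, ← SMod.ap_par]
    exact congrArg (SMod.ap (H.toRed I) U) ((H.centHeis I).par_br U x y)
  res_br {U V} h x y := by
    obtain ⟨x, rfl⟩ := SMod.proj_surj _ x
    obtain ⟨y, rfl⟩ := SMod.proj_surj _ y
    simp only [redBr_proj, ← SMod.ap_res]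
    exact congrArg (SMod.ap (H.toRed I) V) ((H.centHeis I).res_br h x y)
  br_smul U f x y := by
    obtain ⟨x, rfl⟩ := SMod.proj_surj _ x
    obtain ⟨y, rfl⟩ := SMod.proj_surj _ y
    simp only [redBr_proj, ← SMod.ap_smul]
    exact congrArg (SMod.ap (H.toRed I) U) ((H.centHeis I).br_smul U f x y)
  br_skew U p q x y hx hy := by
    obtain ⟨x, hx', rfl⟩ := quot_homog hx
    obtain ⟨y, hy', rfl⟩ := quot_homog hy
    rw [redBr_proj, redBr_proj, ← map_zsmul (SMod.ap (H.toRed I) U), ← map_neg]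
    exact congrArg (SMod.ap (H.toRed I) U) ((H.centHeis I).br_skew U p q x y hx' hy')
  one_br U x := by
    obtain ⟨x, rfl⟩ := SMod.proj_surj _ x
    rw [redBr_proj, ← map_zero (SMod.ap (H.toRed I) U)]
    exact congrArg (SMod.ap (H.toRed I) U) ((H.centHeis I).one_br U x)
  br_mem U x y := by
    obtain ⟨x, rfl⟩ := SMod.proj_surj _ x
    obtain ⟨y, rfl⟩ := SMod.proj_surj _ y
    obtain ⟨f, hf⟩ := (H.centHeis I).br_mem U x y
    refine ⟨f, ?_⟩
    rw [redBr_proj, ← SMod.ap_smul]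
    exact congrArg (SMod.ap (H.toRed I) U) hf

/-- For `J ⊆ H`, the image of `J ∩ c(I)` in `c(I) / I`. -/
def redSub (I J : H.toSMod.Sub) : (H.red I).toSMod.Sub where
  C U := ((J.C U).comap ((H.cent I).C U).subtype).map ((H.inCent I).C U).mkQ
  par_mem U m := by
    rintro ⟨x, hx, rfl⟩
    exact ⟨(H.cent I).toSMod.par U x, J.par_mem U _ hx, rfl⟩
  res_mem h m := by
    rintro ⟨x, hx, rfl⟩
    exact ⟨(H.cent I).toSMod.res h x, J.res_mem h _ hx, rfl⟩

/-- The intersection of two graded submodules. -/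
def inter (J K : H.toSMod.Sub) : H.toSMod.Sub where
  C U := J.C U ⊓ K.C U
  par_mem U m hm := ⟨J.par_mem U m hm.1, K.par_mem U m hm.2⟩
  res_mem h m hm := ⟨J.res_mem h m hm.1, K.res_mem h m hm.2⟩

end PreHeis

/-- A Heisenberg flat connection: a flat connection on `H` compatible with the bracket which
restricts to the standard connection on `O ⊆ H`. -/
structure Conn (H : PreHeis S) where
  nab : ∀ {U : S.Aff} {p : ZMod 2}, VF S U p →+ H.C U →+ H.C U
  dop : ∀ {U : S.Aff} {p : ZMod 2} (v : VF S U p), IsDop H.toSMod p v.top (nab v)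
  smul : ∀ {U : S.Aff} {p q : ZMod 2} (f : S.O U) (hf : S.Homog q f) (v : VF S U p) x,
    nab (VF.smul f hf v) x = f • nab v x
  flat : ∀ {U : S.Aff} {p q : ZMod 2} (v : VF S U p) (w : VF S U q) x,
    nab (VF.br v w) x = nab v (nab w x) - sg (p * q) • nab w (nab v x)
  res : ∀ {U V : S.Aff} {p : ZMod 2} (h : V ≤ U) (v : VF S U p) x,
    H.res h (nab v x) = nab (VF.res h v) (H.res h x)
  br : ∀ {U : S.Aff} {p : ZMod 2} (v : VF S U p) x y,
    nab v (H.br U x y) = H.br U (nab v x) y + H.br U (H.tw p x) (nab v y)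
  one : ∀ {U : S.Aff} {p : ZMod 2} (v : VF S U p), nab v (H.one U) = 0

namespace Conn

variable {H : PreHeis S} (D : Conn H)

/-- The graded submodule `I ⊆ H` is preserved by the connection. -/
def Preserves (I : H.toSMod.Sub) : Prop :=
  ∀ (U : S.Aff) (p : ZMod 2) (v : VF S U p), ∀ x ∈ I.C U, D.nab v x ∈ I.C U

variable {D} {I : H.toSMod.Sub}

theorem Preserves.cent (hI : D.Preserves I) : D.Preserves (H.cent I) := fun U p v x hx V h y hy => by
  rw [D.res]
  have h1 := D.br (VF.res h v) (H.res h x) y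
  rw [PreHeis.cent_br ((H.cent I).res_mem h x hx) hy, map_zero,
    PreHeis.cent_br ((H.cent I).tw_mem p ((H.cent I).res_mem h x hx)) (hI V p _ y hy),
    add_zero] at h1
  exact h1.symm

end Conn

namespace Conn

variable {H : PreHeis S} (D : Conn H) {I : H.toSMod.Sub} (hI : D.Preserves I)

/-- The connection on `c(I)`. -/
def centNab {U : S.Aff} {p : ZMod 2} :
    VF S U p →+ (H.cent I).toSMod.C U →+ (H.cent I).toSMod.C U :=
  AddMonoidHom.mk' (fun v => AddMonoidHom.mk' (fun x => ⟨D.nab v x.1, hI.cent U p v x.1 x.2⟩)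
    fun a b => Subtype.ext (map_add (D.nab v) a.1 b.1))
    fun v w => AddMonoidHom.ext fun x => Subtype.ext (by
      change D.nab (v + w) x.1 = D.nab v x.1 + D.nab w x.1
      simp)

theorem centNab_dop {U : S.Aff} {p : ZMod 2} (v : VF S U p) :
    IsDop (H.cent I).toSMod p v.top (D.centNab hI v) :=
  ⟨fun m => Subtype.ext ((D.dop v).1 m.1), fun f m => Subtype.ext ((D.dop v).2 f m.1)⟩

theorem centNab_mem {U : S.Aff} {p : ZMod 2} (v : VF S U p) :
    ∀ x ∈ (H.inCent I).C U, D.centNab hI v x ∈ (H.inCent I).C U := fun x hx => hI U p v x.1 hx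

/-- The connection on `c(I) / I`. -/
def redNab {U : S.Aff} {p : ZMod 2} : VF S U p →+ (H.redMod I).C U →+ (H.redMod I).C U :=
  AddMonoidHom.mk' (fun v => SMod.qop (D.centNab hI v) (D.centNab_mem hI v))
    fun v w => AddMonoidHom.ext fun x => by
      obtain ⟨x, rfl⟩ := SMod.proj_surj _ x
      rw [AddMonoidHom.add_apply, SMod.qop_proj, SMod.qop_proj, SMod.qop_proj, map_add,
        AddMonoidHom.add_apply, map_add]

theorem redNab_proj {U : S.Aff} {p : ZMod 2} (v : VF S U p) (x : (H.cent I).toSMod.C U) :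
    D.redNab hI v (SMod.ap (H.toRed I) U x) = SMod.ap (H.toRed I) U (D.centNab hI v x) := rfl

theorem cent_tw {p : ZMod 2} {U : S.Aff} (x : (H.cent I).toSMod.C U) :
    ((H.cent I).toSMod.tw p x).1 = H.tw p x.1 := by
  rcases zmod2_cases p with rfl | rfl <;> simp; rfl

/-- The induced Heisenberg flat connection on `c(I) / I`. -/
@[reducible] def red : Conn (H.red I) where
  nab := D.redNab hI
  dop v := (D.centNab_dop hI v).quot (D.centNab_mem hI v)
  smul f hf v x := by
    obtain ⟨x, rfl⟩ := SMod.proj_surj _ x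
    rw [redNab_proj, redNab_proj, ← SMod.ap_smul]
    exact congrArg (SMod.ap (H.toRed I) _) (Subtype.ext (D.smul f hf v x.1))
  flat {U p q} v w x := by
    obtain ⟨x, rfl⟩ := SMod.proj_surj _ x
    simp only [redNab_proj]
    rw [← map_zsmul (SMod.ap (H.toRed I) U), ← map_sub]
    exact congrArg (SMod.ap (H.toRed I) _) (Subtype.ext (D.flat v w x.1))
  res h v x := by
    obtain ⟨x, rfl⟩ := SMod.proj_surj _ x
    rw [redNab_proj, ← SMod.ap_res, ← SMod.ap_res, redNab_proj]
    exact congrArg (SMod.ap (H.toRed I) _) (Subtype.ext (D.res h v x.1))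
  br {U p} v x y := by
    obtain ⟨x, rfl⟩ := SMod.proj_surj _ x
    obtain ⟨y, rfl⟩ := SMod.proj_surj _ y
    rw [← SMod.ap_tw, redNab_proj, redNab_proj, PreHeis.redBr_proj, redNab_proj,
      PreHeis.redBr_proj, PreHeis.redBr_proj, ← map_add]
    refine congrArg (SMod.ap (H.toRed I) _) (Subtype.ext ((D.br v x.1 y.1).trans ?_))
    rw [← cent_tw]; rfl
  one v := by
    rw [redNab_proj, ← map_zero (SMod.ap (H.toRed I) _)]
    exact congrArg (SMod.ap (H.toRed I) _) (Subtype.ext (D.one v))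

theorem Preserves.redSub {D : Conn H} {I : H.toSMod.Sub} (hI : D.Preserves I) {J : H.toSMod.Sub}
    (hJ : D.Preserves J) : (D.red hI).Preserves (H.redSub I J) := by
  rintro U p v _ ⟨x, hx, rfl⟩
  exact ⟨D.centNab hI v x, hJ U p v _ hx, (D.redNab_proj hI v x).symm⟩

end Conn

/-! ### The enveloping algebra -/

/-- Relations of `U(H)`, the enveloping algebra of `H` over `O` modulo `1_H = 1`; the subalgebra `O`
is the image of `O · 1_H`. -/
inductive URel (H : PreHeis S) (U : S.Aff) :
    TensorAlgebra ℤ (H.C U) → TensorAlgebra ℤ (H.C U) → Prop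
  | one : URel H U (TensorAlgebra.ι ℤ (H.one U)) 1
  | smul (f : S.O U) (x : H.C U) : URel H U
      (TensorAlgebra.ι ℤ (f • H.one U) * TensorAlgebra.ι ℤ x) (TensorAlgebra.ι ℤ (f • x))
  | comm (p q : ZMod 2) (x y : H.C U) (hx : H.Homog p x) (hy : H.Homog q y) : URel H U
      (TensorAlgebra.ι ℤ x * TensorAlgebra.ι ℤ y -
        sg (p * q) • (TensorAlgebra.ι ℤ y * TensorAlgebra.ι ℤ x))
      (TensorAlgebra.ι ℤ (H.br U x y))

/-- Sections of `U(H)` over an affine open. -/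
def UH (H : PreHeis S) (U : S.Aff) : Type u := RingQuot (URel H U)

instance (H : PreHeis S) (U : S.Aff) : Ring (UH H U) := inferInstanceAs (Ring (RingQuot _))

namespace UH

variable (H : PreHeis S) {U V : S.Aff}

/-- The canonical map `H → U(H)`. -/
def ι : H.C U →+ UH H U :=
  (RingQuot.mkRingHom (URel H U)).toAddMonoidHom.comp (TensorAlgebra.ι ℤ).toAddMonoidHom

theorem ι_one : ι H (H.one U) = 1 := by
  refine (RingQuot.mkRingHom_rel URel.one).trans (map_one _)

theorem ι_smul_one_mul (f : S.O U) (x : H.C U) : ι H (f • H.one U) * ι H x = ι H (f • x) :=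
  (map_mul (RingQuot.mkRingHom (URel H U)) _ _).symm.trans (RingQuot.mkRingHom_rel (URel.smul f x))

theorem ι_comm {p q : ZMod 2} {x y : H.C U} (hx : H.Homog p x) (hy : H.Homog q y) :
    ι H x * ι H y - sg (p * q) • (ι H y * ι H x) = ι H (H.br U x y) := by
  refine Eq.trans ?_ (RingQuot.mkRingHom_rel (URel.comm p q x y hx hy))
  rw [map_sub, map_zsmul, map_mul, map_mul]; rfl

theorem ind {P : UH H U → Prop} (hι : ∀ x, P (ι H x)) (hadd : ∀ a b, P a → P b → P (a + b))
    (hmul : ∀ a b, P a → P b → P (a * b)) (a : UH H U) : P a := by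
  obtain ⟨a, rfl⟩ := RingQuot.mkRingHom_surjective (URel H U) a
  induction a using TensorAlgebra.induction with
  | algebraMap n =>
    have : RingQuot.mkRingHom (URel H U) (algebraMap ℤ _ n) = ι H (n • H.one U) := by
      rw [map_zsmul, ι_one]; simp
      rfl
    rw [this]; exact hι _
  | ι x => exact hι x
  | mul a b ha hb => rw [map_mul]; exact hmul _ _ ha hb
  | add a b ha hb => rw [map_add]; exact hadd _ _ ha hb

/-- The universal property of `U(H)`. -/
def lift {A : Type*} [Ring A] (φ : H.C U →+ A) (h1 : φ (H.one U) = 1)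
    (h2 : ∀ (f : S.O U) x, φ (f • H.one U) * φ x = φ (f • x))
    (h3 : ∀ (p q : ZMod 2) x y, H.Homog p x → H.Homog q y →
      φ x * φ y - sg (p * q) • (φ y * φ x) = φ (H.br U x y)) : UH H U →+* A :=
  RingQuot.lift ⟨(TensorAlgebra.lift ℤ φ.toIntLinearMap).toRingHom, by
    rintro a b (_ | ⟨f, x⟩ | ⟨p, q, x, y, hx, hy⟩)
    · simpa using h1
    · simpa using h2 f x
    · simpa using h3 p q x y hx hy⟩

@[simp] theorem lift_ι {A : Type*} [Ring A] (φ : H.C U →+ A) (h1 h2 h3) (x : H.C U) :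
    lift H φ h1 h2 h3 (ι H x) = φ x := by
  refine (RingQuot.lift_mkRingHom_apply _ _ _).trans ?_
  simp

/-- The parity involution of `U(H)`. -/
def par (U : S.Aff) : UH H U →+* UH H U :=
  lift H ((ι H).comp (H.par U)) (by simp [H.par_one, ι_one])
    (fun f x => by simp [H.par_smul, H.par_one, ι_smul_one_mul])
    (fun p q x y hx hy => by
      simp only [AddMonoidHom.comp_apply, H.par_br]
      exact ι_comm H hx.par hy.par)

@[simp] theorem par_ι (x : H.C U) : par H U (ι H x) = ι H (H.par U x) := by simp [par]

/-- Restriction of sections of `U(H)`. -/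
def res (h : V ≤ U) : UH H U →+* UH H V :=
  lift H ((ι H).comp (H.res h)) (by simp [H.res_one, ι_one])
    (fun f x => by simp [H.res_smul, H.res_one, ι_smul_one_mul])
    (fun p q x y hx hy => by
      simp only [AddMonoidHom.comp_apply, H.res_br]
      exact ι_comm H (hx.res h) (hy.res h))

@[simp] theorem res_ι (h : V ≤ U) (x : H.C U) : res H h (ι H x) = ι H (H.res h x) := by simp [res]

/-- The structure map `O → U(H)`. -/
def oo (U : S.Aff) : S.O U →+* UH H U where
  toFun f := ι H (f • H.one U)
  map_one' := by rw [one_smul, ι_one]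
  map_mul' f g := by rw [ι_smul_one_mul, mul_smul]
  map_zero' := by simp
  map_add' f g := by rw [add_smul, map_add]

theorem oo_apply (f : S.O U) : oo H U f = ι H (f • H.one U) := rfl

theorem oo_mul_ι (f : S.O U) (x : H.C U) : oo H U f * ι H x = ι H (f • x) := ι_smul_one_mul H f x

instance (U : S.Aff) : Module (S.O U) (UH H U) := Module.compHom _ (oo H U)

theorem smul_def (f : S.O U) (a : UH H U) : f • a = oo H U f * a := rfl

/-- `U(H)` as a supermodule over `O`. -/
@[reducible] def mod : SMod S where
  C U := UH H U
  par U := (par H U).toAddMonoidHom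
  par_par U a := by
    induction a using ind with
    | hι x => simp [H.par_par]
    | hadd a b ha hb => rw [map_add, map_add, ha, hb]
    | hmul a b ha hb => 
      simp only [RingHom.toAddMonoidHom_eq_coe, AddMonoidHom.coe_coe] at *
      rw [map_mul, map_mul, ha, hb]
  par_smul U f a := by
    simp [smul_def, oo_apply, H.par_smul, H.par_one]
  res h := (res H h).toAddMonoidHom
  res_id U a := by
    induction a using ind with
    | hι x => simp [H.res_id]
    | hadd a b ha hb => rw [map_add, ha, hb]
    | hmul a b ha hb => 
      simp only [RingHom.toAddMonoidHom_eq_coe, AddMonoidHom.coe_coe] at *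
      rw [map_mul, ha, hb]
  res_res h k a := by
    simp only [RingHom.toAddMonoidHom_eq_coe, AddMonoidHom.coe_coe]
    induction a using ind with
    | hι x => simp [H.res_res]
    | hadd a b ha hb => simp only [map_add, ha, hb]
    | hmul a b ha hb => simp only [map_mul, ha, hb]
  res_par h a := by
    simp only [RingHom.toAddMonoidHom_eq_coe, AddMonoidHom.coe_coe]
    induction a using ind with
    | hι x => simp [H.res_par]
    | hadd a b ha hb => simp only [map_add, ha, hb]
    | hmul a b ha hb => simp only [map_mul, ha, hb]
  res_smul h f a := by
    simp [smul_def, oo_apply, H.res_smul, H.res_one]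

/-- `H → U(H)` as a morphism of supermodules. -/
def inc : H.toSMod ⟶ mod H := ⟨fun _ => ι H, fun _ f m => (oo_mul_ι H f m).symm,
  fun _ m => (par_ι H m).symm, fun _ _ h m => (res_ι H h m).symm⟩

end UH

namespace UH

variable (H : PreHeis S) {U V : S.Aff}

theorem tw_mul (p : ZMod 2) (a b : UH H U) :
    (mod H).tw p (a * b) = (mod H).tw p a * (mod H).tw p b := by
  rcases zmod2_cases p with rfl | rfl <;> simp

theorem tw_ι (p : ZMod 2) (x : H.C U) : (mod H).tw p (ι H x) = ι H (H.tw p x) := by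
  rcases zmod2_cases p with rfl | rfl <;> simp

/-- Homogeneous functions supercommute with `U(H)`. -/
theorem mul_oo {q : ZMod 2} {f : S.O U} (hf : S.Homog q f) (a : UH H U) :
    a * oo H U f = oo H U f * (mod H).tw q a := by
  induction a using ind with
  | hι x =>
    rw [tw_ι]
    induction x using H.toSMod.homog_ind with
    | hadd x y hx hy => simp only [map_add, add_mul, mul_add, hx, hy]
    | h p x hx =>
      have h1 : H.Homog q (f • H.one U) := by
        simp only [SMod.Homog, H.par_smul, H.par_one]; rw [show S.par U f = _ from hf, smul_assoc]
      have := ι_comm H hx h1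
      rw [H.br_smul_one, map_zero, sub_eq_zero] at this
      rw [oo_apply, this, SMod.Homog.tw hx, map_zsmul, mul_smul_comm, mul_comm p q]
  | hadd a b ha hb => simp only [map_add, add_mul, mul_add, ha, hb]
  | hmul a b ha hb => rw [mul_assoc, hb, ← mul_assoc, ha, tw_mul, mul_assoc]

variable {H} (D : Conn H) {p q : ZMod 2}

/-- Auxiliary ring homomorphism `a ↦ [[a^p, ∇ a], [0, a]]` encoding the extension of `∇_v` to a
superderivation of `U(H)`; here `a^p` is `a` with its Koszul sign. -/
def delMat (v : VF S U p) : UH H U →+* Matrix (Fin 2) (Fin 2) (UH H U) :=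
  lift H (AddMonoidHom.mk' (fun x => !![ι H (H.tw p x), ι H (D.nab v x); 0, ι H x])
      fun x y => by ext i j; fin_cases i <;> fin_cases j <;> simp)
    (by
      have : H.tw p (H.one U) = H.one U := by
        rcases zmod2_cases p with rfl | rfl <;> simp [H.par_one]
      ext i j; fin_cases i <;> fin_cases j <;> simp [this, D.one, ι_one])
    (fun f x => by
      have h1 : H.tw p (H.one U) = H.one U := by
        rcases zmod2_cases p with rfl | rfl <;> simp [H.par_one]
      ext i j
      fin_cases i <;> fin_cases j <;>
        simp [Matrix.mul_apply, Fin.sum_univ_two, SMod.tw_smul, h1, ι_smul_one_mul,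
          (D.dop v).2, D.one, add_comm])
    (fun a b x y hx hy => by
      have h1 : H.Homog a (H.tw p x) := by
        unfold SMod.Homog at *; rw [SMod.par_tw, hx, map_zsmul]
      have h2 : H.Homog b (H.tw p y) := by
        unfold SMod.Homog at *; rw [SMod.par_tw, hy, map_zsmul]
      have h3 : H.tw p (H.br U x y) = H.br U (H.tw p x) (H.tw p y) := by
        rcases zmod2_cases p with rfl | rfl <;> simp [H.par_br]
      have k1 := ι_comm H h1 h2
      have k2 := ι_comm H hx hy
      have k3 := ι_comm H ((D.dop v).homog hx) hy
      have k4 := ι_comm H hx ((D.dop v).homog hy)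
      ext i j
      fin_cases i <;> fin_cases j
      · simpa [Matrix.mul_apply, Fin.sum_univ_two, h3] using k1
      · simp only [Matrix.mul_apply, Fin.sum_univ_two, D.br, map_add, Matrix.sub_apply,
          Matrix.smul_apply, AddMonoidHom.mk'_apply, Matrix.of_apply, Matrix.cons_val', 
          Matrix.cons_val_zero, Matrix.cons_val_one, Matrix.cons_val_fin_one, Fin.zero_eta,
          Fin.mk_one]
        rw [SMod.Homog.tw hx, SMod.Homog.tw hy, map_zsmul, map_zsmul, map_zsmul, 
          AddMonoidHom.smul_apply, map_zsmul, ← k3, ← k4]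
        rcases zmod2_cases p with rfl | rfl <;> rcases zmod2_cases a with rfl | rfl <;>
          rcases zmod2_cases b with rfl | rfl <;>
          simp [show (1 + 1 : ZMod 2) = 0 by decide] <;> abel
      · simp
      · simpa [Matrix.mul_apply, Fin.sum_univ_two] using k2)

theorem delMat_ι (v : VF S U p) (x : H.C U) :
    delMat D v (ι H x) = !![ι H (H.tw p x), ι H (D.nab v x); 0, ι H x] := by simp [delMat]

/-- The extension of `∇_v` to a superderivation of `U(H)`. -/
def del (v : VF S U p) : UH H U →+ UH H U where
  toFun a := delMat D v a 0 1
  map_zero' := by simp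
  map_add' a b := by simp

@[simp] theorem del_ι (v : VF S U p) (x : H.C U) : del D v (ι H x) = ι H (D.nab v x) := by
  change delMat D v (ι H x) 0 1 = _
  rw [delMat_ι]; simp

theorem del_mul (v : VF S U p) (a b : UH H U) :
    del D v (a * b) = del D v a * b + (mod H).tw p a * del D v b := by
  have key : ∀ a : UH H U, delMat D v a 0 0 = (mod H).tw p a ∧ delMat D v a 1 0 = 0 ∧
      delMat D v a 1 1 = a := fun a => by
    induction a using ind with
    | hι x => rw [delMat_ι, tw_ι]; simp
    | hadd a b ha hb => simp [ha, hb]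
    | hmul a b ha hb =>
      rw [map_mul, tw_mul]
      simp [Matrix.mul_apply, Fin.sum_univ_two, ha, hb]
  change delMat D v (a * b) 0 1 = delMat D v a 0 1 * b + _ * delMat D v b 0 1
  rw [map_mul]
  simp [Matrix.mul_apply, Fin.sum_univ_two, key a, key b, add_comm]

theorem del_oo (v : VF S U p) (f : S.O U) : del D v (oo H U f) = oo H U (v.top f) := by
  rw [oo_apply, del_ι, (D.dop v).2, D.one, smul_zero, add_zero, oo_apply]

theorem del_dop (v : VF S U p) : IsDop (mod H) p v.top (del D v) := by
  refine ⟨fun a => ?_, fun f a => ?_⟩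
  · change del D v (par H U a) = sg p • par H U (del D v a)
    induction a using ind with
    | hι x => rw [par_ι, del_ι, del_ι, par_ι, (D.dop v).1, map_zsmul]
    | hadd a b ha hb => simp only [map_add, ha, hb, smul_add]
    | hmul a b ha hb =>
      have : (mod H).tw p (par H U a) = par H U ((mod H).tw p a) := ((mod H).par_tw p a).symm
      simp only [map_mul, del_mul, ha, hb, map_add, this, smul_add, smul_mul_assoc, mul_smul_comm]
  · have : S.tw p f • (del D v a) = (mod H).tw p (oo H U f) * del D v a := by
      rcases zmod2_cases p with rfl | rfl
      · simp [smul_def]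
      · simp [smul_def, oo_apply, H.par_smul, H.par_one]
    rw [smul_def, del_mul, del_oo, this, smul_def]

theorem del_add (v w : VF S U p) (a : UH H U) : del D (v + w) a = del D v a + del D w a := by
  induction a using ind with
  | hι x => simp
  | hadd a b ha hb => simp only [map_add, ha, hb]; abel
  | hmul a b ha hb => simp only [del_mul, ha, hb]; noncomm_ring

theorem del_smul (f : S.O U) (hf : S.Homog q f) (v : VF S U p) (a : UH H U) :
    del D (VF.smul f hf v) a = f • del D v a := by
  induction a using ind with
  | hι x => rw [del_ι, del_ι, D.smul, smul_def, oo_mul_ι]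
  | hadd a b ha hb => simp only [map_add, ha, hb, smul_add]
  | hmul a b ha hb =>
    have : (mod H).tw (q + p) a * oo H U f = oo H U f * (mod H).tw p a := by
      rw [mul_oo H hf, ← (mod H).tw_add, ← add_assoc, CharTwo.add_self_eq_zero, zero_add]
    simp only [del_mul, ha, hb, smul_def, mul_add]
    rw [← mul_assoc ((mod H).tw (q + p) a), this]; simp only [mul_assoc]

theorem del_br (v : VF S U p) (w : VF S U q) (a : UH H U) :
    del D (VF.br v w) a = del D v (del D w a) - sg (p * q) • del D w (del D v a) := by
  induction a using ind with
  | hι x => simp [D.flat]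
  | hadd a b ha hb => simp only [map_add, ha, hb, smul_add]; abel
  | hmul a b ha hb =>
    simp only [del_mul, ha, hb, map_add, (del_dop D v).tw, (del_dop D w).tw]
    rw [mul_comm q p, ← (mod H).tw_add, ← (mod H).tw_add, add_comm q p]
    simp only [smul_mul_assoc, mul_smul_comm, smul_add, sub_mul, mul_sub, smul_smul, sg_sq,
      one_smul]
    abel

theorem del_res (h : V ≤ U) (v : VF S U p) (a : UH H U) :
    res H h (del D v a) = del D (VF.res h v) (res H h a) := by
  induction a using ind with
  | hι x => simp [D.res]
  | hadd a b ha hb => simp only [map_add, ha, hb]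
  | hmul a b ha hb =>
    have : res H h ((mod H).tw p a) = (mod H).tw p (res H h a) := (mod H).res_tw h p a
    simp only [map_mul, del_mul, map_add, ha, hb, this]

end UH

/-! ### The right module `M^r(J)` and the Lie algebroid -/

/-- The right ideal `J · U(H)`. -/
def rIdeal (H : PreHeis S) (J : H.toSMod.Sub) : (UH.mod H).Sub :=
  SMod.Sub.gen (fun U => {a | ∃ j ∈ J.C U, ∃ u : UH H U, a = UH.ι H j * u})
    (by rintro U _ ⟨j, hj, u, rfl⟩
        exact ⟨H.par U j, J.par_mem U j hj, UH.par H U u, by simp⟩)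
    (by rintro U V h _ ⟨j, hj, u, rfl⟩
        exact ⟨H.res h j, J.res_mem h j hj, UH.res H h u, by simp⟩)

/-- The right `U(H)`-module `M^r(J) = U(H) / J U(H)`. -/
abbrev Mr (H : PreHeis S) (J : H.toSMod.Sub) : SMod S := (UH.mod H).quot (rIdeal H J)

namespace Mr

variable {H : PreHeis S} {J : H.toSMod.Sub} {U V : S.Aff}

/-- The class of an element of `U(H)`. -/
def mk (J : H.toSMod.Sub) (a : UH H U) : (Mr H J).C U := SMod.ap (SMod.proj _ (rIdeal H J)) U a

theorem mk_surj (m : (Mr H J).C U) : ∃ a, mk J a = m := SMod.proj_surj _ m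

theorem mk_add (a b : UH H U) : mk J (a + b) = mk J a + mk J b := map_add _ a b
theorem mk_zsmul (n : ℤ) (a : UH H U) : mk J (n • a) = n • mk J a := map_zsmul _ n a
theorem mk_smul (f : S.O U) (a : UH H U) : f • mk J a = mk J (f • a) := rfl
theorem mk_par (a : UH H U) : (Mr H J).par U (mk J a) = mk J (UH.par H U a) := rfl
theorem mk_res (h : V ≤ U) (a : UH H U) : (Mr H J).res h (mk J a) = mk J (UH.res H h a) := rfl
theorem mk_tw (p : ZMod 2) (a : UH H U) : (Mr H J).tw p (mk J a) = mk J ((UH.mod H).tw p a) :=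
  (SMod.ap_tw (SMod.proj _ (rIdeal H J)) p a).symm

theorem mk_J {j : H.C U} (hj : j ∈ J.C U) (u : UH H U) : mk J (UH.ι H j * u) = 0 :=
  SMod.proj_zero _ (Submodule.subset_span ⟨j, hj, u, rfl⟩)

/-- The right action of `U(H)` on `M^r(J)`. -/
def rmul (b : UH H U) : (Mr H J).C U →+ (Mr H J).C U :=
  SMod.qop (AddMonoidHom.mulRight b) fun a ha => by
    induction ha using Submodule.span_induction with
    | mem x hx =>
      obtain ⟨j, hj, u, rfl⟩ := hx
      exact Submodule.subset_span ⟨j, hj, u * b, by simp [mul_assoc]⟩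
    | zero => simp
    | add x y _ _ hx hy => rw [map_add]; exact add_mem hx hy
    | smul f x _ hx =>
      have : AddMonoidHom.mulRight b (f • x) = f • AddMonoidHom.mulRight b x := by
        simp [UH.smul_def, mul_assoc]
      rw [this]; exact Submodule.smul_mem _ _ hx

@[simp] theorem rmul_mk (b a : UH H U) : rmul b (mk J a) = mk J (a * b) := rfl

/-- The left action of the centralizer `c(J)` on `M^r(J)`; it factors through
`c(J) / J = U_{≤ 1}(c(J) / J)`. -/
def lmul (x : H.C U) (hx : x ∈ (H.cent J).C U) : (Mr H J).C U →+ (Mr H J).C U :=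
  SMod.qop (AddMonoidHom.mulLeft (UH.ι H x)) fun a ha => by
    have key : ∀ (p : ZMod 2) (x : H.C U), H.Homog p x → x ∈ (H.cent J).C U →
        ∀ a ∈ (rIdeal H J).C U, UH.ι H x * a ∈ (rIdeal H J).C U := fun p x hp hx a ha => by
      induction ha using Submodule.span_induction with
      | mem a ha =>
        obtain ⟨j, hj, u, rfl⟩ := ha
        have k2 : ∀ (q : ZMod 2) (j : H.C U), H.Homog q j → j ∈ J.C U →
            UH.ι H x * (UH.ι H j * u) ∈ (rIdeal H J).C U := fun q j hq hj => by
          have := UH.ι_comm H hp hq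
          rw [PreHeis.cent_br hx hj, map_zero, sub_eq_zero] at this
          rw [← mul_assoc, this, smul_mul_assoc, mul_assoc]
          have h2 : UH.ι H j * (UH.ι H x * u) ∈ (rIdeal H J).C U :=
            Submodule.subset_span ⟨j, hj, UH.ι H x * u, rfl⟩
          exact zsmul_mem h2 _
        rw [← H.pr_add_pr j, map_add, add_mul, mul_add]
        exact add_mem (k2 0 _ (H.pr_homog 0 j) (J.pr_mem 0 hj))
          (k2 1 _ (H.pr_homog 1 j) (J.pr_mem 1 hj))
      | zero => simp
      | add x y _ _ hx hy => rw [mul_add]; exact add_mem hx hy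
      | smul f a _ ha =>
        induction f using O_homog_ind with
        | hadd f g hf hg => rw [add_smul, mul_add]; exact add_mem hf hg
        | h q f hf =>
          rw [UH.smul_def, ← mul_assoc, UH.mul_oo H hf, UH.tw_ι, SMod.Homog.tw hp, map_zsmul,
            mul_smul_comm, smul_mul_assoc, mul_assoc]
          exact zsmul_mem (Submodule.smul_mem _ f ha) _
    change UH.ι H x * a ∈ _
    rw [← H.pr_add_pr x, map_add, add_mul]
    exact add_mem (key 0 _ (H.pr_homog 0 x) ((H.cent J).pr_mem 0 hx) a ha)
      (key 1 _ (H.pr_homog 1 x) ((H.cent J).pr_mem 1 hx) a ha)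

@[simp] theorem lmul_mk (x : H.C U) (hx : x ∈ (H.cent J).C U) (a : UH H U) :
    lmul x hx (mk J a) = mk J (UH.ι H x * a) := rfl

end Mr

namespace Mr

variable {H : PreHeis S} {J : H.toSMod.Sub} {U V : S.Aff}

theorem lmul_add (x y : H.C U) (hx hy h) (m : (Mr H J).C U) :
    lmul (x + y) h m = lmul x hx m + lmul y hy m := by
  obtain ⟨a, rfl⟩ := mk_surj m
  simp only [lmul_mk, map_add, add_mul, mk_add]

theorem lmul_zsmul (n : ℤ) (x : H.C U) (hx h) (m : (Mr H J).C U) :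
    lmul (n • x) h m = n • lmul x hx m := by
  obtain ⟨a, rfl⟩ := mk_surj m
  simp only [lmul_mk, map_zsmul, smul_mul_assoc, mk_zsmul]

theorem lmul_smul (f : S.O U) (x : H.C U) (hx h) (m : (Mr H J).C U) :
    lmul (f • x) h m = f • lmul x hx m := by
  obtain ⟨a, rfl⟩ := mk_surj m
  rw [lmul_mk, lmul_mk, mk_smul, UH.smul_def, ← mul_assoc, UH.oo_mul_ι]

theorem smul_lmul {q a : ZMod 2} {f : S.O U} (hf : S.Homog q f) {x : H.C U} (hx)
    (ha : H.Homog a x) (m : (Mr H J).C U) :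
    lmul x hx (f • m) = sg (q * a) • f • lmul x hx m := by
  obtain ⟨b, rfl⟩ := mk_surj m
  rw [lmul_mk, mk_smul, lmul_mk, mk_smul, ← mk_zsmul, UH.smul_def, UH.smul_def, ← mul_assoc,
    UH.mul_oo H hf, UH.tw_ι, SMod.Homog.tw ha, map_zsmul, mul_smul_comm, smul_mul_assoc, mul_assoc]

theorem rmul_smul (f : S.O U) (b : UH H U) (m : (Mr H J).C U) :
    rmul b (f • m) = f • rmul b m := by
  obtain ⟨a, rfl⟩ := mk_surj m
  rw [mk_smul, rmul_mk, rmul_mk, mk_smul, UH.smul_def, UH.smul_def, mul_assoc]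

theorem rmul_zsmul (n : ℤ) (b : UH H U) (m : (Mr H J).C U) :
    rmul (n • b) m = n • rmul b m := by
  obtain ⟨a, rfl⟩ := mk_surj m
  rw [rmul_mk, rmul_mk, mul_smul_comm, mk_zsmul]

theorem rmul_add (b c : UH H U) (m : (Mr H J).C U) : rmul (b + c) m = rmul b m + rmul c m := by
  obtain ⟨a, rfl⟩ := mk_surj m
  rw [rmul_mk, rmul_mk, rmul_mk, mul_add, mk_add]

theorem rmul_mul (b c : UH H U) (m : (Mr H J).C U) : rmul (b * c) m = rmul c (rmul b m) := by
  obtain ⟨a, rfl⟩ := mk_surj m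
  rw [rmul_mk, rmul_mk, rmul_mk, mul_assoc]

theorem rmul_one (m : (Mr H J).C U) : rmul 1 m = m := by
  obtain ⟨a, rfl⟩ := mk_surj m
  rw [rmul_mk, mul_one]

theorem tw_rmul (p : ZMod 2) (b : UH H U) (m : (Mr H J).C U) :
    (Mr H J).tw p (rmul b m) = rmul ((UH.mod H).tw p b) ((Mr H J).tw p m) := by
  obtain ⟨a, rfl⟩ := mk_surj m
  rw [mk_tw, rmul_mk, mk_tw, rmul_mk, UH.tw_mul]

theorem res_rmul (h : V ≤ U) (b : UH H U) (m : (Mr H J).C U) :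
    (Mr H J).res h (rmul b m) = rmul (UH.res H h b) ((Mr H J).res h m) := by
  obtain ⟨a, rfl⟩ := mk_surj m
  rw [mk_res, rmul_mk, mk_res, rmul_mk, map_mul]

end Mr

theorem IsDop.smul {M : SMod S} {U : S.Aff} {p q : ZMod 2} {v w : S.O U →+ S.O U}
    {α β : M.C U →+ M.C U} (h : IsDop M p v α) {f : S.O U} (hf : S.Homog q f)
    (hw : ∀ g, w g = f * v g) (hβ : ∀ m, β m = f • α m) : IsDop M (q + p) w β := by
  refine ⟨fun m => ?_, fun g m => ?_⟩
  · rw [hβ, hβ, h.1, M.par_smul, show S.par U f = _ from hf, sg_add, smul_assoc, mul_comm, mul_smul,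
      smul_smul (sg q), sg_sq, one_smul, smul_comm]
  · rw [hβ, hβ, h.2, smul_add, smul_smul, smul_smul, hw, mul_comm_tw hf, mul_smul (S.tw _ g)]

theorem IsDop.br {M : SMod S} {U : S.Aff} {p q : ZMod 2} {v w z : S.O U →+ S.O U}
    {α β γ : M.C U →+ M.C U} (hα : IsDop M p v α) (hβ : IsDop M q w β)
    (hv : ∀ r f, v (S.tw r f) = sg (r * p) • S.tw r (v f))
    (hw : ∀ r f, w (S.tw r f) = sg (r * q) • S.tw r (w f))
    (hz : ∀ f, z f = v (w f) - sg (p * q) • w (v f))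
    (hγ : ∀ m, γ m = α (β m) - sg (p * q) • β (α m)) : IsDop M (p + q) z γ := by
  refine ⟨fun m => ?_, fun f m => ?_⟩
  · rw [hγ, hγ, hα.1, hβ.1, map_zsmul, map_zsmul, hα.1, hβ.1, map_sub, map_zsmul, smul_sub, sg_add]
    simp only [smul_smul]
    congr 2 <;> ring
  · rw [hγ, hγ, hα.2, hβ.2, map_add, map_add, hα.2, hα.2, hβ.2, hβ.2, hz, hv, hw, tw_tw']
    have : S.tw q (S.tw p f) = S.tw p (S.tw q f) := by rw [← tw_tw', ← tw_tw', add_comm]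
    rw [this]
    simp only [smul_add, smul_sub, sub_smul, smul_assoc, smul_smul, sg_sq, mul_comm q p, one_smul,
      smul_comm (_ : S.O U) (_ : ℤ)]
    abel

section Algebroid

variable (H : PreHeis S) (D : Conn H) (J : H.toSMod.Sub)

/-- Sections over `U`, of parity `p`, of the Lie algebroid `A_{H, ∇, J}`: first order operators `α`
on `M^r(J)` with a symbol `v`, such that `α (m x) = α (m) x ± m ∇_v (x)` for `x` in `H`, and whose
supercommutator with the left action of a section of `c(J) / J` is again of this form. -/
def AAsub (U : S.Aff) (p : ZMod 2) :
    AddSubgroup ((∀ V : {V : S.Aff // V ≤ U}, (Mr H J).C V.1 →+ (Mr H J).C V.1) × VF S U p) where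
  carrier := {A | ∀ V h,
    IsDop (Mr H J) p (A.2.ap h) (A.1 ⟨V, h⟩) ∧
    (∀ (x : H.C V) m, A.1 ⟨V, h⟩ (Mr.rmul (UH.ι H x) m) = Mr.rmul (UH.ι H x) (A.1 ⟨V, h⟩ m) +
      Mr.rmul (UH.ι H (D.nab (VF.res h A.2) x)) ((Mr H J).tw p m)) ∧
    (∀ (q : ZMod 2) (x : H.C V) (hx : x ∈ (H.cent J).C V), H.Homog q x →
      ∃ (y : H.C V) (hy : y ∈ (H.cent J).C V), H.Homog (p + q) y ∧ ∀ m,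
        A.1 ⟨V, h⟩ (Mr.lmul x hx m) - sg (p * q) • Mr.lmul x hx (A.1 ⟨V, h⟩ m) = Mr.lmul y hy m) ∧
    (∀ W (k : W ≤ V) m, (Mr H J).res k (A.1 ⟨V, h⟩ m) = A.1 ⟨W, k.trans h⟩ ((Mr H J).res k m))}
  zero_mem' V h := by
    refine ⟨⟨fun m => ?_, fun f m => ?_⟩, fun x m => ?_, fun q x hx hq => ?_, fun W k m => ?_⟩
    · simp
    · change 0 = (0 : S.O V) • m + _ • (0 : (Mr H J).C V); simp
    · have h1 : Mr.rmul (0 : UH H V) ((Mr H J).tw p m) = 0 := by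
        simpa using Mr.rmul_zsmul 0 (0 : UH H V) ((Mr H J).tw p m)
      simp [h1]
    · refine ⟨0, zero_mem _, by simp [SMod.Homog], fun m => ?_⟩
      have h1 : Mr.lmul (0 : H.C V) (zero_mem _) m = 0 := by
        simpa using Mr.lmul_zsmul 0 (0 : H.C V) (zero_mem _) (by simp) m
      simp [h1]
    · simp
  add_mem' {a b} ha hb V h := by
    obtain ⟨a1, a2, a3, a4⟩ := ha V h
    obtain ⟨b1, b2, b3, b4⟩ := hb V h
    refine ⟨⟨fun m => ?_, fun f m => ?_⟩, fun x m => ?_, fun q x hx hq => ?_, fun W k m => ?_⟩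
    · simp [a1.1, b1.1]
    · change a.1 ⟨V, h⟩ (f • m) + b.1 ⟨V, h⟩ (f • m) =
        (a.2.ap h f + b.2.ap h f) • m + _ • (a.1 ⟨V, h⟩ m + b.1 ⟨V, h⟩ m)
      rw [a1.2, b1.2, add_smul, smul_add]; abel
    · simp only [Prod.fst_add, Prod.snd_add, Pi.add_apply, AddMonoidHom.add_apply, map_add, a2, b2,
        Mr.rmul_add]
      abel
    · obtain ⟨y, hy, y1, y2⟩ := a3 q x hx hq
      obtain ⟨z, hz, z1, z2⟩ := b3 q x hx hq
      refine ⟨y + z, add_mem hy hz, ?_, fun m => ?_⟩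
      · unfold SMod.Homog at *; rw [map_add, y1, z1, smul_add]
      · rw [Mr.lmul_add _ _ hy hz, ← y2, ← z2]
        simp only [Prod.fst_add, Pi.add_apply, AddMonoidHom.add_apply, map_add, smul_add]
        abel
    · simp [a4, b4]
  neg_mem' {a} ha V h := by
    obtain ⟨a1, a2, a3, a4⟩ := ha V h
    refine ⟨⟨fun m => ?_, fun f m => ?_⟩, fun x m => ?_, fun q x hx hq => ?_, fun W k m => ?_⟩
    · simp [a1.1]
    · change -a.1 ⟨V, h⟩ (f • m) = (-a.2.ap h f) • m + _ • (-a.1 ⟨V, h⟩ m)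
      rw [a1.2, neg_smul, smul_neg]; abel
    · have h1 : ∀ b : UH H V, ∀ m : (Mr H J).C V, Mr.rmul (-b) m = -Mr.rmul b m := fun b m => by
        have := Mr.rmul_zsmul (-1) b m
        simpa using this
      simp only [Prod.fst_neg, Prod.snd_neg, Pi.neg_apply, AddMonoidHom.neg_apply, map_neg, a2, h1]
      abel
    · obtain ⟨y, hy, y1, y2⟩ := a3 q x hx hq
      refine ⟨(-1 : ℤ) • y, zsmul_mem hy _, ?_, fun m => ?_⟩
      · unfold SMod.Homog at *; rw [map_zsmul, y1, smul_comm]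
      · rw [Mr.lmul_zsmul _ _ hy, ← y2]
        simp only [Prod.fst_neg, Pi.neg_apply, AddMonoidHom.neg_apply, map_neg, smul_neg]
        abel
    · simp [a4]

/-- The sections over `U`, of parity `p`, of the Lie algebroid `A_{H, ∇, J}`. -/
def AA (U : S.Aff) (p : ZMod 2) : Type u := AAsub H D J U p

instance (U : S.Aff) (p : ZMod 2) : AddCommGroup (AA H D J U p) :=
  inferInstanceAs (AddCommGroup (AAsub H D J U p))

end Algebroid

namespace AA

variable {H : PreHeis S} {D : Conn H} {J : H.toSMod.Sub} {U V W : S.Aff} {p q : ZMod 2}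

/-- The operator on `M^r(J)` over `V ⊆ U`. -/
def ap (A : AA H D J U p) (h : V ≤ U) : (Mr H J).C V →+ (Mr H J).C V := A.1.1 ⟨V, h⟩

abbrev top (A : AA H D J U p) : (Mr H J).C U →+ (Mr H J).C U := A.ap le_rfl

/-- The anchor: the symbol of an operator. -/
def anchor : AA H D J U p →+ VF S U p where
  toFun A := A.1.2
  map_zero' := rfl
  map_add' _ _ := rfl

theorem dop (A : AA H D J U p) (h : V ≤ U) : IsDop (Mr H J) p (A.anchor.ap h) (A.ap h) :=
  (A.2 V h).1
theorem ap_rmul (A : AA H D J U p) (h : V ≤ U) (x : H.C V) (m : (Mr H J).C V) :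
    A.ap h (Mr.rmul (UH.ι H x) m) = Mr.rmul (UH.ι H x) (A.ap h m) +
      Mr.rmul (UH.ι H (D.nab (VF.res h A.anchor) x)) ((Mr H J).tw p m) := (A.2 V h).2.1 x m
theorem nrm (A : AA H D J U p) (h : V ≤ U) (x : H.C V) (hx : x ∈ (H.cent J).C V)
    (hq : H.Homog q x) : ∃ (y : H.C V) (hy : y ∈ (H.cent J).C V), H.Homog (p + q) y ∧ ∀ m,
      A.ap h (Mr.lmul x hx m) - sg (p * q) • Mr.lmul x hx (A.ap h m) = Mr.lmul y hy m :=
  (A.2 V h).2.2.1 q x hx hq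
theorem res_ap (A : AA H D J U p) (h : V ≤ U) (k : W ≤ V) (m : (Mr H J).C V) :
    (Mr H J).res k (A.ap h m) = A.ap (k.trans h) ((Mr H J).res k m) := (A.2 V h).2.2.2 W k m

/-- Restriction of sections. -/
def res (h : V ≤ U) : AA H D J U p →+ AA H D J V p where
  toFun A := ⟨⟨fun W => A.1.1 ⟨W.1, W.2.trans h⟩, VF.res h A.1.2⟩, fun _ k => A.2 _ (k.trans h)⟩
  map_zero' := rfl
  map_add' _ _ := rfl

/-- The product of a homogeneous function and a section. -/
def smul (f : S.O U) (hf : S.Homog q f) (A : AA H D J U p) : AA H D J U (q + p) :=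
  ⟨⟨fun V => (DistribSMul.toAddMonoidHom _ (S.res V.2 f)).comp (A.1.1 V),
    VF.smul f hf A.anchor⟩, fun V h => by
    have e : ∀ (W : S.Aff) (k : W ≤ U) m,
      ((DistribSMul.toAddMonoidHom _ (S.res k f)).comp (A.1.1 ⟨W, k⟩)) m =
      S.res k f • A.ap k m := fun _ _ _ => rfl
    refine ⟨(A.dop h).smul (hf.res h) (fun _ => rfl) (e V h), fun x m => ?_, fun r x hx hr => ?_,
      fun W k m => ?_⟩
    · rw [e, e, A.ap_rmul, smul_add, Mr.rmul_smul]
      congr 1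
      obtain ⟨a, rfl⟩ := Mr.mk_surj m
      have : VF.res h (VF.smul f hf A.anchor) =
        VF.smul (S.res h f) (hf.res h) (VF.res h A.anchor) := by
        refine Subtype.ext (funext fun W => AddMonoidHom.ext fun g => ?_)
        change S.res _ f * _ = S.res _ (S.res h f) * _
        rw [S.res_res]; rfl
      rw [this, D.smul, Mr.mk_tw, Mr.mk_tw, Mr.rmul_mk, Mr.rmul_mk, Mr.mk_smul, ← UH.oo_mul_ι,
        UH.smul_def, ← mul_assoc ((UH.mod H).tw (q + p) a), UH.mul_oo H (hf.res h),
        ← (UH.mod H).tw_add, ← add_assoc, CharTwo.add_self_eq_zero, zero_add, mul_assoc]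
    · obtain ⟨y, hy, y1, y2⟩ := A.nrm h x hx hr
      refine ⟨S.res h f • y, Submodule.smul_mem _ _ hy, ?_, fun m => ?_⟩
      · rw [add_assoc]; exact SMod.Homog.smul (hf.res h) y1
      · rw [Mr.lmul_smul _ _ hy, ← y2, e, e, Mr.smul_lmul (hf.res h) hx hr, smul_smul, add_mul,
          sg_add, mul_right_comm, sg_sq, one_mul, smul_sub, smul_comm (sg (p * r))]
    · rw [e, e, SMod.res_smul, S.res_res, A.res_ap]⟩

/-- The supercommutator of sections. -/
def br (A : AA H D J U p) (B : AA H D J U q) : AA H D J U (p + q) :=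
  ⟨⟨fun V => (A.1.1 V).comp (B.1.1 V) - sg (p * q) • (B.1.1 V).comp (A.1.1 V),
    VF.br A.anchor B.anchor⟩, fun V h => by
    have e : ∀ (W : S.Aff) (k : W ≤ U) m,
      ((A.1.1 ⟨W, k⟩).comp (B.1.1 ⟨W, k⟩) - sg (p * q) • (B.1.1 ⟨W, k⟩).comp (A.1.1 ⟨W, k⟩)) m =
      A.ap k (B.ap k m) - sg (p * q) • B.ap k (A.ap k m) := fun _ _ _ => rfl
    refine ⟨(A.dop h).br (B.dop h) (fun r f => A.anchor.tw_ap h f r) (fun r f => B.anchor.tw_ap h f r)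
      (fun _ => rfl) (e V h), fun x m => ?_, fun r x hx hr => ?_, fun W k m => ?_⟩
    · have h1 : VF.res h (VF.br A.anchor B.anchor) =
        VF.br (VF.res h A.anchor) (VF.res h B.anchor) := rfl
      rw [e, e, h1, D.flat, B.ap_rmul, A.ap_rmul, map_add, map_add, A.ap_rmul, B.ap_rmul,
        A.ap_rmul, B.ap_rmul, (A.dop h).tw, (B.dop h).tw, ← (Mr H J).tw_add, ← (Mr H J).tw_add,
        add_comm q p, mul_comm q p, map_sub, map_zsmul, map_sub, map_zsmul, map_zsmul, map_zsmul,
        sub_eq_add_neg (UH.ι H _), ← neg_smul, Mr.rmul_add, Mr.rmul_zsmul]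
      simp only [smul_add, smul_smul, sg_sq, one_smul, neg_smul]
      abel
    · obtain ⟨y, hy, y1, y2⟩ := A.nrm h x hx hr
      obtain ⟨z, hz, z1, z2⟩ := B.nrm h x hx hr
      obtain ⟨y', hy', y1', y2'⟩ := A.nrm h z hz z1
      obtain ⟨z', hz', z1', z2'⟩ := B.nrm h y hy y1
      refine ⟨y' + (-sg (p * q)) • z', add_mem hy' (zsmul_mem hz' _), ?_, fun m => ?_⟩
      · unfold SMod.Homog at *
        rw [map_add, map_zsmul, y1', z1', smul_add, smul_comm, add_assoc, add_left_comm q p r]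
      · rw [e, e, Mr.lmul_add _ _ hy' (zsmul_mem hz' _), Mr.lmul_zsmul _ _ hz', ← y2', ← z2']
        have k1 : ∀ m, A.ap h (Mr.lmul x hx m) = Mr.lmul y hy m + sg (p * r) • Mr.lmul x hx (A.ap h m) :=
          fun m => by rw [← y2]; abel
        have k2 : ∀ m, B.ap h (Mr.lmul x hx m) = Mr.lmul z hz m + sg (q * r) • Mr.lmul x hx (B.ap h m) :=
          fun m => by rw [← z2]; abel
        rw [k1, k2, map_add, map_add, map_zsmul, map_zsmul, k1, k2, map_sub, map_zsmul]
        simp only [smul_add, smul_sub, smul_smul, neg_smul, mul_add, sg_add, add_mul]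
        rw [mul_comm q p]
        rcases zmod2_cases p with rfl | rfl <;> rcases zmod2_cases q with rfl | rfl <;>
          rcases zmod2_cases r with rfl | rfl <;> simp <;> abel
    · rw [e, e, map_sub, map_zsmul, A.res_ap, B.res_ap, B.res_ap, A.res_ap]⟩

end AA

/-- An isomorphism of Lie algebroids `A_{H, ∇, J} ≅ A_{H', ∇', J'}` over the same base: even,
`O`-linear, compatible with anchors, brackets and restrictions. -/
structure AlgIso (H : PreHeis S) (D : Conn H) (J : H.toSMod.Sub) (H' : PreHeis S) (D' : Conn H')
    (J' : H'.toSMod.Sub) where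
  eqv : ∀ {U : S.Aff} {p : ZMod 2}, AA H D J U p ≃+ AA H' D' J' U p
  anchor : ∀ {U : S.Aff} {p : ZMod 2} (A : AA H D J U p), (eqv A).anchor = A.anchor
  smul : ∀ {U : S.Aff} {p q : ZMod 2} (f : S.O U) (hf : S.Homog q f) (A : AA H D J U p),
    eqv (A.smul f hf) = (eqv A).smul f hf
  br : ∀ {U : S.Aff} {p q : ZMod 2} (A : AA H D J U p) (B : AA H D J U q),
    eqv (A.br B) = (eqv A).br (eqv B)
  res : ∀ {U V : S.Aff} {p : ZMod 2} (h : V ≤ U) (A : AA H D J U p),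
    eqv (AA.res h A) = AA.res h (eqv A)

/-- Left `U(H)`-modules with a flat connection compatible with the action of `H`. The action of `U(H)`
is given by an action of the Lie algebra `H` for which `1_H` acts as the identity. -/
structure FlatMod (H : PreHeis S) (D : Conn H) extends SMod S where
  hact : ∀ {U : S.Aff}, H.C U →+ C U →+ C U
  hact_par : ∀ {U : S.Aff} (x : H.C U) m, par U (hact x m) = hact (H.par U x) (par U m)
  hact_res : ∀ {U V : S.Aff} (h : V ≤ U) (x : H.C U) m,
    res h (hact x m) = hact (H.res h x) (res h m)
  hact_smul : ∀ {U : S.Aff} (f : S.O U) (x : H.C U) m, hact (f • x) m = f • hact x m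
  hact_one : ∀ {U : S.Aff} m, hact (H.one U) m = m
  hact_br : ∀ {U : S.Aff} (p q : ZMod 2) (x y : H.C U) m, H.Homog p x → H.Homog q y →
    hact x (hact y m) - sg (p * q) • hact y (hact x m) = hact (H.br U x y) m
  conn : ∀ {U : S.Aff} {p : ZMod 2}, VF S U p →+ C U →+ C U
  conn_dop : ∀ {U : S.Aff} {p : ZMod 2} (v : VF S U p), IsDop toSMod p v.top (conn v)
  conn_smul : ∀ {U : S.Aff} {p q : ZMod 2} (f : S.O U) (hf : S.Homog q f) (v : VF S U p) m,
    conn (VF.smul f hf v) m = f • conn v m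
  conn_br : ∀ {U : S.Aff} {p q : ZMod 2} (v : VF S U p) (w : VF S U q) m,
    conn (VF.br v w) m = conn v (conn w m) - sg (p * q) • conn w (conn v m)
  conn_res : ∀ {U V : S.Aff} {p : ZMod 2} (h : V ≤ U) (v : VF S U p) m,
    res h (conn v m) = conn (VF.res h v) (res h m)
  conn_hact : ∀ {U : S.Aff} {p : ZMod 2} (v : VF S U p) (x : H.C U) m,
    conn v (hact x m) = hact (D.nab v x) m + hact (H.tw p x) (conn v m)

namespace FlatMod

variable {H : PreHeis S} {D : Conn H} {U : S.Aff}

/-- Morphisms of `U(H)`-modules with connections. -/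
def homs (M N : FlatMod H D) : AddSubgroup (M.toSMod ⟶ N.toSMod) where
  carrier := {φ | (∀ (U : S.Aff) (x : H.C U) m, SMod.ap φ U (M.hact x m) = N.hact x (SMod.ap φ U m)) ∧
    (∀ (U : S.Aff) (p : ZMod 2) (v : VF S U p) m,
      SMod.ap φ U (M.conn v m) = N.conn v (SMod.ap φ U m))}
  zero_mem' := by simp
  add_mem' ha hb := ⟨fun U x m => by simp [ha.1, hb.1], fun U p v m => by simp [ha.2, hb.2]⟩
  neg_mem' ha := ⟨fun U x m => by simp [ha.1], fun U p v m => by simp [ha.2]⟩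

instance : Category (FlatMod H D) where
  Hom M N := homs M N
  id M := ⟨𝟙 M.toSMod, by simp [homs]⟩
  comp f g := ⟨f.1 ≫ g.1, fun U x m => by simp [f.2.1, g.2.1], fun U p v m => by
    simp [f.2.2, g.2.2]⟩

instance (M N : FlatMod H D) : AddCommGroup (M ⟶ N) := inferInstanceAs (AddCommGroup (homs M N))

instance : Preadditive (FlatMod H D) where
  add_comp _ _ _ _ _ _ := Subtype.ext (Preadditive.add_comp _ _ _ _ _ _)
  comp_add _ _ _ _ _ _ := Subtype.ext (Preadditive.comp_add _ _ _ _ _ _)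

/-- The underlying morphism of supermodules. -/
def toHom {M N : FlatMod H D} (f : M ⟶ N) : M.toSMod ⟶ N.toSMod := f.1

theorem hom_ext {M N : FlatMod H D} {f g : M ⟶ N} (h : toHom f = toHom g) : f = g := Subtype.ext h

@[simp] theorem toHom_id (M : FlatMod H D) : toHom (𝟙 M) = 𝟙 M.toSMod := rfl
@[simp] theorem toHom_comp {M N K : FlatMod H D} (f : M ⟶ N) (g : N ⟶ K) :
    toHom (f ≫ g) = toHom f ≫ toHom g := rfl
@[simp] theorem toHom_add {M N : FlatMod H D} (f g : M ⟶ N) :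
    toHom (f + g) = toHom f + toHom g := rfl
theorem toHom_hact {M N : FlatMod H D} (f : M ⟶ N) (x : H.C U) (m : M.C U) :
    SMod.ap (toHom f) U (M.hact x m) = N.hact x (SMod.ap (toHom f) U m) := f.2.1 U x m
theorem toHom_conn {M N : FlatMod H D} (f : M ⟶ N) {p : ZMod 2} (v : VF S U p) (m : M.C U) :
    SMod.ap (toHom f) U (M.conn v m) = N.conn v (SMod.ap (toHom f) U m) := f.2.2 U p v m

theorem hact_smul_one (M : FlatMod H D) (f : S.O U) (m : M.C U) :
    M.hact (f • H.one U) m = f • m := by rw [M.hact_smul, M.hact_one]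

theorem smul_hact (M : FlatMod H D) {q : ZMod 2} {f : S.O U} (hf : S.Homog q f) (x : H.C U)
    (m : M.C U) : M.hact x (f • m) = f • M.hact (H.tw q x) m := by
  induction x using H.toSMod.homog_ind with
  | hadd x y hx hy => simp only [map_add, AddMonoidHom.add_apply, hx, hy, smul_add]
  | h p x hx =>
    have h1 : H.Homog q (f • H.one U) := by
      simp only [SMod.Homog, H.par_smul, H.par_one]; rw [show S.par U f = _ from hf, smul_assoc]
    have := M.hact_br p q x _ m hx h1
    rw [H.br_smul_one, map_zero, AddMonoidHom.zero_apply, sub_eq_zero, hact_smul_one,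
      hact_smul_one] at this
    rw [this, SMod.Homog.tw hx, map_zsmul, AddMonoidHom.smul_apply, smul_comm, mul_comm]

/-- The action of `H`, in the ring of additive endomorphisms. -/
def hactEnd (M : FlatMod H D) (U : S.Aff) : H.C U →+ AddMonoid.End (M.C U) where
  toFun x := M.hact x
  map_zero' := map_zero _
  map_add' x y := map_add _ x y

/-- The action of `U(H)`. -/
def uring (M : FlatMod H D) (U : S.Aff) : UH H U →+* AddMonoid.End (M.C U) :=
  UH.lift H (M.hactEnd U) (AddMonoidHom.ext fun m => M.hact_one m)
    (fun f x => AddMonoidHom.ext fun m => by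
      change M.hact (f • H.one U) (M.hact x m) = M.hact (f • x) m
      rw [hact_smul_one, M.hact_smul])
    (fun p q x y hx hy => AddMonoidHom.ext fun m => M.hact_br p q x y m hx hy)

theorem uring_ι (M : FlatMod H D) (x : H.C U) : M.uring U (UH.ι H x) = M.hactEnd U x :=
  UH.lift_ι H _ _ _ _ x

def uact (M : FlatMod H D) (a : UH H U) : M.C U →+ M.C U := M.uring U a

theorem uact_ι (M : FlatMod H D) (x : H.C U) (m : M.C U) : M.uact (UH.ι H x) m = M.hact x m := by
  rw [uact, uring_ι]; rfl

theorem uact_mul (M : FlatMod H D) (a b : UH H U) (m : M.C U) :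
    M.uact (a * b) m = M.uact a (M.uact b m) := by rw [uact, map_mul]; rfl

theorem uact_add (M : FlatMod H D) (a b : UH H U) (m : M.C U) :
    M.uact (a + b) m = M.uact a m + M.uact b m := by rw [uact, map_add]; rfl

theorem uact_smul (M : FlatMod H D) (f : S.O U) (a : UH H U) (m : M.C U) :
    M.uact (f • a) m = f • M.uact a m := by
  rw [UH.smul_def, uact_mul, UH.oo_apply, uact_ι, hact_smul_one]

theorem smul_uact (M : FlatMod H D) {q : ZMod 2} {f : S.O U} (hf : S.Homog q f) (a : UH H U)
    (m : M.C U) : M.uact a (f • m) = M.uact (f • (UH.mod H).tw q a) m := by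
  rw [uact_smul]
  induction a using UH.ind generalizing m with
  | hι x => rw [UH.tw_ι, uact_ι, uact_ι, smul_hact M hf]
  | hadd a b ha hb => simp only [map_add, uact_add, ha, hb, smul_add]
  | hmul a b ha hb => rw [UH.tw_mul, uact_mul, uact_mul, hb, ha]

theorem uact_par (M : FlatMod H D) (a : UH H U) (m : M.C U) :
    M.par U (M.uact a m) = M.uact (UH.par H U a) (M.par U m) := by
  induction a using UH.ind generalizing m with
  | hι x => rw [UH.par_ι, uact_ι, uact_ι, M.hact_par]
  | hadd a b ha hb => simp only [map_add, uact_add, ha, hb]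
  | hmul a b ha hb => rw [map_mul, uact_mul, uact_mul, ha, hb]

theorem uact_res (M : FlatMod H D) {V : S.Aff} (h : V ≤ U) (a : UH H U) (m : M.C U) :
    M.res h (M.uact a m) = M.uact (UH.res H h a) (M.res h m) := by
  induction a using UH.ind generalizing m with
  | hι x => rw [UH.res_ι, uact_ι, uact_ι, M.hact_res]
  | hadd a b ha hb => simp only [map_add, uact_add, ha, hb]
  | hmul a b ha hb => rw [map_mul, uact_mul, uact_mul, ha, hb]

theorem uact_conn (M : FlatMod H D) {p : ZMod 2} (v : VF S U p) (a : UH H U) (m : M.C U) :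
    M.conn v (M.uact a m) = M.uact (UH.del D v a) m + M.uact ((UH.mod H).tw p a) (M.conn v m) := by
  induction a using UH.ind generalizing m with
  | hι x => rw [UH.del_ι, UH.tw_ι, uact_ι, uact_ι, uact_ι, M.conn_hact]
  | hadd a b ha hb => simp only [map_add, uact_add, ha, hb]; abel
  | hmul a b ha hb =>
    rw [UH.del_mul, UH.tw_mul, uact_add, uact_mul, uact_mul, uact_mul, uact_mul, ha, hb, map_add]
    abel

theorem uact_hom {M N : FlatMod H D} (f : M ⟶ N) (a : UH H U) (m : M.C U) :
    SMod.ap (toHom f) U (M.uact a m) = N.uact a (SMod.ap (toHom f) U m) := by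
  induction a using UH.ind generalizing m with
  | hι x => rw [uact_ι, uact_ι, toHom_hact]
  | hadd a b ha hb => simp only [map_add, uact_add, ha, hb]
  | hmul a b ha hb => rw [uact_mul, uact_mul, ha, hb]

end FlatMod

/-- Modules over the Lie algebroid `A_{H, ∇, J}`. -/
structure AMod (H : PreHeis S) (D : Conn H) (J : H.toSMod.Sub) extends SMod S where
  act : ∀ {U : S.Aff} {p : ZMod 2}, AA H D J U p →+ C U →+ C U
  act_dop : ∀ {U : S.Aff} {p : ZMod 2} (A : AA H D J U p), IsDop toSMod p A.anchor.top (act A)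
  act_smul : ∀ {U : S.Aff} {p q : ZMod 2} (f : S.O U) (hf : S.Homog q f) (A : AA H D J U p) m,
    act (A.smul f hf) m = f • act A m
  act_br : ∀ {U : S.Aff} {p q : ZMod 2} (A : AA H D J U p) (B : AA H D J U q) m,
    act (A.br B) m = act A (act B m) - sg (p * q) • act B (act A m)
  act_res : ∀ {U V : S.Aff} {p : ZMod 2} (h : V ≤ U) (A : AA H D J U p) m,
    res h (act A m) = act (AA.res h A) (res h m)

namespace AMod

variable {H : PreHeis S} {D : Conn H} {J : H.toSMod.Sub}

/-- Morphisms of modules over the Lie algebroid. -/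
def homs (M N : AMod H D J) : AddSubgroup (M.toSMod ⟶ N.toSMod) where
  carrier := {φ | ∀ (U : S.Aff) (p : ZMod 2) (A : AA H D J U p) m,
    SMod.ap φ U (M.act A m) = N.act A (SMod.ap φ U m)}
  zero_mem' := by simp
  add_mem' ha hb := fun U p A m => by simp [ha U p A m, hb U p A m]
  neg_mem' ha := fun U p A m => by simp [ha U p A m]

instance : Category (AMod H D J) where
  Hom M N := homs M N
  id M := ⟨𝟙 M.toSMod, by simp [homs]⟩
  comp f g := ⟨f.1 ≫ g.1, fun U p A m => by simp [f.2 U p A m, g.2 U p A]⟩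

instance (M N : AMod H D J) : AddCommGroup (M ⟶ N) := inferInstanceAs (AddCommGroup (homs M N))

instance : Preadditive (AMod H D J) where
  add_comp _ _ _ _ _ _ := Subtype.ext (Preadditive.add_comp _ _ _ _ _ _)
  comp_add _ _ _ _ _ _ := Subtype.ext (Preadditive.comp_add _ _ _ _ _ _)

/-- The underlying supermodule. -/
@[reducible] def forget : AMod H D J ⥤ SMod S where
  obj M := M.toSMod
  map f := f.1

instance : (forget (H := H) (D := D) (J := J)).Additive where
  map_add := rfl

/-- Restriction of scalars along an isomorphism of Lie algebroids. -/
@[reducible] def pull {H' : PreHeis S} {D' : Conn H'} {J' : H'.toSMod.Sub}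
    (Φ : AlgIso H D J H' D' J') :
    AMod H' D' J' ⥤ AMod H D J where
  obj M :=
    { toSMod := M.toSMod
      act := fun {U p} => M.act.comp Φ.eqv.toAddMonoidHom
      act_dop := fun A => by
        have := M.act_dop (Φ.eqv A)
        rw [Φ.anchor] at this
        exact this
      act_smul := fun f hf A m => by
        have := M.act_smul f hf (Φ.eqv A) m
        rw [← Φ.smul] at this
        exact this
      act_br := fun A B m => by
        have := M.act_br (Φ.eqv A) (Φ.eqv B) m
        rw [← Φ.br] at this
        exact this
      act_res := fun h A m => by
        have := M.act_res h (Φ.eqv A) m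
        rw [← Φ.res] at this
        exact this }
  map f := ⟨f.1, fun U p A m => f.2 U p (Φ.eqv A) m⟩

instance {H' : PreHeis S} {D' : Conn H'} {J' : H'.toSMod.Sub} (Φ : AlgIso H D J H' D' J') :
    (pull Φ).Additive where
  map_add := rfl

end AMod

/-! ### Tensor products over `O` -/

namespace SMod

variable {U V : S.Aff} (P Q : SMod S)

/-- The relations `x f ⊗ y = x ⊗ f y`, where `x f = (-1)^(x f) f x`. -/
def oRel : (ztens P Q).Sub :=
  Sub.gen (fun U => {z | ∃ (q : ZMod 2) (f : S.O U) (_ : S.Homog q f) (x : P.C U) (y : Q.C U),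
      z = zt (f • P.tw q x) y - zt x (f • y)})
    (by rintro U _ ⟨q, f, hf, x, y, rfl⟩
        refine ⟨q, S.par U f, ?_, P.par U x, Q.par U y, ?_⟩
        · unfold SuperScheme.Homog at *; rw [hf, map_zsmul, hf]
        · rw [map_sub, par_zt, par_zt, P.par_smul, Q.par_smul, P.par_tw])
    (by rintro U V h _ ⟨q, f, hf, x, y, rfl⟩
        refine ⟨q, S.res h f, hf.res h, P.res h x, Q.res h y, ?_⟩
        rw [map_sub, res_zt, res_zt, P.res_smul, Q.res_smul, P.res_tw])

/-- The tensor product `P ⊗_O Q`. -/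
@[reducible] def otens : SMod S := (ztens P Q).quot (oRel P Q)

variable {P Q}

/-- The pure tensor in `P ⊗_O Q`. -/
def ot (x : P.C U) (y : Q.C U) : (otens P Q).C U := ap (proj _ (oRel P Q)) U (zt x y)

theorem ot_ind {R : (otens P Q).C U → Prop} (h : ∀ x y, R (ot x y))
    (hadd : ∀ a b, R a → R b → R (a + b)) (z) : R z := by
  obtain ⟨z, rfl⟩ := proj_surj _ z
  induction z using zt_ind with
  | h0 =>
    have : (zt 0 0 : (ztens P Q).C U) = 0 := TensorProduct.zero_tmul _ _
    rw [← this]; exact h 0 0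
  | h x y => exact h x y
  | hadd a b ha hb => rw [map_add]; exact hadd _ _ ha hb

theorem ot_add (x : P.C U) (y y' : Q.C U) : ot x (y + y') = ot x y + ot x y' := by
  rw [ot, zt_add, map_add]; rfl
theorem add_ot (x x' : P.C U) (y : Q.C U) : ot (x + x') y = ot x y + ot x' y := by
  rw [ot, add_zt, map_add]; rfl
theorem ot_zsmul (n : ℤ) (x : P.C U) (y : Q.C U) : ot x (n • y) = n • ot x y := by
  rw [ot, zt_zsmul, map_zsmul]; rfl
theorem zsmul_ot (n : ℤ) (x : P.C U) (y : Q.C U) : ot (n • x) y = n • ot x y := by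
  rw [ot, zsmul_zt, map_zsmul]; rfl
theorem smul_ot (f : S.O U) (x : P.C U) (y : Q.C U) : ot (f • x) y = f • ot x y := by
  rw [ot, smul_zt, ap_smul]; rfl
theorem ot_smul {q : ZMod 2} {f : S.O U} (hf : S.Homog q f) (x : P.C U) (y : Q.C U) :
    ot x (f • y) = f • ot (P.tw q x) y := by
  rw [← smul_ot]
  refine (sub_eq_zero.1 ?_).symm
  rw [ot, ot, ← map_sub]
  exact proj_zero _ (Submodule.subset_span ⟨q, f, hf, x, y, rfl⟩)
theorem par_ot (x : P.C U) (y : Q.C U) :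
    (otens P Q).par U (ot x y) = ot (P.par U x) (Q.par U y) := rfl
theorem res_ot (h : V ≤ U) (x : P.C U) (y : Q.C U) :
    (otens P Q).res h (ot x y) = ot (P.res h x) (Q.res h y) := rfl
theorem tw_ot (p : ZMod 2) (x : P.C U) (y : Q.C U) :
    (otens P Q).tw p (ot x y) = ot (P.tw p x) (Q.tw p y) := by
  rcases zmod2_cases p with rfl | rfl <;> simp [par_ot]

/-- Additive maps out of `P ⊗_O Q`. -/
def olift {G : Type*} [AddCommGroup G] (b : P.C U →+ Q.C U →+ G)
    (h : ∀ (q : ZMod 2) (f g : S.O U), S.Homog q f → ∀ x y,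
      b (g • f • P.tw q x) y = b (g • x) (f • y)) : (otens P Q).C U →+ G :=
  qlift _ (zlift b) fun z hz => by
    suffices H : ∀ g : S.O U, zlift b (g • z) = 0 by simpa using H 1
    induction hz using Submodule.span_induction with
    | mem z hz =>
      obtain ⟨q, f, hf, x, y, rfl⟩ := hz
      intro g
      rw [smul_sub, map_sub, ← smul_zt, ← smul_zt, zlift_zt, zlift_zt, h q f g hf, sub_self]
    | zero => simp
    | add a b _ _ ha hb => intro g; rw [smul_add, map_add, ha, hb, add_zero]
    | smul f a _ ha => intro g; rw [smul_smul]; exact ha _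

@[simp] theorem olift_ot {G : Type*} [AddCommGroup G] (b : P.C U →+ Q.C U →+ G) (h) (x : P.C U)
    (y : Q.C U) : olift b h (ot x y) = b x y := rfl

/-- The functoriality of `P ⊗_O Q` in `Q`. -/
def omap {Q' : SMod S} (φ : Q ⟶ Q') : otens P Q ⟶ otens P Q' :=
  ⟨fun U => olift (AddMonoidHom.mk' (fun x => AddMonoidHom.mk' (fun y => ot x (ap φ U y))
      fun y y' => by rw [map_add, ot_add])
      fun x x' => AddMonoidHom.ext fun y => add_ot _ _ _) fun q f g hf x y => by
        change ot (g • f • P.tw q x) (ap φ U y) = ot (g • x) (ap φ U (f • y))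
        rw [smul_ot, smul_ot, smul_ot, ap_smul, ot_smul hf], by
    refine ⟨fun U f z => ?_, fun U z => ?_, fun U V h z => ?_⟩
    · induction z using ot_ind with
      | h x y => rw [← smul_ot]; exact smul_ot _ _ _
      | hadd a b ha hb => rw [smul_add, map_add, ha, hb, map_add, smul_add]
    · induction z using ot_ind with
      | h x y => exact congrArg (ot _) (ap_par φ y)
      | hadd a b ha hb => rw [map_add, map_add, ha, hb, map_add, map_add]
    · induction z using ot_ind with
      | h x y => exact congrArg (ot _) (ap_res φ h y)
      | hadd a b ha hb => rw [map_add, map_add, ha, hb, map_add, map_add]⟩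

@[simp] theorem omap_ot {Q' : SMod S} (φ : Q ⟶ Q') (x : P.C U) (y : Q.C U) :
    ap (omap φ) U (ot x y) = ot x (ap φ U y) := rfl

theorem osum_mem {p : ZMod 2} {v : VF S U p} {α : P.C U →+ P.C U} {β : Q.C U →+ Q.C U}
    (hα : IsDop P p v.top α) (hβ : IsDop Q p v.top β) :
    ∀ z ∈ (oRel P Q).C U, zsum p α β z ∈ (oRel P Q).C U :=
  IsDop.span (hα.zsum hβ.1) (by
    rintro _ ⟨q, f, hf, x, y, rfl⟩
    have gen : ∀ (q : ZMod 2) (f : S.O U) (_ : S.Homog q f) (x : P.C U) (y : Q.C U),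
      zt (f • P.tw q x) y - zt x (f • y) ∈ (oRel P Q).C U := fun q f hf x y =>
        Submodule.subset_span ⟨q, f, hf, x, y, rfl⟩
    have hv : S.Homog (p + q) (v.top f) := by
      have := v.par le_rfl f
      unfold SuperScheme.Homog at *
      rw [hf, map_zsmul] at this
      rw [sg_add, mul_smul, this, smul_smul, sg_sq, one_smul]
    have h1 := gen (p + q) (v.top f) hv (P.tw p x) y
    have h2 := gen q f hf (α x) y
    have h3 := zsmul_mem (gen q f hf (P.tw p x) (β y)) (sg (p * q))
    have e1 : P.tw (p + q) (P.tw p x) = P.tw q x := by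
      rw [← P.tw_add, add_right_comm, CharTwo.add_self_eq_zero, zero_add]
    have e2 : P.tw p (P.tw q x) = P.tw q (P.tw p x) := by rw [← P.tw_add, ← P.tw_add, add_comm]
    rw [e1] at h1
    refine (congrArg (· ∈ (oRel P Q).C U) ?_).mpr (add_mem (add_mem h1 h2) h3)
    rw [map_sub, zsum_zt, zsum_zt, hα.2, hβ.2, P.tw_smul, hf.tw, hα.tw, e2]
    simp only [add_zt, zt_add, smul_zt, smul_assoc, zt_zsmul, zsmul_zt, smul_sub,
      smul_comm (_ : S.O U) (_ : ℤ), smul_smul (sg _) (sg _), sg_sq, one_smul]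
    abel)

/-- The operator `α ⊗ 1 + 1 ⊗ β` on `P ⊗_O Q`, for operators with the same symbol. -/
def osum {p : ZMod 2} {v : VF S U p} {α : P.C U →+ P.C U} {β : Q.C U →+ Q.C U}
    (hα : IsDop P p v.top α) (hβ : IsDop Q p v.top β) : (otens P Q).C U →+ (otens P Q).C U :=
  qop (zsum p α β) (osum_mem hα hβ)

theorem osum_dop {p : ZMod 2} {v : VF S U p} {α : P.C U →+ P.C U} {β : Q.C U →+ Q.C U}
    (hα : IsDop P p v.top α) (hβ : IsDop Q p v.top β) :
    IsDop (otens P Q) p v.top (osum hα hβ) :=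
  (hα.zsum hβ.1).quot (osum_mem hα hβ)

@[simp] theorem osum_ot {p : ZMod 2} {v : VF S U p} {α : P.C U →+ P.C U} {β : Q.C U →+ Q.C U}
    (hα : IsDop P p v.top α) (hβ : IsDop Q p v.top β) (x : P.C U) (y : Q.C U) :
    osum hα hβ (ot x y) = ot (α x) y + ot (P.tw p x) (β y) := rfl

end SMod

/-! ### The bar resolution -/

namespace Bar

variable {H : PreHeis S} {D : Conn H} {U V : S.Aff}

/-- The pure tensor in `U(H) ⊗_O Q`. -/
def uo {Q : SMod S} (a : UH H U) (y : Q.C U) : (SMod.otens (UH.mod H) Q).C U :=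
  SMod.ot (P := UH.mod H) a y

section uo

variable {Q : SMod S}

theorem uo_ind {R : (SMod.otens (UH.mod H) Q).C U → Prop} (h : ∀ (a : UH H U) y, R (uo a y))
    (hadd : ∀ a b, R a → R b → R (a + b)) (z) : R z := SMod.ot_ind h hadd z

theorem uo_add (a : UH H U) (y y' : Q.C U) : uo a (y + y') = uo a y + uo a y' := SMod.ot_add _ _ _
theorem add_uo (a b : UH H U) (y : Q.C U) : uo (a + b) y = uo a y + uo b y := SMod.add_ot _ _ _
theorem uo_zsmul (n : ℤ) (a : UH H U) (y : Q.C U) : uo a (n • y) = n • uo a y :=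
  SMod.ot_zsmul _ _ _
theorem zsmul_uo (n : ℤ) (a : UH H U) (y : Q.C U) : uo (n • a) y = n • uo a y :=
  SMod.zsmul_ot _ _ _
theorem sub_uo (a b : UH H U) (y : Q.C U) : uo (a - b) y = uo a y - uo b y := by
  rw [eq_sub_iff_add_eq, ← add_uo, sub_add_cancel]
theorem uo_sub (a : UH H U) (y y' : Q.C U) : uo a (y - y') = uo a y - uo a y' := by
  rw [eq_sub_iff_add_eq, ← uo_add, sub_add_cancel]
theorem smul_uo (f : S.O U) (a : UH H U) (y : Q.C U) : uo (UH.oo H U f * a) y = f • uo a y :=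
  SMod.smul_ot f _ _
theorem smul_uo' (f : S.O U) (a : UH H U) (y : Q.C U) : uo (f • a) y = f • uo a y :=
  SMod.smul_ot f _ _
theorem uo_smul {q : ZMod 2} {f : S.O U} (hf : S.Homog q f) (a : UH H U) (y : Q.C U) :
    uo a (f • y) = f • uo ((UH.mod H).tw q a) y := SMod.ot_smul hf _ _
theorem par_uo (a : UH H U) (y : Q.C U) :
    (SMod.otens (UH.mod H) Q).par U (uo a y) = uo (UH.par H U a) (Q.par U y) := rfl
theorem res_uo (h : V ≤ U) (a : UH H U) (y : Q.C U) :
    (SMod.otens (UH.mod H) Q).res h (uo a y) = uo (UH.res H h a) (Q.res h y) := rfl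

/-- Additive maps out of `U(H) ⊗_O Q`. -/
def ulift {G : Type*} [AddCommGroup G] (b : UH H U → Q.C U →+ G)
    (hb : ∀ x x' y, b (x + x') y = b x y + b x' y)
    (h : ∀ (q : ZMod 2) (f : S.O U), S.Homog q f → ∀ x y,
      b (UH.oo H U f * (UH.mod H).tw q x) y = b x (f • y)) : (SMod.otens (UH.mod H) Q).C U →+ G :=
  SMod.olift (P := UH.mod H) (AddMonoidHom.mk' b fun x x' => AddMonoidHom.ext (hb x x'))
    fun q f g hf x y => by
      have h1 := h q f hf (UH.oo H U g * x) y
      have h2 : UH.oo H U f * (UH.mod H).tw q (UH.oo H U g * x) =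
          UH.oo H U g * (UH.oo H U f * (UH.mod H).tw q x) := by
        have e : (UH.mod H).tw q (UH.oo H U g * x) = UH.oo H U (S.tw q g) * (UH.mod H).tw q x :=
          (UH.mod H).tw_smul q g x
        have e' : g * f = f * S.tw q g := by
          rw [mul_comm_tw hf, CharTwo.add_self_eq_zero, tw_apply_zero]
        rw [e, ← mul_assoc, ← mul_assoc, ← map_mul, ← map_mul, e']
      rw [h2] at h1
      exact h1

@[simp] theorem ulift_uo {G : Type*} [AddCommGroup G] (b : UH H U → Q.C U →+ G) (hb h)
    (x : UH H U) (y : Q.C U) : ulift b hb h (uo x y) = b x y := rfl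

/-- Left multiplication on `U(H) ⊗_O Q`. -/
def lact (b : UH H U) : (SMod.otens (UH.mod H) Q).C U →+ (SMod.otens (UH.mod H) Q).C U :=
  ulift (fun x => AddMonoidHom.mk' (fun y => uo (b * x) y) fun y y' => uo_add _ _ _)
    (fun x x' y => by simp only [AddMonoidHom.mk'_apply, mul_add, add_uo])
    fun q f hf x y => by
      simp only [AddMonoidHom.mk'_apply]
      rw [uo_smul hf, UH.tw_mul, ← smul_uo, ← mul_assoc, ← mul_assoc, UH.mul_oo H hf]

@[simp] theorem lact_uo (b x : UH H U) (y : Q.C U) : lact b (uo x y) = uo (b * x) y := rfl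

theorem lact_add (b c : UH H U) (z : (SMod.otens (UH.mod H) Q).C U) :
    lact (b + c) z = lact b z + lact c z := by
  induction z using uo_ind with
  | h x y => rw [lact_uo, lact_uo, lact_uo, add_mul, add_uo]
  | hadd a b ha hb => rw [map_add, ha, hb, map_add, map_add]; abel

end uo

/-- The connection on `U(H) ⊗_O M`. -/
def uconn (M : FlatMod H D) {p : ZMod 2} (v : VF S U p) :
    (SMod.otens (UH.mod H) M.toSMod).C U →+ (SMod.otens (UH.mod H) M.toSMod).C U :=
  SMod.osum (UH.del_dop D v) (M.conn_dop v)

@[simp] theorem uconn_uo (M : FlatMod H D) {p : ZMod 2} (v : VF S U p) (a : UH H U) (m : M.C U) :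
    uconn M v (uo a m) = uo (UH.del D v a) m + uo ((UH.mod H).tw p a) (M.conn v m) := rfl

theorem uconn_add (M : FlatMod H D) {p : ZMod 2} (v w : VF S U p) (z) :
    uconn M (v + w) z = uconn M v z + uconn M w z := by
  induction z using uo_ind with
  | h a m =>
    rw [uconn_uo, uconn_uo, uconn_uo, UH.del_add, map_add, AddMonoidHom.add_apply, uo_add, add_uo]
    abel
  | hadd a b ha hb => rw [map_add, ha, hb, map_add, map_add]; abel

/-- The flat module `U(H) ⊗_O M`. -/
@[reducible] def Fobj (M : FlatMod H D) : FlatMod H D where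
  toSMod := SMod.otens (UH.mod H) M.toSMod
  hact := fun {U} => AddMonoidHom.mk' (fun x => lact (UH.ι H x)) fun x y => AddMonoidHom.ext fun z => by
    rw [map_add, lact_add]; rfl
  hact_par x z := by
    induction z using uo_ind with
    | h a m => simp only [AddMonoidHom.mk'_apply, lact_uo, par_uo, map_mul, UH.par_ι]
    | hadd a b ha hb => simp only [map_add, ha, hb]
  hact_res h x z := by
    induction z using uo_ind with
    | h a m => simp only [AddMonoidHom.mk'_apply, lact_uo, res_uo, map_mul, UH.res_ι]
    | hadd a b ha hb => simp only [map_add, ha, hb]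
  hact_smul f x z := by
    induction z using uo_ind with
    | h a m =>
      simp only [AddMonoidHom.mk'_apply, lact_uo]
      rw [← smul_uo, ← UH.oo_mul_ι, mul_assoc]
    | hadd a b ha hb => simp only [map_add, ha, hb, smul_add]
  hact_one z := by
    induction z using uo_ind with
    | h a m => simp only [AddMonoidHom.mk'_apply, lact_uo, UH.ι_one, one_mul]
    | hadd a b ha hb => simp only [map_add, ha, hb]
  hact_br p q x y z hx hy := by
    induction z using uo_ind with
    | h a m =>
      simp only [AddMonoidHom.mk'_apply, lact_uo]
      rw [← zsmul_uo, ← UH.ι_comm H hx hy, sub_mul, smul_mul_assoc, mul_assoc, mul_assoc, sub_uo]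
    | hadd a b ha hb => simp only [map_add, ← ha, ← hb, smul_add]; abel
  conn := fun {U p} => AddMonoidHom.mk' (fun v => uconn M v)
    fun v w => AddMonoidHom.ext fun z => uconn_add M v w z
  conn_dop v := SMod.osum_dop (UH.del_dop D v) (M.conn_dop v)
  conn_smul {U p q} f hf v z := by
    induction z using uo_ind with
    | h a m =>
      simp only [AddMonoidHom.mk'_apply, uconn_uo]
      rw [UH.del_smul, M.conn_smul, smul_uo', uo_smul hf, ← SMod.tw_add, ← add_assoc,
        CharTwo.add_self_eq_zero, zero_add, smul_add]
    | hadd a b ha hb => simp only [map_add, ha, hb, smul_add]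
  conn_br {U p q} v w z := by
    induction z using uo_ind with
    | h a m =>
      simp only [AddMonoidHom.mk'_apply, uconn_uo, map_add]
      rw [UH.del_br, M.conn_br, (UH.del_dop D v).tw, (UH.del_dop D w).tw, ← SMod.tw_add,
        ← SMod.tw_add, add_comm q p, mul_comm q p, sub_uo, uo_sub, zsmul_uo, uo_zsmul, zsmul_uo,
        zsmul_uo]
      simp only [smul_add, smul_smul, sg_sq, one_smul]
      abel
    | hadd a b ha hb => simp only [map_add, ha, hb, smul_add]; abel
  conn_res h v z := by
    induction z using uo_ind with
    | h a m =>
      simp only [AddMonoidHom.mk'_apply, uconn_uo, map_add, res_uo]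
      rw [M.conn_res, UH.del_res]
      congr 2
      exact (UH.mod H).res_tw h _ a
    | hadd a b ha hb => simp only [map_add, ha, hb]
  conn_hact {U p} v x z := by
    induction z using uo_ind with
    | h a m =>
      simp only [AddMonoidHom.mk'_apply, uconn_uo, map_add, lact_uo]
      rw [UH.del_mul, UH.del_ι, UH.tw_mul, UH.tw_ι, add_uo, add_assoc]
    | hadd a b ha hb => simp only [map_add, ha, hb]; abel

theorem Fobj_conn_uo (M : FlatMod H D) {p : ZMod 2} (v : VF S U p) (a : UH H U) (m : M.C U) :
    (Fobj M).conn v (uo a m) = uo (UH.del D v a) m + uo ((UH.mod H).tw p a) (M.conn v m) := rfl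

/-- Functoriality of `U(H) ⊗_O M`. -/
def Fmap {M N : FlatMod H D} (φ : M ⟶ N) : Fobj M ⟶ Fobj N :=
  ⟨SMod.omap (FlatMod.toHom φ), by
    refine ⟨fun U x z => ?_, fun U p v z => ?_⟩
    · induction z using uo_ind with
      | h a m => rfl
      | hadd a b ha hb => simp only [map_add, ha, hb]
    · induction z using uo_ind with
      | h a m =>
        rw [Fobj_conn_uo, map_add]
        exact congrArg (_ + uo ((UH.mod H).tw p a) ·) (FlatMod.toHom_conn φ v m)
      | hadd a b ha hb => simp only [map_add, ha, hb]⟩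

theorem Fmap_ot {M N : FlatMod H D} (φ : M ⟶ N) (a : UH H U) (m : M.C U) :
    SMod.ap (FlatMod.toHom (Fmap φ)) U (uo a m) =
      uo a (SMod.ap (FlatMod.toHom φ) U m) := rfl

/-- The action map `U(H) ⊗_O M → M`. -/
def ε (M : FlatMod H D) : Fobj M ⟶ M :=
  ⟨⟨fun U => ulift (fun a => M.uact a) M.uact_add fun q f hf a m =>
        (M.smul_uact hf a m).symm, by
      refine ⟨fun U f z => ?_, fun U z => ?_, fun U V h z => ?_⟩
      · induction z using uo_ind with
        | h a m => rw [← smul_uo]; exact M.uact_smul f a m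
        | hadd a b ha hb => simp only [map_add, ha, hb, smul_add]
      · induction z using uo_ind with
        | h a m => exact (M.uact_par a m).symm
        | hadd a b ha hb => simp only [map_add, ha, hb]
      · induction z using uo_ind with
        | h a m => exact (M.uact_res h a m).symm
        | hadd a b ha hb => simp only [map_add, ha, hb]⟩, by
    refine ⟨fun U x z => ?_, fun U p v z => ?_⟩
    · induction z using uo_ind with
      | h a m => exact (M.uact_mul _ a m).trans (M.uact_ι x _)
      | hadd a b ha hb => simp only [map_add, ha, hb]
    · induction z using uo_ind with
      | h a m =>
        rw [Fobj_conn_uo, map_add]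
        exact (M.uact_conn v a m).symm
      | hadd a b ha hb => simp only [map_add, ha, hb]⟩

theorem ε_ot (M : FlatMod H D) (a : UH H U) (m : M.C U) :
    SMod.ap (FlatMod.toHom (ε M)) U (uo a m) = M.uact a m := rfl

theorem ε_nat {M N : FlatMod H D} (φ : M ⟶ N) : Fmap φ ≫ ε N = ε M ≫ φ := by
  refine FlatMod.hom_ext (SMod.hom_ext fun U z => ?_)
  induction z using uo_ind with
  | h a m => exact (FlatMod.uact_hom φ a m).symm
  | hadd a b ha hb => simp only [map_add, ha, hb]

theorem Fmap_comp {M N K : FlatMod H D} (φ : M ⟶ N) (ψ : N ⟶ K) :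
    Fmap (φ ≫ ψ) = Fmap φ ≫ Fmap ψ := by
  refine FlatMod.hom_ext (SMod.hom_ext fun U z => ?_)
  induction z using uo_ind with
  | h a m => rfl
  | hadd a b ha hb => simp only [map_add, ha, hb]

theorem Fmap_zero (M N : FlatMod H D) : Fmap (0 : M ⟶ N) = 0 := by
  refine FlatMod.hom_ext (SMod.hom_ext fun U z => ?_)
  induction z using uo_ind with
  | h a m =>
    change uo a (0 : N.C U) = 0
    simpa using uo_zsmul 0 a (0 : N.C U)
  | hadd a b ha hb => rw [map_add, ha, hb, map_add]

/-- The `n`-fold tensor product `U(H) ⊗_O ⋯ ⊗_O U(H) ⊗_O M`. -/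
def pow (M : FlatMod H D) : ℕ → FlatMod H D
  | 0 => M
  | n + 1 => Fobj (pow M n)

/-- The inductive step in the definition of the bar differential. -/
def estep {N : FlatMod H D} (d : Fobj N ⟶ N) : Fobj (Fobj N) ⟶ Fobj N := ε (Fobj N) - Fmap d

/-- The differential of the augmented bar resolution:
`e (u₀ ⊗ u₁ ⊗ ⋯ ⊗ m) = u₀ u₁ ⊗ ⋯ ⊗ m - u₀ ⊗ e (u₁ ⊗ ⋯ ⊗ m)`. -/
def e (M : FlatMod H D) : ∀ n, pow M (n + 1) ⟶ pow M n
  | 0 => ε M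
  | n + 1 => estep (N := pow M n) (e M n)

theorem estep_estep {N : FlatMod H D} (d : Fobj N ⟶ N) (h : estep d ≫ d = 0) :
    estep (estep d) ≫ estep d = 0 := by
  have h1 : Fmap (estep d) ≫ ε (Fobj N) = ε (Fobj (Fobj N)) ≫ estep d := ε_nat (estep d)
  have h2 : Fmap (estep d) ≫ Fmap d = 0 := by rw [← Fmap_comp, h, Fmap_zero]
  have h3 : Fmap (estep d) ≫ estep d = ε (Fobj (Fobj N)) ≫ estep d := by
    rw [← h1, ← sub_zero (Fmap (estep d) ≫ ε (Fobj N)), ← h2, ← Preadditive.comp_sub]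
    rfl
  rw [estep.eq_def (estep d), Preadditive.sub_comp, h3, sub_self]

theorem e_e (M : FlatMod H D) : ∀ n, e M (n + 1) ≫ e M n = 0
  | 0 => by
    change estep (ε M) ≫ ε M = 0
    rw [estep, Preadditive.sub_comp, ε_nat, sub_self]
  | n + 1 => estep_estep (N := pow M n) (e M n) (e_e M n)

end Bar

/-! ### Coinvariants -/

section Coinv

variable {H : PreHeis S} {D : Conn H} (J : H.toSMod.Sub)

/-- The relations `m x ⊗ n = m ⊗ x n` for `x` in `H`. -/
def cRel (N : FlatMod H D) : (SMod.ztens (Mr H J) N.toSMod).Sub :=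
  SMod.Sub.gen (fun U => {z | ∃ (x : H.C U) (m : (Mr H J).C U) (n : N.C U),
      z = SMod.zt (Mr.rmul (UH.ι H x) m) n - SMod.zt m (N.hact x n)})
    (by rintro U _ ⟨x, m, n, rfl⟩
        refine ⟨H.par U x, (Mr H J).par U m, N.par U n, ?_⟩
        rw [map_sub, SMod.par_zt, SMod.par_zt, N.hact_par, ← UH.par_ι]
        obtain ⟨a, rfl⟩ := Mr.mk_surj m
        rw [Mr.rmul_mk, Mr.mk_par, Mr.mk_par, Mr.rmul_mk, map_mul])
    (by rintro U V h _ ⟨x, m, n, rfl⟩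
        refine ⟨H.res h x, (Mr H J).res h m, N.res h n, ?_⟩
        rw [map_sub, SMod.res_zt, SMod.res_zt, N.hact_res, ← UH.res_ι, Mr.res_rmul])

theorem cAct_mem (N : FlatMod H D) {U : S.Aff} {p : ZMod 2} (A : AA H D J U p) :
    ∀ z ∈ (cRel J N).C U, zsum p A.top (N.conn A.anchor) z ∈ (cRel J N).C U :=
  IsDop.span ((A.dop le_rfl).zsum (N.conn_dop A.anchor).1) (by
    rintro _ ⟨x, m, n, rfl⟩
    have gen : ∀ (x : H.C U) (m : (Mr H J).C U) (n : N.C U),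
      SMod.zt (Mr.rmul (UH.ι H x) m) n - SMod.zt m (N.hact x n) ∈ (cRel J N).C U := fun x m n =>
        Submodule.subset_span ⟨x, m, n, rfl⟩
    have h1 := gen x (A.top m) n
    have h2 := gen (D.nab A.anchor x) ((Mr H J).tw p m) n
    have h3 := gen (H.tw p x) ((Mr H J).tw p m) (N.conn A.anchor n)
    refine (congrArg (· ∈ (cRel J N).C U) ?_).mpr (add_mem (add_mem h1 h2) h3)
    have e : VF.res le_rfl A.anchor = A.anchor := rfl
    rw [map_sub, zsum_zt, zsum_zt, A.ap_rmul, e, N.conn_hact, Mr.tw_rmul, UH.tw_ι]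
    simp only [SMod.add_zt, SMod.zt_add]
    abel)

/-- The action of the Lie algebroid on `M^r(J) ⊗_{U(H)} N`. -/
def cAct (N : FlatMod H D) {U : S.Aff} {p : ZMod 2} (A : AA H D J U p) :
    ((SMod.ztens (Mr H J) N.toSMod).quot (cRel J N)).C U →+
      ((SMod.ztens (Mr H J) N.toSMod).quot (cRel J N)).C U :=
  SMod.qop (zsum p A.top (N.conn A.anchor)) (cAct_mem J N A)

/-- The pure tensor in `M^r(J) ⊗_{U(H)} N`. -/
def ct (N : FlatMod H D) {U : S.Aff} (m : (Mr H J).C U) (n : N.C U) :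
    ((SMod.ztens (Mr H J) N.toSMod).quot (cRel J N)).C U :=
  SMod.ap (SMod.proj _ (cRel J N)) U (SMod.zt m n)

section ct

variable {J} {N : FlatMod H D} {U V : S.Aff}

theorem ct_ind {R : ((SMod.ztens (Mr H J) N.toSMod).quot (cRel J N)).C U → Prop}
    (h : ∀ m n, R (ct J N m n)) (hadd : ∀ a b, R a → R b → R (a + b)) (z) : R z := by
  obtain ⟨z, rfl⟩ := SMod.proj_surj _ z
  induction z using SMod.zt_ind with
  | h0 =>
    have : (SMod.zt 0 0 : (SMod.ztens (Mr H J) N.toSMod).C U) = 0 := TensorProduct.zero_tmul _ _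
    rw [← this]; exact h 0 0
  | h x y => exact h x y
  | hadd a b ha hb => rw [map_add]; exact hadd _ _ ha hb

theorem ct_add (m : (Mr H J).C U) (n n' : N.C U) :
    ct J N m (n + n') = ct J N m n + ct J N m n' := by rw [ct, SMod.zt_add, map_add]; rfl
theorem add_ct (m m' : (Mr H J).C U) (n : N.C U) :
    ct J N (m + m') n = ct J N m n + ct J N m' n := by rw [ct, SMod.add_zt, map_add]; rfl
theorem ct_zsmul (k : ℤ) (m : (Mr H J).C U) (n : N.C U) : ct J N m (k • n) = k • ct J N m n := by
  rw [ct, SMod.zt_zsmul, map_zsmul]; rfl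
theorem zsmul_ct (k : ℤ) (m : (Mr H J).C U) (n : N.C U) : ct J N (k • m) n = k • ct J N m n := by
  rw [ct, SMod.zsmul_zt, map_zsmul]; rfl
theorem smul_ct (f : S.O U) (m : (Mr H J).C U) (n : N.C U) : ct J N (f • m) n = f • ct J N m n := by
  rw [ct, SMod.smul_zt, SMod.ap_smul]; rfl
theorem ct_bal (x : H.C U) (m : (Mr H J).C U) (n : N.C U) :
    ct J N (Mr.rmul (UH.ι H x) m) n = ct J N m (N.hact x n) := by
  rw [← sub_eq_zero, ct, ct, ← map_sub]
  exact SMod.proj_zero _ (Submodule.subset_span ⟨x, m, n, rfl⟩)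
theorem ct_smul {q : ZMod 2} {f : S.O U} (hf : S.Homog q f) (m : (Mr H J).C U) (n : N.C U) :
    ct J N m (f • n) = f • ct J N ((Mr H J).tw q m) n := by
  rw [← N.hact_smul_one, ← ct_bal, ← smul_ct]
  congr 1
  obtain ⟨a, rfl⟩ := Mr.mk_surj m
  rw [Mr.mk_tw, Mr.rmul_mk, ← UH.oo_apply, UH.mul_oo H hf]
  rfl
theorem res_ct (h : V ≤ U) (m : (Mr H J).C U) (n : N.C U) :
    ((SMod.ztens (Mr H J) N.toSMod).quot (cRel J N)).res h (ct J N m n) =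
      ct J N ((Mr H J).res h m) (N.res h n) := rfl
theorem cAct_ct {p : ZMod 2} (A : AA H D J U p) (m : (Mr H J).C U) (n : N.C U) :
    cAct J N A (ct J N m n) =
      ct J N (A.top m) n + ct J N ((Mr H J).tw p m) (N.conn A.anchor n) :=
  map_add (SMod.ap (SMod.proj _ (cRel J N)) U) _ _

end ct

/-- The coinvariants `M^r(J) ⊗_{U(H)} N` with the action
`D (m ⊗ n) = D m ⊗ n ± m ⊗ ∇_{σ(D)} n` of the Lie algebroid `A_{H, ∇, J}`. -/
@[reducible] def Cobj (N : FlatMod H D) : AMod H D J where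
  toSMod := (SMod.ztens (Mr H J) N.toSMod).quot (cRel J N)
  act := fun {U p} => AddMonoidHom.mk' (fun A => cAct J N A)
    fun A B => AddMonoidHom.ext fun z => by
      induction z using ct_ind with
      | h m n =>
        have : (A + B).top m = A.top m + B.top m := rfl
        rw [AddMonoidHom.add_apply, cAct_ct, cAct_ct, cAct_ct, map_add, map_add,
          AddMonoidHom.add_apply, ct_add, this, add_ct]
        abel
      | hadd a b ha hb => rw [map_add, ha, hb, map_add]
  act_dop A := ((A.dop le_rfl).zsum (N.conn_dop A.anchor).1).quot (cAct_mem J N A)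
  act_smul {U p q} f hf A z := by
    simp only [AddMonoidHom.mk'_apply]
    induction z using ct_ind with
    | h m n =>
      have e1 : (A.smul f hf).anchor = VF.smul f hf A.anchor := rfl
      have e2 : (A.smul f hf).top m = f • A.top m := by
        have : (A.smul f hf).top m = S.res (le_refl U) f • A.top m := rfl
        rw [this, S.res_id]
      rw [cAct_ct, cAct_ct, e1, e2, N.conn_smul, smul_add, smul_ct, ct_smul hf, ← SMod.tw_add,
        ← add_assoc, CharTwo.add_self_eq_zero, zero_add]
    | hadd a b ha hb => simp only [map_add, ha, hb, smul_add]
  act_br {U p q} A B z := by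
    simp only [AddMonoidHom.mk'_apply]
    induction z using ct_ind with
    | h m n =>
      have e1 : (A.br B).anchor = VF.br A.anchor B.anchor := rfl
      have e2 : (A.br B).top m = A.top (B.top m) - sg (p * q) • B.top (A.top m) := rfl
      simp only [cAct_ct, map_add]
      rw [e1, e2, N.conn_br, (A.dop le_rfl).tw, (B.dop le_rfl).tw, ← SMod.tw_add, ← SMod.tw_add,
        add_comm q p, mul_comm q p, sub_eq_add_neg, sub_eq_add_neg, ← neg_smul, ← neg_smul]
      simp only [add_ct, ct_add, zsmul_ct, ct_zsmul, smul_add, smul_smul, sg_sq,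
        one_smul]
      simp only [neg_smul]
      abel
    | hadd a b ha hb => simp only [map_add, ha, hb, smul_add]; abel
  act_res h A z := by
    simp only [AddMonoidHom.mk'_apply]
    induction z using ct_ind with
    | h m n =>
      rw [cAct_ct, map_add, res_ct, res_ct, res_ct, cAct_ct, N.conn_res, SMod.res_tw, A.res_ap]; rfl
    | hadd a b ha hb => simp only [map_add, ha, hb]

/-- Functoriality of `M^r(J) ⊗_{U(H)} N` in `N`. -/
def cmap {N N' : FlatMod H D} (φ : N ⟶ N') (U : S.Aff) :
    ((SMod.ztens (Mr H J) N.toSMod).quot (cRel J N)).C U →+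
      ((SMod.ztens (Mr H J) N'.toSMod).quot (cRel J N')).C U :=
  SMod.qop (N := cRel J N) (N' := cRel J N')
    (SMod.zmap (AddMonoidHom.id _) (SMod.ap (FlatMod.toHom φ) U)) (by
      intro z hz
      induction hz using Submodule.span_induction with
      | mem z hz =>
        obtain ⟨x, m, n, rfl⟩ := hz
        refine Submodule.subset_span ⟨x, m, SMod.ap (FlatMod.toHom φ) U n, ?_⟩
        rw [map_sub, SMod.zmap_zt, SMod.zmap_zt, FlatMod.toHom_hact]; rfl
      | zero => simp
      | add a b _ _ ha hb => rw [map_add]; exact add_mem ha hb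
      | smul f a _ ha =>
        have : ∀ a, SMod.zmap (P := Mr H J) (P' := Mr H J) (AddMonoidHom.id _)
            (SMod.ap (FlatMod.toHom φ) U) (f • a) = f • SMod.zmap (P := Mr H J) (P' := Mr H J)
            (AddMonoidHom.id _) (SMod.ap (FlatMod.toHom φ) U) a := fun a => by
          induction a using SMod.zt_ind with
          | h0 => simp
          | h m n => rfl
          | hadd a b ha hb => rw [smul_add, map_add, ha, hb, map_add, smul_add]
        rw [this]; exact Submodule.smul_mem _ _ ha)

theorem cmap_ct {N N' : FlatMod H D} (φ : N ⟶ N') {U : S.Aff} (m : (Mr H J).C U) (n : N.C U) :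
    cmap J φ U (ct J N m n) = ct J N' m (SMod.ap (FlatMod.toHom φ) U n) := rfl

/-- The functor of coinvariants, from flat modules to modules over the Lie algebroid. -/
@[reducible] def coinv : FlatMod H D ⥤ AMod H D J where
  obj := Cobj J
  map {N N'} φ := ⟨⟨fun U => cmap J φ U, by
      refine ⟨fun U f z => ?_, fun U z => ?_, fun U V h z => ?_⟩
      · induction z using ct_ind with
        | h m n => rw [← smul_ct]; exact smul_ct _ _ _
        | hadd a b ha hb => rw [smul_add, map_add, ha, hb, map_add, smul_add]
      · induction z using ct_ind with
        | h m n => exact congrArg (ct J N' _) (SMod.ap_par (FlatMod.toHom φ) n)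
        | hadd a b ha hb => rw [map_add, map_add, ha, hb, map_add, map_add]
      · induction z using ct_ind with
        | h m n => exact congrArg (ct J N' _) (SMod.ap_res (FlatMod.toHom φ) h n)
        | hadd a b ha hb => rw [map_add, map_add, ha, hb, map_add, map_add]⟩, fun U p A z => by
    change cmap J φ U (cAct J N A z) = cAct J N' A (cmap J φ U z)
    induction z using ct_ind with
    | h m n => rw [cAct_ct, map_add, cmap_ct, cmap_ct, cmap_ct, cAct_ct, FlatMod.toHom_conn]
    | hadd a b ha hb => rw [map_add, map_add, ha, hb, map_add, map_add]⟩
  map_id N := by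
    refine Subtype.ext (SMod.hom_ext fun U z => ?_)
    change cmap J (𝟙 N) U z = z
    induction z using ct_ind with
    | h m n => rfl
    | hadd a b ha hb => rw [map_add, ha, hb]
  map_comp {N N' N''} f g := by
    refine Subtype.ext (SMod.hom_ext fun U z => ?_)
    change cmap J (f ≫ g) U z = cmap J g U (cmap J f U z)
    induction z using ct_ind with
    | h m n => rfl
    | hadd a b ha hb => rw [map_add, ha, hb, map_add, map_add]

theorem coinv_zero (N N' : FlatMod H D) : (coinv J).map (0 : N ⟶ N') = 0 := by
  refine Subtype.ext (SMod.hom_ext fun U z => ?_)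
  change cmap J (0 : N ⟶ N') U z = 0
  induction z using ct_ind with
  | h m n =>
    change ct J N' m 0 = 0
    simpa using ct_zsmul 0 m (0 : N'.C U)
  | hadd a b ha hb => rw [map_add, ha, hb, add_zero]

/-- The derived coinvariants `C_J(M)` as a complex of modules over the Lie algebroid `A_{H, ∇, J}`:
the coinvariants of the bar resolution of `M`. -/
@[reducible] def barCx (M : FlatMod H D) : ChainComplex (AMod H D J) ℕ :=
  ChainComplex.of (fun n => (coinv J).obj (Bar.pow M (n + 1)))
    (fun n => (coinv J).map (Bar.e M (n + 1)))
    (fun n => by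
      have := Bar.e_e M (n + 1)
      rw [← (coinv J).map_comp, this, coinv_zero])

end Coinv

/-! ### Invariants and Fock modules -/

namespace FlatMod

variable {H : PreHeis S} {D : Conn H}

/-- `I` acts locally nilpotently on `M`: every section is killed by all products of `n` sections of
`I`, for some `n`. -/
def LocNilp (M : FlatMod H D) (I : H.toSMod.Sub) : Prop :=
  ∀ (U : S.Aff) (m : M.C U), ∃ n : ℕ, ∀ l : List (H.C U), l.length = n → (∀ x ∈ l, x ∈ I.C U) →
    l.foldr (fun x m => M.hact x m) m = 0

variable (M : FlatMod H D) (I : H.toSMod.Sub)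

/-- The invariants `M^I`. -/
def inv : M.toSMod.Sub where
  C U :=
    { carrier := {m | ∀ V (h : V ≤ U), ∀ y ∈ I.C V, M.hact y (M.res h m) = 0}
      zero_mem' := by simp
      add_mem' := fun {a b} ha hb V h y hy => by simp [ha V h y hy, hb V h y hy]
      smul_mem' := fun f m hm V h y hy => by
        induction f using O_homog_ind with
        | hadd f g hf hg => rw [add_smul, map_add, map_add, hf, hg, add_zero]
        | h q f hf =>
          rw [M.res_smul, M.smul_hact (hf.res h), hm V h _ (I.tw_mem q hy), smul_zero] }
  par_mem U m hm V h y hy := by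
    have := hm V h _ (I.par_mem V y hy)
    rw [M.res_par, ← H.par_par V y, ← M.hact_par, this, map_zero]
  res_mem h m hm V k y hy := by rw [M.res_res]; exact hm V _ y hy

variable {M I}

theorem inv_hact {U : S.Aff} {y : H.C U} {m : M.C U} (hm : m ∈ (M.inv I).C U) (hy : y ∈ I.C U) :
    M.hact y m = 0 := by
  have := hm U le_rfl y hy
  rwa [M.res_id] at this

theorem hact_mem {U : S.Aff} {x : H.C U} {m : M.C U} (hx : x ∈ (H.cent I).C U)
    (hm : m ∈ (M.inv I).C U) : M.hact x m ∈ (M.inv I).C U := fun V h y hy => by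
  rw [M.hact_res]
  have key : ∀ (p q : ZMod 2) (x y : H.C V), H.Homog p x → H.Homog q y → x ∈ (H.cent I).C V →
      y ∈ I.C V → M.hact y (M.hact x (M.res h m)) = 0 := fun p q x y hp hq hx hy => by
    have h1 := M.hact_br q p y x (M.res h m) hq hp
    rw [H.br_skew V q p y x hq hp, PreHeis.cent_br hx hy, hm V h y hy] at h1
    simpa using h1
  have hx' := (H.cent I).res_mem h x hx
  rw [← H.pr_add_pr y, ← H.pr_add_pr (H.res h x)]
  simp only [map_add, AddMonoidHom.add_apply]
  rw [key _ _ _ _ (H.pr_homog 0 _) (H.pr_homog 0 _) ((H.cent I).pr_mem 0 hx') (I.pr_mem 0 hy),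
    key _ _ _ _ (H.pr_homog 0 _) (H.pr_homog 1 _) ((H.cent I).pr_mem 0 hx') (I.pr_mem 1 hy),
    key _ _ _ _ (H.pr_homog 1 _) (H.pr_homog 0 _) ((H.cent I).pr_mem 1 hx') (I.pr_mem 0 hy),
    key _ _ _ _ (H.pr_homog 1 _) (H.pr_homog 1 _) ((H.cent I).pr_mem 1 hx') (I.pr_mem 1 hy)]
  simp

theorem conn_mem (hI : D.Preserves I) {U : S.Aff} {p : ZMod 2} (v : VF S U p) {m : M.C U}
    (hm : m ∈ (M.inv I).C U) : M.conn v m ∈ (M.inv I).C U := fun V h y hy => by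
  rw [M.conn_res]
  have h1 := M.conn_hact (VF.res h v) (H.tw p y) (M.res h m)
  rw [hm V h _ (I.tw_mem p hy), hm V h _ (hI V p _ _ (I.tw_mem p hy)), H.tw_tw, map_zero,
    zero_add] at h1
  exact h1.symm

variable (M I)

/-- The action of `c(I)` on `M^I`. -/
def invHact (U : S.Aff) :
    (H.cent I).toSMod.C U →+ (M.inv I).toSMod.C U →+ (M.inv I).toSMod.C U :=
  AddMonoidHom.mk' (fun x => AddMonoidHom.mk' (fun m => ⟨M.hact x.1 m.1, hact_mem x.2 m.2⟩)
    fun a b => Subtype.ext (map_add (M.hact x.1) a.1 b.1))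
    fun a b => AddMonoidHom.ext fun y => Subtype.ext (by
      change M.hact (a.1 + b.1) y.1 = M.hact a.1 y.1 + M.hact b.1 y.1
      simp)

/-- The action of `c(I) / I` on `M^I`. -/
def redHact (U : S.Aff) :
    (H.red I).C U →+ (M.inv I).toSMod.C U →+ (M.inv I).toSMod.C U :=
  SMod.qlift _ (M.invHact I U) fun x hx => AddMonoidHom.ext fun m => Subtype.ext (inv_hact m.2 hx)

theorem redHact_proj {U : S.Aff} (x : (H.cent I).toSMod.C U) (m : (M.inv I).toSMod.C U) :
    M.redHact I U (SMod.ap (H.toRed I) U x) m = M.invHact I U x m := rfl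

variable {I}

/-- The connection on `M^I`. -/
def invConn (hI : D.Preserves I) (U : S.Aff) (p : ZMod 2) :
    VF S U p →+ (M.inv I).toSMod.C U →+ (M.inv I).toSMod.C U :=
  AddMonoidHom.mk' (fun v => AddMonoidHom.mk' (fun m => ⟨M.conn v m.1, conn_mem hI v m.2⟩)
    fun a b => Subtype.ext (map_add (M.conn v) a.1 b.1))
    fun a b => AddMonoidHom.ext fun y => Subtype.ext (by
      change M.conn (a + b) y.1 = M.conn a y.1 + M.conn b y.1
      simp)

/-- The invariants `M^I` as a flat module over the reduced Heisenberg algebra `c(I) / I`. -/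
@[reducible] def invMod (hI : D.Preserves I) : FlatMod (H.red I) (D.red hI) where
  toSMod := (M.inv I).toSMod
  hact := fun {U} => M.redHact I U
  hact_par x m := by
    obtain ⟨x, rfl⟩ := SMod.proj_surj _ x
    rw [← SMod.ap_par, redHact_proj, redHact_proj]
    exact Subtype.ext (M.hact_par x.1 m.1)
  hact_res h x m := by
    obtain ⟨x, rfl⟩ := SMod.proj_surj _ x
    rw [← SMod.ap_res, redHact_proj, redHact_proj]
    exact Subtype.ext (M.hact_res h x.1 m.1)
  hact_smul f x m := by
    obtain ⟨x, rfl⟩ := SMod.proj_surj _ x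
    rw [← SMod.ap_smul, redHact_proj, redHact_proj]
    exact Subtype.ext (M.hact_smul f x.1 m.1)
  hact_one m := by
    rw [redHact_proj]
    exact Subtype.ext (M.hact_one m.1)
  hact_br p q x y m hx hy := by
    obtain ⟨x, hx', rfl⟩ := PreHeis.quot_homog hx
    obtain ⟨y, hy', rfl⟩ := PreHeis.quot_homog hy
    rw [PreHeis.redBr_proj, redHact_proj, redHact_proj, redHact_proj, redHact_proj, redHact_proj]
    exact Subtype.ext (M.hact_br p q x.1 y.1 m.1 (congrArg Subtype.val hx')
      (congrArg Subtype.val hy'))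
  conn := fun {U p} => M.invConn hI U p
  conn_dop v := ⟨fun m => Subtype.ext ((M.conn_dop v).1 m.1),
    fun f m => Subtype.ext ((M.conn_dop v).2 f m.1)⟩
  conn_smul f hf v m := Subtype.ext (M.conn_smul f hf v m.1)
  conn_br v w m := Subtype.ext (M.conn_br v w m.1)
  conn_res h v m := Subtype.ext (M.conn_res h v m.1)
  conn_hact {U p} v x m := by
    obtain ⟨x, rfl⟩ := SMod.proj_surj _ x
    rw [← SMod.ap_tw, Conn.redNab_proj, redHact_proj, redHact_proj, redHact_proj]
    refine Subtype.ext ((M.conn_hact v x.1 m.1).trans ?_)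
    rw [← Conn.cent_tw]
    rfl

end FlatMod

section Fock

variable (H : PreHeis S) (J : H.toSMod.Sub)

/-- The left ideal `U(H) · J`. -/
def lIdeal : (UH.mod H).Sub :=
  SMod.Sub.gen (fun U => {a | ∃ j ∈ J.C U, ∃ u : UH H U, a = u * UH.ι H j})
    (by rintro U _ ⟨j, hj, u, rfl⟩
        exact ⟨H.par U j, J.par_mem U j hj, UH.par H U u, by simp⟩)
    (by rintro U V h _ ⟨j, hj, u, rfl⟩
        exact ⟨H.res h j, J.res_mem h j hj, UH.res H h u, by simp⟩)

variable {H J} {U V : S.Aff}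

theorem lIdeal_mul (b : UH H U) : ∀ a ∈ (lIdeal H J).C U,
    AddMonoidHom.mulLeft b a ∈ (lIdeal H J).C U := fun a ha => by
  change b * a ∈ _
  induction ha using Submodule.span_induction generalizing b with
  | mem a ha =>
    obtain ⟨j, hj, u, rfl⟩ := ha
    exact Submodule.subset_span ⟨j, hj, b * u, by rw [mul_assoc]⟩
  | zero => rw [mul_zero]; exact zero_mem _
  | add x y _ _ hx hy => rw [mul_add]; exact add_mem (hx b) (hy b)
  | smul f a _ ha =>
    induction f using O_homog_ind with
    | hadd f g hf hg => rw [add_smul, mul_add]; exact add_mem hf hg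
    | h q f hf =>
      rw [UH.smul_def, ← mul_assoc, UH.mul_oo H hf, mul_assoc]
      exact Submodule.smul_mem _ f (ha _)

theorem lIdeal_del {D : Conn H} (hJ : D.Preserves J) {p : ZMod 2} (v : VF S U p) :
    ∀ a ∈ (lIdeal H J).C U, UH.del D v a ∈ (lIdeal H J).C U :=
  IsDop.span (UH.del_dop D v) (by
    rintro _ ⟨j, hj, u, rfl⟩
    rw [UH.del_mul, UH.del_ι]
    exact add_mem (Submodule.subset_span ⟨j, hj, _, rfl⟩)
      (Submodule.subset_span ⟨_, hJ U p v j hj, _, rfl⟩))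

/-- The class in `M(J) = U(H) / U(H) J` of an element of `U(H)`; the class of `1` is the vacuum
vector. -/
def fmk (J : H.toSMod.Sub) (a : UH H U) : ((UH.mod H).quot (lIdeal H J)).C U :=
  SMod.ap (SMod.proj _ (lIdeal H J)) U a

theorem fmk_surj (m : ((UH.mod H).quot (lIdeal H J)).C U) : ∃ a, fmk J a = m := SMod.proj_surj _ m
theorem fmk_add (a b : UH H U) : fmk J (a + b) = fmk J a + fmk J b := map_add _ a b
theorem fmk_zsmul (n : ℤ) (a : UH H U) : fmk J (n • a) = n • fmk J a := map_zsmul _ n a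
theorem fmk_sub (a b : UH H U) : fmk J (a - b) = fmk J a - fmk J b := map_sub _ a b
theorem fmk_smul (f : S.O U) (a : UH H U) : f • fmk J a = fmk J (f • a) := rfl

/-- Left multiplication on `M(J)`. -/
def fmul (b : UH H U) :
    ((UH.mod H).quot (lIdeal H J)).C U →+ ((UH.mod H).quot (lIdeal H J)).C U :=
  SMod.qop (AddMonoidHom.mulLeft b) (lIdeal_mul b)

theorem fmul_fmk (b a : UH H U) : fmul b (fmk J a) = fmk J (b * a) := rfl

/-- The connection on `M(J)`. -/
def fdel {D : Conn H} (hJ : D.Preserves J) {p : ZMod 2} (v : VF S U p) :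
    ((UH.mod H).quot (lIdeal H J)).C U →+ ((UH.mod H).quot (lIdeal H J)).C U :=
  SMod.qop (UH.del D v) (lIdeal_del hJ v)

theorem fdel_fmk {D : Conn H} (hJ : D.Preserves J) {p : ZMod 2} (v : VF S U p) (a : UH H U) :
    fdel hJ v (fmk J a) = fmk J (UH.del D v a) := rfl

/-- The flat module `M(J) = U(H) / U(H) J` associated with `J` preserved by the connection. -/
@[reducible] def fock {D : Conn H} (hJ : D.Preserves J) : FlatMod H D where
  toSMod := (UH.mod H).quot (lIdeal H J)
  hact := fun {U} => AddMonoidHom.mk' (fun x => fmul (UH.ι H x)) fun x y => AddMonoidHom.ext fun m => by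
    obtain ⟨a, rfl⟩ := fmk_surj m
    rw [AddMonoidHom.add_apply, fmul_fmk, fmul_fmk, fmul_fmk, map_add, add_mul, fmk_add]
  hact_par x m := by
    obtain ⟨a, rfl⟩ := fmk_surj m
    exact congrArg (fmk J) ((map_mul (UH.par H _) _ _).trans (by rw [UH.par_ι]; rfl))
  hact_res h x m := by
    obtain ⟨a, rfl⟩ := fmk_surj m
    exact congrArg (fmk J) ((map_mul (UH.res H h) _ _).trans (by rw [UH.res_ι]; rfl))
  hact_smul f x m := by
    obtain ⟨a, rfl⟩ := fmk_surj m
    simp only [AddMonoidHom.mk'_apply, fmul_fmk]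
    rw [fmk_smul, UH.smul_def, ← UH.oo_mul_ι, mul_assoc]
  hact_one m := by
    obtain ⟨a, rfl⟩ := fmk_surj m
    simp only [AddMonoidHom.mk'_apply, fmul_fmk, UH.ι_one, one_mul]
  hact_br p q x y m hx hy := by
    obtain ⟨a, rfl⟩ := fmk_surj m
    simp only [AddMonoidHom.mk'_apply, fmul_fmk]
    rw [← UH.ι_comm H hx hy, ← fmk_zsmul, ← fmk_sub, sub_mul, smul_mul_assoc, mul_assoc, mul_assoc]
  conn := fun {U p} => AddMonoidHom.mk' (fun v => fdel hJ v) fun v w => AddMonoidHom.ext fun m => by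
    obtain ⟨a, rfl⟩ := fmk_surj m
    rw [AddMonoidHom.add_apply, fdel_fmk, fdel_fmk, fdel_fmk, UH.del_add, fmk_add]
  conn_dop v := (UH.del_dop D v).quot (lIdeal_del hJ v)
  conn_smul f hf v m := by
    obtain ⟨a, rfl⟩ := fmk_surj m
    simp only [AddMonoidHom.mk'_apply, fdel_fmk]
    rw [UH.del_smul, fmk_smul]
  conn_br v w m := by
    obtain ⟨a, rfl⟩ := fmk_surj m
    simp only [AddMonoidHom.mk'_apply, fdel_fmk]
    rw [UH.del_br, fmk_sub, fmk_zsmul]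
  conn_res h v m := by
    obtain ⟨a, rfl⟩ := fmk_surj m
    exact congrArg (fmk J) (UH.del_res D h v a)
  conn_hact {U p} v x m := by
    obtain ⟨a, rfl⟩ := fmk_surj m
    simp only [AddMonoidHom.mk'_apply, fdel_fmk, fmul_fmk]
    rw [UH.del_mul, UH.del_ι, UH.tw_ι, fmk_add]

end Fock

/-! ### The tensor product `M^r(J) ⊗_{U(c(I))} U(c(I) / I)` -/

section RedTens

variable (H : PreHeis S) (I J : H.toSMod.Sub)

/-- The relations `m x ⊗ u = m ⊗ x u` for `x` in `c(I)`. -/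
def redRel : (SMod.ztens (Mr H J) (UH.mod (H.red I))).Sub :=
  SMod.Sub.gen (fun U => {z | ∃ (x : (H.cent I).toSMod.C U) (m : (Mr H J).C U)
      (u : UH (H.red I) U), z = SMod.zt (Q := UH.mod (H.red I)) (Mr.rmul (UH.ι H x.1) m) u -
        SMod.zt (Q := UH.mod (H.red I)) m (UH.ι (H.red I) (SMod.ap (H.toRed I) U x) * u)})
    (by rintro U _ ⟨x, m, u, rfl⟩
        refine ⟨(H.cent I).toSMod.par U x, (Mr H J).par U m, UH.par (H.red I) U u, ?_⟩
        rw [map_sub, SMod.par_zt, SMod.par_zt]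
        obtain ⟨a, rfl⟩ := Mr.mk_surj m
        rw [SMod.ap_par, ← UH.par_ι (H.red I), ← map_mul]
        congr 2
        exact congrArg (Mr.mk J) ((map_mul (UH.par H U) _ _).trans (by rw [UH.par_ι]; rfl)))
    (by rintro U V h _ ⟨x, m, u, rfl⟩
        refine ⟨(H.cent I).toSMod.res h x, (Mr H J).res h m, UH.res (H.red I) h u, ?_⟩
        rw [map_sub, SMod.res_zt, SMod.res_zt, Mr.res_rmul, UH.res_ι, SMod.ap_res,
          ← UH.res_ι (H.red I), ← map_mul]
        rfl)

/-- The supermodule `M^r(J) ⊗_{U(c(I))} U(c(I) / I)`. -/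
@[reducible] def redTens : SMod S :=
  (SMod.ztens (Mr H J) (UH.mod (H.red I))).quot (redRel H I J)

/-- The pure tensor in `M^r(J) ⊗_{U(c(I))} U(c(I) / I)`. -/
def rt {U : S.Aff} (m : (Mr H J).C U) (u : UH (H.red I) U) : (redTens H I J).C U :=
  SMod.ap (SMod.proj _ (redRel H I J)) U (SMod.zt (Q := UH.mod (H.red I)) m u)

end RedTens

/-! ### The Koszul complex -/

/-- An `O`-linear action of `P` on `T` by supercommuting operators. -/
structure Act (P T : SMod S) where
  a : ∀ {U : S.Aff}, P.C U →+ T.C U →+ T.C U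
  par : ∀ {U : S.Aff} (x : P.C U) t, T.par U (a x t) = a (P.par U x) (T.par U t)
  res : ∀ {U V : S.Aff} (h : V ≤ U) (x : P.C U) t, T.res h (a x t) = a (P.res h x) (T.res h t)
  smul : ∀ {U : S.Aff} (f : S.O U) (x : P.C U) t, a (f • x) t = f • a x t
  smul_right : ∀ {U : S.Aff} {q : ZMod 2} (f : S.O U), S.Homog q f → ∀ (x : P.C U) t,
    a x (f • t) = f • a (P.tw q x) t
  comm : ∀ {U : S.Aff} (p q : ZMod 2) (x y : P.C U) t, P.Homog p x → P.Homog q y →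
    a x (a y t) = sg (p * q) • a y (a x t)

namespace Act

open SMod

variable {P T : SMod S} (A : Act P T) {U V : S.Aff}

theorem o_comm {q r : ZMod 2} {f : S.O U} (hf : S.Homog q f) (g : S.O U) :
    S.tw r g * f = f * S.tw q (S.tw r g) := by
  rw [mul_comm_tw hf, CharTwo.add_self_eq_zero, tw_apply_zero]

/-- For each parity `r`, the operator `y ⊗ t ↦ (-1)^(r y) y ⊗ x' t` on `P ⊗_O T`, where `x'` is
the component of `x` of parity `r`. -/
def opr (r : ZMod 2) (x : P.C U) : (otens P T).C U →+ (otens P T).C U :=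
  olift (AddMonoidHom.mk' (fun y => AddMonoidHom.mk' (fun t => ot (P.tw r y) (A.a (P.pr r x) t))
      fun t t' => by rw [map_add, ot_add])
      fun y y' => AddMonoidHom.ext fun t => by
        simp only [AddMonoidHom.mk'_apply, AddMonoidHom.add_apply, map_add, add_ot])
    fun q f g hf y t => by
      simp only [AddMonoidHom.mk'_apply]
      rw [A.smul_right f hf, (P.pr_homog r x).tw, map_zsmul, AddMonoidHom.smul_apply,
        smul_comm f (sg _), ot_zsmul, ot_smul hf, P.tw_smul, P.tw_smul, P.tw_smul, P.tw_smul,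
        smul_ot, smul_ot, smul_ot, hf.tw, smul_assoc, smul_comm _ (sg _), smul_smul, smul_smul,
        o_comm hf, mul_comm q r, ← P.tw_add, ← P.tw_add, add_comm]

theorem opr_ot (r : ZMod 2) (x y : P.C U) (t : T.C U) :
    A.opr r x (ot y t) = ot (P.tw r y) (A.a (P.pr r x) t) := rfl

/-- The operator `y ⊗ t ↦ (-1)^(x y) y ⊗ x t` on `P ⊗_O T`. -/
def op (x : P.C U) : (otens P T).C U →+ (otens P T).C U := A.opr 0 x + A.opr 1 x

theorem op_ot {p : ZMod 2} {x : P.C U} (hx : P.Homog p x) (y : P.C U) (t : T.C U) :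
    A.op x (ot y t) = ot (P.tw p y) (A.a x t) := by
  rw [op, AddMonoidHom.add_apply, opr_ot, opr_ot, hx.pr_eq, hx.pr_eq]
  have h0 : ∀ y : P.C U, (ot y 0 : (otens P T).C U) = 0 := fun y => by
    simpa using ot_zsmul 0 y (0 : T.C U)
  rcases zmod2_cases p with rfl | rfl <;> simp [h0]

theorem op_add (x x' : P.C U) (z) : A.op (x + x') z = A.op x z + A.op x' z := by
  induction z using ot_ind with
  | h y t =>
    simp only [op, AddMonoidHom.add_apply, opr_ot, map_add, ot_add]
    abel
  | hadd a b ha hb => simp only [map_add, ha, hb]; abel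

theorem homog_ind2 {R : P.C U → (otens P T).C U → Prop}
    (hadd : ∀ x x' z, R x z → R x' z → R (x + x') z) (hadd' : ∀ x z z', R x z → R x z' → R x (z + z'))
    (h : ∀ p x, P.Homog p x → ∀ y t, R x (ot y t)) (x z) : R x z := by
  induction x using P.homog_ind with
  | hadd a b ha hb => exact hadd _ _ _ ha hb
  | h p x hx =>
    induction z using ot_ind with
    | h y t => exact h p x hx y t
    | hadd a b ha hb => exact hadd' _ _ _ ha hb

/-- The induced action on `P ⊗_O T`. -/
def step : Act P (otens P T) where
  a := fun {U} => AddMonoidHom.mk' (fun x => A.op x) fun x x' => AddMonoidHom.ext fun z => A.op_add x x' z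
  par x z := by
    simp only [AddMonoidHom.mk'_apply]
    induction x, z using homog_ind2 with
    | hadd x x' z h h' => simp only [map_add, op_add, h, h']
    | hadd' x z z' h h' => simp only [map_add, h, h']
    | h p x hx y t => rw [A.op_ot hx, par_ot, par_ot, A.op_ot hx.par, P.par_tw, A.par]
  res h x z := by
    simp only [AddMonoidHom.mk'_apply]
    induction x, z using homog_ind2 with
    | hadd x x' z h h' => simp only [map_add, op_add, h, h']
    | hadd' x z z' h h' => simp only [map_add, h, h']
    | h p x hx y t => rw [A.op_ot hx, res_ot, res_ot, A.op_ot (hx.res h), P.res_tw, A.res]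
  smul f x z := by
    simp only [AddMonoidHom.mk'_apply]
    induction f using O_homog_ind with
    | hadd f g hf hg => rw [add_smul, op_add, hf, hg, add_smul]
    | h q f hf =>
      induction x, z using homog_ind2 with
      | hadd x x' z h h' => simp only [smul_add, op_add, h, h']
      | hadd' x z z' h h' => simp only [map_add, smul_add, h, h']
      | h p x hx y t =>
        rw [A.op_ot hx, A.op_ot (SMod.Homog.smul hf hx), A.smul, ot_smul hf, ← P.tw_add,
          ← add_assoc, CharTwo.add_self_eq_zero, zero_add]
  smul_right {U q} f hf x z := by
    simp only [AddMonoidHom.mk'_apply]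
    induction x, z using homog_ind2 with
    | hadd x x' z h h' => simp only [map_add, smul_add, op_add, h, h']
    | hadd' x z z' h h' => simp only [map_add, smul_add, h, h']
    | h p x hx y t =>
      have h1 : P.Homog p (P.tw q x) := by
        unfold SMod.Homog at *; rw [P.par_tw, hx, map_zsmul]
      rw [← smul_ot, A.op_ot hx, A.op_ot h1, P.tw_smul, hf.tw, hx.tw, map_zsmul,
        AddMonoidHom.smul_apply, ot_zsmul, smul_ot, smul_assoc, smul_comm f, mul_comm]
  comm p q x y z hx hy := by
    simp only [AddMonoidHom.mk'_apply]
    induction z using ot_ind with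
    | h w t =>
      rw [A.op_ot hx, A.op_ot hy, A.op_ot hx, A.op_ot hy, A.comm p q x y t hx hy, ot_zsmul,
        ← P.tw_add, ← P.tw_add, add_comm]
    | hadd a b ha hb => simp only [map_add, ha, hb, smul_add]

theorem step_ot {p : ZMod 2} {x : P.C U} (hx : P.Homog p x) (y : P.C U) (t : T.C U) :
    A.step.a x (ot y t) = ot (P.tw p y) (A.a x t) := A.op_ot hx y t

/-- The action map `P ⊗_O T → T`. -/
def ev : otens P T ⟶ T :=
  ⟨fun U => olift A.a fun q f g hf x t => by
      rw [A.smul, A.smul, A.smul, A.smul_right f hf], by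
    refine ⟨fun U f z => ?_, fun U z => ?_, fun U V h z => ?_⟩
    · induction z using ot_ind with
      | h x t => rw [← smul_ot]; exact A.smul f x t
      | hadd a b ha hb => simp only [smul_add, map_add, ha, hb]
    · induction z using ot_ind with
      | h x t => exact (A.par x t).symm
      | hadd a b ha hb => simp only [map_add, ha, hb]
    · induction z using ot_ind with
      | h x t => exact (A.res h x t).symm
      | hadd a b ha hb => simp only [map_add, ha, hb]⟩

theorem ev_ot (x : P.C U) (t : T.C U) : ap A.ev U (ot x t) = A.a x t := rfl

/-- Morphisms commuting with the actions of `P`. -/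
def Eqv {T' : SMod S} (A : Act P T) (B : Act P T') (φ : T ⟶ T') : Prop :=
  ∀ (U : S.Aff) (x : P.C U) t, ap φ U (A.a x t) = B.a x (ap φ U t)

theorem ev_eqv : Eqv A.step A A.ev := fun U x z => by
  induction x, z using homog_ind2 with
  | hadd x x' z h h' => simp only [map_add, AddMonoidHom.add_apply, h, h']
  | hadd' x z z' h h' => simp only [map_add, h, h']
  | h p x hx y t =>
    rw [A.step_ot hx, ev_ot, ev_ot]
    induction y using P.homog_ind with
    | hadd a b ha hb => simp only [map_add, AddMonoidHom.add_apply, ha, hb]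
    | h q y hy =>
      rw [A.comm p q x y t hx hy, hy.tw, map_zsmul, AddMonoidHom.smul_apply]

theorem omap_eqv {T' : SMod S} {B : Act P T'} {φ : T ⟶ T'} (h : Eqv A B φ) :
    Eqv A.step B.step (omap φ) := fun U x z => by
  induction x, z using homog_ind2 with
  | hadd x x' z h h' => simp only [map_add, AddMonoidHom.add_apply, h, h']
  | hadd' x z z' h h' => simp only [map_add, h, h']
  | h p x hx y t => rw [A.step_ot hx, omap_ot, omap_ot, B.step_ot hx, h]

theorem omap_ev {T' : SMod S} {B : Act P T'} {φ : T ⟶ T'} (h : Eqv A B φ) :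
    omap φ ≫ B.ev = A.ev ≫ φ := SMod.hom_ext fun U z => by
  induction z using ot_ind with
  | h x t => exact (h U x t).symm
  | hadd a b ha hb => simp only [map_add, ha, hb]

theorem omap_comp {T' T'' : SMod S} (φ : T ⟶ T') (ψ : T' ⟶ T'') :
    (omap (φ ≫ ψ) : otens P T ⟶ _) = omap φ ≫ omap ψ := SMod.hom_ext fun U z => by
  induction z using ot_ind with
  | h x t => rfl
  | hadd a b ha hb => simp only [map_add, ha, hb]

theorem omap_zero (T T' : SMod S) : (omap (0 : T ⟶ T') : otens P T ⟶ _) = 0 :=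
  SMod.hom_ext fun U z => by
  induction z using ot_ind with
  | h x t => simpa using ot_zsmul 0 x (0 : T'.C U)
  | hadd a b ha hb => rw [map_add, ha, hb, map_add]

/-- The inductive step in the definition of the Koszul differential:
`x ⊗ t ↦ - x t - x ⊗ d t`. -/
def kstep (d : otens P T ⟶ T) : otens P (otens P T) ⟶ otens P T := -A.step.ev - omap d

theorem kstep_ot (d : otens P T ⟶ T) (x : P.C U) (z : (otens P T).C U) :
    ap (A.kstep d) U (ot x z) = -A.step.a x z - ot x (ap d U z) := by
  rw [kstep, ap_sub, ap_neg]; rfl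

theorem neg_eqv {T' : SMod S} {B : Act P T'} {φ : T ⟶ T'} (h : Eqv A B φ) : Eqv A B (-φ) :=
  fun U x t => by rw [ap_neg, ap_neg, h, map_neg]

theorem kstep_eqv {d : otens P T ⟶ T} (h : Eqv A.step A d) :
    Eqv A.step.step A.step (A.kstep d) := fun U x t => by
  rw [kstep, ap_sub, ap_sub, ap_neg, ap_neg, A.step.ev_eqv, A.step.omap_eqv h, map_sub, map_neg]

theorem kstep_kstep {d : otens P T ⟶ T} (h : Eqv A.step A d) (h0 : A.kstep d ≫ d = 0) :
    A.step.kstep (A.kstep d) ≫ A.kstep d = 0 := by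
  have h1 : omap (A.kstep d) ≫ A.step.ev = A.step.step.ev ≫ A.kstep d :=
    A.step.step.omap_ev (A.kstep_eqv h)
  have h2 : (omap (A.kstep d) : otens P _ ⟶ _) ≫ omap d = 0 := by rw [← omap_comp, h0, omap_zero]
  have h3 : omap (A.kstep d) ≫ A.kstep d = -(A.step.step.ev ≫ A.kstep d) := by
    rw [← h1, ← sub_zero (-_), ← h2, ← Preadditive.comp_neg, ← Preadditive.comp_sub]
    rfl
  rw [kstep, Preadditive.sub_comp, Preadditive.neg_comp, h3]
  abel

theorem kstep_ev : A.kstep (-A.ev) ≫ (-A.ev) = 0 := by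
  have h := omap_ev A.step (neg_eqv A.step A.ev_eqv)
  rw [kstep, Preadditive.sub_comp, Preadditive.comp_neg (omap _), h, Preadditive.neg_comp]
  abel

end Act

namespace Kosz

open SMod

variable {P M : SMod S} (A : Act P M) {U V : S.Aff}

/-- The tensor powers `P ⊗_O ⋯ ⊗_O P ⊗_O M` with the action of `P` through `M`. -/
def stage : ℕ → Σ T : SMod S, Act P T
  | 0 => ⟨M, A⟩
  | n + 1 => ⟨otens P (stage n).1, (stage n).2.step⟩

/-- The tensor power `P ⊗_O ⋯ ⊗_O P ⊗_O M`. -/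
abbrev T (n : ℕ) : SMod S := (stage A n).1

/-- The differential of the Koszul complex, on tensor powers. -/
def d : ∀ n, T A (n + 1) ⟶ T A n
  | 0 => -A.ev
  | n + 1 => Act.kstep (T := T A n) (stage A n).2 (d n)

theorem d_eqv : ∀ n, Act.Eqv (stage A (n + 1)).2 (stage A n).2 (d A n)
  | 0 => Act.neg_eqv A.step A.ev_eqv
  | n + 1 => Act.kstep_eqv (T := T A n) (stage A n).2 (d_eqv n)

theorem d_d : ∀ n, d A (n + 1) ≫ d A n = 0
  | 0 => A.kstep_ev
  | n + 1 => Act.kstep_kstep (T := T A n) (stage A n).2 (d_eqv A n) (d_d n)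

/-- The submodule of `P ⊗ P ⊗ T` generated by `x ⊗ y ⊗ t + (-1)^(x y) y ⊗ x ⊗ t` and by `P ⊗ R`. -/
def anti {T : SMod S} (R : (otens P T).Sub) : (otens P (otens P T)).Sub :=
  Sub.gen (fun U => {z | (∃ (p q : ZMod 2) (x y : P.C U) (t : T.C U), P.Homog p x ∧ P.Homog q y ∧
      z = ot x (ot y t) + sg (p * q) • ot y (ot x t)) ∨ ∃ (x : P.C U), ∃ r ∈ R.C U, z = ot x r})
    (by rintro U _ (⟨p, q, x, y, t, hx, hy, rfl⟩ | ⟨x, r, hr, rfl⟩)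
        · refine Or.inl ⟨p, q, P.par U x, P.par U y, T.par U t, hx.par, hy.par, ?_⟩
          rw [map_add, map_zsmul]; rfl
        · exact Or.inr ⟨P.par U x, _, R.par_mem U r hr, rfl⟩)
    (by rintro U V h _ (⟨p, q, x, y, t, hx, hy, rfl⟩ | ⟨x, r, hr, rfl⟩)
        · refine Or.inl ⟨p, q, P.res h x, P.res h y, T.res h t, hx.res h, hy.res h, ?_⟩
          rw [map_add, map_zsmul]; rfl
        · exact Or.inr ⟨P.res h x, _, R.res_mem h r hr, rfl⟩)

/-- The zero submodule. -/
def botSub (T : SMod S) : T.Sub where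
  C U := ⊥
  par_mem U m hm := by rw [(Submodule.mem_bot _).1 hm, map_zero]; exact zero_mem _
  res_mem h m hm := by rw [(Submodule.mem_bot _).1 hm, map_zero]; exact zero_mem _

/-- The relations defining the exterior power `Λ^n P ⊗ M` as a quotient of the tensor power. -/
def rel : ∀ n, (T A n).Sub
  | 0 => botSub _
  | 1 => botSub _
  | n + 2 => anti (T := T A n) (rel (n + 1))

theorem anti_ot {T : SMod S} {R : (otens P T).Sub} {p q : ZMod 2} {x y : P.C U} (t : T.C U)
    (hx : P.Homog p x) (hy : P.Homog q y) :
    ot x (ot y t) + sg (p * q) • ot y (ot x t) ∈ (anti R).C U :=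
  Submodule.subset_span (Or.inl ⟨p, q, x, y, t, hx, hy, rfl⟩)

theorem anti_ot' {T : SMod S} {R : (otens P T).Sub} (x : P.C U) {r : (otens P T).C U}
    (hr : r ∈ R.C U) : ot x r ∈ (anti R).C U :=
  Submodule.subset_span (Or.inr ⟨x, r, hr, rfl⟩)

theorem anti_act {T : SMod S} {R : (otens P T).Sub} (B : Act P T)
    (hR : ∀ (U : S.Aff) (x : P.C U), ∀ r ∈ R.C U, B.step.a x r ∈ R.C U) :
    ∀ (U : S.Aff) (x : P.C U), ∀ r ∈ (anti R).C U, B.step.step.a x r ∈ (anti R).C U :=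
  fun U x r hr => by
  have key : ∀ (p : ZMod 2) (x : P.C U), P.Homog p x → ∀ r ∈ (anti R).C U,
      B.step.step.a x r ∈ (anti R).C U := fun p x hx r hr => by
    induction hr using Submodule.span_induction with
    | mem z hz =>
      obtain (⟨a, b, y, z, t, hy, hz, rfl⟩ | ⟨y, r, hr, rfl⟩) := hz
      · have : B.step.step.a x (ot y (ot z t) + sg (a * b) • ot z (ot y t)) =
            sg (p * a) • sg (p * b) • (ot y (ot z (B.a x t)) + sg (a * b) • ot z (ot y (B.a x t))) := by
          rw [map_add, map_zsmul, B.step.step_ot hx, B.step.step_ot hx, B.step_ot hx, B.step_ot hx,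
            hy.tw, hz.tw]
          simp only [zsmul_ot, ot_zsmul, smul_add]
          rw [smul_comm (sg (p * b)) (sg (p * a)), smul_comm (sg (a * b)) (sg (p * a)),
            smul_comm (sg (a * b)) (sg (p * b))]
        rw [this]
        exact zsmul_mem (zsmul_mem (anti_ot _ hy hz) _) _
      · rw [B.step.step_ot hx]
        exact anti_ot' _ (hR U x r hr)
    | zero => rw [map_zero]; exact zero_mem _
    | add a b _ _ ha hb => rw [map_add]; exact add_mem ha hb
    | smul f a _ ha =>
      induction f using O_homog_ind with
      | hadd f g hf hg => rw [add_smul, map_add]; exact add_mem hf hg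
      | h q f hf =>
        rw [B.step.step.smul_right f hf, hx.tw, map_zsmul, AddMonoidHom.smul_apply]
        exact Submodule.smul_mem _ _ (zsmul_mem ha _)
  rw [← P.pr_add_pr x, map_add, AddMonoidHom.add_apply]
  exact add_mem (key 0 _ (P.pr_homog 0 x) r hr) (key 1 _ (P.pr_homog 1 x) r hr)

theorem rel_act : ∀ n (U : S.Aff) (x : P.C U), ∀ r ∈ (rel A n).C U,
    (stage A n).2.a x r ∈ (rel A n).C U
  | 0 => fun U x r hr => by
    rw [(Submodule.mem_bot _).1 hr, map_zero]; exact zero_mem _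
  | 1 => fun U x r hr => by
    rw [(Submodule.mem_bot _).1 hr, map_zero]; exact zero_mem _
  | n + 2 => anti_act (T := T A n) (stage A n).2 (rel_act (n + 1))

/-- The image of `x ⊗ y ⊗ t + (-1)^(x y) y ⊗ x ⊗ t` under the differential. -/
theorem kstep_anti {T : SMod S} (B : Act P T) (e : otens P T ⟶ T) (e' : otens P (otens P T) ⟶ otens P T)
    (he : e' = B.kstep e) {p q : ZMod 2} {x y : P.C U} (z : (otens P T).C U)
    (hx : P.Homog p x) (hy : P.Homog q y) :
    ap (B.step.kstep e') U (ot x (ot y z) + sg (p * q) • ot y (ot x z)) =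
      ot x (ot y (ap e U z)) + sg (p * q) • ot y (ot x (ap e U z)) := by
  subst he
  simp only [map_add, map_zsmul, Act.kstep_ot, B.step.step_ot hx, B.step.step_ot hy]
  rw [hx.tw, hy.tw, mul_comm q p]
  have s : ∀ (x : P.C U) (a b : (otens P T).C U), ot x (-a - b) = -ot x a - ot x b := fun x a b => by
    rw [eq_sub_iff_add_eq, ← ot_add, sub_add_cancel]
    have := ot_zsmul (-1) x a
    simpa using this
  rw [s, s, zsmul_ot, zsmul_ot]
  simp only [smul_sub, smul_neg, smul_smul, sg_sq, one_smul]
  abel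

theorem kstep_anti_zero {p q : ZMod 2} {x y : P.C U} (t : M.C U)
    (hx : P.Homog p x) (hy : P.Homog q y) :
    ap (A.kstep (-A.ev)) U (ot x (ot y t) + sg (p * q) • ot y (ot x t)) = 0 := by
  have e0 : ∀ x : P.C U, ∀ t : M.C U, ot x (-t) = -ot x t := fun x t => by
    simpa using ot_zsmul (-1) x t
  rw [map_add, map_zsmul, Act.kstep_ot, Act.kstep_ot, A.step_ot hx, A.step_ot hy, ap_neg,
    ap_neg, A.ev_ot, A.ev_ot, hx.tw, hy.tw, mul_comm q p, e0, e0, zsmul_ot, zsmul_ot]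
  simp only [smul_sub, smul_neg, smul_smul, sg_sq, one_smul]
  abel

theorem anti_map {T T' : SMod S} {R : (otens P T).Sub} {R' : T'.Sub}
    (φ : otens P (otens P T) ⟶ T')
    (h1 : ∀ (U : S.Aff) (p q : ZMod 2) (x y : P.C U) (t : T.C U), P.Homog p x → P.Homog q y →
      ap φ U (ot x (ot y t) + sg (p * q) • ot y (ot x t)) ∈ R'.C U)
    (h2 : ∀ (U : S.Aff) (x : P.C U), ∀ r ∈ R.C U, ap φ U (ot x r) ∈ R'.C U) :
    ∀ (U : S.Aff), ∀ r ∈ (anti R).C U, ap φ U r ∈ R'.C U := fun U r hr => by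
  induction hr using Submodule.span_induction with
  | mem z hz =>
    obtain (⟨p, q, x, y, t, hx, hy, rfl⟩ | ⟨x, r, hr, rfl⟩) := hz
    · exact h1 U p q x y t hx hy
    · exact h2 U x r hr
  | zero => rw [map_zero]; exact zero_mem _
  | add a b _ _ ha hb => rw [map_add]; exact add_mem ha hb
  | smul f a _ ha => rw [ap_smul]; exact Submodule.smul_mem _ _ ha

theorem ap_bot {T T' : SMod S} (φ : T ⟶ T') (R : T'.Sub) (r : T.C U) (hr : r ∈ (botSub T).C U) :
    ap φ U r ∈ R.C U := by
  rw [(Submodule.mem_bot _).1 hr, map_zero]; exact zero_mem _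

theorem ot_bot {T T' : SMod S} (φ : otens P T ⟶ T') (R : T'.Sub) (x : P.C U) (r : T.C U)
    (hr : r ∈ (botSub T).C U) : ap φ U (ot x r) ∈ R.C U := by
  have : (ot x 0 : (otens P T).C U) = 0 := by simpa using ot_zsmul 0 x (0 : T.C U)
  rw [(Submodule.mem_bot _).1 hr, this, map_zero]; exact zero_mem _

theorem d_rel : ∀ n (U : S.Aff), ∀ r ∈ (rel A (n + 1)).C U, ap (d A n) U r ∈ (rel A n).C U
  | 0 => fun U r hr => ap_bot (d A 0) _ r hr
  | 1 => anti_map (T := M) (R' := rel A 1) (A.kstep (-A.ev))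
      (fun U p q x y t hx hy => (Submodule.mem_bot _).2 (kstep_anti_zero A t hx hy))
      fun U x r hr => ot_bot (A.kstep (-A.ev)) _ x r hr
  | n + 2 => anti_map (T := T A (n + 1)) (R' := rel A (n + 2))
      (Act.kstep (T := T A (n + 1)) (stage A (n + 1)).2 (d A (n + 1)))
      (fun U p q x y t hx hy => by
        have := kstep_anti (stage A n).2 (d A n) (d A (n + 1)) rfl t hx hy
        refine (congrArg (· ∈ (rel A (n + 2)).C U) this).mpr ?_
        exact anti_ot (T := T A n) _ hx hy)
      fun U x r hr => by
        have := Act.kstep_ot (T := T A (n + 1)) (stage A (n + 1)).2 (d A (n + 1)) x r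
        refine (congrArg (· ∈ (rel A (n + 2)).C U) this).mpr ?_
        refine sub_mem (neg_mem (rel_act A (n + 2) U x r hr)) ?_
        exact anti_ot' (T := T A n) x (d_rel (n + 1) U r hr)

/-- The term `Λ^n P ⊗ M` of the Koszul complex. -/
abbrev K (n : ℕ) : SMod S := (T A n).quot (rel A n)

/-- The class in `Λ^n P ⊗ M` of an element of the tensor power. -/
abbrev kp (n : ℕ) : T A n ⟶ K A n := SMod.proj _ (rel A n)

/-- The differential of the Koszul complex. -/
def kd (n : ℕ) : K A (n + 1) ⟶ K A n :=
  SMod.desc (rel A (n + 1)) (d A n ≫ kp A n) fun U m hm => by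
    rw [ap_comp]; exact SMod.proj_zero _ (d_rel A n U m hm)

theorem kd_kd (n : ℕ) : kd A (n + 1) ≫ kd A n = 0 := SMod.hom_ext fun U m => by
  obtain ⟨m, rfl⟩ := SMod.proj_surj _ m
  change ap (kp A n) U (ap (d A (n + 1) ≫ d A n) U m) = 0
  rw [d_d, ap_zero, map_zero]

/-- The Koszul complex `Λ^• P ⊗ M`, with the differential
`x₁ ∧ ⋯ ∧ xₙ ⊗ m ↦ ∑ᵢ ± x₁ ∧ ⋯ x̂ᵢ ⋯ ∧ xₙ ⊗ xᵢ m`, the sign being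
`(-1)^(i + xᵢ (xᵢ₊₁ + ⋯ + xₙ))`. -/
@[reducible] def cx : ChainComplex (SMod S) ℕ := ChainComplex.of (K A) (kd A) (kd_kd A)

end Kosz

/-! ### Derived categories -/

/-- Quasi-isomorphisms: the maps induced on the homology sheaves are injective and surjective, that
is, on the homology presheaves they are injective and surjective locally. -/
def IsQis {C C' : ChainComplex (SMod S) ℕ} (f : C ⟶ C') : Prop :=
  ∀ (n : ℕ) (U : S.Aff),
    (∀ z : (C.X n).C U, (∀ j, SMod.ap (C.d n j) U z = 0) →
      (∃ w : (C'.X (n + 1)).C U, SMod.ap (f.f n) U z = SMod.ap (C'.d (n + 1) n) U w) →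
      ∀ s : S.X, s ∈ U.1 → ∃ (V : S.Aff) (h : V ≤ U), s ∈ V.1 ∧
        ∃ w : (C.X (n + 1)).C V, (C.X n).res h z = SMod.ap (C.d (n + 1) n) V w) ∧
    (∀ z : (C'.X n).C U, (∀ j, SMod.ap (C'.d n j) U z = 0) →
      ∀ s : S.X, s ∈ U.1 → ∃ (V : S.Aff) (h : V ≤ U), s ∈ V.1 ∧
        ∃ y : (C.X n).C V, (∀ j, SMod.ap (C.d n j) V y = 0) ∧
          ∃ w : (C'.X (n + 1)).C V, (C'.X n).res h z =
            SMod.ap (f.f n) V y + SMod.ap (C'.d (n + 1) n) V w)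

/-- Quasi-isomorphisms of complexes of supermodules. -/
def qis (S : SuperScheme.{u}) : MorphismProperty (ChainComplex (SMod S) ℕ) := fun _ _ f => IsQis f

section

variable (H : PreHeis S) (D : Conn H) (J : H.toSMod.Sub)

/-- The complex of supermodules underlying a complex of modules over the Lie algebroid. -/
@[reducible] def und : ChainComplex (AMod H D J) ℕ ⥤ ChainComplex (SMod S) ℕ :=
  AMod.forget.mapHomologicalComplex (ComplexShape.down ℕ)

/-- Quasi-isomorphisms of complexes of modules over the Lie algebroid. -/
def aqis : MorphismProperty (ChainComplex (AMod H D J) ℕ) := (qis S).inverseImage (und H D J)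

/-- The forgetful functor from the derived category of modules over the Lie algebroid
`A_{H, ∇, J}` to the derived category of supermodules (complexes in nonpositive cohomological
degrees, localized at quasi-isomorphisms). -/
def dForget : (aqis H D J).Localization ⥤ (qis S).Localization :=
  Localization.Construction.lift (und H D J ⋙ (qis S).Q) fun _ _ _ hf =>
    MorphismProperty.Q_inverts (qis S) _ hf

end

/-! ### The Koszul complex computing derived coinvariants -/

section Koszul

variable {H : PreHeis S} {D : Conn H} {J : H.toSMod.Sub}

/-- The action of an abelian `J` on `M`. -/
def koszAct (hJ : ∀ U, ∀ x ∈ J.C U, ∀ y ∈ J.C U, H.br U x y = 0) (M : FlatMod H D) :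
    Act J.toSMod M.toSMod where
  a := fun {U} => M.hact.comp (SMod.ap J.incl U)
  par x m := M.hact_par x.1 m
  res h x m := M.hact_res h x.1 m
  smul f x m := M.hact_smul f x.1 m
  smul_right {U q} f hf x m := by
    refine (M.smul_hact hf x.1 m).trans ?_
    rcases zmod2_cases q with rfl | rfl
    · simp
    · simp; rfl
  comm p q x y m hx hy := by
    have := M.hact_br p q x.1 y.1 m (congrArg Subtype.val hx) (congrArg Subtype.val hy)
    rw [hJ _ _ x.2 _ y.2, map_zero, AddMonoidHom.zero_apply, sub_eq_zero] at this
    exact this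

/-- The comparison between the Koszul complex `Λ^• J ⊗ M` and the coinvariants of the bar resolution:
it sends `x₁ ∧ ⋯ ∧ xₙ ⊗ m` to the antisymmetrization
`∑_σ ± 1 ⊗ 1 ⊗ x_{σ 1} ⊗ ⋯ ⊗ x_{σ n} ⊗ m`. The antisymmetrization `a (x₁ ⊗ t) = s x₁ (a t)` is built
from the operators `s x (u₁ ⊗ ⋯ ⊗ m)` inserting `x` with signs at all possible places. -/
def IsComparison (hJ : ∀ U, ∀ x ∈ J.C U, ∀ y ∈ J.C U, H.br U x y = 0) (M : FlatMod H D)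
    (κ : Kosz.cx (koszAct hJ M) ⟶ (und H D J).obj (barCx J M)) : Prop :=
  ∃ (s : ∀ (n : ℕ) (U : S.Aff), J.toSMod.C U →+ (Bar.pow M n).C U →+ (Bar.pow M (n + 1)).C U)
    (a : ∀ (n : ℕ) (U : S.Aff), (Kosz.T (koszAct hJ M) n).C U →+ (Bar.pow M n).C U),
    (∀ U x (m : M.C U), s 0 U x m = Bar.uo (UH.ι H x.1) m) ∧
    (∀ n U (p : ZMod 2) x, J.toSMod.Homog p x → ∀ (u : UH H U) (t : (Bar.pow M n).C U),
      s (n + 1) U x (Bar.uo u t) =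
        Bar.uo (Q := (Bar.pow M (n + 1)).toSMod) (UH.ι H x.1) (Bar.uo u t) -
          Bar.uo (Q := (Bar.pow M (n + 1)).toSMod) ((UH.mod H).tw p u) (s n U x t)) ∧
    (∀ U (m : M.C U), a 0 U m = m) ∧
    (∀ n U x (t : (Kosz.T (koszAct hJ M) n).C U), a (n + 1) U (SMod.ot x t) = s n U x (a n U t)) ∧
    (∀ n U (t : (Kosz.T (koszAct hJ M) n).C U),
      SMod.ap (κ.f n) U (SMod.ap (Kosz.kp (koszAct hJ M) n) U t) =
        ct J (Bar.pow M (n + 1)) (Mr.mk J 1) (Bar.uo 1 (a n U t)))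

theorem redSub_abel {I : H.toSMod.Sub} (hJ : ∀ U, ∀ x ∈ J.C U, ∀ y ∈ J.C U, H.br U x y = 0) :
    ∀ U, ∀ x ∈ (H.redSub I J).C U, ∀ y ∈ (H.redSub I J).C U, (H.red I).br U x y = 0 := by
  rintro U _ ⟨x, hx, rfl⟩ _ ⟨y, hy, rfl⟩
  refine (H.redBr_proj I x y).trans ?_
  have : H.centBr I U x y = 0 := Subtype.ext (hJ U x.1 hx y.1 hy)
  rw [this, map_zero]

/-- The chain map `Λ^• (J ∩ c(I)) ⊗ M^I → Λ^• J ⊗ M` induced by the embeddings `J ∩ c(I) → J` and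
`M^I → M`, where `J ∩ c(I)` is identified with its image in `c(I) / I`. -/
def IsInclusion {I : H.toSMod.Sub} (hI : D.Preserves I)
    (hJ : ∀ U, ∀ x ∈ J.C U, ∀ y ∈ J.C U, H.br U x y = 0) (M : FlatMod H D)
    (k : Kosz.cx (koszAct (redSub_abel (I := I) hJ) (M.invMod hI)) ⟶ Kosz.cx (koszAct hJ M)) : Prop :=
  ∃ b : ∀ (n : ℕ) (U : S.Aff), (Kosz.T (koszAct (redSub_abel (I := I) hJ) (M.invMod hI)) n).C U →+
      (Kosz.T (koszAct hJ M) n).C U,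
    (∀ U (m : (M.inv I).C U), b 0 U m = m.1) ∧
    (∀ n U (x : (H.cent I).toSMod.C U) (hx : x.1 ∈ J.C U)
      (t : (Kosz.T (koszAct (redSub_abel (I := I) hJ) (M.invMod hI)) n).C U),
      b (n + 1) U (SMod.ot (P := (H.redSub I J).toSMod)
        ⟨SMod.ap (H.toRed I) U x, Submodule.mem_map_of_mem hx⟩ t) =
        SMod.ot (P := J.toSMod) ⟨x.1, hx⟩ (b n U t)) ∧
    (∀ n U (t : (Kosz.T (koszAct (redSub_abel (I := I) hJ) (M.invMod hI)) n).C U),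
      SMod.ap (k.f n) U (SMod.ap (Kosz.kp (koszAct (redSub_abel hJ) (M.invMod hI)) n) U t) =
        SMod.ap (Kosz.kp (koszAct hJ M) n) U (b n U t))

end Koszul

end SuperHeis

end

open SuperHeis

noncomputable section

namespace SuperHeis

variable {S : SuperScheme.{u}}

/-! ### Locally finite operators with integral eigenvalues -/

section Euler

variable {N N' : Type*} [AddCommGroup N] [AddCommGroup N']

/-- The operator `∏ (E - k)`, the product being over the entries of a list. -/
def evList (E : N →+ N) : List ℕ → (N →+ N)
  | [] => AddMonoidHom.id N
  | k :: l => (E - k • AddMonoidHom.id N).comp (evList E l)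

@[simp] theorem evList_nil (E : N →+ N) (w : N) : evList E [] w = w := rfl
theorem evList_cons (E : N →+ N) (k : ℕ) (l : List ℕ) (w : N) :
    evList E (k :: l) w = E (evList E l w) - k • evList E l w := by simp [evList]

theorem evList_append (E : N →+ N) (l l' : List ℕ) (w : N) :
    evList E (l ++ l') w = evList E l (evList E l' w) := by
  induction l with
  | nil => rfl
  | cons k l ih => rw [List.cons_append, evList_cons, evList_cons, ih]

theorem evList_map {E : N →+ N} {E' : N' →+ N'} (T : N →+ N') (h : ∀ w, T (E w) = E' (T w))
    (l : List ℕ) (w : N) : T (evList E l w) = evList E' l (T w) := by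
  induction l with
  | nil => rfl
  | cons k l ih => rw [evList_cons, evList_cons, map_sub, h, ih, map_nsmul, ih]

theorem evList_lower {E : N →+ N} {E' : N' →+ N'} (T : N →+ N') (h : ∀ w, T (E w) = E' (T w) + T w)
    (l : List ℕ) (w : N) : T (evList E (l.map (· + 1)) w) = evList E' l (T w) := by
  induction l with
  | nil => rfl
  | cons k l ih =>
    rw [List.map_cons, evList_cons, evList_cons, map_sub, h, map_nsmul, ih, add_smul, one_smul]
    abel

theorem evList_raise {E : N →+ N} {E' : N' →+ N'} (T : N →+ N') (h : ∀ w, E' (T w) = T (E w) + T w)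
    (l : List ℕ) (w : N) : evList E' (l.map (· + 1)) (T w) = T (evList E l w) := by
  induction l with
  | nil => rfl
  | cons k l ih =>
    rw [List.map_cons, evList_cons, evList_cons, map_sub, ih, h, map_nsmul, add_smul, one_smul]
    abel

theorem evList_self (E : N →+ N) (l : List ℕ) (w : N) : E (evList E l w) = evList E l (E w) :=
  evList_map E (fun _ => rfl) l w

theorem evList_comm (E : N →+ N) (l l' : List ℕ) (w : N) :
    evList E l (evList E l' w) = evList E l' (evList E l w) :=
  evList_map (evList E l) (fun w => (evList_self E l w).symm) l' w

theorem evList_append_add {E : N →+ N} {l l' : List ℕ} {a b : N} (ha : evList E l a = 0)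
    (hb : evList E l' b = 0) : evList E (l ++ l') (a + b) = 0 := by
  rw [map_add, evList_append, evList_append, hb, evList_comm, ha, map_zero, map_zero, add_zero]

/-- The scalar by which `∏ (E - k)` acts on the eigenvectors of eigenvalue `c`. -/
def evScalar (c : ℤ) : List ℕ → ℤ
  | [] => 1
  | k :: l => (c - k) * evScalar c l

theorem evScalar_ne_zero {c : ℤ} {l : List ℕ} (h : ∀ k ∈ l, c ≠ (k : ℤ)) : evScalar c l ≠ 0 := by
  induction l with
  | nil => exact one_ne_zero
  | cons k l ih =>
    exact mul_ne_zero (sub_ne_zero.2 (h k (by simp))) (ih fun k hk => h k (by simp [hk]))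

theorem evList_eigen {E : N →+ N} {c : ℤ} {w : N} (h : E w = c • w) (l : List ℕ) :
    evList E l w = evScalar c l • w := by
  induction l with
  | nil => simp [evScalar]
  | cons k l ih =>
    rw [evList_cons, ih, map_zsmul, h, evScalar, ← natCast_zsmul, smul_smul, smul_smul, ← sub_smul]
    congr 1; ring

/-- The quotient of `∏ (E - k)` by `E`. -/
def evQuot (E : N →+ N) : List ℕ → (N →+ N)
  | [] => 0
  | k :: l => evList E l - k • evQuot E l

theorem evList_eq (E : N →+ N) (l : List ℕ) (w : N) :
    evList E l w = evScalar 0 l • w + E (evQuot E l w) := by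
  induction l with
  | nil => simp [evScalar, evQuot]
  | cons k l ih =>
    rw [evList_cons]
    nth_rewrite 2 [ih]
    rw [evQuot, evScalar]
    simp only [AddMonoidHom.sub_apply, AddMonoidHom.smul_apply, map_sub, map_nsmul, smul_add]
    rw [zero_sub, neg_mul, neg_smul, mul_smul, natCast_zsmul]
    abel

theorem evQuot_map {E : N →+ N} {E' : N' →+ N'} (T : N →+ N') (h : ∀ w, T (E w) = E' (T w))
    (l : List ℕ) (w : N) : T (evQuot E l w) = evQuot E' l (T w) := by
  induction l with
  | nil => simp [evQuot]
  | cons k l ih =>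
    simp only [evQuot, AddMonoidHom.sub_apply, AddMonoidHom.smul_apply, map_sub, map_nsmul, ih,
      evList_map T h]

variable [Module ℚ N]

theorem zsmul_cancel {c : ℤ} (hc : c ≠ 0) {w : N} (h : c • w = 0) : w = 0 := by
  have h1 : (c : ℚ) • w = 0 := by rw [Int.cast_smul_eq_zsmul, h]
  exact (smul_eq_zero_iff_right (by exact_mod_cast hc)).1 h1

theorem eq_zero_of_evList {E : N →+ N} {c : ℤ} {l : List ℕ} {w : N} (hl : ∀ k ∈ l, c ≠ (k : ℤ))
    (h : evList E l w = 0) (hw : E w = c • w) : w = 0 := by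
  rw [evList_eigen hw] at h
  exact zsmul_cancel (evScalar_ne_zero hl) h

/-- An element killed by `∏ (E - k)`, with all `k` nonzero, is in the image of `E`. -/
theorem solve_evList {E : N →+ N} {l : List ℕ} {w : N} (hl : ∀ k ∈ l, k ≠ 0)
    (h : evList E l w = 0) : ∃ c : ℚ, w = E (c • evQuot E l w) := by
  have hc : (evScalar 0 l : ℚ) ≠ 0 := by
    exact_mod_cast evScalar_ne_zero fun k hk h0 => hl k hk (by exact_mod_cast h0.symm)
  refine ⟨-(evScalar 0 l : ℚ)⁻¹, ?_⟩
  rw [evList_eq] at h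
  rw [map_rat_smul, neg_smul, ← smul_neg, ← eq_neg_of_add_eq_zero_left h, ← Int.cast_smul_eq_zsmul ℚ,
    smul_smul, inv_mul_cancel₀ hc, one_smul]

/-- If a family of operators which lower the eigenvalues of `E` by `1` is nilpotent on `w`, and if `E`
vanishes on the common kernel of this family, then `∏ (E - k)` kills `w`. -/
theorem evList_of_nilp {N : Type*} [AddCommGroup N] {E : N →+ N} {𝒜 : Set (N →+ N)}
    (h1 : ∀ α ∈ 𝒜, ∀ w, α (E w) = E (α w) + α w) (h2 : ∀ w, (∀ α ∈ 𝒜, α w = 0) → E w = 0) (n : ℕ)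
    (w : N) (hn : ∀ l : List (N →+ N), l.length = n → (∀ α ∈ l, α ∈ 𝒜) →
      l.foldr (fun α w => α w) w = 0) : evList E (List.range n) w = 0 := by
  induction n generalizing w with
  | zero => exact hn [] rfl (by simp)
  | succ n ih =>
    rw [List.range_succ_eq_map, evList_cons, zero_smul, sub_zero]
    refine h2 _ fun α hα => ?_
    have := evList_lower α (h1 α hα) (List.range n) w
    refine this.trans (ih (α w) fun l hl hl' => ?_)
    have := hn (l ++ [α]) (by simp [hl]) (by
      intro β hβ
      rcases List.mem_append.1 hβ with h | h
      · exact hl' β h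
      · rw [List.mem_singleton.1 h]; exact hα)
    simpa using this

/-- The splitting of the kernel of a locally finite operator. -/
theorem exists_kernel_part {E : N →+ N} {n : ℕ} {w : N} (h : evList E (List.range n) w = 0) :
    ∃ (w₀ : N) (l : List ℕ), (∀ k ∈ l, k ≠ 0) ∧ E w₀ = 0 ∧ evList E l (w - w₀) = 0 := by
  obtain _ | n := n
  · exact ⟨0, [], by simp, by simp, by simpa using h⟩
  rw [List.range_succ_eq_map, evList_cons, zero_smul, sub_zero] at h
  set l := (List.range n).map Nat.succ with hl
  have hl' : ∀ k ∈ l, k ≠ 0 := by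
    intro k hk
    obtain ⟨j, _, rfl⟩ := List.mem_map.1 hk
    exact j.succ_ne_zero
  have hc : (evScalar 0 l : ℚ) ≠ 0 := by
    exact_mod_cast evScalar_ne_zero fun k hk h0 => hl' k hk (by exact_mod_cast h0.symm)
  refine ⟨(evScalar 0 l : ℚ)⁻¹ • evList E l w, l, hl', by rw [map_rat_smul, h, smul_zero], ?_⟩
  rw [map_sub, map_rat_smul, evList_eigen (w := evList E l w) (c := 0) (by rw [h, zero_smul]), ← Int.cast_smul_eq_zsmul ℚ,
    smul_smul, inv_mul_cancel₀ hc, one_smul, sub_self]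

end Euler

/-! ### Complexes of abelian groups -/

/-- Complexes of abelian groups in nonnegative degrees. -/
structure Cpx where
  X : ℕ → Type u
  [grp : ∀ n, AddCommGroup (X n)]
  d : ∀ n, X (n + 1) →+ X n

attribute [instance] Cpx.grp

namespace Cpx

/-- The cycles of a complex. -/
def Cyc (K : Cpx.{u}) : ∀ n, K.X n → Prop
  | 0, _ => True
  | n + 1, z => K.d n z = 0

/-- Chain maps. -/
structure Hom (K L : Cpx.{u}) where
  f : ∀ n, K.X n →+ L.X n
  comm : ∀ n z, f n (K.d n z) = L.d n (f (n + 1) z)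

variable {K L : Cpx.{u}}

theorem Hom.cyc (φ : Hom K L) : ∀ {n} {z : K.X n}, K.Cyc n z → L.Cyc n (φ.f n z)
  | 0, _, _ => trivial
  | n + 1, z, h => by
    change L.d n (φ.f (n + 1) z) = 0
    rw [← φ.comm, show K.d n z = 0 from h, map_zero]

theorem Cyc.sub : ∀ {n} {z w : K.X n}, K.Cyc n z → K.Cyc n w → K.Cyc n (z - w)
  | 0, _, _, _, _ => trivial
  | n + 1, z, w, hz, hw => by
    change K.d n (z - w) = 0
    rw [map_sub, show K.d n z = 0 from hz, show K.d n w = 0 from hw, sub_zero]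

/-- Injectivity on homology in degree `n`. -/
def Hom.Inj (φ : Hom K L) (n : ℕ) : Prop :=
  ∀ z, K.Cyc n z → (∃ w, φ.f n z = L.d n w) → ∃ w, z = K.d n w

/-- Surjectivity on homology in degree `n`. -/
def Hom.Surj (φ : Hom K L) (n : ℕ) : Prop :=
  ∀ z, L.Cyc n z → ∃ y, K.Cyc n y ∧ ∃ w, z = φ.f n y + L.d n w

/-- Quasi-isomorphisms. -/
def Hom.Qis (φ : Hom K L) : Prop := ∀ n, φ.Inj n ∧ φ.Surj n

theorem Hom.Qis.of_comp {M : Cpx.{u}} {φ : Hom K L} {ψ : Hom L M} {χ : Hom K M} (hφ : φ.Qis)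
    (hχ : χ.Qis) (h : ∀ n z, χ.f n z = ψ.f n (φ.f n z)) : ψ.Qis := fun n => by
  refine ⟨fun z hz => ?_, fun z hz => ?_⟩
  · rintro ⟨w, hw⟩
    obtain ⟨y, hy, v, rfl⟩ := (hφ n).2 z hz
    obtain ⟨x, hx⟩ := (hχ n).1 y hy ⟨w - ψ.f _ v, by
      rw [map_sub, ← hw, map_add, ψ.comm, h, add_sub_cancel_right]⟩
    exact ⟨φ.f _ x + v, by rw [hx, map_add, φ.comm]⟩
  · obtain ⟨y, hy, v, rfl⟩ := (hχ n).2 z hz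
    exact ⟨φ.f n y, φ.cyc hy, v, by rw [h]⟩

theorem Hom.Qis.comp {M : Cpx.{u}} {φ : Hom K L} {ψ : Hom L M} {χ : Hom K M} (hφ : φ.Qis)
    (hψ : ψ.Qis) (h : ∀ n z, χ.f n z = ψ.f n (φ.f n z)) : χ.Qis := fun n => by
  refine ⟨fun z hz => ?_, fun z hz => ?_⟩
  · rintro ⟨w, hw⟩
    exact (hφ n).1 z hz ((hψ n).1 _ (φ.cyc hz) ⟨w, by rw [← h, hw]⟩)
  · obtain ⟨y, hy, v, rfl⟩ := (hψ n).2 z hz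
    obtain ⟨x, hx, w, rfl⟩ := (hφ n).2 y hy
    exact ⟨x, hx, ψ.f _ w + v, by rw [h, map_add, map_add, ψ.comm, add_assoc]⟩

theorem Hom.Qis.of_bijective {φ : Hom K L} (h : ∀ n, Function.Bijective (φ.f n)) : φ.Qis := fun n => by
  refine ⟨fun z _ => ?_, fun z hz => ?_⟩
  · rintro ⟨w, hw⟩
    obtain ⟨v, rfl⟩ := (h _).2 w
    exact ⟨v, (h n).1 (by rw [hw, φ.comm])⟩
  · obtain ⟨y, rfl⟩ := (h _).2 z
    refine ⟨y, ?_, 0, by rw [map_zero, add_zero]⟩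
    cases n with
    | zero => trivial
    | succ n => exact (h n).1 (by rw [φ.comm, show L.d n _ = 0 from hz, map_zero])

/-- Short exact sequences of complexes. -/
structure Exact {A B C : Cpx.{u}} (i : Hom A B) (p : Hom B C) : Prop where
  inj : ∀ n, Function.Injective (i.f n)
  surj : ∀ n, Function.Surjective (p.f n)
  zero : ∀ n a, p.f n (i.f n a) = 0
  exact : ∀ n b, p.f n b = 0 → ∃ a, i.f n a = b

/-- Acyclicity in positive degrees. -/
def Acyc (K : Cpx.{u}) : Prop := ∀ n z, K.d n z = 0 → ∃ w, z = K.d (n + 1) w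

section shift

variable {A B C A' B' C' : Cpx.{u}} {i : Hom A B} {p : Hom B C} {i' : Hom A' B'} {p' : Hom B' C'}
  {a : Hom A A'} {b : Hom B B'} {c : Hom C C'}

theorem lift_cycle (hE : Exact i p) (dd : ∀ n z, B.d n (B.d (n + 1) z) = 0) {n : ℕ}
    {z : C.X (n + 1)} (hz : C.d n z = 0) :
    ∃ (y : B.X (n + 1)) (x : A.X n), p.f _ y = z ∧ B.d n y = i.f n x ∧ A.Cyc n x := by
  obtain ⟨y, rfl⟩ := hE.surj _ z
  obtain ⟨x, hx⟩ := hE.exact n (B.d n y) (by rw [p.comm, hz])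
  refine ⟨y, x, rfl, hx.symm, ?_⟩
  cases n with
  | zero => trivial
  | succ n => exact hE.inj n (by rw [i.comm, hx, dd, map_zero])

theorem inj_shift (hE : Exact i p) (hE' : Exact i' p') (dd : ∀ n z, B.d n (B.d (n + 1) z) = 0)
    (dd' : ∀ n z, B'.d n (B'.d (n + 1) z) = 0) (hB : B.Acyc)
    (h1 : ∀ n z, b.f n (i.f n z) = i'.f n (a.f n z)) (h2 : ∀ n z, c.f n (p.f n z) = p'.f n (b.f n z))
    {n : ℕ} (ha : a.Inj n) : c.Inj (n + 1) := by
  rintro z hz ⟨w, hw⟩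
  obtain ⟨y, x, rfl, hy, hx⟩ := lift_cycle hE dd hz
  obtain ⟨w, rfl⟩ := hE'.surj _ w
  obtain ⟨v, hv⟩ := hE'.exact _ (b.f _ y - B'.d _ w) (by rw [map_sub, p'.comm, ← hw, h2, sub_self])
  obtain ⟨u, hu⟩ := ha x hx ⟨v, hE'.inj n (by
    rw [← h1, ← hy, i'.comm, hv, map_sub, dd', sub_zero, b.comm])⟩
  obtain ⟨t, ht⟩ := hB n (y - i.f _ u) (by rw [map_sub, ← i.comm, hy, hu, sub_self])
  exact ⟨p.f _ t, by rw [← p.comm, ← ht, map_sub, hE.zero, sub_zero]⟩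

theorem surj_shift (hE : Exact i p) (hE' : Exact i' p') (dd' : ∀ n z, B'.d n (B'.d (n + 1) z) = 0)
    (hB' : B'.Acyc)
    (h1 : ∀ n z, b.f n (i.f n z) = i'.f n (a.f n z)) (h2 : ∀ n z, c.f n (p.f n z) = p'.f n (b.f n z))
    {n : ℕ} (ha : a.Surj n) (hb : b.Inj n) : c.Surj (n + 1) := by
  intro z hz
  obtain ⟨z, x, rfl, hy, hx⟩ := lift_cycle hE' dd' hz
  obtain ⟨y, hy', w, rfl⟩ := ha x hx
  obtain ⟨t, ht⟩ := hb (i.f n y) (i.cyc hy') ⟨z - i'.f _ w, by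
    rw [map_sub, ← i'.comm, hy, map_add, h1, add_sub_cancel_right]⟩
  obtain ⟨v, hv⟩ := hB' n (z - i'.f _ w - b.f _ t) (by
    rw [map_sub, map_sub, ← i'.comm, hy, map_add, ← b.comm, ← ht, h1]; abel)
  refine ⟨p.f _ t, ?_, p'.f _ v, ?_⟩
  · change C.d n (p.f _ t) = 0
    rw [← p.comm, ← ht, hE.zero]
  · rw [← p'.comm, ← hv, map_sub, map_sub, hE'.zero, h2]; abel

end shift

end Cpx

/-! ### The order filtration of the enveloping algebra -/

instance ratModule (M : SMod S) (U : S.Aff) : Module ℚ (M.C U) :=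
  Module.compHom _ ((algebraMap ℂ (S.O U)).comp (algebraMap ℚ ℂ))

namespace UH

variable (H : PreHeis S) {U : S.Aff}

theorem tw_oo (p : ZMod 2) (f : S.O U) : (mod H).tw p (oo H U f) = oo H U (S.tw p f) := by
  rcases zmod2_cases p with rfl | rfl <;> simp [oo_apply, H.par_smul, H.par_one]

/-- The supercommutator with a section `x` of `H` of parity `p`. -/
def ad (p : ZMod 2) (x : H.C U) : UH H U →+ UH H U :=
  AddMonoidHom.mulLeft (ι H x) - (AddMonoidHom.mulRight (ι H x)).comp ((mod H).tw p)

theorem ad_apply (p : ZMod 2) (x : H.C U) (u : UH H U) :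
    ad H p x u = ι H x * u - (mod H).tw p u * ι H x := rfl

theorem ad_mul (p : ZMod 2) (x : H.C U) (a b : UH H U) :
    ad H p x (a * b) = ad H p x a * b + (mod H).tw p a * ad H p x b := by
  rw [ad_apply, ad_apply, ad_apply, tw_mul]; noncomm_ring

theorem ad_ι {p : ZMod 2} {x : H.C U} (hx : H.Homog p x) (y : H.C U) :
    ad H p x (ι H y) = ι H (H.br U x y) := by
  induction y using H.toSMod.homog_ind with
  | hadd a b ha hb => simp only [map_add, ha, hb]
  | h q y hy =>
    rw [← ι_comm H hx hy, ad_apply, tw_ι, hy.tw, map_zsmul, smul_mul_assoc]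

theorem ad_oo {p : ZMod 2} {x : H.C U} (hx : H.Homog p x) (f : S.O U) : ad H p x (oo H U f) = 0 := by
  rw [oo_apply, ad_ι H hx, H.br_smul_one, map_zero]

theorem ad_smul {p : ZMod 2} {x : H.C U} (hx : H.Homog p x) (f : S.O U) (a : UH H U) :
    ad H p x (oo H U f * a) = oo H U (S.tw p f) * ad H p x a := by
  rw [ad_mul, ad_oo H hx, zero_mul, zero_add, tw_oo]

variable (U) in
/-- The filtration of `U(H)` by the order. -/
def fil : ℕ → AddSubgroup (UH H U)
  | 0 => (oo H U).range.toAddSubgroup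
  | n + 1 => AddSubgroup.closure {a | ∃ (x : H.C U), ∃ v ∈ fil n, a = ι H x * v}

variable {H}

theorem ι_mul_mem_fil {n : ℕ} (x : H.C U) {v : UH H U} (hv : v ∈ fil H U n) :
    ι H x * v ∈ fil H U (n + 1) := AddSubgroup.subset_closure ⟨x, v, hv, rfl⟩

theorem fil_mono {m n : ℕ} (h : m ≤ n) : fil H U m ≤ fil H U n :=
  monotone_nat_of_le_succ (f := fil H U) (fun n v hv => by
    have := ι_mul_mem_fil (H.one U) hv
    rwa [ι_one, one_mul] at this) h

theorem oo_mul_mem_fil {n : ℕ} (f : S.O U) {v : UH H U} (hv : v ∈ fil H U n) :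
    oo H U f * v ∈ fil H U n := by
  cases n with
  | zero =>
    obtain ⟨g, rfl⟩ := hv
    exact ⟨f * g, map_mul _ _ _⟩
  | succ n =>
    induction hv using AddSubgroup.closure_induction with
    | mem a ha =>
      obtain ⟨x, v, hv, rfl⟩ := ha
      rw [← mul_assoc, oo_mul_ι]
      exact ι_mul_mem_fil _ hv
    | zero => rw [mul_zero]; exact zero_mem _
    | add a b _ _ ha hb => rw [mul_add]; exact add_mem ha hb
    | neg a _ ha => rw [mul_neg]; exact neg_mem ha

theorem exists_mem_fil (u : UH H U) : ∃ n, u ∈ fil H U n := by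
  suffices ∀ n, ∀ v ∈ fil H U n, ∃ m, u * v ∈ fil H U m by
    simpa using this 0 1 ⟨1, map_one _⟩
  induction u using ind with
  | hι x => exact fun n v hv => ⟨n + 1, ι_mul_mem_fil x hv⟩
  | hadd a b ha hb =>
    intro n v hv
    obtain ⟨m, hm⟩ := ha n v hv
    obtain ⟨k, hk⟩ := hb n v hv
    exact ⟨max m k, by
      rw [add_mul]
      exact add_mem (fil_mono (le_max_left _ _) hm) (fil_mono (le_max_right _ _) hk)⟩
  | hmul a b ha hb =>
    intro n v hv
    obtain ⟨m, hm⟩ := hb n v hv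
    rw [mul_assoc]
    exact ha m _ hm

theorem ad_fil {p : ZMod 2} {x : H.C U} (hx : H.Homog p x) :
    (∀ v ∈ fil H U 0, ad H p x v = 0) ∧ ∀ n, ∀ v ∈ fil H U (n + 1), ad H p x v ∈ fil H U n := by
  have h0 : ∀ v ∈ fil H U 0, ad H p x v = 0 := by
    rintro _ ⟨f, rfl⟩
    exact ad_oo H hx f
  refine ⟨h0, fun n => ?_⟩
  induction n with
  | zero =>
    intro v hv
    induction hv using AddSubgroup.closure_induction with
    | mem a ha =>
      obtain ⟨y, v, hv, rfl⟩ := ha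
      obtain ⟨f, hf⟩ := H.br_mem U x y
      rw [ad_mul, h0 v hv, mul_zero, add_zero, ad_ι H hx, hf, ← oo_apply]
      exact oo_mul_mem_fil f hv
    | zero => rw [map_zero]; exact zero_mem _
    | add a b _ _ ha hb => rw [map_add]; exact add_mem ha hb
    | neg a _ ha => rw [map_neg]; exact neg_mem ha
  | succ n ih =>
    intro v hv
    induction hv using AddSubgroup.closure_induction with
    | mem a ha =>
      obtain ⟨y, v, hv, rfl⟩ := ha
      obtain ⟨f, hf⟩ := H.br_mem U x y
      rw [ad_mul, ad_ι H hx, hf, ← oo_apply, tw_ι]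
      exact add_mem (oo_mul_mem_fil f hv) (ι_mul_mem_fil _ (ih v hv))
    | zero => rw [map_zero]; exact zero_mem _
    | add a b _ _ ha hb => rw [map_add]; exact add_mem ha hb
    | neg a _ ha => rw [map_neg]; exact neg_mem ha

end UH

/-! ### Dual bases -/

/-- A finite family of homogeneous sections `b a` of `I` over `U`, dual to a family of sections `l a`
of `H`: every section `x` of `I` over an affine open contained in `U` is the combination of the `b a`
with coefficients `[x, l a]`. -/
structure DualBasis (H : PreHeis S) (I : H.toSMod.Sub) (U : S.Aff) where
  n : ℕ
  p : Fin n → ZMod 2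
  b : Fin n → H.C U
  l : Fin n → H.C U
  mem : ∀ a, b a ∈ I.C U
  hb : ∀ a, H.Homog (p a) (b a)
  hl : ∀ a, H.Homog (p a) (l a)
  span : ∀ {V : S.Aff} (h : V ≤ U), ∀ x ∈ I.C V, ∃ f : Fin n → S.O V,
    (∀ a, H.br V x (H.res h (l a)) = f a • H.one V) ∧ x = ∑ a, f a • H.res h (b a)

namespace DualBasis

open UH

variable {H : PreHeis S} {I : H.toSMod.Sub} {U : S.Aff} (B : DualBasis H I U)

theorem ι_eq {x : H.C U} (hx : x ∈ I.C U) :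
    ι H x = ∑ a, ι H (H.br U x (B.l a)) * ι H (B.b a) := by
  obtain ⟨f, h1, h2⟩ := B.span le_rfl x hx
  simp only [H.res_id] at h1 h2
  conv_lhs => rw [h2]
  rw [map_sum]
  exact Finset.sum_congr rfl fun a _ => by rw [h1, ← oo_apply, oo_mul_ι]

/-- Scalars and sections supercommute. -/
theorem ι_br_mul {p q r : ZMod 2} {x y z : H.C U} (hx : H.Homog p x) (hy : H.Homog q y)
    (hz : H.Homog r z) : ι H (H.br U x y) * ι H z =
      sg ((p + q) * r) • (ι H z * ι H (H.br U x y)) := by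
  have h1 : H.Homog (p + q) (H.br U x y) := by
    unfold SMod.Homog at *
    rw [H.par_br, hx, hy, sg_add, map_zsmul, map_zsmul, AddMonoidHom.smul_apply, mul_smul, smul_comm]
  have h2 : H.br U (H.br U x y) z = 0 := by
    obtain ⟨f, hf⟩ := H.br_mem U x y
    rw [hf, H.br_smul, H.one_br, smul_zero]
  have := ι_comm H h1 hz
  rwa [h2, map_zero, sub_eq_zero] at this

theorem ι_eq' {x : H.C U} (hx : x ∈ I.C U) :
    ι H x = ∑ a, ι H (B.b a) * ι H (H.br U (-sg (B.p a) • B.l a) x) := by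
  have key : ∀ q, ι H (H.pr q x) =
      ∑ a, ι H (B.b a) * ι H (H.br U (-sg (B.p a) • B.l a) (H.pr q x)) := fun q => by
    rw [B.ι_eq (I.pr_mem q hx)]
    refine Finset.sum_congr rfl fun a _ => ?_
    rw [ι_br_mul (H.pr_homog q x) (B.hl a) (B.hb a), H.br_skew U _ _ _ _ (H.pr_homog q x) (B.hl a),
      map_zsmul, AddMonoidHom.smul_apply, map_neg, map_zsmul, map_zsmul, mul_neg, mul_smul_comm,
      mul_smul_comm, ← smul_neg, neg_smul, ← smul_neg, smul_comm, smul_smul]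
    congr 1
    rcases zmod2_cases q with rfl | rfl <;> rcases zmod2_cases (B.p a) with h | h <;>
      simp [h, show (1 + 1 : ZMod 2) = 0 by decide]
  rw [← H.pr_add_pr x]
  simp only [map_add, mul_add, Finset.sum_add_distrib]
  rw [key 0, key 1]

/-- The operator `∑ bₐ [lₐ, u]` of `U(H)`. -/
def euler : UH H U →+ UH H U :=
  ∑ a, (AddMonoidHom.mulLeft (ι H (B.b a))).comp (ad H (B.p a) (-sg (B.p a) • B.l a))

theorem hl' (a : Fin B.n) : H.Homog (B.p a) (-sg (B.p a) • B.l a) := by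
  have := B.hl a
  unfold SMod.Homog at *
  rw [map_zsmul, this, smul_comm]

theorem euler_apply (u : UH H U) :
    B.euler u = ∑ a, ι H (B.b a) * ad H (B.p a) (-sg (B.p a) • B.l a) u := by
  simp [euler, AddMonoidHom.finsetSum_apply]

theorem euler_ι (x : H.C U) : ∃ y ∈ I.C U, B.euler (ι H x) = ι H y := by
  have key : ∀ a, ∃ y ∈ I.C U, ι H (B.b a) * ad H (B.p a) (-sg (B.p a) • B.l a) (ι H x) = ι H y :=
    fun a => by
    obtain ⟨f, hf⟩ := H.br_mem U (-sg (B.p a) • B.l a) x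
    rw [ad_ι H (B.hl' a), hf, ← oo_apply]
    clear hf
    induction f using O_homog_ind with
    | hadd f g hf hg =>
      obtain ⟨y, hy, h1⟩ := hf
      obtain ⟨z, hz, h2⟩ := hg
      exact ⟨y + z, add_mem hy hz, by rw [map_add, mul_add, h1, h2, map_add]⟩
    | h q f hf =>
      exact ⟨f • H.tw q (B.b a), Submodule.smul_mem _ _ (I.tw_mem q (B.mem a)), by
        rw [mul_oo H hf, tw_ι, oo_mul_ι]⟩
  choose y hy h using key
  exact ⟨∑ a, y a, sum_mem fun a _ => hy a, by rw [euler_apply, map_sum]; simp only [h]⟩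

theorem euler_ι_mem {x : H.C U} (hx : x ∈ I.C U) : B.euler (ι H x) = ι H x := by
  rw [euler_apply]
  conv_rhs => rw [B.ι_eq' hx]
  exact Finset.sum_congr rfl fun a _ => by rw [ad_ι H (B.hl' a)]

theorem euler_mul (x : H.C U) (v : UH H U) : B.euler (ι H x * v) = B.euler (ι H x) * v +
    ι H x * B.euler v -
      ∑ a, ι H (H.br U x (B.b a)) * ad H (B.p a) (-sg (B.p a) • B.l a) v := by
  have key : ∀ q (x : H.C U), H.Homog q x → ∀ a,
      ι H (B.b a) * (mod H).tw (B.p a) (ι H x) = ι H x * ι H (B.b a) - ι H (H.br U x (B.b a)) :=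
    fun q x hx a => by
      rw [← ι_comm H hx (B.hb a), tw_ι, hx.tw, map_zsmul, mul_smul_comm, mul_comm q]; abel
  simp only [euler_apply, Finset.sum_mul, Finset.mul_sum, ← Finset.sum_add_distrib,
    ← Finset.sum_sub_distrib]
  refine Finset.sum_congr rfl fun a _ => ?_
  rw [ad_mul, mul_add, mul_assoc, ← mul_assoc _ ((mod H).tw _ _), add_sub_assoc]
  congr 1
  induction x using H.toSMod.homog_ind with
  | hadd x y hx hy =>
    rw [map_add, map_add, mul_add, add_mul, hx, hy, map_add, AddMonoidHom.add_apply, map_add]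
    noncomm_ring
  | h q x hx => rw [key q x hx a]; noncomm_ring

theorem euler_fil : ∀ {n : ℕ} {v : UH H U}, v ∈ fil H U n → B.euler v ∈ fil H U n
  | 0, v, hv => by
    rw [euler_apply]
    exact sum_mem fun a _ => by rw [(ad_fil (B.hl' a)).1 v hv, mul_zero]; exact zero_mem _
  | n + 1, v, hv => by
    rw [euler_apply]
    exact sum_mem fun a _ => ι_mul_mem_fil _ ((ad_fil (B.hl' a)).2 n v hv)

theorem euler_step {n : ℕ} {x : H.C U} {v : UH H U}
    (hv : v ∈ fil H U n) (ε : ℕ) (hx : B.euler (ι H x) = ε • ι H x) (l : List ℕ) :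
    evList B.euler (l.map (· + ε)) (ι H x * v) - ι H x * evList B.euler l v ∈ fil H U n := by
  have stab : ∀ l, evList B.euler l v ∈ fil H U n := fun l => by
    induction l with
    | nil => exact hv
    | cons k l ih =>
      rw [evList_cons]; exact sub_mem (B.euler_fil ih) (nsmul_mem ih k)
  induction l with
  | nil => simp
  | cons k l ih =>
    rw [List.map_cons, evList_cons, evList_cons]
    have h1 := sub_mem (B.euler_fil ih) (nsmul_mem ih (k + ε))
    rw [map_sub, B.euler_mul, hx] at h1
    have h2 : ∑ a, ι H (H.br U x (B.b a)) *
        ad H (B.p a) (-sg (B.p a) • B.l a) (evList B.euler l v) ∈ fil H U n :=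
      sum_mem fun a _ => by
        obtain ⟨f, hf⟩ := H.br_mem U x (B.b a)
        rw [hf, ← oo_apply]
        refine oo_mul_mem_fil f ?_
        cases n with
        | zero => rw [(ad_fil (B.hl' a)).1 _ (stab l)]; exact zero_mem _
        | succ n => exact fil_mono n.le_succ ((ad_fil (B.hl' a)).2 n _ (stab l))
    refine (congrArg (· ∈ fil H U n) ?_).mpr (sub_mem h1 h2)
    simp only [mul_sub, smul_sub, add_smul, smul_mul_assoc, mul_smul_comm]
    abel

/-- `∑ bₐ [lₐ, u]` is locally finite on `U(H)`, with nonnegative integral eigenvalues. -/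
theorem exists_evList_euler (u : UH H U) :
    ∃ l, evList B.euler l u = 0 := by
  have add : ∀ a b : UH H U, (∃ l, evList B.euler l a = 0) → (∃ l, evList B.euler l b = 0) →
      ∃ l, evList B.euler l (a + b) = 0 := fun a b ⟨l, hl⟩ ⟨l', hl'⟩ =>
    ⟨l ++ l', evList_append_add hl hl'⟩
  suffices ∀ n, ∀ v ∈ fil H U n, ∃ l, evList B.euler l v = 0 by
    obtain ⟨n, hn⟩ := exists_mem_fil u
    exact this n u hn
  intro n
  induction n with
  | zero =>
    intro v hv
    refine ⟨[0], ?_⟩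
    rw [evList_cons, evList_nil, zero_smul, sub_zero, euler_apply]
    exact Finset.sum_eq_zero fun a _ => by rw [(ad_fil (B.hl' a)).1 v hv, mul_zero]
  | succ n ih =>
    intro v hv
    induction hv using AddSubgroup.closure_induction with
    | mem a ha =>
      obtain ⟨x, v, hv, rfl⟩ := ha
      have key : ∀ (x : H.C U) (ε : ℕ), B.euler (ι H x) = ε • ι H x →
          ∃ l, evList B.euler l (ι H x * v) = 0 := fun x ε hx => by
        obtain ⟨l, hl⟩ := ih v hv
        have := B.euler_step hv ε hx l
        rw [hl, mul_zero, sub_zero] at this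
        obtain ⟨l', hl'⟩ := ih _ this
        exact ⟨l' ++ l.map (· + ε), by rw [evList_append, hl']⟩
      obtain ⟨y, hy, hxy⟩ := B.euler_ι x
      have h1 := key y 1 (by rw [B.euler_ι_mem hy, one_smul])
      have h2 := key (x - y) 0 (by rw [map_sub, map_sub, B.euler_ι_mem hy, hxy, sub_self, zero_smul])
      have := add _ _ h1 h2
      rwa [← add_mul, ← map_add, add_sub_cancel] at this
    | zero => exact ⟨[], rfl⟩
    | add a b _ _ ha hb => exact add a b ha hb
    | neg a _ ha =>
      obtain ⟨l, hl⟩ := ha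
      exact ⟨l, by rw [map_neg, hl, neg_zero]⟩

end DualBasis

/-! ### Exterior powers -/

theorem SuperScheme.Homog.tw' {U : S.Aff} {q : ZMod 2} {f : S.O U} (hf : S.Homog q f)
    (p : ZMod 2) : S.Homog q (S.tw p f) := by
  rw [hf.tw]; unfold SuperScheme.Homog at *; rw [map_zsmul, hf, smul_comm]

theorem SMod.Homog.tw' {M : SMod S} {U : S.Aff} {q : ZMod 2} {m : M.C U} (hm : M.Homog q m)
    (p : ZMod 2) : M.Homog q (M.tw p m) := by
  unfold SMod.Homog at *; rw [M.par_tw, hm, map_zsmul]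

namespace Kosz

open SMod

variable {P M : SMod S} (A : Act P M) {U V : S.Aff}

theorem rel_ot {n : ℕ} (x : P.C U) {r : (T A n).C U} (hr : r ∈ (rel A n).C U) :
    (ot x r : (otens P (T A n)).C U) ∈ (rel A (n + 1)).C U := by
  have h0 : (ot x 0 : (otens P (T A n)).C U) = 0 := by
    simpa using ot_zsmul 0 x (0 : (T A n).C U)
  cases n with
  | zero =>
    rw [(Submodule.mem_bot _).1 hr, h0]; exact zero_mem _
  | succ n => exact anti_ot' (T := T A n) x hr

/-- The identification of `M` with the term of degree `0` of the Koszul complex. -/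
def kz : M.C U →+ (K A 0).C U := ap (kp A 0) U

/-- Multiplication by sections of `P` on exterior powers. -/
def otk (n : ℕ) : P.C U →+ (K A n).C U →+ (K A (n + 1)).C U :=
  AddMonoidHom.mk' (fun x => qmap _ _ (AddMonoidHom.mk'
    (fun z : (T A n).C U => (ot x z : (otens P (T A n)).C U)) (ot_add x))
    fun _ hr => rel_ot A x hr) fun x y => AddMonoidHom.ext fun z => by
      obtain ⟨z, rfl⟩ := Submodule.Quotient.mk_surjective _ z
      exact congrArg (Submodule.Quotient.mk (p := (rel A (n + 1)).C U)) (add_ot x y z)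

/-- The action of `P` on exterior powers. -/
def kact (n : ℕ) : P.C U →+ (K A n).C U →+ (K A n).C U :=
  AddMonoidHom.mk' (fun x => qop ((stage A n).2.a x) (rel_act A n U x))
    fun x y => AddMonoidHom.ext fun z => by
      obtain ⟨z, rfl⟩ := Submodule.Quotient.mk_surjective _ z
      exact congrArg (Submodule.Quotient.mk (p := (rel A n).C U))
        (DFunLike.congr_fun (map_add (stage A n).2.a x y) z)

theorem otk_kp (n : ℕ) (x : P.C U) (z : (T A n).C U) :
    otk A n x (ap (kp A n) U z) = ap (kp A (n + 1)) U (ot x z : (otens P (T A n)).C U) := rfl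

theorem kz_surj (z : (K A 0).C U) : ∃ m, kz A m = z := proj_surj _ z

theorem k_ind {n : ℕ} {R : (K A (n + 1)).C U → Prop} (h : ∀ x z, R (otk A n x z))
    (hadd : ∀ a b, R a → R b → R (a + b)) (z) : R z := by
  obtain ⟨z, rfl⟩ := proj_surj _ z
  exact ot_ind (P := P) (Q := T A n) (R := fun z => R (ap (kp A (n + 1)) U z))
    (fun x t => h x (ap (kp A n) U t)) (fun a b ha hb => by
      have e : ap (kp A (n + 1)) U (a + b) = ap (kp A (n + 1)) U a + ap (kp A (n + 1)) U b :=
        map_add _ _ _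
      exact e.symm ▸ hadd _ _ ha hb) z

theorem otk_smul (n : ℕ) (f : S.O U) (x : P.C U) (z : (K A n).C U) :
    otk A n (f • x) z = f • otk A n x z := by
  obtain ⟨z, rfl⟩ := proj_surj _ z
  exact congrArg (ap (kp A (n + 1)) U) (smul_ot f x z)

theorem smul_otk (n : ℕ) {q : ZMod 2} {f : S.O U} (hf : S.Homog q f) (x : P.C U)
    (z : (K A n).C U) : otk A n x (f • z) = f • otk A n (P.tw q x) z := by
  obtain ⟨z, rfl⟩ := proj_surj _ z
  exact congrArg (ap (kp A (n + 1)) U) (ot_smul hf x z)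

theorem par_otk (n : ℕ) (x : P.C U) (z : (K A n).C U) :
    (K A (n + 1)).par U (otk A n x z) = otk A n (P.par U x) ((K A n).par U z) := by
  obtain ⟨z, rfl⟩ := proj_surj _ z
  exact congrArg (ap (kp A (n + 1)) U) (par_ot x z)

theorem res_otk (n : ℕ) (h : V ≤ U) (x : P.C U) (z : (K A n).C U) :
    (K A (n + 1)).res h (otk A n x z) = otk A n (P.res h x) ((K A n).res h z) := by
  obtain ⟨z, rfl⟩ := proj_surj _ z
  exact congrArg (ap (kp A (n + 1)) V) (res_ot h x z)

theorem otk_anti (n : ℕ) {p q : ZMod 2} {x y : P.C U} (hx : P.Homog p x) (hy : P.Homog q y)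
    (z : (K A n).C U) :
    otk A (n + 1) x (otk A n y z) + sg (p * q) • otk A (n + 1) y (otk A n x z) = 0 := by
  obtain ⟨z, rfl⟩ := proj_surj _ z
  exact proj_zero (rel A (n + 2)) (anti_ot (T := T A n) (R := rel A (n + 1)) z hx hy)

theorem kact_kz (x : P.C U) (m : M.C U) : kact A 0 x (kz A m) = kz A (A.a x m) := rfl

theorem kact_otk (n : ℕ) {p : ZMod 2} {x : P.C U} (hx : P.Homog p x) (y : P.C U)
    (z : (K A n).C U) : kact A (n + 1) x (otk A n y z) = otk A n (P.tw p y) (kact A n x z) := by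
  obtain ⟨z, rfl⟩ := proj_surj _ z
  exact congrArg (ap (kp A (n + 1)) U) ((stage A n).2.step_ot hx y z)

theorem kd_zero (x : P.C U) (m : M.C U) : ap (kd A 0) U (otk A 0 x (kz A m)) = -kz A (A.a x m) :=
  rfl

theorem kd_succ (n : ℕ) (x : P.C U) (z : (K A (n + 1)).C U) :
    ap (kd A (n + 1)) U (otk A (n + 1) x z) =
      -kact A (n + 1) x z - otk A n x (ap (kd A n) U z) := by
  obtain ⟨z, rfl⟩ := proj_surj _ z
  exact (congrArg (ap (kp A (n + 1)) U) (Act.kstep_ot (T := T A n) (stage A n).2 (d A n) x z)).trans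
    (map_sub _ _ _)

theorem kd_kd_apply (n : ℕ) (z : (K A (n + 2)).C U) :
    ap (kd A n) U (ap (kd A (n + 1)) U z) = 0 := by
  rw [← ap_comp, kd_kd, ap_zero]

/-- Targets of maps from exterior powers. -/
structure Tow (P : SMod S) (U : S.Aff) (p : ZMod 2) where
  Y : ℕ → Type u
  [grp : ∀ n, AddCommGroup (Y n)]
  [mod : ∀ n, Module (S.O U) (Y n)]
  o : ∀ n, P.C U →+ Y n →+ Y (n + 1)
  o_smul : ∀ n (f : S.O U) x y, o n (f • x) y = S.tw p f • o n x y
  smul_o : ∀ n (q : ZMod 2) (f : S.O U), S.Homog q f → ∀ x y,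
    o n x (f • y) = f • o n (P.tw q x) y
  anti : ∀ n (q r : ZMod 2) (x y : P.C U), P.Homog q x → P.Homog r y → ∀ z,
    o (n + 1) x (o n y z) + sg (q * r) • o (n + 1) y (o n x z) = 0

attribute [instance] Tow.grp Tow.mod

section stepHom

variable {p : ZMod 2} (W : Tow P U p) {Q : SMod S} (n : ℕ) (φ : Q.C U →+ W.Y n)
  (hφ : ∀ (f : S.O U) z, φ (f • z) = S.tw p f • φ z)

/-- The inductive step in the definition of maps from tensor powers. -/
def stepHom : (otens P Q).C U →+ W.Y (n + 1) :=
  olift (AddMonoidHom.mk' (fun x => (W.o n x).comp φ)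
      fun x y => AddMonoidHom.ext fun z => by
        simp only [map_add, AddMonoidHom.comp_apply, AddMonoidHom.add_apply])
      (fun q f g hf x y => by
        simp only [AddMonoidHom.mk'_apply, AddMonoidHom.comp_apply]
        rw [W.o_smul, W.o_smul, W.o_smul, hφ, W.smul_o n q _ (hf.tw' p)])

theorem stepHom_ot (x : P.C U) (z : Q.C U) : stepHom W n φ hφ (ot x z) = W.o n x (φ z) := rfl

theorem stepHom_smul (f : S.O U) (z : (otens P Q).C U) :
    stepHom W n φ hφ (f • z) = S.tw p f • stepHom W n φ hφ z := by
  induction z using ot_ind with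
  | h x t => rw [← smul_ot, stepHom_ot, stepHom_ot, W.o_smul]
  | hadd a b ha hb => rw [smul_add, map_add, ha, hb, map_add, smul_add]

end stepHom

section klift

variable {p : ZMod 2} (W : Tow P U p) (g : M.C U →+ W.Y 0)
  (hg : ∀ (f : S.O U) m, g (f • m) = S.tw p f • g m)

/-- The map on tensor powers. -/
def tlift : ∀ n, {φ : (T A n).C U →+ W.Y n // ∀ (f : S.O U) z, φ (f • z) = S.tw p f • φ z}
  | 0 => ⟨g, hg⟩
  | n + 1 => ⟨stepHom (Q := T A n) W n (tlift n).1 (tlift n).2,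
      stepHom_smul (Q := T A n) W n (tlift n).1 (tlift n).2⟩

theorem tlift_ot (n : ℕ) (x : P.C U) (z : (T A n).C U) :
    (tlift A W g hg (n + 1)).1 (ot x z : (otens P (T A n)).C U) =
      W.o n x ((tlift A W g hg n).1 z) := rfl

theorem tlift_rel : ∀ n, ∀ r ∈ (rel A n).C U, (tlift A W g hg n).1 r = 0
  | 0, r, hr => by rw [(Submodule.mem_bot _).1 hr, map_zero]
  | 1, r, hr => by rw [(Submodule.mem_bot _).1 hr, map_zero]
  | n + 2, r, hr => by
    refine Submodule.span_induction (p := fun r _ => (tlift A W g hg (n + 2)).1 r = 0) ?_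
      (map_zero _) (fun a b _ _ ha hb => ?_) (fun a z _ hz => ?_) hr
    · rintro _ (⟨q, r, x, y, t, hx, hy, rfl⟩ | ⟨x, r, hr, rfl⟩)
      · exact ((map_add (tlift A W g hg (n + 2)).1 _ _).trans (congrArg₂ (· + ·) rfl
          (map_zsmul (tlift A W g hg (n + 2)).1 _ _))).trans (W.anti n q r x y hx hy _)
      · refine (tlift_ot A W g hg (n + 1) x r).trans ?_
        rw [tlift_rel (n + 1) r hr, map_zero]
    · exact (map_add (tlift A W g hg (n + 2)).1 _ _).trans (by rw [ha, hb, add_zero])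
    · exact ((tlift A W g hg (n + 2)).2 _ _).trans (by rw [hz, smul_zero])

/-- The universal property of exterior powers. -/
def klift (n : ℕ) : (K A n).C U →+ W.Y n := qlift _ (tlift A W g hg n).1 (tlift_rel A W g hg n)

theorem klift_otk (n : ℕ) (x : P.C U) (z : (K A n).C U) :
    klift A W g hg (n + 1) (otk A n x z) = W.o n x (klift A W g hg n z) := by
  obtain ⟨z, rfl⟩ := proj_surj _ z
  rfl

theorem klift_smul (n : ℕ) (f : S.O U) (z : (K A n).C U) :
    klift A W g hg n (f • z) = S.tw p f • klift A W g hg n z := by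
  obtain ⟨z, rfl⟩ := proj_surj _ z
  exact (tlift A W g hg n).2 f z

end klift

/-- The Koszul complex over an affine open. -/
@[reducible] def sec (U : S.Aff) : Cpx where
  X n := (K A n).C U
  d n := ap (kd A n) U

/-! ### Functoriality of exterior powers -/

section kmap

variable {P' M' : SMod S} (A' : Act P' M')

/-- The exterior powers of `P'` as a target of maps. -/
@[reducible] def mapTow (f : P.C U →ₗ[S.O U] P'.C U) (hf : ∀ x, f (P.par U x) = P'.par U (f x)) :
    Tow P U 0 where
  Y n := (K A' n).C U
  o n := (otk A' n).comp f.toAddMonoidHom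
  o_smul n a x y := by
    change otk A' n (f (a • x)) y = _
    rw [map_smul, otk_smul]; simp
  smul_o n q a ha x y := by
    have : f (P.tw q x) = P'.tw q (f x) := by
      rcases zmod2_cases q with rfl | rfl <;> simp [hf]
    change otk A' n (f x) (a • y) = a • otk A' n (f _) y
    rw [smul_otk A' n ha, this]
  anti n q r x y hx hy z := otk_anti A' n
    (show P'.par U (f x) = sg q • f x by rw [← hf, hx, map_zsmul])
    (show P'.par U (f y) = sg r • f y by rw [← hf, hy, map_zsmul]) z

variable (f : P.C U →ₗ[S.O U] P'.C U) (hf : ∀ x, f (P.par U x) = P'.par U (f x))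
  (g : M.C U →ₗ[S.O U] M'.C U)

/-- The map of exterior powers. -/
def kmap (n : ℕ) : (K A n).C U →+ (K A' n).C U :=
  klift A (mapTow A' f hf) ((kz A').comp g.toAddMonoidHom) (fun a m => by
    change kz A' (g (a • m)) = _
    rw [map_smul]; rfl) n

theorem kmap_kz (m : M.C U) : kmap A A' f hf g 0 (kz A m) = kz A' (g m) := rfl

theorem kmap_otk (n : ℕ) (x : P.C U) (z : (K A n).C U) :
    kmap A A' f hf g (n + 1) (otk A n x z) = otk A' n (f x) (kmap A A' f hf g n z) :=
  klift_otk A _ _ _ n x z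

variable (h : ∀ (x : P.C U) (m : M.C U), g (A.a x m) = A'.a (f x) (g m))

include h in
theorem kmap_kact : ∀ n (x : P.C U) (z : (K A n).C U),
    kmap A A' f hf g n (kact A n x z) = kact A' n (f x) (kmap A A' f hf g n z)
  | 0, x, z => by
    obtain ⟨m, rfl⟩ := kz_surj A z
    rw [kact_kz, kmap_kz, kmap_kz, kact_kz, h]
  | n + 1, x, z => by
    refine P.homog_ind (P := fun x => kmap A A' f hf g (n + 1) (kact A (n + 1) x z) =
      kact A' (n + 1) (f x) (kmap A A' f hf g (n + 1) z)) (fun a b ha hb => ?_)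
      (fun p x hx => ?_) x
    · simp only [map_add, AddMonoidHom.add_apply, ha, hb]
    · have hx' : P'.Homog p (f x) := by rw [SMod.Homog, ← hf, hx, map_zsmul]
      have ht : ∀ y, f (P.tw p y) = P'.tw p (f y) := fun y => by
        rcases zmod2_cases p with rfl | rfl <;> simp [hf]
      induction z using k_ind with
      | h y z => rw [kact_otk A n hx, kmap_otk, kmap_otk, kact_otk A' n hx', kmap_kact n, ht]
      | hadd a b ha hb => simp only [map_add, ha, hb]

include h in
theorem kmap_kd : ∀ n (z : (K A (n + 1)).C U),
    kmap A A' f hf g n (ap (kd A n) U z) = ap (kd A' n) U (kmap A A' f hf g (n + 1) z)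
  | 0, z => by
    induction z using k_ind with
    | h y z =>
      obtain ⟨m, rfl⟩ := kz_surj A z
      rw [kd_zero, kmap_otk, kmap_kz, kd_zero, map_neg, kmap_kz, h]
    | hadd a b ha hb => simp only [map_add, ha, hb]
  | n + 1, z => by
    induction z using k_ind with
    | h y z =>
      rw [kd_succ, kmap_otk, kd_succ, map_sub, map_neg, kmap_kact A A' f hf g h, ← kmap_kd n z]
      exact congrArg _ (kmap_otk A A' f hf g n y _)
    | hadd a b ha hb => simp only [map_add, ha, hb]

/-- The map of Koszul complexes over an affine open. -/
@[reducible] def secMap : Cpx.Hom (sec A U) (sec A' U) :=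
  ⟨kmap A A' f hf g, kmap_kd A A' f hf g h⟩

end kmap

end Kosz

/-! ### A homotopy of the Koszul complex -/

/-- Operators `λₐ` on `M`, together with sections `jₐ` of `P`, such that the commutators of the `λₐ`
with the action of `P` are scalars. -/
structure KoszHtpy {P M : SMod S} (A : Act P M) (U : S.Aff) where
  n : ℕ
  p : Fin n → ZMod 2
  j : Fin n → P.C U
  hj : ∀ a, P.Homog (p a) (j a)
  lam : ∀ _ : Fin n, M.C U →+ M.C U
  lam_smul : ∀ a (f : S.O U) m, lam a (f • m) = S.tw (p a) f • lam a m
  c : Fin n → P.C U →+ S.O U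
  hc : ∀ a (r : ZMod 2) (x : P.C U), P.Homog r x → S.Homog (p a + r) (c a x)
  lam_act : ∀ a (x : P.C U) (m : M.C U),
    lam a (A.a x m) = c a x • m + A.a (P.tw (p a) x) (lam a m)
  π : P.C U →+ P.C U
  hπ : ∀ (r : ZMod 2) (x : P.C U), P.Homog r x →
    π x = ∑ a, c a x • P.tw (p a + r) (j a)

namespace KoszHtpy

open SMod Kosz

variable {P M : SMod S} {A : Act P M} {U : S.Aff} (B : KoszHtpy A U)

theorem otk_π (n : ℕ) (x : P.C U) (z : (K A n).C U) :
    otk A n (B.π x) z = ∑ a, otk A n (B.j a) (B.c a x • z) := by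
  induction x using P.homog_ind with
  | hadd x y hx hy =>
    rw [map_add, map_add, AddMonoidHom.add_apply, hx, hy, ← Finset.sum_add_distrib]
    exact Finset.sum_congr rfl fun a _ => by rw [map_add, add_smul, map_add]
  | h r x hx =>
    rw [B.hπ r x hx, map_sum, AddMonoidHom.finsetSum_apply]
    exact Finset.sum_congr rfl fun a _ => by rw [smul_otk A n (B.hc a r x hx), otk_smul]

/-- The exterior powers as a target of semilinear maps. -/
@[reducible] def tow (A : Act P M) (U : S.Aff) (p : ZMod 2) : Tow P U p where
  Y n := (K A n).C U
  o n := (otk A n).comp (P.tw p)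
  o_smul n f x y := by
    change otk A n (P.tw p (f • x)) y = _
    rw [P.tw_smul, otk_smul]; rfl
  smul_o n q f hf x y := by
    change otk A n (P.tw p x) (f • y) = f • otk A n (P.tw p (P.tw q x)) y
    rw [smul_otk A n hf, ← P.tw_add, ← P.tw_add, add_comm q p]
  anti n q r x y hx hy z := otk_anti A n (hx.tw' p) (hy.tw' p) z

/-- The operators `λₐ` on exterior powers. -/
def Lam (a : Fin B.n) (n : ℕ) : (K A n).C U →+ (K A n).C U :=
  klift A (tow A U (B.p a)) ((kz A).comp (B.lam a)) (fun f m => by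
    change kz A (B.lam a (f • m)) = _
    rw [B.lam_smul]; rfl) n

theorem Lam_kz (a : Fin B.n) (m : M.C U) : B.Lam a 0 (kz A m) = kz A (B.lam a m) := rfl

theorem Lam_otk (a : Fin B.n) (n : ℕ) (y : P.C U) (t : (K A n).C U) :
    B.Lam a (n + 1) (otk A n y t) = otk A n (P.tw (B.p a) y) (B.Lam a n t) :=
  klift_otk A _ _ _ n y t

theorem kz_smul (f : S.O U) (m : M.C U) : kz A (f • m) = f • kz A m := rfl

theorem Lam_act (a : Fin B.n) : ∀ n (x : P.C U) (z : (K A n).C U),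
    B.Lam a n (kact A n x z) = B.c a x • z + kact A n (P.tw (B.p a) x) (B.Lam a n z)
  | 0, x, z => by
    obtain ⟨m, rfl⟩ := kz_surj A z
    rw [kact_kz, Lam_kz, Lam_kz, B.lam_act, kact_kz, map_add, kz_smul]
  | n + 1, x, z => by
    refine P.homog_ind (P := fun x => B.Lam a (n + 1) (kact A (n + 1) x z) =
      B.c a x • z + kact A (n + 1) (P.tw (B.p a) x) (B.Lam a (n + 1) z)) (fun a b ha hb => ?_)
      (fun p x hx => ?_) x
    · simp only [map_add, AddMonoidHom.add_apply, ha, hb, add_smul]; abel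
    · induction z using k_ind with
      | hadd z z' h h' => simp only [map_add, h, h', smul_add]; abel
      | h y t =>
        have e : B.p a + p + B.p a + p = 0 := by
          generalize B.p a = q; clear hx; revert p q; decide
        rw [kact_otk A n hx, Lam_otk, Lam_act a n, Lam_otk, kact_otk A n (hx.tw' _), map_add,
          smul_otk A n (B.hc a p x hx), ← P.tw_add, ← P.tw_add, e, ← P.tw_add (B.p a) p y,
          add_comm (B.p a) p, P.tw_add p, show P.tw 0 y = y by simp]

/-- The homotopy `z ↦ ∑ jₐ ⊗ λₐ z` on exterior powers. -/
def h (n : ℕ) : (K A n).C U →+ (K A (n + 1)).C U := ∑ a, (otk A n (B.j a)).comp (B.Lam a n)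

theorem h_apply (n : ℕ) (z : (K A n).C U) : B.h n z = ∑ a, otk A n (B.j a) (B.Lam a n z) := by
  simp [h]

/-- The operator `-(d h + h d)` of the Koszul complex. -/
def lap : ∀ n, (K A n).C U →+ (K A n).C U
  | 0 => -(ap (kd A 0) U).comp (B.h 0)
  | n + 1 => -((ap (kd A (n + 1)) U).comp (B.h (n + 1)) + (B.h n).comp (ap (kd A n) U))

theorem lap_succ (n : ℕ) (z : (K A (n + 1)).C U) : B.lap (n + 1) z =
    -(ap (kd A (n + 1)) U (B.h (n + 1) z) + B.h n (ap (kd A n) U z)) := rfl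

/-- The operator `∑ jₐ λₐ` of `M`. -/
def lapM : M.C U →+ M.C U := ∑ a, (A.a (B.j a)).comp (B.lam a)

theorem lapM_apply (m : M.C U) : B.lapM m = ∑ a, A.a (B.j a) (B.lam a m) := by simp [lapM]

theorem lap_zero (m : M.C U) : B.lap 0 (kz A m) = kz A (B.lapM m) := by
  change -(ap (kd A 0) U (B.h 0 (kz A m))) = _
  rw [h_apply, lapM_apply, map_sum, map_sum, ← Finset.sum_neg_distrib]
  exact Finset.sum_congr rfl fun a _ => by rw [Lam_kz, kd_zero, neg_neg]

theorem swap (n : ℕ) (a : Fin B.n) (x : P.C U) (w : (K A n).C U) :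
    otk A (n + 1) (B.j a) (otk A n (P.tw (B.p a) x) w) =
      -otk A (n + 1) x (otk A n (B.j a) w) := by
  induction x using P.homog_ind with
  | hadd x y hx hy =>
    simp only [map_add, AddMonoidHom.add_apply, hx, hy]; abel
  | h r x hx =>
    have := congrArg (sg (B.p a * r) • ·) (otk_anti A n (B.hj a) hx w)
    simp only [smul_add, smul_smul, sg_sq, one_smul, smul_zero] at this
    rw [hx.tw, map_zsmul, AddMonoidHom.smul_apply, map_zsmul, eq_neg_iff_add_eq_zero, this]

theorem step_act (n : ℕ) (a : Fin B.n) (x : P.C U) (w : (K A n).C U) :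
    kact A (n + 1) (B.j a) (otk A n (P.tw (B.p a) x) w) = otk A n x (kact A n (B.j a) w) := by
  rw [kact_otk A n (B.hj a), P.tw_tw]

theorem lap_otk_zero (x : P.C U) (m : M.C U) : B.lap 1 (otk A 0 x (kz A m)) =
    otk A 0 (B.π x) (kz A m) + otk A 0 x (B.lap 0 (kz A m)) := by
  have key : ∀ a, otk A 0 (B.j a) (B.Lam a 0 (kz A (A.a x m))) -
      ap (kd A 1) U (otk A 1 (B.j a) (B.Lam a 1 (otk A 0 x (kz A m)))) =
      otk A 0 (B.j a) (B.c a x • kz A m) + otk A 0 x (kz A (A.a (B.j a) (B.lam a m))) := fun a => by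
    rw [Lam_otk, kd_succ, step_act, Lam_kz, Lam_kz, kd_zero, kact_kz, B.lam_act, map_add, map_add,
      map_neg, kz_smul]
    abel
  rw [lap_zero, lap_succ, kd_zero, map_neg, h_apply, h_apply, lapM_apply, otk_π, map_sum, map_sum,
    map_sum, ← sub_eq_add_neg, neg_sub, ← Finset.sum_add_distrib, ← Finset.sum_sub_distrib]
  exact Finset.sum_congr rfl fun a _ => key a

theorem lap_otk_succ (n : ℕ) (x : P.C U) (z : (K A (n + 1)).C U) :
    B.lap (n + 2) (otk A (n + 1) x z) =
      otk A (n + 1) (B.π x) z + otk A (n + 1) x (B.lap (n + 1) z) := by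
  have key : ∀ a, -ap (kd A (n + 2)) U (otk A (n + 2) (B.j a) (B.Lam a (n + 2) (otk A (n + 1) x z))) +
      (otk A (n + 1) (B.j a) (B.Lam a (n + 1) (kact A (n + 1) x z)) +
        otk A (n + 1) (B.j a) (B.Lam a (n + 1) (otk A n x (ap (kd A n) U z)))) =
      otk A (n + 1) (B.j a) (B.c a x • z) -
        (otk A (n + 1) x (ap (kd A (n + 1)) U (otk A (n + 1) (B.j a) (B.Lam a (n + 1) z))) +
        otk A (n + 1) x (otk A n (B.j a) (B.Lam a n (ap (kd A n) U z)))) := fun a => by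
    rw [Lam_otk, kd_succ, step_act, Lam_act, kd_succ, Lam_otk, kd_succ, swap]
    simp only [map_add, map_sub, map_neg]
    rw [swap]
    abel
  have h1 : ap (kd A (n + 2)) U (B.h (n + 2) (otk A (n + 1) x z)) =
      ∑ a, ap (kd A (n + 2)) U (otk A (n + 2) (B.j a) (B.Lam a (n + 2) (otk A (n + 1) x z))) := by
    rw [h_apply, map_sum]
  have h2 : otk A (n + 1) x (ap (kd A (n + 1)) U (B.h (n + 1) z)) =
      ∑ a, otk A (n + 1) x (ap (kd A (n + 1)) U (otk A (n + 1) (B.j a) (B.Lam a (n + 1) z))) := by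
    rw [h_apply, map_sum, map_sum]
  have h3 : otk A (n + 1) x (B.h n (ap (kd A n) U z)) =
      ∑ a, otk A (n + 1) x (otk A n (B.j a) (B.Lam a n (ap (kd A n) U z))) := by
    rw [h_apply, map_sum]
  have h4 := Finset.sum_congr (rfl : (Finset.univ : Finset (Fin B.n)) = _) fun a _ => key a
  simp only [Finset.sum_add_distrib, Finset.sum_sub_distrib, Finset.sum_neg_distrib] at h4
  rw [← h1, ← h2, ← h3, ← h_apply, ← h_apply, ← otk_π] at h4
  rw [lap_succ, lap_succ, kd_succ, map_neg (otk A (n + 1) x), map_add (otk A (n + 1) x),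
    map_sub (B.h (n + 1)), map_neg (B.h (n + 1)), ← sub_eq_add_neg, ← h4]
  abel

theorem lap_otk : ∀ n (x : P.C U) (z : (K A n).C U),
    B.lap (n + 1) (otk A n x z) = otk A n (B.π x) z + otk A n x (B.lap n z)
  | 0, x, z => by
    obtain ⟨m, rfl⟩ := kz_surj A z
    exact B.lap_otk_zero x m
  | n + 1, x, z => B.lap_otk_succ n x z

theorem lap_kd (n : ℕ) (z : (K A (n + 1)).C U) :
    ap (kd A n) U (B.lap (n + 1) z) = B.lap n (ap (kd A n) U z) := by
  cases n with
  | zero =>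
    change ap (kd A 0) U (-(ap (kd A 1) U (B.h 1 z) + B.h 0 (ap (kd A 0) U z))) =
      -(ap (kd A 0) U (B.h 0 (ap (kd A 0) U z)))
    rw [map_neg, map_add, kd_kd_apply, zero_add]
  | succ n => rw [lap_succ, lap_succ, map_neg, map_add, kd_kd_apply, kd_kd_apply, zero_add,
      map_zero, add_zero]

/-- A cycle killed by `∏ (L - k)`, with all `k` nonzero, is a boundary. -/
theorem exact {n : ℕ} {z : (K A n).C U} (hz : (sec A U).Cyc n z) {l : List ℕ}
    (hl : ∀ k ∈ l, k ≠ 0) (h : evList (B.lap n) l z = 0) : ∃ w, z = ap (kd A n) U w := by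
  obtain ⟨c, hc⟩ := solve_evList hl h
  cases n with
  | zero => exact ⟨-B.h 0 (c • evQuot (B.lap 0) l z), by rw [map_neg]; exact hc⟩
  | succ n =>
    have h0 : ap (kd A n) U (c • evQuot (B.lap (n + 1)) l z) = 0 := by
      rw [map_rat_smul, evQuot_map (ap (kd A n) U) (B.lap_kd n) l z,
        show ap (kd A n) U z = 0 from hz, map_zero, smul_zero]
    refine ⟨-B.h (n + 1) (c • evQuot (B.lap (n + 1)) l z), hc.trans ?_⟩
    rw [lap_succ, h0, map_zero, add_zero, map_neg]

theorem lap_locfin (hπ : ∀ x, B.π x = x) (h0 : ∀ m : M.C U, ∃ l, evList B.lapM l m = 0) :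
    ∀ n (z : (K A (n + 1)).C U),
    ∃ l : List ℕ, (∀ k ∈ l, k ≠ 0) ∧ evList (B.lap (n + 1)) l z = 0
  | n, z => by
    induction z using k_ind with
    | hadd a b ha hb =>
      obtain ⟨l, hl, h⟩ := ha
      obtain ⟨l', hl', h'⟩ := hb
      exact ⟨l ++ l', fun k hk => (List.mem_append.1 hk).elim (hl k) (hl' k), evList_append_add h h'⟩
    | h x z =>
      have : ∃ l, evList (B.lap n) l z = 0 := by
        cases n with
        | zero =>
          obtain ⟨m, rfl⟩ := kz_surj A z
          obtain ⟨l, hl⟩ := h0 m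
          refine ⟨l, ?_⟩
          rw [← evList_map (kz A) (E := B.lapM) (fun w => (B.lap_zero w).symm), hl, map_zero]
        | succ n =>
          obtain ⟨l, -, h⟩ := lap_locfin hπ h0 n z
          exact ⟨l, h⟩
      obtain ⟨l, hl⟩ := this
      refine ⟨l.map (· + 1), ?_, ?_⟩
      · intro k hk
        obtain ⟨j, _, rfl⟩ := List.mem_map.1 hk
        exact j.succ_ne_zero
      · rw [evList_raise (otk A n x) (E := B.lap n) (fun w => by
          rw [lap_otk, hπ, add_comm (otk A n x w)]) l z, hl, map_zero]

/-- Acyclicity of the Koszul complex. -/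
theorem acyc (hπ : ∀ x, B.π x = x) (h0 : ∀ m : M.C U, ∃ l, evList B.lapM l m = 0) :
    (sec A U).Acyc := fun n z hz => by
  obtain ⟨l, hl, h⟩ := B.lap_locfin hπ h0 n z
  exact B.exact (n := n + 1) hz hl h

end KoszHtpy

/-! ### Operators on the bar resolution -/

theorem UH.ad_tw {H : PreHeis S} {U : S.Aff} {p : ZMod 2} {x : H.C U} (hx : H.Homog p x)
    (q : ZMod 2) (u : UH H U) :
    ad H p x ((mod H).tw q u) = sg (p * q) • (mod H).tw q (ad H p x u) := by
  have h : (mod H).tw q (ι H x) = sg (p * q) • ι H x := by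
    rw [tw_ι, hx.tw, map_zsmul, mul_comm]
  rw [ad_apply, ad_apply, map_sub, tw_mul, tw_mul, h, ← (mod H).tw_add, add_comm, (mod H).tw_add,
    smul_mul_assoc, mul_smul_comm, smul_sub, smul_smul, smul_smul, sg_sq, one_smul, one_smul]

namespace Bar

variable {H : PreHeis S} {U V : S.Aff} {Q Q' : SMod S}

/-- The operator `u ⊗ t ↦ ± u ⊗ φ t`. -/
def utail (r : ZMod 2) (φ : Q.C U →+ Q'.C U) (hφ : ∀ (f : S.O U) t, φ (f • t) = S.tw r f • φ t) :
    (SMod.otens (UH.mod H) Q).C U →+ (SMod.otens (UH.mod H) Q').C U :=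
  ulift (fun u => AddMonoidHom.mk' (fun t => uo ((UH.mod H).tw r u) (φ t))
      fun t t' => by rw [map_add, uo_add])
    (fun u u' t => by simp only [AddMonoidHom.mk'_apply, map_add, add_uo])
    (fun q f hf u t => by
      simp only [AddMonoidHom.mk'_apply]
      rw [hφ, uo_smul (hf.tw' r), UH.tw_mul, UH.tw_oo, smul_uo, ← (UH.mod H).tw_add,
        ← (UH.mod H).tw_add, add_comm r q])

theorem utail_uo (r : ZMod 2) (φ : Q.C U →+ Q'.C U) (hφ) (u : UH H U) (t : Q.C U) :
    utail r φ hφ (uo u t) = uo ((UH.mod H).tw r u) (φ t) := rfl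

theorem utail_smul (r : ZMod 2) (φ : Q.C U →+ Q'.C U) (hφ) (f : S.O U)
    (z : (SMod.otens (UH.mod H) Q).C U) :
    utail r φ hφ (f • z) = S.tw r f • utail r φ hφ z := by
  induction z using uo_ind with
  | h u t => rw [← smul_uo, utail_uo, utail_uo, UH.tw_mul, UH.tw_oo, smul_uo]
  | hadd a b ha hb => rw [smul_add, map_add, ha, hb, map_add, smul_add]

/-- The operator `u ⊗ t ↦ [x, u] ⊗ t`. -/
def uhead {p : ZMod 2} {x : H.C U} (hx : H.Homog p x) :
    (SMod.otens (UH.mod H) Q).C U →+ (SMod.otens (UH.mod H) Q).C U :=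
  ulift (fun u => AddMonoidHom.mk' (fun t => uo (UH.ad H p x u) t) fun t t' => uo_add _ _ _)
    (fun u u' t => by simp only [AddMonoidHom.mk'_apply, map_add, add_uo])
    (fun q f hf u t => by
      simp only [AddMonoidHom.mk'_apply]
      rw [uo_smul hf, UH.ad_smul H hx, UH.ad_tw hx, smul_uo, zsmul_uo, hf.tw, smul_assoc,
        smul_comm f, smul_smul, sg_sq, one_smul])

theorem uhead_uo {p : ZMod 2} {x : H.C U} (hx : H.Homog p x) (u : UH H U) (t : Q.C U) :
    uhead hx (uo u t) = uo (UH.ad H p x u) t := rfl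

theorem uhead_smul {p : ZMod 2} {x : H.C U} (hx : H.Homog p x) (f : S.O U)
    (z : (SMod.otens (UH.mod H) Q).C U) :
    uhead hx (f • z) = S.tw p f • uhead hx z := by
  induction z using uo_ind with
  | h u t => rw [← smul_uo, uhead_uo, uhead_uo, UH.ad_smul H hx, smul_uo]
  | hadd a b ha hb => rw [smul_add, map_add, ha, hb, map_add, smul_add]

/-- The map `z ↦ u ⊗ z`. -/
def uoHom (u : UH H U) : Q.C U →+ (SMod.otens (UH.mod H) Q).C U :=
  AddMonoidHom.mk' (fun t => uo u t) fun _ _ => uo_add _ _ _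

theorem uoHom_apply (u : UH H U) (t : Q.C U) : uoHom u t = uo u t := rfl

theorem uo_ι_smul {p : ZMod 2} {x : H.C U} (hx : H.Homog p x) (f : S.O U) (t : Q.C U) :
    uo (UH.ι H x) (f • t) = S.tw p f • uo (UH.ι H x) t := by
  refine O_homog_ind (P := fun f => uo (UH.ι H x) (f • t) = S.tw p f • uo (UH.ι H x) t)
    (fun a b ha hb => ?_) (fun q f hf => ?_) f
  · rw [add_smul, uo_add, ha, hb, map_add, add_smul]
  · rw [uo_smul hf, UH.tw_ι, hx.tw, map_zsmul, zsmul_uo, hf.tw, smul_assoc, smul_comm f, mul_comm]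

/-! ### Insertion operators -/

/-- Families of operators depending on a section of `H`, semilinear in the second variable. -/
def Semi (Q Q' : SMod S) (σ : H.C U →+ Q.C U →+ Q'.C U) : Prop :=
  ∀ (r : ZMod 2) (x : H.C U), H.Homog r x → ∀ (f : S.O U) t, σ x (f • t) = S.tw r f • σ x t

/-- The inductive step in the definition of the insertion operators. -/
def sstep (σ : H.C U →+ Q.C U →+ (SMod.otens (UH.mod H) Q).C U)
    (hσ : Semi Q (SMod.otens (UH.mod H) Q) σ) : H.C U →+ (SMod.otens (UH.mod H) Q).C U →+
      (SMod.otens (UH.mod H) (SMod.otens (UH.mod H) Q)).C U :=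
  AddMonoidHom.mk' (fun x => uoHom (UH.ι H x) -
      (utail 0 (σ (H.pr 0 x)) (hσ 0 _ (H.pr_homog 0 x)) +
        utail 1 (σ (H.pr 1 x)) (hσ 1 _ (H.pr_homog 1 x)))) fun x y => AddMonoidHom.ext fun z => by
    induction z using uo_ind with
    | h u t =>
      simp only [AddMonoidHom.sub_apply, AddMonoidHom.add_apply, utail_uo, uoHom_apply, map_add,
        uo_add, add_uo]
      abel
    | hadd a b ha hb => rw [map_add, ha, hb, map_add]

theorem sstep_uo (σ : H.C U →+ Q.C U →+ (SMod.otens (UH.mod H) Q).C U) (hσ) {p : ZMod 2}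
    {x : H.C U} (hx : H.Homog p x) (u : UH H U) (t : Q.C U) : sstep σ hσ x (uo u t) =
      uo (UH.ι H x) (uo u t) - uo ((UH.mod H).tw p u) (σ x t) := by
  change uo (UH.ι H x) (uo u t) - (uo ((UH.mod H).tw 0 u) (σ (H.pr 0 x) t) +
    uo ((UH.mod H).tw 1 u) (σ (H.pr 1 x) t)) = _
  have h0 : ∀ v : UH H U, uo v (0 : (SMod.otens (UH.mod H) Q).C U) = 0 := fun v =>
    map_zero (uoHom v)
  rw [hx.pr_eq, hx.pr_eq]
  rcases zmod2_cases p with rfl | rfl <;> simp [h0]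

theorem sstep_semi (σ : H.C U →+ Q.C U →+ (SMod.otens (UH.mod H) Q).C U) (hσ) :
    Semi (SMod.otens (UH.mod H) Q) (SMod.otens (UH.mod H) (SMod.otens (UH.mod H) Q))
      (sstep σ hσ) := fun r x hx f z => by
  induction z using uo_ind with
  | h u t =>
    rw [← smul_uo, sstep_uo σ hσ hx, sstep_uo σ hσ hx, smul_uo, uo_ι_smul hx, UH.tw_mul,
      UH.tw_oo, smul_uo, smul_sub]
  | hadd a b ha hb => rw [smul_add, map_add, ha, hb, map_add, smul_add]

theorem h_ind {R : H.C U → Prop} (hadd : ∀ a b, R a → R b → R (a + b))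
    (h : ∀ p m, H.Homog p m → R m) (m : H.C U) : R m := H.homog_ind hadd h m

theorem uo_zero (v : UH H U) : uo v (0 : Q.C U) = 0 := map_zero (uoHom v)

theorem zero_uo (y : Q.C U) : uo (0 : UH H U) y = 0 := by simpa using zsmul_uo 0 (0 : UH H U) y

theorem sstep_smul (σ : H.C U →+ Q.C U →+ (SMod.otens (UH.mod H) Q).C U) (hσ)
    (h : ∀ (f : S.O U) x t, σ (f • x) t = f • σ x t) (f : S.O U) (x : H.C U)
    (z : (SMod.otens (UH.mod H) Q).C U) : sstep σ hσ (f • x) z = f • sstep σ hσ x z := by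
  refine O_homog_ind (P := fun f => sstep σ hσ (f • x) z = f • sstep σ hσ x z)
    (fun a b ha hb => ?_) (fun q f hf => ?_) f
  · rw [add_smul, map_add, AddMonoidHom.add_apply, ha, hb, add_smul]
  · induction x using h_ind with
    | hadd a b ha hb =>
      rw [smul_add, map_add, map_add, AddMonoidHom.add_apply, ha, hb, AddMonoidHom.add_apply,
        smul_add]
    | h p x hx =>
      induction z using uo_ind with
      | h u t =>
        rw [sstep_uo σ hσ (SMod.Homog.smul hf hx), sstep_uo σ hσ hx, h, ← UH.oo_mul_ι, smul_uo,
          uo_smul hf, ← (UH.mod H).tw_add, ← add_assoc, CharTwo.add_self_eq_zero, zero_add, smul_sub]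
      | hadd a b ha hb => rw [map_add, ha, hb, map_add, smul_add]

theorem sstep_par (σ : H.C U →+ Q.C U →+ (SMod.otens (UH.mod H) Q).C U) (hσ)
    (h : ∀ x t, (SMod.otens (UH.mod H) Q).par U (σ x t) = σ (H.par U x) (Q.par U t)) (x : H.C U)
    (z : (SMod.otens (UH.mod H) Q).C U) :
    (SMod.otens (UH.mod H) (SMod.otens (UH.mod H) Q)).par U (sstep σ hσ x z) =
      sstep σ hσ (H.par U x) ((SMod.otens (UH.mod H) Q).par U z) := by
  induction x using h_ind with
  | hadd a b ha hb =>
    simp only [map_add, AddMonoidHom.add_apply, ha, hb]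
  | h p x hx =>
    induction z using uo_ind with
    | h u t =>
      rw [sstep_uo σ hσ hx, map_sub, par_uo, par_uo, par_uo, h, sstep_uo σ hσ hx.par, UH.par_ι]
      congr 2
      exact (UH.mod H).par_tw p u
    | hadd a b ha hb =>
      rw [map_add, map_add, ha, hb, map_add, map_add]

theorem sstep_res (k : V ≤ U) (σ : H.C U →+ Q.C U →+ (SMod.otens (UH.mod H) Q).C U) (hσ)
    (τ : H.C V →+ Q.C V →+ (SMod.otens (UH.mod H) Q).C V) (hτ)
    (h : ∀ x t, (SMod.otens (UH.mod H) Q).res k (σ x t) = τ (H.res k x) (Q.res k t)) (x : H.C U)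
    (z : (SMod.otens (UH.mod H) Q).C U) :
    (SMod.otens (UH.mod H) (SMod.otens (UH.mod H) Q)).res k (sstep σ hσ x z) =
      sstep τ hτ (H.res k x) ((SMod.otens (UH.mod H) Q).res k z) := by
  induction x using h_ind with
  | hadd a b ha hb =>
    simp only [map_add, AddMonoidHom.add_apply, ha, hb]
  | h p x hx =>
    induction z using uo_ind with
    | h u t =>
      rw [sstep_uo σ hσ hx, map_sub, res_uo, res_uo, res_uo, h, sstep_uo τ hτ (hx.res k), UH.res_ι]
      congr 2
      exact (UH.mod H).res_tw k p u
    | hadd a b ha hb =>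
      rw [map_add, map_add, ha, hb, map_add, map_add]

theorem tw_ι_homog (p : ZMod 2) {q : ZMod 2} {y : H.C U} (hy : H.Homog q y) :
    (UH.mod H).tw p (UH.ι H y) = sg (p * q) • UH.ι H y := by
  rw [UH.tw_ι, hy.tw, map_zsmul]

/-- The base case of the anticommutation of the insertion operators. -/
theorem sstep_anti_base (σ : H.C U →+ Q.C U →+ (SMod.otens (UH.mod H) Q).C U) (hσ)
    (h : ∀ x t, σ x t = uo (UH.ι H x) t) {p q : ZMod 2} {x y : H.C U} (hx : H.Homog p x)
    (hy : H.Homog q y) (t : Q.C U) :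
    sstep σ hσ x (σ y t) + sg (p * q) • sstep σ hσ y (σ x t) = 0 := by
  simp only [h]
  rw [sstep_uo σ hσ hx, sstep_uo σ hσ hy, tw_ι_homog p hy, tw_ι_homog q hx, h, h, zsmul_uo,
    zsmul_uo, smul_sub, smul_smul, mul_comm q p, sg_sq, one_smul]
  abel

/-- The anticommutation of the insertion operators. -/
theorem sstep_anti (σ : H.C U →+ Q.C U →+ (SMod.otens (UH.mod H) Q).C U) (hσ)
    {p q : ZMod 2} {x y : H.C U} (hx : H.Homog p x) (hy : H.Homog q y)
    (h : ∀ t, sstep σ hσ x (σ y t) + sg (p * q) • sstep σ hσ y (σ x t) = 0)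
    (z : (SMod.otens (UH.mod H) Q).C U) :
    sstep (sstep σ hσ) (sstep_semi σ hσ) x (sstep σ hσ y z) +
      sg (p * q) • sstep (sstep σ hσ) (sstep_semi σ hσ) y (sstep σ hσ x z) = 0 := by
  induction z using uo_ind with
  | h u t =>
    have e := congrArg (uo (H := H) ((UH.mod H).tw p ((UH.mod H).tw q u))) (h t)
    rw [uo_add, uo_zsmul, uo_zero] at e
    have e' : (UH.mod H).tw q ((UH.mod H).tw p u) = (UH.mod H).tw p ((UH.mod H).tw q u) := by
      rw [← (UH.mod H).tw_add, add_comm, (UH.mod H).tw_add]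
    have hσx := sstep_semi σ hσ
    rw [sstep_uo σ hσ hx, sstep_uo σ hσ hy, map_sub, map_sub, sstep_uo _ hσx hx, sstep_uo _ hσx hx,
      sstep_uo _ hσx hy, sstep_uo _ hσx hy, sstep_uo σ hσ hx, sstep_uo σ hσ hy, tw_ι_homog p hy,
      tw_ι_homog q hx, zsmul_uo, zsmul_uo, mul_comm q p, e']
    simp only [uo_sub, smul_sub, smul_smul, sg_sq, one_smul]
    rw [← e]
    abel
  | hadd a b ha hb =>
    simp only [map_add, smul_add]
    rw [add_add_add_comm, ha, hb, add_zero]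

/-- The inductive step in the definition of the adjoint action. -/
def astep {p : ZMod 2} {x : H.C U} (hx : H.Homog p x) (α : Q.C U →+ Q.C U)
    (hα : ∀ (f : S.O U) t, α (f • t) = S.tw p f • α t) :
    (SMod.otens (UH.mod H) Q).C U →+ (SMod.otens (UH.mod H) Q).C U :=
  uhead hx + utail p α hα

theorem astep_uo {p : ZMod 2} {x : H.C U} (hx : H.Homog p x) (α : Q.C U →+ Q.C U) (hα) (u : UH H U)
    (t : Q.C U) : astep hx α hα (uo u t) =
      uo (UH.ad H p x u) t + uo ((UH.mod H).tw p u) (α t) := rfl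

theorem astep_smul {p : ZMod 2} {x : H.C U} (hx : H.Homog p x) (α : Q.C U →+ Q.C U) (hα) (f : S.O U)
    (z : (SMod.otens (UH.mod H) Q).C U) : astep hx α hα (f • z) = S.tw p f • astep hx α hα z := by
  rw [astep, AddMonoidHom.add_apply, uhead_smul, utail_smul, AddMonoidHom.add_apply, smul_add]

theorem astep_sstep_base {p q : ZMod 2} {x y : H.C U} (hx : H.Homog p x) (hy : H.Homog q y)
    (hxy : H.br U x y = 0) (α : Q.C U →+ Q.C U) (hα) (t : Q.C U) :
    astep hx α hα (uo (UH.ι H y) t) = sg (p * q) • uo (UH.ι H y) (α t) := by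
  rw [astep_uo, UH.ad_ι H hx, hxy, map_zero, tw_ι_homog p hy, zsmul_uo, zero_uo, zero_add]

theorem astep_sstep {p q : ZMod 2} {x y : H.C U} (hx : H.Homog p x) (hy : H.Homog q y)
    (hxy : H.br U x y = 0) (α : Q.C U →+ Q.C U) (hα)
    (σ : H.C U →+ Q.C U →+ (SMod.otens (UH.mod H) Q).C U) (hσ)
    (h : ∀ t, astep hx α hα (σ y t) = sg (p * q) • σ y (α t))
    (z : (SMod.otens (UH.mod H) Q).C U) :
    astep hx (astep hx α hα) (astep_smul hx α hα) (sstep σ hσ y z) =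
      sg (p * q) • sstep σ hσ y (astep hx α hα z) := by
  induction z using uo_ind with
  | h u t =>
    have e' : (UH.mod H).tw q ((UH.mod H).tw p u) = (UH.mod H).tw p ((UH.mod H).tw q u) := by
      rw [← (UH.mod H).tw_add, add_comm, (UH.mod H).tw_add]
    rw [sstep_uo σ hσ hy, map_sub, astep_sstep_base hx hy hxy,
      astep_uo hx (astep hx α hα), h, UH.ad_tw hx, astep_uo, map_add, sstep_uo σ hσ hy, sstep_uo σ hσ hy, e', zsmul_uo, uo_zsmul, uo_add]
    simp only [smul_add, smul_sub]
    abel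
  | hadd a b ha hb => simp only [map_add, smul_add, ha, hb]

section homotopy

variable {D : Conn H}

theorem lact_mul (a b : UH H U) (z : (SMod.otens (UH.mod H) Q).C U) :
    lact (a * b) z = lact a (lact b z) := by
  induction z using uo_ind with
  | h c t => rw [lact_uo, lact_uo, lact_uo, mul_assoc]
  | hadd z w hz hw => simp only [map_add, hz, hw]

theorem Fobj_uact (N : FlatMod H D) (u : UH H U) (w : (Fobj N).C U) :
    (Fobj N).uact u w = lact u w := by
  revert w
  induction u using UH.ind with
  | hι x => exact fun w => FlatMod.uact_ι _ _ _
  | hadd a b ha hb => exact fun w => by rw [FlatMod.uact_add, ha, hb, lact_add]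
  | hmul a b ha hb => exact fun w => by rw [FlatMod.uact_mul, ha, hb, lact_mul]

theorem estep_uo {N : FlatMod H D} (d : Fobj N ⟶ N) (u : UH H U) (w : (Fobj N).C U) :
    SMod.ap (FlatMod.toHom (estep d)) U (uo u w) =
      lact u w - uo u (SMod.ap (FlatMod.toHom d) U w) := by
  change SMod.ap (FlatMod.toHom (ε (Fobj N)) - FlatMod.toHom (Fmap d)) U (uo u w) = _
  rw [SMod.ap_sub, ε_ot, Fobj_uact]
  rfl

theorem sstep_lact (σ : H.C U →+ Q.C U →+ (SMod.otens (UH.mod H) Q).C U) (hσ) {p : ZMod 2}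
    {x : H.C U} (hx : H.Homog p x) (u : UH H U) (z : (SMod.otens (UH.mod H) Q).C U) :
    sstep σ hσ x (lact u z) - lact ((UH.mod H).tw p u) (sstep σ hσ x z) =
      uo (UH.ι H x) (lact u z) - uo ((UH.mod H).tw p u * UH.ι H x) z := by
  induction z using uo_ind with
  | h v t =>
    rw [lact_uo, sstep_uo σ hσ hx, sstep_uo σ hσ hx, map_sub, lact_uo, lact_uo, UH.tw_mul]
    abel
  | hadd a b ha hb =>
    simp only [map_add, uo_add, add_sub_add_comm, ha, hb]

theorem homotopy_base {M : FlatMod H D} (σ : H.C U →+ M.C U →+ (Fobj M).C U) (hσ)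
    (h : ∀ x t, σ x t = uo (UH.ι H x) t) {p : ZMod 2} {x : H.C U} (hx : H.Homog p x)
    (hα) (z : (Fobj M).C U) :
    SMod.ap (FlatMod.toHom (estep (ε M))) U (sstep σ hσ x z) +
      σ x (SMod.ap (FlatMod.toHom (ε M)) U z) = astep hx (M.hact x) hα z := by
  induction z using uo_ind with
  | h u t =>
    rw [sstep_uo σ hσ hx, map_sub, estep_uo, estep_uo, ε_ot, h, h, ε_ot, FlatMod.uact_ι, lact_uo,
      lact_uo, astep_uo, UH.ad_apply, sub_uo]
    abel
  | hadd a b ha hb =>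
    simp only [map_add, ← ha, ← hb]; abel

theorem homotopy_step {N : FlatMod H D} (d : Fobj N ⟶ N) (σ : H.C U →+ N.C U →+ (Fobj N).C U) (hσ)
    {p : ZMod 2} {x : H.C U} (hx : H.Homog p x) (α : N.C U →+ N.C U) (hα)
    (h : ∀ z, SMod.ap (FlatMod.toHom (estep d)) U (sstep σ hσ x z) +
      σ x (SMod.ap (FlatMod.toHom d) U z) = astep hx α hα z) (z : (Fobj (Fobj N)).C U) :
    SMod.ap (FlatMod.toHom (estep (estep d))) U (sstep (sstep σ hσ) (sstep_semi σ hσ) x z) +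
      sstep σ hσ x (SMod.ap (FlatMod.toHom (estep d)) U z) =
        astep hx (astep hx α hα) (astep_smul hx α hα) z := by
  induction z using uo_ind with
  | h u t =>
    have e := congrArg (uo (H := H) ((UH.mod H).tw p u)) (h t)
    have e2 := sstep_lact σ hσ hx u t
    rw [sub_eq_iff_eq_add] at e2
    rw [uo_add] at e
    rw [sstep_uo (sstep σ hσ) (sstep_semi σ hσ) hx, map_sub, estep_uo, estep_uo, estep_uo, map_sub,
      sstep_uo σ hσ hx, lact_uo, e2, astep_uo hx (astep hx α hα), ← e, uo_sub, UH.ad_apply, sub_uo]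
    abel
  | hadd a b ha hb =>
    simp only [map_add, ← ha, ← hb]; abel

end homotopy

/-! ### The antisymmetrization map -/

variable {D : Conn H} (M : FlatMod H D)

/-- The insertion operators. -/
def ins (U : S.Aff) : ∀ n, {σ : H.C U →+ (pow M n).C U →+ (pow M (n + 1)).C U //
    Semi (pow M n).toSMod (pow M (n + 1)).toSMod σ}
  | 0 => ⟨AddMonoidHom.mk' (fun x => uoHom (Q := M.toSMod) (UH.ι H x)) fun x y =>
      AddMonoidHom.ext fun t => by rw [map_add]; exact add_uo (Q := M.toSMod) _ _ t,
      fun r x hx f t => uo_ι_smul (Q := M.toSMod) hx f t⟩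
  | n + 1 => ⟨sstep (Q := (pow M n).toSMod) (ins U n).1 (ins U n).2,
      sstep_semi (Q := (pow M n).toSMod) (ins U n).1 (ins U n).2⟩

theorem ins_succ (n : ℕ) {p : ZMod 2} {x : H.C U} (hx : H.Homog p x) (u : UH H U)
    (t : (pow M n).C U) : (ins M U (n + 1)).1 x (uo u t : (Fobj (pow M n)).C U) =
      uo (Q := (Fobj (pow M n)).toSMod) (UH.ι H x) (uo u t) -
        uo (Q := (Fobj (pow M n)).toSMod) ((UH.mod H).tw p u) ((ins M U n).1 x t) :=
  sstep_uo (Q := (pow M n).toSMod) _ (ins M U n).2 hx u t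

theorem ins_smul : ∀ n (f : S.O U) (x : H.C U) (t : (pow M n).C U),
    (ins M U n).1 (f • x) t = f • (ins M U n).1 x t
  | 0, f, x, t => by
    refine Eq.trans ?_ (smul_uo (Q := M.toSMod) f (UH.ι H x) t)
    rw [UH.oo_mul_ι]; rfl
  | n + 1, f, x, t => sstep_smul (Q := (pow M n).toSMod) _ (ins M U n).2 (ins_smul n) f x t

theorem ins_par : ∀ n (x : H.C U) (t : (pow M n).C U),
    (pow M (n + 1)).par U ((ins M U n).1 x t) = (ins M U n).1 (H.par U x) ((pow M n).par U t)
  | 0, x, t => (par_uo (Q := M.toSMod) (UH.ι H x) t).trans (by rw [UH.par_ι]; rfl)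
  | n + 1, x, t => sstep_par (Q := (pow M n).toSMod) _ (ins M U n).2 (ins_par n) x t

theorem ins_res (k : V ≤ U) : ∀ n (x : H.C U) (t : (pow M n).C U),
    (pow M (n + 1)).res k ((ins M U n).1 x t) = (ins M V n).1 (H.res k x) ((pow M n).res k t)
  | 0, x, t => (res_uo (Q := M.toSMod) k (UH.ι H x) t).trans (by rw [UH.res_ι]; rfl)
  | n + 1, x, t => sstep_res (Q := (pow M n).toSMod) k _ (ins M U n).2 _ (ins M V n).2
      (ins_res k n) x t

theorem ins_anti {p q : ZMod 2} {x y : H.C U} (hx : H.Homog p x) (hy : H.Homog q y) :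
    ∀ n (t : (pow M n).C U), (ins M U (n + 1)).1 x ((ins M U n).1 y t) +
      sg (p * q) • (ins M U (n + 1)).1 y ((ins M U n).1 x t) = 0
  | 0, t => sstep_anti_base (Q := M.toSMod) _ (ins M U 0).2 (fun _ _ => rfl) hx hy t
  | n + 1, t => sstep_anti (Q := (pow M n).toSMod) _ (ins M U n).2 hx hy (ins_anti hx hy n) t

theorem hact_semi {p : ZMod 2} {x : H.C U} (hx : H.Homog p x) (f : S.O U) (m : M.C U) :
    M.hact x (f • m) = S.tw p f • M.hact x m := by
  refine O_homog_ind (P := fun f => M.hact x (f • m) = S.tw p f • M.hact x m)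
    (fun a b ha hb => ?_) (fun q f hf => ?_) f
  · rw [add_smul, map_add, ha, hb, map_add, add_smul]
  · rw [M.smul_hact hf, hx.tw, map_zsmul, AddMonoidHom.smul_apply, hf.tw, smul_assoc, smul_comm f,
      mul_comm]

/-- The adjoint action on the bar resolution. -/
def adj {p : ZMod 2} {x : H.C U} (hx : H.Homog p x) : ∀ n, {α : (pow M n).C U →+ (pow M n).C U //
    ∀ (f : S.O U) t, α (f • t) = S.tw p f • α t}
  | 0 => ⟨M.hact x, hact_semi M hx⟩
  | n + 1 => ⟨astep (Q := (pow M n).toSMod) hx (adj hx n).1 (adj hx n).2,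
      astep_smul (Q := (pow M n).toSMod) hx (adj hx n).1 (adj hx n).2⟩

theorem adj_ins {p q : ZMod 2} {x y : H.C U} (hx : H.Homog p x) (hy : H.Homog q y)
    (hxy : H.br U x y = 0) : ∀ n (t : (pow M n).C U),
    (adj M hx (n + 1)).1 ((ins M U n).1 y t) = sg (p * q) • (ins M U n).1 y ((adj M hx n).1 t)
  | 0, t => astep_sstep_base (Q := M.toSMod) hx hy hxy _ (adj M hx 0).2 t
  | n + 1, t => astep_sstep (Q := (pow M n).toSMod) hx hy hxy _ (adj M hx n).2 _ (ins M U n).2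
      (adj_ins hx hy hxy n) t

theorem e_ins_zero (x : H.C U) (m : M.C U) :
    SMod.ap (FlatMod.toHom (e M 0)) U ((ins M U 0).1 x m) = M.hact x m :=
  (ε_ot M (UH.ι H x) m).trans (M.uact_ι x m)

theorem e_ins {p : ZMod 2} {x : H.C U} (hx : H.Homog p x) : ∀ n (z : (pow M (n + 1)).C U),
    SMod.ap (FlatMod.toHom (e M (n + 1))) U ((ins M U (n + 1)).1 x z) +
      (ins M U n).1 x (SMod.ap (FlatMod.toHom (e M n)) U z) = (adj M hx (n + 1)).1 z
  | 0, z => homotopy_base (M := M) _ (ins M U 0).2 (fun _ _ => rfl) hx (adj M hx 0).2 z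
  | n + 1, z => homotopy_step (N := pow M n) (e M n) _ (ins M U n).2 hx _ (adj M hx n).2
      (e_ins hx n) z

end Bar

/-! ### The comparison map -/

section chain

/-- Chain maps from their components. -/
def mkChainMap {𝒞 : Type*} [Category 𝒞] [Preadditive 𝒞] {C C' : ChainComplex 𝒞 ℕ}
    (f : ∀ n, C.X n ⟶ C'.X n) (h : ∀ n, f (n + 1) ≫ C'.d (n + 1) n = C.d (n + 1) n ≫ f n) :
    C ⟶ C' where
  f := f
  comm' := by
    rintro i j (rfl : j + 1 = i)
    exact h j

/-- A chain map is a quasi-isomorphism if it is one over every affine open. -/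
theorem isQis_of {C C' : ChainComplex (SMod S) ℕ} (f : C ⟶ C')
    (d : ∀ (U : S.Aff) n, (C.X (n + 1)).C U →+ (C.X n).C U)
    (d' : ∀ (U : S.Aff) n, (C'.X (n + 1)).C U →+ (C'.X n).C U)
    (hd : ∀ U n z, d U n z = SMod.ap (C.d (n + 1) n) U z)
    (hd' : ∀ U n z, d' U n z = SMod.ap (C'.d (n + 1) n) U z)
    (φ : ∀ U, Cpx.Hom ⟨fun n => (C.X n).C U, d U⟩ ⟨fun n => (C'.X n).C U, d' U⟩)
    (hφ : ∀ U n z, (φ U).f n z = SMod.ap (f.f n) U z) (h : ∀ U, (φ U).Qis) : IsQis f := by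
  have cyc : ∀ (C : ChainComplex (SMod S) ℕ) (U : S.Aff)
      (d : ∀ n, (C.X (n + 1)).C U →+ (C.X n).C U), (∀ n z, d n z = SMod.ap (C.d (n + 1) n) U z) →
      ∀ n (z : (C.X n).C U), (∀ j, SMod.ap (C.d n j) U z = 0) ↔
        Cpx.Cyc ⟨fun n => (C.X n).C U, d⟩ n z := by
    intro C U d hd n z
    cases n with
    | zero =>
      refine ⟨fun _ => trivial, fun _ j => ?_⟩
      rw [C.shape 0 j (by simp), SMod.ap_zero]
    | succ n =>
      refine ⟨fun h => (hd n z).trans (h n), fun h j => ?_⟩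
      by_cases hj : j = n
      · subst hj; exact (hd j z).symm.trans h
      · rw [C.shape (n + 1) j (by simpa using hj), SMod.ap_zero]
  refine fun n U => ⟨fun z hz ⟨w, hw⟩ s hs => ?_, fun z hz s hs => ?_⟩
  · obtain ⟨w', hw'⟩ := (h U n).1 z ((cyc C U (d U) (hd U) n z).1 hz)
      ⟨w, (hφ U n z).trans (hw.trans (hd' U n w).symm)⟩
    exact ⟨U, le_rfl, hs, w', by rw [SMod.res_id]; exact hw'.trans (hd U n w')⟩
  · obtain ⟨y, hy, w, hw⟩ := (h U n).2 z ((cyc C' U (d' U) (hd' U) n z).1 hz)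
    refine ⟨U, le_rfl, hs, y, (cyc C U (d U) (hd U) n y).2 hy, w, ?_⟩
    rw [SMod.res_id, ← hφ, ← hd']
    exact hw

end chain

namespace Bar

variable {H : PreHeis S} {D : Conn H} {U V : S.Aff} (M : FlatMod H D)

/-- The pure tensors of the bar resolution. -/
def bo (n : ℕ) (u : UH H U) : (pow M n).C U →+ (pow M (n + 1)).C U :=
  uoHom (Q := (pow M n).toSMod) u

theorem bo_ind {n : ℕ} {R : (pow M (n + 1)).C U → Prop} (h : ∀ u t, R (bo M n u t))
    (hadd : ∀ a b, R a → R b → R (a + b)) (z) : R z :=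
  uo_ind (Q := (pow M n).toSMod) (R := R) h hadd z

theorem bo_smul (n : ℕ) {q : ZMod 2} {f : S.O U} (hf : S.Homog q f) (u : UH H U)
    (t : (pow M n).C U) : bo M n u (f • t) = f • bo M n ((UH.mod H).tw q u) t :=
  uo_smul (Q := (pow M n).toSMod) hf u t

theorem par_bo (n : ℕ) (u : UH H U) (t : (pow M n).C U) :
    (pow M (n + 1)).par U (bo M n u t) = bo M n (UH.par H U u) ((pow M n).par U t) :=
  par_uo (Q := (pow M n).toSMod) u t

theorem res_bo (n : ℕ) (h : V ≤ U) (u : UH H U) (t : (pow M n).C U) :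
    (pow M (n + 1)).res h (bo M n u t) = bo M n (UH.res H h u) ((pow M n).res h t) :=
  res_uo (Q := (pow M n).toSMod) h u t

theorem uact_bo (n : ℕ) (u v : UH H U) (t : (pow M n).C U) :
    (pow M (n + 1)).uact u (bo M n v t) = bo M n (u * v) t :=
  (Fobj_uact (pow M n) u (uo v t)).trans (lact_uo (Q := (pow M n).toSMod) u v t)

theorem hact_bo (n : ℕ) (x : H.C U) (v : UH H U) (t : (pow M n).C U) :
    (pow M (n + 1)).hact x (bo M n v t) = bo M n (UH.ι H x * v) t := by
  rw [← FlatMod.uact_ι, uact_bo]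

theorem uact_one (N : FlatMod H D) (m : N.C U) : N.uact 1 m = m := by
  rw [← UH.ι_one, N.uact_ι, N.hact_one]

theorem e_zero_bo (u : UH H U) (m : M.C U) :
    SMod.ap (FlatMod.toHom (e M 0)) U (bo M 0 u m) = M.uact u m := ε_ot M u m

theorem e_bo (n : ℕ) (u : UH H U) (w : (pow M (n + 1)).C U) :
    SMod.ap (FlatMod.toHom (e M (n + 1))) U (bo M (n + 1) u w) =
      (pow M (n + 1)).uact u w - bo M n u (SMod.ap (FlatMod.toHom (e M n)) U w) :=
  (estep_uo (N := pow M n) (e M n) u w).trans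
    (congrArg (· - bo M n u (SMod.ap (FlatMod.toHom (e M n)) U w)) (Fobj_uact (pow M n) u w).symm)

theorem ins_bo (n : ℕ) {p : ZMod 2} {x : H.C U} (hx : H.Homog p x) (u : UH H U)
    (t : (pow M n).C U) : (ins M U (n + 1)).1 x (bo M n u t) =
      bo M (n + 1) (UH.ι H x) (bo M n u t) -
        bo M (n + 1) ((UH.mod H).tw p u) ((ins M U n).1 x t) := ins_succ M n hx u t

end Bar

section comparison

open Bar Kosz

variable {H : PreHeis S} {D : Conn H} {J : H.toSMod.Sub} {U V : S.Aff}

/-- The bar resolution as a target of maps from exterior powers. -/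
@[reducible] def insTow (J : H.toSMod.Sub) (M : FlatMod H D) (U : S.Aff) : Tow J.toSMod U 0 where
  Y n := (pow M n).C U
  o n := (ins M U n).1.comp (SMod.ap J.incl U)
  o_smul n f x y := (ins_smul M n f x.1 y).trans (by simp)
  smul_o n q f hf x y := by
    change (ins M U n).1 (SMod.ap J.incl U x) (f • y) =
      f • (ins M U n).1 (SMod.ap J.incl U (J.toSMod.tw q x)) y
    rw [SMod.ap_tw]
    generalize SMod.ap J.incl U x = z
    induction z using h_ind with
    | hadd a b ha hb => simp only [map_add, AddMonoidHom.add_apply, ha, hb, smul_add]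
    | h p z hz =>
      rw [(ins M U n).2 p z hz, hz.tw, hf.tw, map_zsmul, AddMonoidHom.smul_apply, smul_assoc,
        smul_comm f, mul_comm]
  anti n q r x y hx hy z := ins_anti M (SMod.ap_homog J.incl hx) (SMod.ap_homog J.incl hy) n z

variable (hJ : ∀ U, ∀ x ∈ J.C U, ∀ y ∈ J.C U, H.br U x y = 0) (M : FlatMod H D)

/-- The antisymmetrization map. -/
def aK (U : S.Aff) (n : ℕ) : (K (koszAct hJ M) n).C U →+ (pow M n).C U :=
  klift (koszAct hJ M) (insTow J M U) (AddMonoidHom.id _) (fun f m => by simp; rfl) n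

theorem aK_otk (n : ℕ) (x : J.toSMod.C U) (z : (K (koszAct hJ M) n).C U) :
    aK hJ M U (n + 1) (otk _ n x z) = (ins M U n).1 (SMod.ap J.incl U x) (aK hJ M U n z) :=
  klift_otk _ _ _ _ n x z

theorem aK_smul (n : ℕ) (f : S.O U) (z : (K (koszAct hJ M) n).C U) :
    aK hJ M U n (f • z) = f • aK hJ M U n z :=
  (klift_smul _ _ _ _ n f z).trans (by simp; rfl)

theorem aK_par : ∀ n (z : (K (koszAct hJ M) n).C U),
    aK hJ M U n ((K (koszAct hJ M) n).par U z) = (pow M n).par U (aK hJ M U n z)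
  | 0, z => by
    obtain ⟨m, rfl⟩ := kz_surj _ z
    rfl
  | n + 1, z => by
    induction z using k_ind with
    | h x z => rw [par_otk, aK_otk, aK_otk, ins_par, aK_par n, SMod.ap_par]
    | hadd a b ha hb => simp only [map_add, ha, hb]

theorem aK_res (k : V ≤ U) : ∀ n (z : (K (koszAct hJ M) n).C U),
    aK hJ M V n ((K (koszAct hJ M) n).res k z) = (pow M n).res k (aK hJ M U n z)
  | 0, z => by
    obtain ⟨m, rfl⟩ := kz_surj _ z
    rfl
  | n + 1, z => by
    induction z using k_ind with
    | h x z => rw [res_otk, aK_otk, aK_otk, ins_res, aK_res k n, SMod.ap_res]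
    | hadd a b ha hb => simp only [map_add, ha, hb]

theorem aK_kact {p : ZMod 2} {x : J.toSMod.C U} (hx : H.Homog p (SMod.ap J.incl U x)) :
    ∀ n (z : (K (koszAct hJ M) n).C U),
    (adj M hx n).1 (aK hJ M U n z) = aK hJ M U n (kact _ n x z)
  | 0, z => by
    obtain ⟨m, rfl⟩ := kz_surj _ z
    rfl
  | n + 1, z => by
    have hx' : J.toSMod.Homog p x := Subtype.ext hx
    induction z using k_ind with
    | h y z =>
      refine J.toSMod.homog_ind (P := fun y => (adj M hx (n + 1)).1 (aK hJ M U (n + 1) (otk _ n y z)) =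
        aK hJ M U (n + 1) (kact _ (n + 1) x (otk _ n y z))) (fun a b ha hb => ?_)
        (fun q y hy => ?_) y
      · simp only [map_add, AddMonoidHom.add_apply, ha, hb]
      · rw [kact_otk _ n hx', aK_otk, aK_otk,
          adj_ins M hx (SMod.ap_homog J.incl hy) (hJ U _ x.2 _ y.2), hy.tw, aK_kact hx n,
          map_zsmul, map_zsmul, AddMonoidHom.smul_apply]
    | hadd a b ha hb => simp only [map_add, ha, hb]

theorem e_aK : ∀ n (z : (K (koszAct hJ M) (n + 1)).C U),
    SMod.ap (FlatMod.toHom (e M n)) U (aK hJ M U (n + 1) z) =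
      -aK hJ M U n (SMod.ap (kd _ n) U z)
  | 0, z => by
    induction z using k_ind with
    | h x z =>
      obtain ⟨m, rfl⟩ := kz_surj _ z
      rw [aK_otk, kd_zero, map_neg, neg_neg]
      exact e_ins_zero M (SMod.ap J.incl U x) m
    | hadd a b ha hb => simp only [map_add, ha, hb, neg_add]
  | n + 1, z => by
    induction z using k_ind with
    | h x z =>
      refine J.toSMod.homog_ind (P := fun x => SMod.ap (FlatMod.toHom (e M (n + 1))) U
        (aK hJ M U (n + 2) (otk _ (n + 1) x z)) = -aK hJ M U (n + 1)
          (SMod.ap (kd _ (n + 1)) U (otk _ (n + 1) x z))) (fun a b ha hb => ?_)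
        (fun q x hx => ?_) x
      · simp only [map_add, AddMonoidHom.add_apply, ha, hb, neg_add]
      · have hx' : H.Homog q (SMod.ap J.incl U x) := SMod.ap_homog J.incl hx
        have h1 := e_ins M hx' n (aK hJ M U (n + 1) z)
        rw [e_aK n z, aK_kact, map_neg, ← sub_eq_add_neg, sub_eq_iff_eq_add] at h1
        rw [aK_otk, h1, kd_succ, map_sub, map_neg, aK_otk]
        abel
    | hadd a b ha hb => simp only [map_add, ha, hb, neg_add]

theorem ct_aK : ∀ n (z : (K (koszAct hJ M) (n + 1)).C U),
    ct J (pow M (n + 1)) (Mr.mk J 1) (aK hJ M U (n + 1) z) = 0 := by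
  have key : ∀ n (z : (K (koszAct hJ M) (n + 1)).C U), aK hJ M U (n + 1) z ∈
      AddSubgroup.closure {w | ∃ (j : H.C U) (_ : j ∈ J.C U) (t : (pow M n).C U),
        w = bo M n (UH.ι H j) t} := by
    intro n
    induction n with
    | zero =>
      intro z
      induction z using k_ind with
      | h x z => rw [aK_otk]; exact AddSubgroup.subset_closure ⟨x.1, x.2, _, rfl⟩
      | hadd a b ha hb => rw [map_add]; exact add_mem ha hb
    | succ n ih =>
      intro z
      induction z using k_ind with
      | h x z =>
        rw [aK_otk]
        have hz := ih z
        generalize aK hJ M U (n + 1) z = w at hz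
        induction hz using AddSubgroup.closure_induction with
        | mem w hw =>
          obtain ⟨j, hj, t, rfl⟩ := hw
          have : ∀ y : J.toSMod.C U, (ins M U (n + 1)).1 (SMod.ap J.incl U y) (bo M n (UH.ι H j) t) ∈
            AddSubgroup.closure {w | ∃ (j : H.C U) (_ : j ∈ J.C U) (t : (pow M (n + 1)).C U),
              w = bo M (n + 1) (UH.ι H j) t} := fun y => by
            induction y using J.toSMod.homog_ind with
            | hadd a b ha hb =>
              rw [map_add, map_add, AddMonoidHom.add_apply]; exact add_mem ha hb
            | h p y hy =>
              rw [ins_bo M n (SMod.ap_homog J.incl hy)]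
              refine sub_mem (AddSubgroup.subset_closure ⟨y.1, y.2, _, rfl⟩) ?_
              rw [UH.tw_ι]
              exact AddSubgroup.subset_closure ⟨_, J.tw_mem p hj, _, rfl⟩
          exact this x
        | zero => rw [map_zero]; exact zero_mem _
        | add a b _ _ ha hb => rw [map_add]; exact add_mem ha hb
        | neg a _ ha => rw [map_neg]; exact neg_mem ha
      | hadd a b ha hb => rw [map_add]; exact add_mem ha hb
  intro n z
  have hz := key n z
  generalize aK hJ M U (n + 1) z = w at hz
  induction hz using AddSubgroup.closure_induction with
  | mem w hw =>
    obtain ⟨j, hj, t, rfl⟩ := hw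
    have e1 := hact_bo M n j 1 t
    rw [mul_one] at e1
    rw [← e1, ← ct_bal, Mr.rmul_mk, one_mul, ← mul_one (UH.ι H j), Mr.mk_J hj]
    simpa using zsmul_ct 0 (0 : (Mr H J).C U) (bo M n 1 t)
  | zero => simpa using ct_zsmul 0 (Mr.mk J 1) (0 : (pow M (n + 1)).C U)
  | add a b _ _ ha hb => rw [ct_add, ha, hb, add_zero]
  | neg a _ ha =>
    have := ct_zsmul (-1) (Mr.mk J 1) a
    rwa [ha, smul_zero, neg_one_zsmul] at this

/-- The coinvariants of the bar resolution over an affine open. -/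
@[reducible] def barSec (J : H.toSMod.Sub) (M : FlatMod H D) (U : S.Aff) : Cpx where
  X n := ((coinv J).obj (pow M (n + 1))).C U
  d n := cmap J (e M (n + 1)) U

/-- The comparison map over an affine open. -/
def compAp (U : S.Aff) (n : ℕ) :
    (K (koszAct hJ M) n).C U →+ ((coinv J).obj (pow M (n + 1))).C U :=
  AddMonoidHom.mk' (fun z => ct J (pow M (n + 1)) (Mr.mk J 1) (bo M n 1 (aK hJ M U n z)))
    fun a b => by rw [map_add, map_add, ct_add]

theorem compAp_apply (n : ℕ) (z : (K (koszAct hJ M) n).C U) : compAp hJ M U n z =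
    ct J (pow M (n + 1)) (Mr.mk J 1) (bo M n 1 (aK hJ M U n z)) := rfl

theorem ct_sub {N : FlatMod H D} (m : (Mr H J).C U) (n n' : N.C U) :
    ct J N m (n - n') = ct J N m n - ct J N m n' :=
  map_sub (AddMonoidHom.mk' (fun n => ct J N m n) (ct_add m)) n n'

theorem ct_neg {N : FlatMod H D} (m : (Mr H J).C U) (n : N.C U) :
    ct J N m (-n) = -ct J N m n :=
  map_neg (AddMonoidHom.mk' (fun n => ct J N m n) (ct_add m)) n

theorem compAp_comm (n : ℕ) (z : (K (koszAct hJ M) (n + 1)).C U) :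
    compAp hJ M U n (SMod.ap (kd _ n) U z) = cmap J (e M (n + 1)) U (compAp hJ M U (n + 1) z) := by
  rw [compAp_apply, compAp_apply, cmap_ct, e_bo, uact_one, e_aK, ct_sub, ct_aK, zero_sub, map_neg,
    ct_neg, neg_neg]

/-- The comparison map of complexes over an affine open. -/
@[reducible] def compSec (U : S.Aff) : Cpx.Hom (sec (koszAct hJ M) U) (barSec J M U) :=
  ⟨compAp hJ M U, compAp_comm hJ M⟩

theorem tw_one_UH (q : ZMod 2) : (UH.mod H).tw q (1 : UH H U) = 1 := by
  rcases zmod2_cases q with rfl | rfl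
  · simp
  · change twist _ 1 _ = _
    rw [twist_one]
    exact map_one (UH.par H U)

/-- The components of the comparison map. -/
def compHom (n : ℕ) : K (koszAct hJ M) n ⟶ ((coinv J).obj (pow M (n + 1))).toSMod :=
  ⟨fun U => compAp hJ M U n, by
    refine ⟨fun U f z => ?_, fun U z => ?_, fun U V h z => ?_⟩
    · rw [compAp_apply, compAp_apply, aK_smul]
      refine O_homog_ind (P := fun f => ct J (pow M (n + 1)) (Mr.mk J 1)
        (bo M n 1 (f • aK hJ M U n z)) = f • ct J (pow M (n + 1)) (Mr.mk J 1)
        (bo M n 1 (aK hJ M U n z))) (fun a b ha hb => ?_) (fun q f hf => ?_) f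
      · rw [add_smul, map_add, ct_add, ha, hb, add_smul]
      · rw [bo_smul M n hf, tw_one_UH, ct_smul hf, Mr.mk_tw, tw_one_UH]
    · rw [compAp_apply, compAp_apply, aK_par]
      have e := par_bo M n 1 (aK hJ M U n z)
      rw [map_one] at e
      rw [← e]
      refine Eq.trans ?_ (congrArg (SMod.ap (SMod.proj _ (cRel J (pow M (n + 1)))) U)
        (SMod.par_zt (Mr.mk J 1) (bo M n 1 (aK hJ M U n z)))).symm
      rw [Mr.mk_par, map_one]; rfl
    · rw [compAp_apply, compAp_apply, aK_res]
      have e := res_bo M n h 1 (aK hJ M U n z)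
      rw [map_one] at e
      rw [← e, res_ct, Mr.mk_res, map_one]⟩

theorem barCx_d (J : H.toSMod.Sub) (M : FlatMod H D) (n : ℕ) :
    (barCx J M).d (n + 1) n = (coinv J).map (e M (n + 1)) := by
  unfold barCx
  simp only [ChainComplex.of, ChainComplex.of_d]

theorem und_d (n : ℕ) : ((und H D J).obj (barCx J M)).d (n + 1) n =
    AMod.forget.map ((coinv J).map (e M (n + 1))) :=
  congrArg AMod.forget.map (barCx_d J M n)

theorem cx_d {P N : SMod S} (A : Act P N) (n : ℕ) : (Kosz.cx A).d (n + 1) n = kd A n :=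
  ChainComplex.of_d _ _ _

/-- The comparison between the Koszul complex and the coinvariants of the bar resolution. -/
def comp : Kosz.cx (koszAct hJ M) ⟶ (und H D J).obj (barCx J M) :=
  mkChainMap (fun n => compHom hJ M n) fun n => by
    rw [und_d, cx_d]
    exact SMod.hom_ext fun U z => (compAp_comm hJ M n z).symm

theorem comp_isComparison : IsComparison hJ M (comp hJ M) :=
  ⟨fun n U => (ins M U n).1.comp (SMod.ap J.incl U),
    fun n U => (aK hJ M U n).comp (SMod.ap (kp (koszAct hJ M) n) U),
    fun U x m => rfl, fun n U p x hx u t => ins_succ M n (SMod.ap_homog J.incl hx) u t,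
    fun U m => rfl, fun n U x t => aK_otk hJ M n x (SMod.ap (kp _ n) U t), fun n U t => rfl⟩

theorem comp_isQis (h : ∀ U, (compSec hJ M U).Qis) : IsQis (comp hJ M) :=
  isQis_of _ (fun U n => SMod.ap (kd _ n) U) (fun U n => cmap J (e M (n + 1)) U)
    (fun U n z => by rw [cx_d]) (fun U n z => by rw [und_d]; rfl)
    (fun U => compSec hJ M U) (fun U n z => rfl) h

end comparison

/-! ### Functoriality in the Heisenberg algebra -/

namespace SMod

variable {P P' Q Q' : SMod S} {U : S.Aff}

/-- The map `f ⊗ g` over an affine open. -/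
def otAp (f : P ⟶ P') (g : Q ⟶ Q') (U : S.Aff) : (otens P Q).C U →+ (otens P' Q').C U :=
  olift (AddMonoidHom.mk' (fun x => AddMonoidHom.mk' (fun y => ot (ap f U x) (ap g U y))
      fun y y' => by rw [map_add, ot_add])
      fun x x' => AddMonoidHom.ext fun y => by
        simp only [AddMonoidHom.mk'_apply, AddMonoidHom.add_apply, map_add, add_ot])
      fun q a b ha x y => by
        simp only [AddMonoidHom.mk'_apply]
        rw [ap_smul, ap_smul, ap_smul, ap_smul, ap_tw, smul_ot, smul_ot, smul_ot, ot_smul ha]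

theorem otAp_ot (f : P ⟶ P') (g : Q ⟶ Q') (x : P.C U) (y : Q.C U) :
    otAp f g U (ot x y) = ot (ap f U x) (ap g U y) := rfl

/-- The functoriality of the tensor product. -/
def otHom (f : P ⟶ P') (g : Q ⟶ Q') : otens P Q ⟶ otens P' Q' :=
  ⟨otAp f g, by
    refine ⟨fun U a z => ?_, fun U z => ?_, fun U V h z => ?_⟩
    · induction z using ot_ind with
      | h x y => rw [← smul_ot, otAp_ot, otAp_ot, ap_smul, smul_ot]
      | hadd a b ha hb => rw [smul_add, map_add, ha, hb, map_add, smul_add]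
    · induction z using ot_ind with
      | h x y => rw [par_ot, otAp_ot, otAp_ot, ap_par, ap_par, par_ot]
      | hadd a b ha hb => rw [map_add, map_add, ha, hb, map_add, map_add]
    · induction z using ot_ind with
      | h x y => rw [res_ot, otAp_ot, otAp_ot, ap_res, ap_res, res_ot]
      | hadd a b ha hb => rw [map_add, map_add, ha, hb, map_add, map_add]⟩

end SMod

/-- Morphisms of Heisenberg algebras with connections. -/
structure HHom {H H' : PreHeis S} (D : Conn H) (D' : Conn H') where
  φ : H.toSMod ⟶ H'.toSMod
  one : ∀ U, SMod.ap φ U (H.one U) = H'.one U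
  br : ∀ U x y, SMod.ap φ U (H.br U x y) = H'.br U (SMod.ap φ U x) (SMod.ap φ U y)
  nab : ∀ {U : S.Aff} {p : ZMod 2} (v : VF S U p) (x : H.C U),
    SMod.ap φ U (D.nab v x) = D'.nab v (SMod.ap φ U x)

namespace HHom

variable {H H' : PreHeis S} {D : Conn H} {D' : Conn H'} (F : HHom D D') {U V : S.Aff}

/-- The identity. -/
def id (D : Conn H) : HHom D D := ⟨𝟙 _, fun _ => rfl, fun _ _ _ => rfl, fun _ _ => rfl⟩

/-- The homomorphism of enveloping algebras. -/
def uh (U : S.Aff) : UH H U →+* UH H' U :=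
  UH.lift H ((UH.ι H').comp (SMod.ap F.φ U))
    (by rw [AddMonoidHom.comp_apply, F.one, UH.ι_one])
    (fun f x => by
      simp only [AddMonoidHom.comp_apply]
      rw [SMod.ap_smul, SMod.ap_smul, F.one, UH.ι_smul_one_mul])
    (fun p q x y hx hy => by
      simp only [AddMonoidHom.comp_apply]
      rw [F.br, UH.ι_comm H' (SMod.ap_homog F.φ hx) (SMod.ap_homog F.φ hy)])

theorem uh_ι (x : H.C U) : F.uh U (UH.ι H x) = UH.ι H' (SMod.ap F.φ U x) := by
  rw [uh, UH.lift_ι]; rfl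

theorem uh_oo (f : S.O U) : F.uh U (UH.oo H U f) = UH.oo H' U f := by
  rw [UH.oo_apply, uh_ι, SMod.ap_smul, F.one, UH.oo_apply]

theorem uh_par (a : UH H U) : F.uh U (UH.par H U a) = UH.par H' U (F.uh U a) := by
  induction a using UH.ind with
  | hι x => rw [UH.par_ι, uh_ι, uh_ι, UH.par_ι, SMod.ap_par]
  | hadd a b ha hb => simp only [map_add, ha, hb]
  | hmul a b ha hb => simp only [map_mul, ha, hb]

theorem uh_res (h : V ≤ U) (a : UH H U) : F.uh V (UH.res H h a) = UH.res H' h (F.uh U a) := by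
  induction a using UH.ind with
  | hι x => rw [UH.res_ι, uh_ι, uh_ι, UH.res_ι, SMod.ap_res]
  | hadd a b ha hb => simp only [map_add, ha, hb]
  | hmul a b ha hb => simp only [map_mul, ha, hb]

/-- The homomorphism of enveloping algebras, as a morphism of supermodules. -/
def uhHom : UH.mod H ⟶ UH.mod H' :=
  ⟨fun U => (F.uh U).toAddMonoidHom, fun U f a => by
      change F.uh U (UH.oo H U f * a) = UH.oo H' U f * F.uh U a
      rw [map_mul, uh_oo], fun U a => F.uh_par a, fun U V h a => F.uh_res h a⟩

theorem uh_tw (p : ZMod 2) (a : UH H U) :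
    F.uh U ((UH.mod H).tw p a) = (UH.mod H').tw p (F.uh U a) := SMod.ap_tw F.uhHom p a

theorem uh_del {p : ZMod 2} (v : VF S U p) (a : UH H U) :
    F.uh U (UH.del D v a) = UH.del D' v (F.uh U a) := by
  induction a using UH.ind with
  | hι x => rw [UH.del_ι, uh_ι, uh_ι, UH.del_ι, F.nab]
  | hadd a b ha hb => simp only [map_add, ha, hb]
  | hmul a b ha hb => rw [UH.del_mul, map_add, map_mul, map_mul, map_mul, UH.del_mul, ha, hb, uh_tw]

theorem uh_id (a : UH H U) : (id D).uh U a = a := by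
  induction a using UH.ind with
  | hι x => rw [uh_ι]; rfl
  | hadd a b ha hb => simp only [map_add, ha, hb]
  | hmul a b ha hb => simp only [map_mul, ha, hb]

end HHom

/-- Morphisms of modules over a morphism of Heisenberg algebras. -/
structure ModHom {H H' : PreHeis S} {D : Conn H} {D' : Conn H'} (F : HHom D D') (M : FlatMod H D)
    (M' : FlatMod H' D') where
  g : M.toSMod ⟶ M'.toSMod
  hact : ∀ {U : S.Aff} (x : H.C U) (m : M.C U),
    SMod.ap g U (M.hact x m) = M'.hact (SMod.ap F.φ U x) (SMod.ap g U m)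
  conn : ∀ {U : S.Aff} {p : ZMod 2} (v : VF S U p) (m : M.C U),
    SMod.ap g U (M.conn v m) = M'.conn v (SMod.ap g U m)

namespace ModHom

open Bar

variable {H H' : PreHeis S} {D : Conn H} {D' : Conn H'} {F : HHom D D'} {M : FlatMod H D}
  {M' : FlatMod H' D'} (G : ModHom F M M') {U V : S.Aff}

/-- Morphisms of flat modules. -/
def ofHom {M N : FlatMod H D} (f : M ⟶ N) : ModHom (HHom.id D) M N :=
  ⟨FlatMod.toHom f, FlatMod.toHom_hact f, FlatMod.toHom_conn f⟩

theorem uact (u : UH H U) (m : M.C U) :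
    SMod.ap G.g U (M.uact u m) = M'.uact (F.uh U u) (SMod.ap G.g U m) := by
  revert m
  induction u using UH.ind with
  | hι x => exact fun m => by rw [F.uh_ι, FlatMod.uact_ι, FlatMod.uact_ι, G.hact]
  | hadd a b ha hb =>
    exact fun m => by rw [map_add, FlatMod.uact_add, map_add, ha, hb, FlatMod.uact_add]
  | hmul a b ha hb =>
    exact fun m => by rw [map_mul, FlatMod.uact_mul, ha, hb, FlatMod.uact_mul]

/-- The map `U(H) ⊗ M → U(H') ⊗ M'`. -/
def fHom : (Fobj M).toSMod ⟶ (Fobj M').toSMod := SMod.otHom F.uhHom G.g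

theorem fHom_uo (u : UH H U) (m : M.C U) :
    SMod.ap G.fHom U (uo u m) = uo (F.uh U u) (SMod.ap G.g U m) := rfl

/-- The map `U(H) ⊗ M → U(H') ⊗ M'` as a morphism of modules. -/
def free : ModHom F (Fobj M) (Fobj M') where
  g := G.fHom
  hact x z := by
    change SMod.ap G.fHom _ (lact (UH.ι H x) z) = lact (UH.ι H' _) (SMod.ap G.fHom _ z)
    induction z using uo_ind with
    | h a m => rw [lact_uo, fHom_uo, fHom_uo, lact_uo, map_mul, F.uh_ι]
    | hadd a b ha hb => simp only [map_add, ha, hb]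
  conn v z := by
    induction z using uo_ind with
    | h a m =>
      rw [Fobj_conn_uo, map_add, fHom_uo, fHom_uo, fHom_uo, Fobj_conn_uo, G.conn, F.uh_del, F.uh_tw]
    | hadd a b ha hb => simp only [map_add, ha, hb]

/-- The maps of bar resolutions. -/
def pw : ∀ n, ModHom F (pow M n) (pow M' n)
  | 0 => G
  | n + 1 => (pw n).free

theorem pw_bo (n : ℕ) (u : UH H U) (t : (pow M n).C U) :
    SMod.ap (G.pw (n + 1)).g U (bo M n u t) = bo M' n (F.uh U u) (SMod.ap (G.pw n).g U t) := rfl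

theorem pw_e : ∀ n (z : (pow M (n + 1)).C U),
    SMod.ap (G.pw n).g U (SMod.ap (FlatMod.toHom (e M n)) U z) =
      SMod.ap (FlatMod.toHom (e M' n)) U (SMod.ap (G.pw (n + 1)).g U z)
  | 0, z => by
    induction z using bo_ind with
    | h u t =>
      rw [pw_bo]
      exact ((congrArg (SMod.ap G.g U) (e_zero_bo M u t)).trans (G.uact u t)).trans
        (e_zero_bo M' _ _).symm
    | hadd a b ha hb => simp only [map_add, ha, hb]
  | n + 1, z => by
    induction z using bo_ind with
    | h u t => rw [pw_bo, e_bo, e_bo, map_sub, (G.pw (n + 1)).uact, pw_bo, pw_e n]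
    | hadd a b ha hb => simp only [map_add, ha, hb]

theorem pw_ins : ∀ n (x : H.C U) (t : (pow M n).C U),
    SMod.ap (G.pw (n + 1)).g U ((ins M U n).1 x t) =
      (ins M' U n).1 (SMod.ap F.φ U x) (SMod.ap (G.pw n).g U t)
  | 0, x, t => by
    refine (G.pw_bo 0 (UH.ι H x) t).trans ?_
    rw [F.uh_ι]; rfl
  | n + 1, x, t => by
    induction x using h_ind with
    | hadd a b ha hb => simp only [map_add, AddMonoidHom.add_apply, ha, hb]
    | h p x hx =>
      induction t using bo_ind with
      | h u t =>
        rw [ins_bo M n hx, pw_bo, ins_bo M' n (SMod.ap_homog F.φ hx), map_sub, pw_bo, pw_bo, pw_bo,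
          F.uh_ι, F.uh_tw, pw_ins n]
      | hadd a b ha hb => simp only [map_add, ha, hb]

end ModHom

section Mr

variable {H H' : PreHeis S} {D : Conn H} {D' : Conn H'} (F : HHom D D') {J : H.toSMod.Sub}
  {J' : H'.toSMod.Sub} (hF : ∀ U, ∀ x ∈ J.C U, SMod.ap F.φ U x ∈ J'.C U) {U V : S.Aff}

include hF in
theorem uh_rIdeal (U : S.Aff) : ∀ a ∈ (rIdeal H J).C U, F.uh U a ∈ (rIdeal H' J').C U := by
  intro a ha
  refine Submodule.span_induction (p := fun a _ => F.uh U a ∈ (rIdeal H' J').C U) ?_ ?_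
    (fun a b _ _ ha hb => ?_) (fun f a _ ha => ?_) ha
  · rintro _ ⟨j, hj, u, rfl⟩
    exact Submodule.subset_span ⟨_, hF U j hj, F.uh U u, by rw [map_mul, F.uh_ι]⟩
  · rw [map_zero]; exact zero_mem _
  · rw [map_add]; exact add_mem ha hb
  · exact (SMod.ap_smul F.uhHom f a).symm ▸ Submodule.smul_mem _ f ha

/-- The map `M^r(J) → M^r(J')`. -/
def mrHom : Mr H J ⟶ Mr H' J' :=
  SMod.desc (rIdeal H J) (F.uhHom ≫ SMod.proj _ (rIdeal H' J')) fun U a ha =>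
    SMod.proj_zero (rIdeal H' J') (uh_rIdeal F hF U a ha)

theorem mrHom_mk (a : UH H U) : SMod.ap (mrHom F hF) U (Mr.mk J a) = Mr.mk J' (F.uh U a) := rfl

theorem mrHom_rmul (u : UH H U) (m : (Mr H J).C U) :
    SMod.ap (mrHom F hF) U (Mr.rmul u m) = Mr.rmul (F.uh U u) (SMod.ap (mrHom F hF) U m) := by
  obtain ⟨a, rfl⟩ := Mr.mk_surj m
  rw [Mr.rmul_mk, mrHom_mk, mrHom_mk, Mr.rmul_mk, map_mul]

/-- The map of coinvariants over an affine open. -/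
def cAp {N : FlatMod H D} {N' : FlatMod H' D'} (G : ModHom F N N') (U : S.Aff) :
    (Cobj J N).C U →+ (Cobj J' N').C U :=
  SMod.qop (N := cRel J N) (N' := cRel J' N')
    (SMod.zmap (SMod.ap (mrHom F hF) U) (SMod.ap G.g U)) fun z hz => by
      refine Submodule.span_induction (p := fun z _ => SMod.zmap (SMod.ap (mrHom F hF) U)
        (SMod.ap G.g U) z ∈ (cRel J' N').C U) ?_ ?_ (fun a b _ _ ha hb => ?_) (fun f a _ ha => ?_) hz
      · rintro _ ⟨x, m, n, rfl⟩
        refine Submodule.subset_span ⟨SMod.ap F.φ U x, SMod.ap (mrHom F hF) U m, SMod.ap G.g U n, ?_⟩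
        rw [map_sub, SMod.zmap_zt, SMod.zmap_zt, mrHom_rmul, F.uh_ι, G.hact]
      · rw [map_zero]; exact zero_mem _
      · rw [map_add]; exact add_mem ha hb
      · have : ∀ z, SMod.zmap (SMod.ap (mrHom F hF) U) (SMod.ap G.g U) (f • z) =
          f • SMod.zmap (SMod.ap (mrHom F hF) U) (SMod.ap G.g U) z := fun z => by
          induction z using SMod.zt_ind with
          | h0 => simp
          | h x y => rw [← SMod.smul_zt, SMod.zmap_zt, SMod.zmap_zt, SMod.ap_smul, SMod.smul_zt]
          | hadd a b ha hb => rw [smul_add, map_add, ha, hb, map_add, smul_add]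
        rw [this]
        exact Submodule.smul_mem _ f ha

theorem cAp_ct {N : FlatMod H D} {N' : FlatMod H' D'} (G : ModHom F N N') (m : (Mr H J).C U)
    (n : N.C U) : cAp F hF G U (ct J N m n) =
      ct J' N' (SMod.ap (mrHom F hF) U m) (SMod.ap G.g U n) := rfl

theorem par_ct {N : FlatMod H D} (m : (Mr H J).C U) (n : N.C U) :
    (Cobj J N).par U (ct J N m n) = ct J N ((Mr H J).par U m) (N.par U n) :=
  congrArg (SMod.ap (SMod.proj _ (cRel J N)) U) (SMod.par_zt m n)

/-- The map of coinvariants. -/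
def cHom {N : FlatMod H D} {N' : FlatMod H' D'} (G : ModHom F N N') :
    (Cobj J N).toSMod ⟶ (Cobj J' N').toSMod :=
  ⟨fun U => cAp F hF G U, by
    refine ⟨fun U a z => ?_, fun U z => ?_, fun U V h z => ?_⟩
    · induction z using ct_ind with
      | h x y => rw [← smul_ct, cAp_ct, cAp_ct, SMod.ap_smul, smul_ct]
      | hadd a b ha hb => rw [smul_add, map_add, ha, hb, map_add, smul_add]
    · induction z using ct_ind with
      | h x y => rw [par_ct, cAp_ct, cAp_ct, SMod.ap_par, SMod.ap_par, par_ct]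
      | hadd a b ha hb => rw [map_add, map_add, ha, hb, map_add, map_add]
    · induction z using ct_ind with
      | h x y => rw [res_ct, cAp_ct, cAp_ct, SMod.ap_res, SMod.ap_res, res_ct]
      | hadd a b ha hb => rw [map_add, map_add, ha, hb, map_add, map_add]⟩

variable {F} {M : FlatMod H D} {M' : FlatMod H' D'} (G : ModHom F M M')

open Bar Kosz

theorem cAp_comm (n : ℕ) (z : (Cobj J (pow M (n + 2))).C U) :
    cAp F hF (G.pw (n + 1)) U (cmap J (e M (n + 1)) U z) =
      cmap J' (e M' (n + 1)) U (cAp F hF (G.pw (n + 2)) U z) := by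
  induction z using ct_ind with
  | h m t => rw [cmap_ct, cAp_ct, cAp_ct, cmap_ct, G.pw_e]
  | hadd a b ha hb => simp only [map_add, ha, hb]

/-- The map of coinvariants of bar resolutions over an affine open. -/
@[reducible] def barSecMap (U : S.Aff) : Cpx.Hom (barSec J M U) (barSec J' M' U) :=
  ⟨fun n => cAp F hF (G.pw (n + 1)) U, fun n z => cAp_comm hF G n z⟩

variable (hJ : ∀ U, ∀ x ∈ J.C U, ∀ y ∈ J.C U, H.br U x y = 0)
  (hJ' : ∀ U, ∀ x ∈ J'.C U, ∀ y ∈ J'.C U, H'.br U x y = 0)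

/-- The map `J → J'`. -/
def subHom : J.toSMod ⟶ J'.toSMod :=
  ⟨fun U => ((SMod.ap F.φ U).comp (SMod.ap J.incl U)).codRestrict (J'.C U).toAddSubgroup
      fun x => hF U x.1 x.2,
    fun U f x => Subtype.ext (SMod.ap_smul F.φ f x.1), fun U x => Subtype.ext (SMod.ap_par F.φ x.1),
    fun U V h x => Subtype.ext (SMod.ap_res F.φ h x.1)⟩

theorem subHom_incl (x : J.toSMod.C U) : SMod.ap J'.incl U (SMod.ap (subHom hF) U x) =
    SMod.ap F.φ U (SMod.ap J.incl U x) := rfl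

/-- The component of a morphism of supermodules over an affine open, as a linear map. -/
def SMod.lin {P Q : SMod S} (f : P ⟶ Q) (U : S.Aff) : P.C U →ₗ[S.O U] Q.C U :=
  { SMod.ap f U with map_smul' := fun a m => SMod.ap_smul f a m }

theorem SMod.lin_apply {P Q : SMod S} (f : P ⟶ Q) (x : P.C U) : SMod.lin f U x = SMod.ap f U x := rfl

/-- The map of exterior powers over an affine open. -/
def kAp (U : S.Aff) (n : ℕ) : (K (koszAct hJ M) n).C U →+ (K (koszAct hJ' M') n).C U :=
  kmap _ _ (SMod.lin (subHom hF) U) (SMod.ap_par (subHom hF)) (SMod.lin G.g U) n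

theorem kAp_kz (m : M.C U) : kAp hF G hJ hJ' U 0 (kz _ m) = kz _ (SMod.ap G.g U m) := rfl

theorem kAp_otk (n : ℕ) (x : J.toSMod.C U) (z : (K (koszAct hJ M) n).C U) :
    kAp hF G hJ hJ' U (n + 1) (otk _ n x z) =
      otk _ n (SMod.ap (subHom hF) U x) (kAp hF G hJ hJ' U n z) :=
  kmap_otk _ _ _ _ _ n x z

theorem kAp_kd (n : ℕ) (z : (K (koszAct hJ M) (n + 1)).C U) :
    kAp hF G hJ hJ' U n (SMod.ap (kd _ n) U z) = SMod.ap (kd _ n) U (kAp hF G hJ hJ' U (n + 1) z) :=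
  kmap_kd _ _ _ _ _ (fun x m => G.hact (SMod.ap J.incl U x) m) n z

/-- The map of Koszul complexes over an affine open. -/
@[reducible] def kSecMap (U : S.Aff) :
    Cpx.Hom (sec (koszAct hJ M) U) (sec (koszAct hJ' M') U) :=
  ⟨kAp hF G hJ hJ' U, kAp_kd hF G hJ hJ'⟩

theorem aK_kAp : ∀ n (z : (K (koszAct hJ M) n).C U),
    aK hJ' M' U n (kAp hF G hJ hJ' U n z) = SMod.ap (G.pw n).g U (aK hJ M U n z)
  | 0, z => by
    obtain ⟨m, rfl⟩ := kz_surj _ z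
    rfl
  | n + 1, z => by
    induction z using k_ind with
    | h x z => rw [kAp_otk, aK_otk, aK_otk, G.pw_ins, aK_kAp n, subHom_incl]
    | hadd a b ha hb => simp only [map_add, ha, hb]

/-- Naturality of the comparison map. -/
theorem compAp_nat (n : ℕ) (z : (K (koszAct hJ M) n).C U) :
    cAp F hF (G.pw (n + 1)) U (compAp hJ M U n z) =
      compAp hJ' M' U n (kAp hF G hJ hJ' U n z) := by
  rw [compAp_apply, compAp_apply, cAp_ct, mrHom_mk, map_one, G.pw_bo, map_one, aK_kAp]

end Mr

/-! ### Functoriality of the Lie algebroid -/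

section Compat

variable {H H' : PreHeis S} {D : Conn H} {D' : Conn H'} (F : HHom D D') {J : H.toSMod.Sub}
  {J' : H'.toSMod.Sub} (hF : ∀ U, ∀ x ∈ J.C U, SMod.ap F.φ U x ∈ J'.C U) {U V : S.Aff}
  {p q : ZMod 2}

/-- Sections of the Lie algebroids of `J` and `J'` with the same symbol which correspond to each
other under the map `M^r(J) → M^r(J')`. -/
def Compat (A : AA H D J U p) (A' : AA H' D' J' U p) : Prop :=
  A'.anchor = A.anchor ∧ ∀ (V : S.Aff) (h : V ≤ U) (m : (Mr H J).C V),
    SMod.ap (mrHom F hF) V (A.ap h m) = A'.ap h (SMod.ap (mrHom F hF) V m)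

namespace Compat

variable {F hF}

theorem add {A B : AA H D J U p} {A' B' : AA H' D' J' U p} (hA : Compat F hF A A')
    (hB : Compat F hF B B') : Compat F hF (A + B) (A' + B') :=
  ⟨by rw [map_add, map_add, hA.1, hB.1], fun V h m => by
    change SMod.ap _ V (A.ap h m + B.ap h m) = A'.ap h _ + B'.ap h _
    rw [map_add, hA.2, hB.2]⟩

theorem smul {A : AA H D J U p} {A' : AA H' D' J' U p} (hA : Compat F hF A A') (f : S.O U)
    (hf : S.Homog q f) : Compat F hF (A.smul f hf) (A'.smul f hf) :=
  ⟨by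
    change VF.smul f hf A'.anchor = VF.smul f hf A.anchor
    rw [hA.1], fun V h m => by
    change SMod.ap _ V (S.res h f • A.ap h m) = S.res h f • A'.ap h _
    rw [SMod.ap_smul, hA.2]⟩

theorem br {A : AA H D J U p} {A' : AA H' D' J' U p} {B : AA H D J U q} {B' : AA H' D' J' U q}
    (hA : Compat F hF A A') (hB : Compat F hF B B') : Compat F hF (A.br B) (A'.br B') :=
  ⟨by
    change VF.br A'.anchor B'.anchor = VF.br A.anchor B.anchor
    rw [hA.1, hB.1], fun V h m => by
    change SMod.ap _ V (A.ap h (B.ap h m) - sg (p * q) • B.ap h (A.ap h m)) =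
      A'.ap h (B'.ap h _) - sg (p * q) • B'.ap h (A'.ap h _)
    rw [map_sub, map_zsmul, hA.2, hB.2, hB.2, hA.2]⟩

theorem res {A : AA H D J U p} {A' : AA H' D' J' U p} (hA : Compat F hF A A') (h : V ≤ U) :
    Compat F hF (AA.res h A) (AA.res h A') :=
  ⟨by
    change VF.res h A'.anchor = VF.res h A.anchor
    rw [hA.1], fun W k m => hA.2 W (k.trans h) m⟩

/-- Compatible sections act compatibly on coinvariants. -/
theorem cAp {A : AA H D J U p} {A' : AA H' D' J' U p} (hA : Compat F hF A A') {N : FlatMod H D}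
    {N' : FlatMod H' D'} (G : ModHom F N N') (z : (Cobj J N).C U) :
    SMod.ap (cHom F hF G) U ((Cobj J N).act A z) =
      (Cobj J' N').act A' (SMod.ap (cHom F hF G) U z) := by
  change SuperHeis.cAp F hF G U (cAct J N A z) = cAct J' N' A' (SuperHeis.cAp F hF G U z)
  induction z using ct_ind with
  | h m n =>
    rw [cAct_ct, map_add, cAp_ct, cAp_ct, cAp_ct, cAct_ct, hA.2, hA.1, G.conn, SMod.ap_tw]
  | hadd a b ha hb => simp only [map_add, ha, hb]

end Compat

end Compat

theorem AA.ext {H : PreHeis S} {D : Conn H} {J : H.toSMod.Sub} {U : S.Aff} {p : ZMod 2}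
    {A B : AA H D J U p} (h : A.anchor = B.anchor)
    (h' : ∀ (V : S.Aff) (k : V ≤ U) m, A.ap k m = B.ap k m) : A = B :=
  Subtype.ext (Prod.ext (funext fun V => AddMonoidHom.ext fun m => h' V.1 V.2 m) h)

/-! ### The comparison map is a quasi-isomorphism -/

section ker

variable {H : PreHeis S} {D : Conn H} {M N : FlatMod H D}

/-- The kernel of a morphism of flat modules. -/
def kerSub (f : M ⟶ N) : M.toSMod.Sub where
  C U := LinearMap.ker (SMod.lin (FlatMod.toHom f) U)
  par_mem U m hm := by
    rw [LinearMap.mem_ker, SMod.lin_apply] at *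
    rw [SMod.ap_par, hm, map_zero]
  res_mem h m hm := by
    rw [LinearMap.mem_ker, SMod.lin_apply] at *
    rw [SMod.ap_res, hm, map_zero]

theorem mem_kerSub (f : M ⟶ N) {U : S.Aff} (m : M.C U) :
    m ∈ (kerSub f).C U ↔ SMod.ap (FlatMod.toHom f) U m = 0 := Iff.rfl

/-- A graded submodule stable under the action and the connection, as a flat module. -/
@[reducible] def subMod (K : M.toSMod.Sub)
    (h1 : ∀ (U : S.Aff) (x : H.C U), ∀ m ∈ K.C U, M.hact x m ∈ K.C U)
    (h2 : ∀ (U : S.Aff) (p : ZMod 2) (v : VF S U p), ∀ m ∈ K.C U, M.conn v m ∈ K.C U) :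
    FlatMod H D where
  toSMod := K.toSMod
  hact {U} := AddMonoidHom.mk' (fun x => AddMonoidHom.mk' (fun m => ⟨M.hact x m.1, h1 U x m.1 m.2⟩)
    fun a b => Subtype.ext (map_add (M.hact x) a.1 b.1))
    fun a b => AddMonoidHom.ext fun m => Subtype.ext (DFunLike.congr_fun (map_add M.hact a b) m.1)
  hact_par x m := Subtype.ext (M.hact_par x m.1)
  hact_res h x m := Subtype.ext (M.hact_res h x m.1)
  hact_smul f x m := Subtype.ext (M.hact_smul f x m.1)
  hact_one m := Subtype.ext (M.hact_one m.1)
  hact_br p q x y m hx hy := Subtype.ext (M.hact_br p q x y m.1 hx hy)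
  conn {U p} := AddMonoidHom.mk' (fun v => AddMonoidHom.mk' (fun m => ⟨M.conn v m.1, h2 U p v m.1 m.2⟩)
    fun a b => Subtype.ext (map_add (M.conn v) a.1 b.1))
    fun a b => AddMonoidHom.ext fun m => Subtype.ext (DFunLike.congr_fun (map_add M.conn a b) m.1)
  conn_dop v := ⟨fun m => Subtype.ext ((M.conn_dop v).1 m.1),
    fun f m => Subtype.ext ((M.conn_dop v).2 f m.1)⟩
  conn_smul f hf v m := Subtype.ext (M.conn_smul f hf v m.1)
  conn_br v w m := Subtype.ext (M.conn_br v w m.1)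
  conn_res h v m := Subtype.ext (M.conn_res h v m.1)
  conn_hact v x m := Subtype.ext (M.conn_hact v x m.1)

/-- The kernel of a morphism of flat modules, as a flat module. -/
@[reducible] def kerMod (f : M ⟶ N) : FlatMod H D :=
  subMod (kerSub f)
    (fun U x m hm => by rw [mem_kerSub] at *; rw [FlatMod.toHom_hact, hm, map_zero])
    (fun U p v m hm => by rw [mem_kerSub] at *; rw [FlatMod.toHom_conn, hm, map_zero])

/-- The inclusion of the kernel. -/
def kerIncl (f : M ⟶ N) : kerMod f ⟶ M := ⟨(kerSub f).incl, fun _ _ _ => rfl, fun _ _ _ _ => rfl⟩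

end ker

namespace Bar

variable {H : PreHeis S} {D : Conn H} {U : S.Aff}

/-- The morphism `U(H) ⊗ M → U(H) ⊗ M'` induced by a morphism compatible with connections only. -/
def linFree {M M' : FlatMod H D} (g : M.toSMod ⟶ M'.toSMod)
    (hg : ∀ (U : S.Aff) (p : ZMod 2) (v : VF S U p) m,
      SMod.ap g U (M.conn v m) = M'.conn v (SMod.ap g U m)) : Fobj M ⟶ Fobj M' :=
  ⟨SMod.omap g, by
    refine ⟨fun U x z => ?_, fun U p v z => ?_⟩
    · change SMod.ap (SMod.omap g) U (lact (UH.ι H x) z) = lact (UH.ι H x) _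
      induction z using uo_ind with
      | h a m => rfl
      | hadd a b ha hb => simp only [map_add, ha, hb]
    · induction z using uo_ind with
      | h a m =>
        rw [Fobj_conn_uo, map_add]
        change uo _ (SMod.ap g U m) + uo _ (SMod.ap g U (M.conn v m)) = uconn M' v (uo a (SMod.ap g U m))
        rw [hg, uconn_uo]
      | hadd a b ha hb => simp only [map_add, ha, hb]⟩

theorem linFree_uo {M M' : FlatMod H D} (g : M.toSMod ⟶ M'.toSMod) (hg) (u : UH H U) (m : M.C U) :
    SMod.ap (FlatMod.toHom (linFree g hg)) U (uo u m) = uo u (SMod.ap g U m) := rfl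

/-- The induced morphisms of the terms of the bar resolution. -/
def linPow {M M' : FlatMod H D} (g : M.toSMod ⟶ M'.toSMod)
    (hg : ∀ (U : S.Aff) (p : ZMod 2) (v : VF S U p) m,
      SMod.ap g U (M.conn v m) = M'.conn v (SMod.ap g U m)) :
    ∀ n, (pow M (n + 1) ⟶ pow M' (n + 1))
  | 0 => linFree g hg
  | n + 1 => Fmap (M := pow M (n + 1)) (N := pow M' (n + 1)) (linPow g hg n)

theorem linPow_succ {M M' : FlatMod H D} (g : M.toSMod ⟶ M'.toSMod) (hg) (n : ℕ) (u : UH H U)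
    (t : (pow M (n + 1)).C U) :
    SMod.ap (FlatMod.toHom (linPow g hg (n + 1))) U (bo M (n + 1) u t) =
      bo M' (n + 1) u (SMod.ap (FlatMod.toHom (linPow g hg n)) U t) := rfl

theorem bo_ext {M : FlatMod H D} {n : ℕ} {G : Type*} [AddCommGroup G]
    {f g : (pow M (n + 1)).C U →+ G} (h : ∀ u t, f (bo M n u t) = g (bo M n u t)) (z) :
    f z = g z := by
  induction z using bo_ind with
  | h u t => exact h u t
  | hadd a b ha hb => rw [map_add, map_add, ha, hb]

theorem sub_eq_add_neg_one_pow {G : Type*} [AddCommGroup G] (x y : G) :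
    x - y = x + (-1 : ℤ) ^ (0 + 1) • y := by
  simp [sub_eq_add_neg]

/-- The section `m ↦ 1 ⊗ m`. -/
def unitAp (Q : SMod S) (U : S.Aff) : Q.C U →+ (SMod.otens (UH.mod H) Q).C U := uoHom 1

theorem uo_one_smul {Q : SMod S} (f : S.O U) (y : Q.C U) :
    uo (1 : UH H U) (f • y) = f • uo (1 : UH H U) y := by
  refine O_homog_ind (P := fun f => uo (1 : UH H U) (f • y) = f • uo (1 : UH H U) y)
    (fun a b ha hb => ?_) (fun q f hf => ?_) f
  · rw [add_smul, uo_add, ha, hb, add_smul]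
  · rw [uo_smul hf, tw_one_UH]

/-- The section `m ↦ 1 ⊗ m` of supermodules. -/
def unitHom (H : PreHeis S) (Q : SMod S) : Q ⟶ SMod.otens (UH.mod H) Q :=
  ⟨fun U => unitAp Q U, fun U f m => uo_one_smul f m,
    fun U m => ((par_uo (1 : UH H U) m).trans (by rw [map_one]; rfl)).symm,
    fun U V h m => ((res_uo h (1 : UH H U) m).trans (by rw [map_one]; rfl)).symm⟩

theorem unitHom_ap {Q : SMod S} (m : Q.C U) : SMod.ap (unitHom H Q) U m = uo 1 m := rfl

theorem del_one {p : ZMod 2} (v : VF S U p) : UH.del D v 1 = 0 := by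
  rw [← UH.ι_one, UH.del_ι, D.one, map_zero]

theorem unitHom_conn (M : FlatMod H D) {p : ZMod 2} (v : VF S U p) (m : M.C U) :
    SMod.ap (unitHom H M.toSMod) U (M.conn v m) =
      (Fobj M).conn v (SMod.ap (unitHom H M.toSMod) U m) := by
  rw [unitHom_ap, unitHom_ap, Fobj_conn_uo, del_one, tw_one_UH, zero_uo, zero_add]

/-- The extra degeneracies of the bar resolution of a free module. -/
def degen (M : FlatMod H D) : ∀ n, (pow (Fobj M) n ⟶ pow (Fobj M) (n + 1))
  | 0 => linFree (unitHom H M.toSMod) fun _ _ v m => unitHom_conn M v m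
  | n + 1 => Fmap (M := pow (Fobj M) n) (N := pow (Fobj M) (n + 1)) (degen M n)

theorem degen_succ (M : FlatMod H D) (n : ℕ) (u : UH H U) (t : (pow (Fobj M) n).C U) :
    SMod.ap (FlatMod.toHom (degen M (n + 1))) U (bo _ n u t) =
      bo _ (n + 1) u (SMod.ap (FlatMod.toHom (degen M n)) U t) := rfl

theorem ε_linFree (M : FlatMod H D) (u : UH H U) (m : M.C U) :
    SMod.ap (FlatMod.toHom (ε (Fobj M))) U (SMod.ap (FlatMod.toHom (linFree (unitHom H M.toSMod)
      fun _ _ v m => unitHom_conn M v m)) U (uo u m)) = uo u m := by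
  rw [linFree_uo, unitHom_ap, ε_ot, Fobj_uact, lact_uo, mul_one]

theorem ap_ap_eq_self {Q Y : SMod S} (f : SMod.otens (UH.mod H) Q ⟶ Y)
    (g : Y ⟶ SMod.otens (UH.mod H) Q)
    (h : ∀ (u : UH H U) m, SMod.ap g U (SMod.ap f U (uo u m)) = uo u m) (z) :
    SMod.ap g U (SMod.ap f U z) = z := by
  induction z using uo_ind with
  | h u m => exact h u m
  | hadd a b ha hb => rw [map_add, map_add, ha, hb]

theorem e_degen_zero (M : FlatMod H D) (z : (Fobj M).C U) :
    SMod.ap (FlatMod.toHom (ε (Fobj M))) U (SMod.ap (FlatMod.toHom (linFree (unitHom H M.toSMod)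
      fun _ _ v m => unitHom_conn M v m)) U z) = z :=
  ap_ap_eq_self (Q := M.toSMod) (Y := (Fobj (Fobj M)).toSMod) _ _ (ε_linFree M) z

theorem e_degen (M : FlatMod H D) : ∀ n (z : (pow (Fobj M) (n + 1)).C U),
    SMod.ap (FlatMod.toHom (e (Fobj M) (n + 1))) U (SMod.ap (FlatMod.toHom (degen M (n + 1))) U z) =
      SMod.ap (FlatMod.toHom (degen M n)) U (SMod.ap (FlatMod.toHom (e (Fobj M) n)) U z) +
        (-1 : ℤ) ^ (n + 1) • z
  | 0, z => by
    induction z using bo_ind with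
    | h u t =>
      have h1 : SMod.ap (FlatMod.toHom (e (Fobj M) 0)) U
        (SMod.ap (FlatMod.toHom (degen M 0)) U t) = t := e_degen_zero M t
      rw [degen_succ, e_bo, h1, ← FlatMod.uact_hom]
      exact sub_eq_add_neg_one_pow _ _
    | hadd a b ha hb => simp only [map_add, ha, hb, smul_add]; abel
  | n + 1, z => by
    induction z using bo_ind with
    | h u t =>
      rw [degen_succ, e_bo, e_degen M n, ← FlatMod.uact_hom, e_bo, map_sub, degen_succ, map_add,
        map_zsmul, pow_succ _ (n + 1), mul_neg_one, neg_smul]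
      abel
    | hadd a b ha hb => simp only [map_add, ha, hb, smul_add]; abel

end Bar

section qis

open Bar Kosz

variable {H : PreHeis S} {D : Conn H} {J : H.toSMod.Sub} {U : S.Aff}

theorem cmap_comp {N N' N'' : FlatMod H D} (f : N ⟶ N') (g : N' ⟶ N'') (z : (Cobj J N).C U) :
    cmap J (f ≫ g) U z = cmap J g U (cmap J f U z) := by
  induction z using ct_ind with
  | h m n => rfl
  | hadd a b ha hb => rw [map_add, ha, hb, map_add, map_add]

/-- The bar complex of a free module is acyclic. -/
theorem barSec_free_acyc (J : H.toSMod.Sub) (M : FlatMod H D) (U : S.Aff) :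
    (barSec J (Fobj M) U).Acyc := fun n z hz => by
  have key : ∀ z : (Cobj J (pow (Fobj M) (n + 2))).C U,
      cmap J (e (Fobj M) (n + 2)) U (cmap J (degen M (n + 2)) U z) =
      cmap J (degen M (n + 1)) U (cmap J (e (Fobj M) (n + 1)) U z) + (-1 : ℤ) ^ (n + 2) • z :=
    fun z => by
      induction z using ct_ind with
      | h m t => rw [cmap_ct, cmap_ct, cmap_ct, cmap_ct, e_degen, ct_add, ct_zsmul]
      | hadd a b ha hb => simp only [map_add, ha, hb, smul_add]; abel
  have h := key z
  rw [show cmap J (e (Fobj M) (n + 1)) U z = 0 from hz, map_zero, zero_add] at h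
  refine ⟨cmap J (degen M (n + 2)) U ((-1 : ℤ) ^ (n + 2) • z), ?_⟩
  change z = cmap J (e (Fobj M) (n + 2)) U (cmap J (degen M (n + 2)) U _)
  rw [map_zsmul, map_zsmul, h, smul_smul, ← mul_pow]
  simp

/-- The coefficient of a bracket. -/
def cf (H : PreHeis S) {U : S.Aff} (x y : H.C U) : S.O U := (H.br_mem U x y).choose

theorem cf_spec (x y : H.C U) : H.br U x y = cf H x y • H.one U := (H.br_mem U x y).choose_spec

/-- The central section is not a torsion element. -/
def OneInj (H : PreHeis S) (U : S.Aff) : Prop := ∀ f : S.O U, f • H.one U = 0 → f = 0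

theorem OneInj.eq (h1 : OneInj H U) {f g : S.O U} (h : f • H.one U = g • H.one U) : f = g :=
  sub_eq_zero.1 (h1 _ (by rw [sub_smul, h, sub_self]))

theorem OneInj.cf_eq (h1 : OneInj H U) {x y : H.C U} {f : S.O U} (h : H.br U x y = f • H.one U) :
    cf H x y = f := h1.eq (by rw [← cf_spec, h])

theorem OneInj.cf_add (h1 : OneInj H U) (x y z : H.C U) : cf H x (y + z) = cf H x y + cf H x z :=
  h1.cf_eq (by rw [map_add, cf_spec, cf_spec x z, add_smul])

theorem OneInj.add_cf (h1 : OneInj H U) (x y z : H.C U) : cf H (x + y) z = cf H x z + cf H y z :=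
  h1.cf_eq (by rw [map_add, AddMonoidHom.add_apply, cf_spec, cf_spec y z, add_smul])

theorem OneInj.smul_cf (h1 : OneInj H U) (f : S.O U) (x y : H.C U) : cf H (f • x) y = f * cf H x y :=
  h1.cf_eq (by rw [H.br_smul, cf_spec, mul_smul])

theorem OneInj.cf_homog (h1 : OneInj H U) {p q : ZMod 2} {x y : H.C U} (hx : H.Homog p x)
    (hy : H.Homog q y) : S.Homog (p + q) (cf H x y) := h1.eq (by
  have := H.par_br U x y
  rw [hx, hy, map_zsmul, map_zsmul, AddMonoidHom.smul_apply, cf_spec, H.par_smul, H.par_one] at this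
  rw [this, smul_smul, mul_comm, ← sg_add, smul_assoc])

/-- An element of a graded submodule as a section of the associated supermodule. -/
def _root_.SuperHeis.SMod.Sub.el {M : SMod S} {U : S.Aff} (K : M.Sub) (x : M.C U) (hx : x ∈ K.C U) :
    K.toSMod.C U := ⟨x, hx⟩

theorem _root_.SuperHeis.SMod.Sub.ap_el {M : SMod S} {U : S.Aff} (K : M.Sub) (x : M.C U)
    (hx : x ∈ K.C U) : SMod.ap K.incl U (K.el x hx) = x := rfl

theorem _root_.SuperHeis.SMod.Sub.el_ext {M : SMod S} {U : S.Aff} {K : M.Sub} {x y : K.toSMod.C U}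
    (h : SMod.ap K.incl U x = SMod.ap K.incl U y) : x = y := Subtype.ext h

variable (hJ : ∀ U, ∀ x ∈ J.C U, ∀ y ∈ J.C U, H.br U x y = 0)

/-- The contracting homotopy of the Koszul complex of a free module. -/
def freeHtpy (h1 : OneInj H U) (B : DualBasis H J U) (M : FlatMod H D) :
    KoszHtpy (koszAct hJ (Fobj M)) U where
  n := B.n
  p := B.p
  j a := J.el (B.b a) (B.mem a)
  hj a := Subtype.ext (B.hb a)
  lam a := uhead (Q := M.toSMod) (B.hl' a)
  lam_smul a f m := uhead_smul (Q := M.toSMod) (B.hl' a) f m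
  c a := AddMonoidHom.mk' (fun x => cf H (-sg (B.p a) • B.l a) (SMod.ap J.incl U x)) fun x y => by
    rw [map_add, h1.cf_add]
  hc a r x hx := h1.cf_homog (B.hl' a) (SMod.ap_homog J.incl hx)
  lam_act a x z := by
    change uhead (B.hl' a) (lact (UH.ι H (SMod.ap J.incl U x)) z) =
      cf H (-sg (B.p a) • B.l a) (SMod.ap J.incl U x) • z +
      lact (UH.ι H (SMod.ap J.incl U (J.toSMod.tw (B.p a) x))) (uhead (B.hl' a) z)
    rw [SMod.ap_tw]
    induction z using uo_ind with
    | h u t =>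
      rw [lact_uo, uhead_uo, uhead_uo, lact_uo, UH.ad_mul, UH.ad_ι H (B.hl' a), cf_spec,
        ← UH.oo_apply, add_uo, smul_uo, UH.tw_ι]
    | hadd z w hz hw => simp only [map_add, hz, hw, smul_add]; abel
  π := AddMonoidHom.id _
  hπ r x hx := by
    obtain ⟨f, hf, hx'⟩ := B.span le_rfl _ x.2
    have hx1 : H.Homog r (SMod.ap J.incl U x) := SMod.ap_homog J.incl hx
    refine Subtype.ext (hx'.trans ?_)
    refine Eq.trans ?_ (map_sum (SMod.ap J.incl U) _ _).symm
    refine Finset.sum_congr rfl fun a _ => ?_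
    have hl : ∀ a, H.res le_rfl (B.l a) = B.l a := fun a => H.res_id U _
    have e : cf H (-sg (B.p a) • B.l a) (SMod.ap J.incl U x) = (sg (B.p a) * sg (B.p a * r)) • f a := by
      refine h1.cf_eq ?_
      have := hf a
      rw [hl] at this
      rw [map_zsmul, AddMonoidHom.smul_apply, H.br_skew U _ _ _ _ (B.hl a) hx1]
      change -sg (B.p a) • -(sg (B.p a * r) • H.br U x.1 (B.l a)) = _
      rw [this, neg_smul, smul_neg, neg_neg, smul_assoc, mul_smul]
    change f a • H.res le_rfl (B.b a) = cf H (-sg (B.p a) • B.l a) (SMod.ap J.incl U x) •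
      SMod.ap J.incl U (J.toSMod.tw (B.p a + r) (J.el (B.b a) (B.mem a)))
    rw [SMod.ap_tw, e, SMod.Sub.ap_el, (B.hb a).tw, H.res_id, smul_assoc, smul_comm (f a), smul_smul]
    have : sg (B.p a) * sg (B.p a * r) * sg ((B.p a + r) * B.p a) = 1 := by
      generalize B.p a = s; clear hx hx1 e; revert s r; decide
    rw [this, one_smul]

theorem freeHtpy_lapM (h1 : OneInj H U) (B : DualBasis H J U) (M : FlatMod H D) (u : UH H U)
    (m : M.C U) : (freeHtpy hJ h1 B M).lapM (uo u m) = uo (B.euler u) m := by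
  rw [KoszHtpy.lapM_apply, DualBasis.euler_apply]
  refine Eq.trans ?_ (map_sum (AddMonoidHom.mk' (fun u : UH H U => uo u m)
    fun a b => add_uo a b m) _ _).symm
  rfl

/-- The Koszul complex of a free module is acyclic. -/
theorem kSec_free_acyc (h1 : OneInj H U) (B : DualBasis H J U) (M : FlatMod H D) :
    (sec (koszAct hJ (Fobj M)) U).Acyc :=
  (freeHtpy hJ h1 B M).acyc (fun _ => rfl) fun z => by
    induction z using uo_ind with
    | h u m =>
      obtain ⟨l, hl⟩ := B.exists_evList_euler u
      refine ⟨l, ?_⟩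
      have := evList_map (E := B.euler) (E' := (freeHtpy hJ h1 B M).lapM) (AddMonoidHom.mk'
        (fun u : UH H U => uo u m) fun a b => add_uo a b m)
        (fun u => (freeHtpy_lapM hJ h1 B M u m).symm) l u
      rw [hl, map_zero] at this
      exact this.symm
    | hadd a b ha hb =>
      obtain ⟨l, hl⟩ := ha
      obtain ⟨l', hl'⟩ := hb
      exact ⟨l ++ l', evList_append_add hl hl'⟩

/-- The sections of `J M`. -/
def jMod (J : H.toSMod.Sub) (M : FlatMod H D) (U : S.Aff) : Submodule (S.O U) (M.C U) :=
  Submodule.span (S.O U) {m | ∃ j ∈ J.C U, ∃ n : M.C U, m = M.hact j n}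

theorem uact_rIdeal (M : FlatMod H D) {a : UH H U} (ha : a ∈ (rIdeal H J).C U) (m : M.C U) :
    M.uact a m ∈ jMod J M U := by
  refine Submodule.span_induction (p := fun a _ => M.uact a m ∈ jMod J M U) ?_ ?_
    (fun a b _ _ ha hb => ?_) (fun f a _ ha => ?_) ha
  · rintro _ ⟨j, hj, u, rfl⟩
    rw [FlatMod.uact_mul, FlatMod.uact_ι]
    exact Submodule.subset_span ⟨j, hj, _, rfl⟩
  · have : M.uact (0 : UH H U) m = 0 := by simpa using M.uact_add (0 : UH H U) 0 m
    rw [this]; exact zero_mem _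
  · rw [FlatMod.uact_add]; exact add_mem ha hb
  · rw [FlatMod.uact_smul]; exact Submodule.smul_mem _ f ha

/-- The pairing `M^r(J) × M → M / J M`. -/
def coPair (J : H.toSMod.Sub) (M : FlatMod H D) (U : S.Aff) :
    (Mr H J).C U →+ M.C U →+ M.C U ⧸ jMod J M U :=
  SMod.qlift _ (AddMonoidHom.mk' (fun a : UH H U =>
      ((jMod J M U).mkQ.toAddMonoidHom).comp (M.uact a))
      fun a b => AddMonoidHom.ext fun m => by
        simp only [AddMonoidHom.comp_apply, FlatMod.uact_add, map_add, AddMonoidHom.add_apply])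
    fun a ha => AddMonoidHom.ext fun m =>
      (Submodule.Quotient.mk_eq_zero _).2 (uact_rIdeal M ha m)

theorem coPair_mk (M : FlatMod H D) (a : UH H U) (m : M.C U) :
    coPair J M U (Mr.mk J a) m = (jMod J M U).mkQ (M.uact a m) := rfl

/-- The map `M^r(J) ⊗_{U(H)} M → M / J M`. -/
def coVal (J : H.toSMod.Sub) (M : FlatMod H D) (U : S.Aff) :
    (Cobj J M).C U →+ M.C U ⧸ jMod J M U :=
  SMod.qlift _ (SMod.zlift (coPair J M U)) fun z hz => by
    refine Submodule.span_induction (p := fun z _ => SMod.zlift (coPair J M U) z = 0) ?_ ?_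
      (fun a b _ _ ha hb => ?_) (fun f a _ ha => ?_) hz
    · rintro _ ⟨x, m, n, rfl⟩
      obtain ⟨a, rfl⟩ := Mr.mk_surj m
      rw [map_sub, SMod.zlift_zt, SMod.zlift_zt, Mr.rmul_mk, coPair_mk, coPair_mk, FlatMod.uact_mul,
        FlatMod.uact_ι, sub_self]
    · rw [map_zero]
    · rw [map_add, ha, hb, add_zero]
    · have : ∀ z, SMod.zlift (coPair J M U) (f • z) = f • SMod.zlift (coPair J M U) z := fun z => by
        induction z using SMod.zt_ind with
        | h0 => simp
        | h x y =>
          obtain ⟨a, rfl⟩ := Mr.mk_surj x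
          rw [← SMod.smul_zt, SMod.zlift_zt, SMod.zlift_zt, Mr.mk_smul, coPair_mk, coPair_mk,
            FlatMod.uact_smul, map_smul]
        | hadd a b ha hb => rw [smul_add, map_add, ha, hb, map_add, smul_add]
      rw [this, ha, smul_zero]

theorem coVal_ct (M : FlatMod H D) (a : UH H U) (m : M.C U) :
    coVal J M U (ct J M (Mr.mk J a) m) = (jMod J M U).mkQ (M.uact a m) := rfl

theorem ct_mk (M : FlatMod H D) (a : UH H U) (m : M.C U) :
    ct J M (Mr.mk J a) m = ct J M (Mr.mk J 1) (M.uact a m) := by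
  have : ∀ b : UH H U, ct J M (Mr.mk J (b * a)) m = ct J M (Mr.mk J b) (M.uact a m) := by
    revert m
    induction a using UH.ind with
    | hι x => exact fun m b => by rw [← Mr.rmul_mk, ct_bal, FlatMod.uact_ι]
    | hadd a a' ha ha' =>
      exact fun m b => by rw [mul_add, Mr.mk_add, add_ct, ha, ha', ← ct_add, FlatMod.uact_add]
    | hmul a a' ha ha' => exact fun m b => by rw [← mul_assoc, ha', ha, FlatMod.uact_mul]
  simpa using this 1

theorem coVal_e_e (M : FlatMod H D) (w : (Cobj J (pow M 2)).C U) :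
    coVal J (pow M 0) U (cmap J (e M 0) U (cmap J (e M 1) U w)) = 0 := by
  rw [← cmap_comp, e_e]
  induction w using ct_ind with
  | h a t =>
    obtain ⟨a, rfl⟩ := Mr.mk_surj a
    rw [cmap_ct]
    refine (coVal_ct _ _ _).trans ?_
    refine (congrArg (fun t => (jMod J _ U).mkQ ((pow M 0).uact a t))
      (show SMod.ap (FlatMod.toHom (0 : pow M 2 ⟶ pow M 0)) U t = 0 from rfl)).trans ?_
    rw [map_zero, map_zero]
  | hadd a b ha hb => rw [map_add, map_add, ha, hb, add_zero]

theorem comp_inj_zero (M : FlatMod H D) : (compSec hJ M U).Inj 0 := by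
  rintro z - ⟨w, hw⟩
  obtain ⟨m, rfl⟩ := kz_surj _ z
  have h2 : coVal J M U (cmap J (ε M) U (ct J (Fobj M) (Mr.mk J 1) (uo 1 m))) =
      (jMod J M U).mkQ m := by
    rw [cmap_ct, ε_ot, coVal_ct, uact_one, uact_one]
  have h3 : m ∈ jMod J M U := by
    refine (Submodule.Quotient.mk_eq_zero _).1 (h2.symm.trans ?_)
    exact (congrArg (fun w => coVal J (pow M 0) U (cmap J (e M 0) U w)) hw).trans (coVal_e_e M w)
  refine Submodule.span_induction (p := fun m _ => ∃ w, kz (koszAct hJ M) m =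
    SMod.ap (kd (koszAct hJ M) 0) U w) ?_ ⟨0, by rw [map_zero, map_zero]⟩ ?_ ?_ h3
  · rintro _ ⟨j, hj, n, rfl⟩
    refine ⟨-otk _ 0 (J.el j hj) (kz _ n), ?_⟩
    rw [map_neg, kd_zero, neg_neg]; rfl
  · rintro a b _ _ ⟨w, hw⟩ ⟨w', hw'⟩
    exact ⟨w + w', by rw [map_add, map_add, hw, hw']⟩
  · rintro f a _ ⟨w, hw⟩
    exact ⟨f • w, by rw [KoszHtpy.kz_smul, SMod.ap_smul, hw]⟩

theorem comp_surj_zero (M : FlatMod H D) : (compSec hJ M U).Surj 0 := by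
  rintro z -
  suffices h : ∃ y w, z = compAp hJ M U 0 y + cmap J (e M 1) U w by
    obtain ⟨y, w, h⟩ := h
    exact ⟨y, trivial, w, h⟩
  change (Cobj J (pow M 1)).C U at z
  induction z using ct_ind with
  | h a t =>
    obtain ⟨a, rfl⟩ := Mr.mk_surj a
    rw [ct_mk]
    generalize (pow M 1).uact a t = t
    induction t using bo_ind with
    | h u m =>
      refine ⟨kz _ (M.uact u m), ct J _ (Mr.mk J 1) (bo M 1 1 (bo M 0 u m)), ?_⟩
      rw [cmap_ct, e_bo, ct_sub, uact_one]
      exact (add_sub_cancel _ _).symm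
    | hadd a b ha hb =>
      obtain ⟨y, w, h⟩ := ha
      obtain ⟨y', w', h'⟩ := hb
      refine ⟨y + y', w + w', ?_⟩
      rw [ct_add, h, h', map_add, map_add]; abel
  | hadd a b ha hb =>
    obtain ⟨y, w, h⟩ := ha
    obtain ⟨y', w', h'⟩ := hb
    refine ⟨y + y', w + w', ?_⟩
    rw [h, h', map_add, map_add]; abel

end qis

theorem Cpx.Exact.of_split {A B C : Cpx.{u}} {i : Cpx.Hom A B} {p : Cpx.Hom B C}
    (r : ∀ n, B.X n → A.X n) (s : ∀ n, C.X n → B.X n) (hri : ∀ n a, r n (i.f n a) = a)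
    (hps : ∀ n c, p.f n (s n c) = c) (h0 : ∀ n a, p.f n (i.f n a) = 0) (hs : ∀ n, s n 0 = 0)
    (h : ∀ n b, i.f n (r n b) + s n (p.f n b) = b) : Cpx.Exact i p where
  inj n := Function.LeftInverse.injective (hri n)
  surj n := Function.RightInverse.surjective (hps n)
  zero := h0
  exact n b hb := ⟨r n b, by have := h n b; rwa [hb, hs, add_zero] at this⟩

section

open Bar Kosz

variable {H : PreHeis S} {D : Conn H} {J : H.toSMod.Sub} {U : S.Aff}

/-- The retraction of `U(H) ⊗ M` to the kernel of the action map. -/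
def retr (M : FlatMod H D) : (Fobj M).toSMod ⟶ (kerMod (ε M)).toSMod :=
  let r := 𝟙 (Fobj M).toSMod - FlatMod.toHom (ε M) ≫ unitHom H M.toSMod
  have hr : ∀ (U : S.Aff) z, SMod.ap r U z ∈ (kerSub (ε M)).C U := fun U z => by
    rw [mem_kerSub, SMod.ap_sub, map_sub, SMod.ap_id, SMod.ap_comp, unitHom_ap, ε_ot, uact_one,
      sub_self]
  ⟨fun U => (SMod.ap r U).codRestrict ((kerSub (ε M)).C U).toAddSubgroup (hr U),
    fun U a z => Subtype.ext (SMod.ap_smul r a z), fun U z => Subtype.ext (SMod.ap_par r z),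
    fun U V h z => Subtype.ext (SMod.ap_res r h z)⟩

theorem retr_incl (M : FlatMod H D) (z : (Fobj M).C U) :
    SMod.ap (FlatMod.toHom (kerIncl (ε M))) U (SMod.ap (retr M) U z) =
      z - uo 1 (SMod.ap (FlatMod.toHom (ε M)) U z) :=
  SMod.ap_sub _ _ z

theorem kerIncl_inj {M N : FlatMod H D} (f : M ⟶ N) {z w : (kerMod f).C U}
    (h : SMod.ap (FlatMod.toHom (kerIncl f)) U z = SMod.ap (FlatMod.toHom (kerIncl f)) U w) : z = w :=
  Subtype.ext h

theorem ap_kerIncl {M N : FlatMod H D} (f : M ⟶ N) (z : (kerMod f).C U) :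
    SMod.ap (FlatMod.toHom f) U (SMod.ap (FlatMod.toHom (kerIncl f)) U z) = 0 := z.2

theorem retr_kerIncl (M : FlatMod H D) (z : (kerMod (ε M)).C U) :
    SMod.ap (retr M) U (SMod.ap (FlatMod.toHom (kerIncl (ε M))) U z) = z :=
  kerIncl_inj (ε M) (by rw [retr_incl, ap_kerIncl, ← unitHom_ap, map_zero, sub_zero])

theorem retr_conn (M : FlatMod H D) {p : ZMod 2} (v : VF S U p) (z : (Fobj M).C U) :
    SMod.ap (retr M) U ((Fobj M).conn v z) = (kerMod (ε M)).conn v (SMod.ap (retr M) U z) :=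
  kerIncl_inj (ε M) (by
    rw [FlatMod.toHom_conn, retr_incl, retr_incl, map_sub, FlatMod.toHom_conn, ← unitHom_ap,
      unitHom_conn, ← unitHom_ap])

theorem ε_unit (M : FlatMod H D) (m : M.C U) :
    SMod.ap (FlatMod.toHom (ε M)) U (SMod.ap (unitHom H M.toSMod) U m) = m := by
  rw [unitHom_ap, ε_ot, uact_one]

/-- The identity preserves `J`. -/
theorem id_mem (J : H.toSMod.Sub) (U : S.Aff) (x : H.C U) (hx : x ∈ J.C U) :
    SMod.ap (HHom.id D).φ U x ∈ J.C U := hx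

theorem subHom_id (x : J.toSMod.C U) : SMod.ap (subHom (F := HHom.id D) (id_mem J)) U x = x := rfl

theorem mrHom_id (x : (Mr H J).C U) : SMod.ap (mrHom (HHom.id D) (id_mem J)) U x = x := by
  obtain ⟨a, rfl⟩ := Mr.mk_surj x
  rw [mrHom_mk, HHom.uh_id]

variable (hJ : ∀ U, ∀ x ∈ J.C U, ∀ y ∈ J.C U, H.br U x y = 0)

/-- Maps of exterior powers induced by maps of coefficients. -/
def cof {M N : FlatMod H D} (g : M.toSMod ⟶ N.toSMod) (U : S.Aff) (n : ℕ) :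
    (K (koszAct hJ M) n).C U →+ (K (koszAct hJ N) n).C U :=
  kmap _ _ LinearMap.id (fun _ => rfl) (SMod.lin g U) n

theorem cof_kz {M N : FlatMod H D} (g : M.toSMod ⟶ N.toSMod) (m : M.C U) :
    cof hJ g U 0 (kz _ m) = kz _ (SMod.ap g U m) := rfl

theorem cof_otk {M N : FlatMod H D} (g : M.toSMod ⟶ N.toSMod) (n : ℕ) (x : J.toSMod.C U)
    (z : (K (koszAct hJ M) n).C U) :
    cof hJ g U (n + 1) (otk _ n x z) = otk _ n x (cof hJ g U n z) := kmap_otk _ _ _ _ _ n x z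

theorem kAp_eq_cof {M N : FlatMod H D} (f : M ⟶ N) : ∀ n (z : (K (koszAct hJ M) n).C U),
    kAp (id_mem J) (ModHom.ofHom f) hJ hJ U n z = cof hJ (FlatMod.toHom f) U n z
  | 0, z => by obtain ⟨z, rfl⟩ := kz_surj _ z; rfl
  | n + 1, z => by
    induction z using k_ind with
    | h x z => rw [kAp_otk, cof_otk, kAp_eq_cof f n, subHom_id]
    | hadd a b ha hb => rw [map_add, map_add, ha, hb]

theorem cof_cof {M N P : FlatMod H D} (f : M.toSMod ⟶ N.toSMod) (g : N.toSMod ⟶ P.toSMod)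
    (k : M.toSMod ⟶ P.toSMod) (h : ∀ m : M.C U, SMod.ap g U (SMod.ap f U m) = SMod.ap k U m) :
    ∀ n (z : (K (koszAct hJ M) n).C U), cof hJ g U n (cof hJ f U n z) = cof hJ k U n z
  | 0, z => by obtain ⟨z, rfl⟩ := kz_surj _ z; rw [cof_kz, cof_kz, cof_kz, h]
  | n + 1, z => by
    induction z using k_ind with
    | h x z => rw [cof_otk, cof_otk, cof_otk, cof_cof f g k h n]
    | hadd a b ha hb => rw [map_add, map_add, map_add, ha, hb]

theorem cof_add {M N : FlatMod H D} (f g k : M.toSMod ⟶ N.toSMod)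
    (h : ∀ m : M.C U, SMod.ap f U m + SMod.ap g U m = SMod.ap k U m) :
    ∀ n (z : (K (koszAct hJ M) n).C U), cof hJ f U n z + cof hJ g U n z = cof hJ k U n z
  | 0, z => by obtain ⟨z, rfl⟩ := kz_surj _ z; rw [cof_kz, cof_kz, cof_kz, ← map_add, h]
  | n + 1, z => by
    induction z using k_ind with
    | h x z => rw [cof_otk, cof_otk, cof_otk, ← map_add, cof_add f g k h n]
    | hadd a b ha hb => rw [map_add, map_add, map_add, add_add_add_comm, ha, hb]

theorem cof_id {M : FlatMod H D} : ∀ n (z : (K (koszAct hJ M) n).C U),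
    cof hJ (𝟙 M.toSMod) U n z = z
  | 0, z => by obtain ⟨z, rfl⟩ := kz_surj _ z; rfl
  | n + 1, z => by
    induction z using k_ind with
    | h x z => rw [cof_otk, cof_id n]
    | hadd a b ha hb => rw [map_add, ha, hb]

theorem cof_zero {M N : FlatMod H D} : ∀ n (z : (K (koszAct hJ M) n).C U),
    cof hJ (0 : M.toSMod ⟶ N.toSMod) U n z = 0
  | 0, z => by obtain ⟨z, rfl⟩ := kz_surj _ z; rw [cof_kz, SMod.ap_zero, map_zero]
  | n + 1, z => by
    induction z using k_ind with
    | h x z => rw [cof_otk, cof_zero n, map_zero]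
    | hadd a b ha hb => rw [map_add, ha, hb, add_zero]

theorem retr_add (M : FlatMod H D) (m : (Fobj M).C U) :
    SMod.ap (retr M ≫ FlatMod.toHom (kerIncl (ε M))) U m +
      SMod.ap (FlatMod.toHom (ε M) ≫ unitHom H M.toSMod) U m = SMod.ap (𝟙 (Fobj M).toSMod) U m := by
  rw [SMod.ap_comp, SMod.ap_comp, retr_incl, unitHom_ap, sub_add_cancel, SMod.ap_id]

theorem k_exact (M : FlatMod H D) (U : S.Aff) :
    Cpx.Exact (kSecMap (id_mem J) (ModHom.ofHom (kerIncl (ε M))) hJ hJ U)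
      (kSecMap (id_mem J) (ModHom.ofHom (ε M)) hJ hJ U) := by
  have h1 : ∀ n (t : (K (koszAct hJ (kerMod (ε M))) n).C U), cof hJ (retr M) U n
      (kAp (id_mem J) (ModHom.ofHom (kerIncl (ε M))) hJ hJ U n t) = t := fun n t => by
    rw [kAp_eq_cof, cof_cof hJ _ _ (𝟙 _) (retr_kerIncl M), cof_id]
  have h2 : ∀ n (t : (K (koszAct hJ M) n).C U), kAp (id_mem J) (ModHom.ofHom (ε M)) hJ hJ U n
      (cof hJ (unitHom H M.toSMod) U n t) = t := fun n t => by
    rw [kAp_eq_cof]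
    refine (cof_cof hJ (N := Fobj M) (unitHom H M.toSMod) _ (𝟙 _) (ε_unit M) n t).trans (cof_id hJ n t)
  have h3 : ∀ n (t : (K (koszAct hJ (kerMod (ε M))) n).C U),
      kAp (id_mem J) (ModHom.ofHom (ε M)) hJ hJ U n
        (kAp (id_mem J) (ModHom.ofHom (kerIncl (ε M))) hJ hJ U n t) = 0 := fun n t => by
    rw [kAp_eq_cof, kAp_eq_cof, cof_cof hJ _ _ 0 (ap_kerIncl (ε M)), cof_zero]
  have h4 : ∀ n (t : (K (koszAct hJ (Fobj M)) n).C U),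
      kAp (id_mem J) (ModHom.ofHom (kerIncl (ε M))) hJ hJ U n (cof hJ (retr M) U n t) +
      cof hJ (unitHom H M.toSMod) U n (kAp (id_mem J) (ModHom.ofHom (ε M)) hJ hJ U n t) = t :=
    fun n t => by
      rw [kAp_eq_cof, kAp_eq_cof, cof_cof hJ _ _ (retr M ≫ FlatMod.toHom (kerIncl (ε M))) fun _ => rfl]
      refine (congrArg (_ + ·) (cof_cof hJ (P := Fobj M) (FlatMod.toHom (ε M)) (unitHom H M.toSMod)
        (FlatMod.toHom (ε M) ≫ unitHom H M.toSMod) (fun _ => rfl) n t)).trans ?_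
      exact (cof_add hJ (N := Fobj M) _ _ (𝟙 _) (retr_add M) n t).trans (cof_id hJ n t)
  exact .of_split (fun n => cof hJ (retr M) U n) (fun n => cof hJ (N := Fobj M) (unitHom H M.toSMod) U n)
    h1 h2 h3 (fun n => map_zero _) h4

theorem ct_zero {N : FlatMod H D} (m : (Mr H J).C U) : ct J N m 0 = 0 := by
  have := ct_zsmul (N := N) 0 m 0
  rwa [zero_smul, zero_smul] at this

theorem pw_eq_linPow {M N : FlatMod H D} (f : M ⟶ N) : ∀ n (t : (pow M (n + 1)).C U),
    SMod.ap ((ModHom.ofHom f).pw (n + 1)).g U t =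
      SMod.ap (FlatMod.toHom (linPow (FlatMod.toHom f) (fun _ _ v m => FlatMod.toHom_conn f v m) n)) U t
  | 0, t => bo_ext (fun u t => congrArg (fun u => bo N 0 u _) (HHom.uh_id u)) t
  | n + 1, t => bo_ext (fun u t => by
      rw [ModHom.pw_bo, linPow_succ, HHom.uh_id, pw_eq_linPow f n]) t

theorem linPow_linPow {M N P : FlatMod H D} (f : M.toSMod ⟶ N.toSMod) (hf) (g : N.toSMod ⟶ P.toSMod)
    (hg) (k : M.toSMod ⟶ P.toSMod) (hk) (h : ∀ m : M.C U, SMod.ap g U (SMod.ap f U m) = SMod.ap k U m) :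
    ∀ n (t : (pow M (n + 1)).C U), SMod.ap (FlatMod.toHom (linPow g hg n)) U
      (SMod.ap (FlatMod.toHom (linPow f hf n)) U t) = SMod.ap (FlatMod.toHom (linPow k hk n)) U t
  | 0, t => bo_ext (f := (SMod.ap (FlatMod.toHom (linPow g hg 0)) U).comp
      (SMod.ap (FlatMod.toHom (linPow f hf 0)) U))
      (g := SMod.ap (FlatMod.toHom (linPow k hk 0)) U) (fun u t => congrArg (bo P 0 u) (h t)) t
  | n + 1, t => bo_ext (f := (SMod.ap (FlatMod.toHom (linPow g hg (n + 1))) U).comp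
      (SMod.ap (FlatMod.toHom (linPow f hf (n + 1))) U))
      (g := SMod.ap (FlatMod.toHom (linPow k hk (n + 1))) U)
      (fun u t => congrArg (bo P (n + 1) u) (linPow_linPow f hf g hg k hk h n t)) t

theorem linPow_add {M N : FlatMod H D} (f g k : M.toSMod ⟶ N.toSMod) (hf) (hg) (hk)
    (h : ∀ m : M.C U, SMod.ap f U m + SMod.ap g U m = SMod.ap k U m) :
    ∀ n (t : (pow M (n + 1)).C U), SMod.ap (FlatMod.toHom (linPow f hf n)) U t +
      SMod.ap (FlatMod.toHom (linPow g hg n)) U t = SMod.ap (FlatMod.toHom (linPow k hk n)) U t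
  | 0, t => bo_ext (f := SMod.ap (FlatMod.toHom (linPow f hf 0)) U +
      SMod.ap (FlatMod.toHom (linPow g hg 0)) U)
      (g := SMod.ap (FlatMod.toHom (linPow k hk 0)) U)
      (fun u t => (map_add (bo N 0 u) _ _).symm.trans (congrArg (bo N 0 u) (h t))) t
  | n + 1, t => bo_ext (f := SMod.ap (FlatMod.toHom (linPow f hf (n + 1))) U +
      SMod.ap (FlatMod.toHom (linPow g hg (n + 1))) U)
      (g := SMod.ap (FlatMod.toHom (linPow k hk (n + 1))) U)
      (fun u t => (map_add (bo N (n + 1) u) _ _).symm.trans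
        (congrArg (bo N (n + 1) u) (linPow_add f g k hf hg hk h n t))) t

theorem linPow_id {M : FlatMod H D} : ∀ n (t : (pow M (n + 1)).C U),
    SMod.ap (FlatMod.toHom (linPow (𝟙 M.toSMod) (fun _ _ _ _ => rfl) n)) U t = t
  | 0, t => bo_ext (f := SMod.ap (FlatMod.toHom (linPow (𝟙 M.toSMod) (fun _ _ _ _ => rfl) 0)) U)
      (g := AddMonoidHom.id _) (fun u t => rfl) t
  | n + 1, t => bo_ext
      (f := SMod.ap (FlatMod.toHom (linPow (𝟙 M.toSMod) (fun _ _ _ _ => rfl) (n + 1))) U)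
      (g := AddMonoidHom.id _) (fun u t => congrArg (bo M (n + 1) u) (linPow_id n t)) t

theorem linPow_of_zero {M N : FlatMod H D} (k : M.toSMod ⟶ N.toSMod) (hk)
    (h : ∀ m : M.C U, SMod.ap k U m = 0) : ∀ n (t : (pow M (n + 1)).C U),
    SMod.ap (FlatMod.toHom (linPow k hk n)) U t = 0
  | 0, t => bo_ext (f := SMod.ap (FlatMod.toHom (linPow k hk 0)) U) (g := 0)
      (fun u t => (congrArg (bo N 0 u) (h t)).trans (map_zero (bo N 0 u))) t
  | n + 1, t => bo_ext (f := SMod.ap (FlatMod.toHom (linPow k hk (n + 1))) U) (g := 0)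
      (fun u t => (congrArg (bo N (n + 1) u) (linPow_of_zero k hk h n t)).trans
        (map_zero (bo N (n + 1) u))) t

theorem bar_exact (J : H.toSMod.Sub) (M : FlatMod H D) (U : S.Aff) :
    Cpx.Exact (barSecMap (id_mem J) (ModHom.ofHom (kerIncl (ε M))) U)
      (barSecMap (id_mem J) (ModHom.ofHom (ε M)) U) := by
  have h1 : ∀ n (t : (pow (kerMod (ε M)) (n + 1)).C U),
      SMod.ap (FlatMod.toHom (linPow (retr M) (fun _ _ v m => retr_conn M v m) n)) U
        (SMod.ap ((ModHom.ofHom (kerIncl (ε M))).pw (n + 1)).g U t) = t := fun n t => by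
    rw [pw_eq_linPow, linPow_linPow _ _ _ _ (𝟙 _) (fun _ _ _ _ => rfl) (retr_kerIncl M), linPow_id]
  have h2 : ∀ n (t : (pow M (n + 1)).C U), SMod.ap ((ModHom.ofHom (ε M)).pw (n + 1)).g U
      (SMod.ap (FlatMod.toHom (linPow (unitHom H M.toSMod) (fun _ _ v m => unitHom_conn M v m) n)) U
        t) = t := fun n t => by
    rw [pw_eq_linPow, linPow_linPow _ _ _ _ (𝟙 _) (fun _ _ _ _ => rfl) (ε_unit M), linPow_id]
  have h3 : ∀ n (t : (pow (kerMod (ε M)) (n + 1)).C U), SMod.ap ((ModHom.ofHom (ε M)).pw (n + 1)).g U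
      (SMod.ap ((ModHom.ofHom (kerIncl (ε M))).pw (n + 1)).g U t) = 0 := fun n t => by
    rw [pw_eq_linPow, pw_eq_linPow, linPow_linPow _ _ _ _
      (FlatMod.toHom (kerIncl (ε M)) ≫ FlatMod.toHom (ε M)) (fun _ _ v m => by
        rw [SMod.ap_comp, SMod.ap_comp, FlatMod.toHom_conn, FlatMod.toHom_conn]) (fun _ => rfl),
      linPow_of_zero _ _ (ap_kerIncl (ε M))]
  have h4 : ∀ n (t : (pow (Fobj M) (n + 1)).C U),
      SMod.ap ((ModHom.ofHom (kerIncl (ε M))).pw (n + 1)).g U (SMod.ap (FlatMod.toHom (linPow (retr M)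
        (fun _ _ v m => retr_conn M v m) n)) U t) +
      SMod.ap (FlatMod.toHom (linPow (unitHom H M.toSMod) (fun _ _ v m => unitHom_conn M v m) n)) U
        (SMod.ap ((ModHom.ofHom (ε M)).pw (n + 1)).g U t) = t := fun n t => by
    rw [pw_eq_linPow, pw_eq_linPow,
      linPow_linPow _ _ _ _ (retr M ≫ FlatMod.toHom (kerIncl (ε M))) (fun _ _ v m => by
        rw [SMod.ap_comp, SMod.ap_comp, retr_conn, FlatMod.toHom_conn]) (fun _ => rfl)]
    refine (congrArg (_ + ·) (linPow_linPow (P := Fobj M) (FlatMod.toHom (ε M)) _ (unitHom H M.toSMod) _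
      (FlatMod.toHom (ε M) ≫ unitHom H M.toSMod) (fun _ _ v m => by
        rw [SMod.ap_comp, SMod.ap_comp, FlatMod.toHom_conn, unitHom_conn]) (fun _ => rfl) n t)).trans ?_
    exact (linPow_add (N := Fobj M) _ _ (𝟙 _) _ _ (fun _ _ _ _ => rfl) (retr_add M) n t).trans
      (linPow_id n t)
  refine .of_split
    (fun n => cmap J (linPow (retr M) (fun _ _ v m => retr_conn M v m) n) U)
    (fun n => cmap J (linPow (unitHom H M.toSMod) (fun _ _ v m => unitHom_conn M v m) n) U)
    (fun n z => ?_) (fun n z => ?_) (fun n z => ?_) (fun n => map_zero _) (fun n z => ?_)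
  · change (Cobj J (pow (kerMod (ε M)) (n + 1))).C U at z
    change cmap J _ U (cAp _ (id_mem J) _ U z) = z
    induction z using ct_ind with
    | h m t => rw [cAp_ct, cmap_ct, h1, mrHom_id]
    | hadd a b ha hb => rw [map_add, map_add, ha, hb]
  · change (Cobj J (pow M (n + 1))).C U at z
    change cAp _ (id_mem J) _ U (cmap J _ U z) = z
    induction z using ct_ind with
    | h m t => rw [cmap_ct, cAp_ct, h2, mrHom_id]
    | hadd a b ha hb => rw [map_add, map_add, ha, hb]
  · change (Cobj J (pow (kerMod (ε M)) (n + 1))).C U at z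
    change cAp _ (id_mem J) _ U (cAp _ (id_mem J) _ U z) = 0
    induction z using ct_ind with
    | h m t => rw [cAp_ct, cAp_ct, h3, ct_zero]
    | hadd a b ha hb => rw [map_add, map_add, ha, hb, add_zero]
  · change (Cobj J (pow (Fobj M) (n + 1))).C U at z
    change cAp _ (id_mem J) _ U (cmap J _ U z) + cmap J _ U (cAp _ (id_mem J) _ U z) = z
    induction z using ct_ind with
    | h m t => rw [cmap_ct, cAp_ct, cAp_ct, cmap_ct, mrHom_id, ← ct_add, h4]
    | hadd a b ha hb => rw [map_add, map_add, map_add, map_add, add_add_add_comm, ha, hb]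

theorem barSec_dd (M : FlatMod H D) (n : ℕ) (z : (Cobj J (pow M (n + 3))).C U) :
    cmap J (e M (n + 1)) U (cmap J (e M (n + 2)) U z) = 0 := by
  rw [← cmap_comp, e_e]
  induction z using ct_ind with
  | h m t =>
    rw [cmap_ct]
    exact ct_zero m
  | hadd a b ha hb => rw [map_add, ha, hb, add_zero]

/-- The comparison of the Koszul complex with the bar complex is a quasi-isomorphism. -/
theorem compSec_qis (h1 : OneInj H U) (B : DualBasis H J U) (M : FlatMod H D) :
    (compSec hJ M U).Qis := by
  have key : ∀ n (M : FlatMod H D), (compSec hJ M U).Inj n ∧ (compSec hJ M U).Surj n := fun n => by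
    induction n with
    | zero => exact fun M => ⟨comp_inj_zero hJ M, comp_surj_zero hJ M⟩
    | succ n ih =>
      refine fun M => ⟨?_, ?_⟩
      · exact Cpx.inj_shift (k_exact hJ M U) (bar_exact J M U)
          (fun n z => kd_kd_apply _ n z) (fun n z => barSec_dd (Fobj M) n z)
          (kSec_free_acyc hJ h1 B M)
          (fun n z => (compAp_nat (id_mem J) (ModHom.ofHom (kerIncl (ε M))) hJ hJ n z).symm)
          (fun n z => (compAp_nat (id_mem J) (ModHom.ofHom (ε M)) hJ hJ n z).symm)
          (b := compSec hJ (Fobj M) U) (ih _).1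
      · exact Cpx.surj_shift (k_exact hJ M U) (bar_exact J M U)
          (fun n z => barSec_dd (Fobj M) n z)
          (barSec_free_acyc J M U)
          (fun n z => (compAp_nat (id_mem J) (ModHom.ofHom (kerIncl (ε M))) hJ hJ n z).symm)
          (fun n z => (compAp_nat (id_mem J) (ModHom.ofHom (ε M)) hJ hJ n z).symm)
          (b := compSec hJ (Fobj M) U) (ih _).2 (ih _).1
  exact fun n => key n M

end

/-! ### Locality -/

section loc

variable {U V : S.Aff}

theorem isUnit_res_even (a : Γ(S.X, U)) :
    IsUnit (S.res (S.X.affineBasicOpen_le a) (S.even U a)) := by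
  rw [S.res_even]
  exact (S.X.toRingedSpace.isUnit_res_basicOpen a).map _

/-- A section which vanishes on a cover by basic opens vanishes. -/
theorem SMod.QCoh.eq_zero {M : SMod S} (hM : M.QCoh) (y : M.C U)
    (h : ∀ x ∈ U.1, ∃ b : Γ(S.X, U), x ∈ S.X.basicOpen b ∧
      M.res (S.X.affineBasicOpen_le b) y = 0) : y = 0 := by
  let A : Ideal Γ(S.X, U) :=
    { carrier := {b | S.even U b • y = 0}
      zero_mem' := by simp
      add_mem' := fun {a b} ha hb => by
        change S.even U (a + b) • y = 0
        rw [map_add, add_smul, show S.even U a • y = 0 from ha, show S.even U b • y = 0 from hb,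
          add_zero]
      smul_mem' := fun c b hb => by
        change S.even U (c * b) • y = 0
        rw [map_mul, mul_smul, show S.even U b • y = 0 from hb, smul_zero] }
  have h1 : U.1 ≤ ⨆ f : (A.radical : Set Γ(S.X, U)), S.X.basicOpen f.1 := fun x hx => by
    obtain ⟨b, hb, hy⟩ := h x hx
    obtain ⟨n, hn⟩ := (hM U b).2 y hy
    rw [← map_pow] at hn
    exact TopologicalSpace.Opens.mem_iSup.2 ⟨⟨b, n, hn⟩, hb⟩
  have h2 := U.2.self_le_iSup_basicOpen_iff.1 h1
  rw [Ideal.span_eq, Ideal.radical_eq_top] at h2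
  have h3 : (1 : Γ(S.X, U)) ∈ A := h2 ▸ Submodule.mem_top
  have h4 : S.even U 1 • y = 0 := h3
  rwa [map_one, one_smul] at h4

/-- Sections over `V` of a quasi-coherent submodule of `M` are, locally, multiples of restrictions of
sections over `U`; hence additive conditions extend from `U` to `V`. -/
theorem SMod.Sub.QCoh.extend {M : SMod S} (hM : M.QCoh) {I : M.Sub} (hI : I.QCoh) (h : V ≤ U)
    (φ : ∀ W : S.Aff, W ≤ U → (M.C W → M.C W))
    (hs : ∀ W (k : W ≤ U) (f : S.O W) x, S.par W f = f → φ W k (f • x) = f • φ W k x)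
    (hr : ∀ {W W'} (k : W ≤ U) (k' : W' ≤ W) x, x ∈ I.C W → M.res k' (φ W k x) =
      φ W' (k'.trans k) (M.res k' x))
    (h0 : ∀ x ∈ I.C U, φ U le_rfl x = 0) (x : M.C V) (hx : x ∈ I.C V) : φ V h x = 0 := by
  refine hM.eq_zero _ fun z hz => ?_
  obtain ⟨a, b, hab, hza⟩ := exists_basicOpen_le_affine_inter U.2 V.2 z ⟨h hz, hz⟩
  refine ⟨b, hab ▸ hza, ?_⟩
  have hW : S.X.affineBasicOpen b = S.X.affineBasicOpen a := Subtype.ext hab.symm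
  rw [hr h _ x hx]
  have key : ∀ W : S.Aff, W = S.X.affineBasicOpen a → ∀ (k : W ≤ U) (y : M.C W), y ∈ I.C W →
      φ W k y = 0 := by
    rintro _ rfl k y hy
    obtain ⟨n, y', hy', e⟩ := hI U a y hy
    have hu : IsUnit (S.res (S.X.affineBasicOpen_le a) (S.even U a ^ n)) := by
      rw [map_pow]; exact (isUnit_res_even a).pow n
    have hp : S.par _ (S.res (S.X.affineBasicOpen_le a) (S.even U a ^ n)) =
        S.res (S.X.affineBasicOpen_le a) (S.even U a ^ n) := by
      rw [← S.res_par, map_pow, (S.even_range U (S.even U a)).2 ⟨a, rfl⟩]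
    have h1 := hr le_rfl (S.X.affineBasicOpen_le a) y' hy'
    rw [h0 y' hy', map_zero, ← e, hs _ _ _ _ hp] at h1
    exact (hu.smul_eq_zero).1 h1.symm
  exact key _ hW _ _ (I.res_mem _ x hx)

end loc

/-! ### Existence of dual bases -/

section cf

variable {H : PreHeis S} {U V : S.Aff}

theorem cf_res (h1 : OneInj H V) (h : V ≤ U) (x y : H.C U) :
    cf H (H.res h x) (H.res h y) = S.res h (cf H x y) :=
  h1.cf_eq (by rw [← H.res_br, cf_spec, H.res_smul, H.res_one])

theorem OneInj.cf_zsmul (h1 : OneInj H U) (k : ℤ) (x y : H.C U) : cf H y (k • x) = k • cf H y x :=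
  map_zsmul (AddMonoidHom.mk' (fun x => cf H y x) fun a b => h1.cf_add y a b) _ _

theorem OneInj.zsmul_cf (h1 : OneInj H U) (k : ℤ) (x y : H.C U) : cf H (k • x) y = k • cf H x y :=
  map_zsmul (AddMonoidHom.mk' (fun x => cf H x y) fun a b => h1.add_cf a b y) _ _

theorem OneInj.cf_zero_iff (h1 : OneInj H U) {x y : H.C U} : cf H x y = 0 ↔ H.br U x y = 0 :=
  ⟨fun h => by rw [cf_spec, h, zero_smul], fun h => h1.cf_eq (by rw [h, zero_smul])⟩

theorem OneInj.cf_skew (h1 : OneInj H U) {p q : ZMod 2} {x y : H.C U} (hx : H.Homog p x)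
    (hy : H.Homog q y) : cf H x y = -(sg (p * q) • cf H y x) :=
  h1.cf_eq (by rw [H.br_skew U _ _ _ _ hx hy, cf_spec, neg_smul, smul_assoc])

theorem OneInj.cf_smul (h1 : OneInj H U) {q : ZMod 2} {f : S.O U} (hf : S.Homog q f) (x y : H.C U) :
    cf H x (f • y) = f * cf H (H.tw q x) y :=
  h1.cf_eq (by rw [H.br_smul_right q f hf, cf_spec, mul_smul])

/-- Dual bases from dual bases over a single affine open. -/
def DualBasis.mk' {I : H.toSMod.Sub} (hH : H.toSMod.QCoh) (h1 : ∀ U, OneInj H U) (hI : I.QCoh)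
    (n : ℕ) (p : Fin n → ZMod 2) (b l : Fin n → H.C U) (mem : ∀ a, b a ∈ I.C U)
    (hb : ∀ a, H.Homog (p a) (b a)) (hl : ∀ a, H.Homog (p a) (l a))
    (span : ∀ x ∈ I.C U, x = ∑ a, cf H x (l a) • b a) : DualBasis H I U where
  n := n
  p := p
  b := b
  l := l
  mem := mem
  hb := hb
  hl := hl
  span {V} h x hx := by
    refine ⟨fun a => cf H x (H.res h (l a)), fun a => cf_spec _ _, ?_⟩
    refine sub_eq_zero.1 (SMod.Sub.QCoh.extend hH hI h
      (fun W k x => x - ∑ a, cf H x (H.res k (l a)) • H.res k (b a)) (fun W k f x _ => ?_)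
      (fun k k' x _ => ?_) (fun x hx => ?_) x hx)
    · simp only [smul_sub, (h1 W).smul_cf, mul_smul, Finset.smul_sum]
    · simp only [map_sub, map_sum, H.res_smul, ← cf_res (h1 _), H.res_res]
    · simp only [H.res_id]; exact sub_eq_zero.2 (span x hx)

/-- The homogeneous version of a dual basis. -/
theorem homog_span (h1 : OneInj H U) {I : H.toSMod.Sub} {n : ℕ} (b l : Fin n → H.C U)
    (span : ∀ x ∈ I.C U, x = ∑ a, cf H x (l a) • b a) :
    ∀ x ∈ I.C U, x = ∑ a, (cf H x (H.pr 0 (l a)) • H.pr 0 (b a) +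
      cf H x (H.pr 1 (l a)) • H.pr 1 (b a)) := by
  have key : ∀ s, ∀ x ∈ I.C U, H.Homog s x → x = ∑ a, (cf H x (H.pr 0 (l a)) • H.pr 0 (b a) +
      cf H x (H.pr 1 (l a)) • H.pr 1 (b a)) := fun s x hx hs => by
    have h := congrArg (H.pr s) (span x hx)
    rw [hs.pr_eq, if_pos rfl, map_sum] at h
    refine h.trans (Finset.sum_congr rfl fun a _ => ?_)
    have e : cf H x (l a) • b a = cf H x (H.pr 0 (l a)) • H.pr 0 (b a) +
        cf H x (H.pr 1 (l a)) • H.pr 0 (b a) + (cf H x (H.pr 0 (l a)) • H.pr 1 (b a) +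
        cf H x (H.pr 1 (l a)) • H.pr 1 (b a)) := by
      rw [← add_smul, ← add_smul, ← smul_add, ← h1.cf_add, H.pr_add_pr, H.pr_add_pr]
    have hom : ∀ q r, H.Homog (s + q + r) (cf H x (H.pr q (l a)) • H.pr r (b a)) := fun q r =>
      SMod.Homog.smul (h1.cf_homog hs (H.pr_homog q _)) (H.pr_homog r _)
    rw [e, map_add, map_add, map_add, (hom 0 0).pr_eq, (hom 1 0).pr_eq, (hom 0 1).pr_eq,
      (hom 1 1).pr_eq]
    rcases zmod2_cases s with rfl | rfl <;> simp [show (1 + 1 : ZMod 2) = 0 by decide]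
  intro x hx
  have h0 := key 0 _ (I.pr_mem 0 hx) (H.pr_homog 0 x)
  have h1' := key 1 _ (I.pr_mem 1 hx) (H.pr_homog 1 x)
  have := congrArg₂ (· + ·) h0 h1'
  simp only [H.pr_add_pr, ← Finset.sum_add_distrib] at this
  refine this.trans (Finset.sum_congr rfl fun a _ => ?_)
  rw [add_add_add_comm, ← add_smul, ← add_smul, ← h1.add_cf, ← h1.add_cf, H.pr_add_pr]

theorem exists_dual (hH : H.IsHeisenberg) {I : H.toSMod.Sub} (hI : H.IsIsotropic I) (U : S.Aff) :
    ∃ (n : ℕ) (b l : Fin n → H.C U), (∀ a, b a ∈ I.C U) ∧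
      ∀ x ∈ I.C U, x = ∑ a, cf H x (l a) • b a := by
  set N := Submodule.span (S.O U) {H.one U} with hN
  have := hH.finite U
  have := hH.projective U
  have := hI.projective U
  obtain ⟨n, f, g, -, -, hfg⟩ := Module.Finite.exists_comp_eq_id_of_projective (S.O U) (H.C U ⧸ N)
  obtain ⟨s, hs⟩ := Module.projective_lifting_property (I.C U ⊔ N).mkQ LinearMap.id
    (Submodule.mkQ_surjective _)
  have hs' : ∀ q, (I.C U ⊔ N).mkQ (s q) = q := fun q => DFunLike.congr_fun hs q
  choose x hx using fun a : Fin n => Submodule.mkQ_surjective N (f (Pi.single a 1))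
  let φ : Fin n → H.C U →ₗ[S.O U] S.O U := fun a => (LinearMap.proj a).comp (g.comp N.mkQ)
  have hφ : ∀ y, y - ∑ a, φ a y • x a ∈ N := fun y => by
    rw [← Submodule.Quotient.mk_eq_zero, ← Submodule.mkQ_apply, map_sub, map_sum, sub_eq_zero]
    have h2 : f (g (N.mkQ y)) = N.mkQ y := DFunLike.congr_fun hfg _
    rw [← h2]
    conv_lhs => rw [← Finset.univ_sum_single (g (N.mkQ y)), map_sum]
    refine Finset.sum_congr rfl fun a _ => ?_
    rw [map_smul, hx, ← map_smul, ← Pi.single_smul, smul_eq_mul, mul_one]; rfl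
  choose l hl using fun a => hH.nondeg_surj U (φ a) (by
    have : N.mkQ (H.one U) = 0 :=
      (Submodule.Quotient.mk_eq_zero _).2 (Submodule.subset_span rfl)
    change g (N.mkQ (H.one U)) a = 0
    rw [this, map_zero]; rfl)
  have hc : ∀ y a, cf H y (l a) = φ a y := fun y a =>
    OneInj.cf_eq (hH.one_inj U) (hl a y)
  have hxs : ∀ a, ∃ b ∈ I.C U, x a - s ((I.C U ⊔ N).mkQ (x a)) - b ∈ N := fun a => by
    have : x a - s ((I.C U ⊔ N).mkQ (x a)) ∈ I.C U ⊔ N := by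
      rw [← Submodule.Quotient.mk_eq_zero, ← Submodule.mkQ_apply, map_sub, hs', sub_self]
    obtain ⟨b, hb, c, hc, e⟩ := Submodule.mem_sup.1 this
    exact ⟨b, hb, by rw [← e, add_sub_cancel_left]; exact hc⟩
  choose b hb hb' using hxs
  refine ⟨n, b, l, hb, fun y hy => ?_⟩
  simp only [hc]
  have e1 : ∑ a, φ a y • x a - s ((I.C U ⊔ N).mkQ (∑ a, φ a y • x a)) - ∑ a, φ a y • b a ∈ N := by
    have : ∑ a, φ a y • (x a - s ((I.C U ⊔ N).mkQ (x a)) - b a) ∈ N :=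
      Submodule.sum_mem _ fun a _ => N.smul_mem _ (hb' a)
    simpa only [smul_sub, Finset.sum_sub_distrib, map_sum, map_smul] using this
  have e2 : (I.C U ⊔ N).mkQ (∑ a, φ a y • x a) = 0 := by
    have h3 : (∑ a, φ a y • x a) ∈ I.C U ⊔ N := by
      have := (I.C U ⊔ N).sub_mem (Submodule.mem_sup_left hy)
        (Submodule.mem_sup_right (hφ y))
      rwa [sub_sub_cancel] at this
    exact (Submodule.Quotient.mk_eq_zero _).2 h3
  rw [e2, map_zero, sub_zero] at e1
  have e3 : y - ∑ a, φ a y • b a ∈ I.C U ⊓ N := ⟨(I.C U).sub_mem hy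
    (Submodule.sum_mem _ fun a _ => (I.C U).smul_mem _ (hb a)), by
      have := N.add_mem (hφ y) e1
      rwa [sub_add_sub_cancel] at this⟩
  rw [hI.disj] at e3
  exact sub_eq_zero.1 ((Submodule.mem_bot _).1 e3)

theorem sum_fin_two {G : Type*} [AddCommGroup G] (n : ℕ) (f : Fin n → ZMod 2 → G) :
    ∑ a : Fin (n * 2), f (finProdFinEquiv.symm a).1 ((finProdFinEquiv.symm a).2 : Fin 2) =
      ∑ a, (f a 0 + f a 1) := by
  rw [← Equiv.sum_comp finProdFinEquiv, Fintype.sum_prod_type]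
  simp only [Equiv.symm_apply_apply]
  exact Finset.sum_congr rfl fun a _ => Fin.sum_univ_two _

/-- Isotropic subbundles have dual bases. -/
theorem exists_dualBasis (hH : H.IsHeisenberg) {I : H.toSMod.Sub} (hI : H.IsIsotropic I)
    (U : S.Aff) : Nonempty (DualBasis H I U) := by
  obtain ⟨n, b, l, hb, h⟩ := exists_dual hH hI U
  have h' := homog_span (hH.one_inj U) b l h
  refine ⟨DualBasis.mk' hH.qcoh hH.one_inj hI.qcoh (n * 2)
    (fun a => ((finProdFinEquiv.symm a).2 : Fin 2))
    (fun a => H.pr ((finProdFinEquiv.symm a).2 : Fin 2) (b (finProdFinEquiv.symm a).1))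
    (fun a => H.pr ((finProdFinEquiv.symm a).2 : Fin 2) (l (finProdFinEquiv.symm a).1))
    (fun a => I.pr_mem _ (hb _)) (fun a => H.pr_homog _ _) (fun a => H.pr_homog _ _) fun x hx => ?_⟩
  exact (h' x hx).trans (sum_fin_two n fun a q => cf H x (H.pr q (l a)) • H.pr q (b a)).symm

end cf

theorem br_cent {H : PreHeis S} {I : H.toSMod.Sub} {U : S.Aff} {x c : H.C U} (hx : x ∈ I.C U) (hc : c ∈ (H.cent I).C U) :
    H.br U x c = 0 := by
  have : ∀ q r, H.br U (H.pr q x) (H.pr r c) = 0 := fun q r => by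
    rw [H.br_skew U _ _ _ _ (H.pr_homog q x) (H.pr_homog r c),
      PreHeis.cent_br ((H.cent I).pr_mem r hc) (I.pr_mem q hx), smul_zero, neg_zero]
  rw [← H.pr_add_pr x, ← H.pr_add_pr c]
  simp only [map_add, AddMonoidHom.add_apply, this, add_zero]

/-- Dual bases of `I ⊆ H` and of a complement of `c(I)` contained in `J`. -/
structure Pol (H : PreHeis S) (I J : H.toSMod.Sub) (U : S.Aff) where
  n : ℕ
  p : Fin n → ZMod 2
  i : Fin n → H.C U
  j : Fin n → H.C U
  hi : ∀ a, i a ∈ I.C U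
  hj : ∀ a, j a ∈ J.C U
  pi : ∀ a, H.Homog (p a) (i a)
  pj : ∀ a, H.Homog (p a) (j a)
  one_inj : ∀ V ≤ U, OneInj H V
  span : ∀ {V : S.Aff} (h : V ≤ U), ∀ x ∈ I.C V, x = ∑ a, cf H x (H.res h (j a)) • H.res h (i a)
  fix : ∀ a, j a = ∑ b, (-sg (p b) • cf H (j a) (i b)) • j b

namespace Pol

variable {H : PreHeis S} {I J : H.toSMod.Sub} {U : S.Aff}

section proj

variable {n : ℕ} (p : Fin n → ZMod 2) (i j : Fin n → H.C U) (h1 : OneInj H U)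

/-- The projection to the span of the `jₐ` along the centralizer of `I`. -/
def prj : H.C U →ₗ[S.O U] H.C U where
  toFun x := ∑ a, (-sg (p a) • cf H x (i a)) • j a
  map_add' x y := by simp only [h1.add_cf, smul_add, add_smul, Finset.sum_add_distrib]
  map_smul' f x := by
    simp only [h1.smul_cf, RingHom.id_apply, Finset.smul_sum, smul_smul, mul_smul_comm]

theorem prj_apply (x : H.C U) : prj p i j h1 x = ∑ a, (-sg (p a) • cf H x (i a)) • j a := rfl

variable {p i j}

theorem prj_homog (pi : ∀ a, H.Homog (p a) (i a)) (pj : ∀ a, H.Homog (p a) (j a)) {s : ZMod 2}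
    {x : H.C U} (hx : H.Homog s x) : H.Homog s (prj p i j h1 x) := by
  unfold SMod.Homog
  rw [prj_apply, map_sum, Finset.smul_sum]
  refine Finset.sum_congr rfl fun a _ => ?_
  have hf : S.Homog (s + p a) (-sg (p a) • cf H x (i a)) := by
    have := h1.cf_homog hx (pi a)
    unfold SuperScheme.Homog at *
    rw [map_zsmul, this, smul_comm]
  have := SMod.Homog.smul hf (pj a)
  unfold SMod.Homog at this
  rw [this, show s + p a + p a = s by rw [add_assoc, CharTwo.add_self_eq_zero, add_zero]]

theorem br_prj (pi : ∀ a, H.Homog (p a) (i a)) (pj : ∀ a, H.Homog (p a) (j a)) {x : H.C U}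
    {y : H.C U} (hy : y = ∑ a, cf H y (j a) • i a) : H.br U (prj p i j h1 x) y = H.br U x y := by
  have key : ∀ (s t : ZMod 2) (x y : H.C U), H.Homog s x → H.Homog t y →
      H.br U (prj p i j h1 x) y = H.br U x (∑ a, cf H y (j a) • i a) := fun s t x y hs ht => by
    rw [prj_apply, map_sum, map_sum, AddMonoidHom.finsetSum_apply]
    refine Finset.sum_congr rfl fun a _ => ?_
    rw [H.br_smul, H.br_smul_right _ _ (h1.cf_homog ht (pj a)), hs.tw, map_zsmul,
      AddMonoidHom.smul_apply, cf_spec (j a), cf_spec x (i a), h1.cf_skew (pj a) ht, smul_smul,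
      smul_comm (cf H y (j a)), smul_smul (cf H y (j a)), ← smul_assoc]
    congr 1
    rw [S.supercomm U _ _ _ _ (h1.cf_homog ht (pj a)) (h1.cf_homog hs (pi a)),
      smul_mul_assoc, mul_neg, mul_smul_comm, smul_neg, neg_smul, neg_neg, smul_smul, smul_smul]
    congr 1
    generalize p a = q
    clear hs ht
    revert s t q; decide
  have key2 : ∀ (t : ZMod 2) (x y : H.C U), H.Homog t y →
      H.br U (prj p i j h1 x) y = H.br U x (∑ a, cf H y (j a) • i a) := fun t x y ht => by
    induction x using H.toSMod.homog_ind with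
    | hadd a b ha hb => simp only [map_add, AddMonoidHom.add_apply, ha, hb]
    | h s x hs => exact key s t x y hs ht
  have key3 : ∀ (x y : H.C U),
      H.br U (prj p i j h1 x) y = H.br U x (∑ a, cf H y (j a) • i a) := fun x y => by
    induction y using H.toSMod.homog_ind with
    | hadd a b ha hb =>
      simp only [map_add, ha, hb, h1.add_cf, add_smul, Finset.sum_add_distrib]
    | h s y hs => exact key2 s x y hs
  rw [key3, ← hy]

end proj

/-- Existence of polarizations. -/
theorem exists_pol (hH : H.IsHeisenberg) (hI : H.IsIsotropic I)
    (hIJ : ∀ U, (H.cent I).C U ⊔ J.C U = ⊤) (U : S.Aff) : Nonempty (Pol H I J U) := by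
  obtain ⟨B⟩ := exists_dualBasis hH hI U
  have h1 : OneInj H U := hH.one_inj U
  have hj : ∀ a, ∃ j ∈ J.C U, H.Homog (B.p a) j ∧ B.l a - j ∈ (H.cent I).C U := fun a => by
    obtain ⟨c, hc, j, hj, e⟩ := Submodule.mem_sup.1 ((hIJ U).symm ▸ Submodule.mem_top (x := B.l a))
    refine ⟨H.pr (B.p a) j, J.pr_mem _ hj, H.pr_homog _ _, ?_⟩
    have h2 := (B.hl a).pr_eq (B.p a)
    rw [if_pos rfl] at h2
    rw [← h2, ← map_sub, ← e, add_sub_cancel_right]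
    exact (H.cent I).pr_mem _ hc
  choose j hj pj hc using hj
  have hsp : ∀ {V : S.Aff} (h : V ≤ U), ∀ x ∈ I.C V,
      x = ∑ a, cf H x (H.res h (j a)) • H.res h (B.b a) := fun {V} h x hx => by
    obtain ⟨f, hf, e⟩ := B.span h x hx
    refine e.trans (Finset.sum_congr rfl fun a _ => ?_)
    have : cf H x (H.res h (j a)) = f a := OneInj.cf_eq (hH.one_inj V) (by
      have := br_cent hx ((H.cent I).res_mem h _ (hc a))
      rw [map_sub, map_sub, sub_eq_zero] at this
      rw [← this, hf])
    rw [this]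
  let π := prj B.p B.b j h1
  have hsp1 : ∀ x ∈ I.C U, x = ∑ a, cf H x (j a) • B.b a := fun x hx => by
    have := hsp le_rfl x hx
    simpa only [H.res_id] using this
  have hππ : ∀ x, ∀ a, cf H (π x) (B.b a) = cf H x (B.b a) := fun x a =>
    h1.cf_eq (by rw [br_prj h1 B.hb pj (hsp1 _ (B.mem a)), cf_spec])
  have hcp : ∀ {V : S.Aff} (h : V ≤ U) (x : H.C V) (a), x ∈ I.C V →
      cf H x (H.res h (π (j a))) = cf H x (H.res h (j a)) := fun {V} h x a hx => by
    have hc : j a - π (j a) ∈ (H.cent I).C U := fun W k y hy => by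
      have hk : ∀ b, H.br W (H.res k (j a - π (j a))) (H.res k (B.b b)) = 0 := fun b => by
        rw [← H.res_br, map_sub, AddMonoidHom.sub_apply, br_prj h1 B.hb pj (hsp1 _ (B.mem b)),
          sub_self, map_zero]
      have hk' : ∀ z, (∀ b, H.br W (H.res k (B.b b)) z = 0) → H.br W y z = 0 := fun z hz => by
        rw [hsp k y hy, map_sum, AddMonoidHom.finsetSum_apply]
        exact Finset.sum_eq_zero fun b _ => by rw [H.br_smul, hz, smul_zero]
      have hom : H.Homog (B.p a) (H.res k (j a - π (j a))) := by
        refine SMod.Homog.res ?_ k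
        have := prj_homog h1 B.hb pj (pj a)
        unfold SMod.Homog at *
        rw [map_sub, this, pj a, smul_sub]
      have h2 := hk' _ fun b => by
        rw [H.br_skew W _ _ _ _ ((B.hb b).res k) hom, hk, smul_zero, neg_zero]
      induction y using H.toSMod.homog_ind with
      | hadd y z hy' hz' =>
        have hq : ∀ q, H.br W (H.res k (j a - π (j a))) (H.pr q (y + z)) = 0 := fun q => by
          have h3 : H.br W (H.pr q (y + z)) (H.res k (j a - π (j a))) = 0 := by
            rw [hsp k _ (I.pr_mem q hy), map_sum, AddMonoidHom.finsetSum_apply]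
            exact Finset.sum_eq_zero fun b _ => by
              rw [H.br_smul, H.br_skew W _ _ _ _ ((B.hb b).res k) hom, hk, smul_zero, neg_zero,
                smul_zero]
          rw [H.br_skew W _ _ _ _ hom (H.pr_homog q _), h3, smul_zero, neg_zero]
        rw [← H.pr_add_pr (y + z), map_add, hq, hq, add_zero]
      | h q y hq => rw [H.br_skew W _ _ _ _ hom hq, h2, smul_zero, neg_zero]
    refine OneInj.cf_eq (hH.one_inj V) ?_
    have := br_cent hx ((H.cent I).res_mem h _ hc)
    rw [map_sub, map_sub, sub_eq_zero] at this
    rw [← this, cf_spec]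
  refine ⟨⟨B.n, B.p, B.b, fun a => π (j a), B.mem, fun a => ?_, B.hb, fun a =>
    prj_homog h1 B.hb pj (pj a), fun V _ => hH.one_inj V, fun h x hx => ?_, fun a => ?_⟩⟩
  · change ∑ b, (-sg (B.p b) • cf H (j a) (B.b b)) • j b ∈ J.C U
    exact Submodule.sum_mem _ fun b _ => (J.C U).smul_mem _ (hj b)
  · exact (hsp h x hx).trans (Finset.sum_congr rfl fun a _ => by rw [hcp h x a hx])
  · have e : ∀ x, π (π x) = π x := fun x => by
      change prj B.p B.b j h1 (π x) = prj B.p B.b j h1 x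
      simp only [prj_apply, hππ]
    calc π (j a) = π (∑ b, (-sg (B.p b) • cf H (j a) (B.b b)) • j b) := (e _).symm
      _ = ∑ b, (-sg (B.p b) • cf H (π (j a)) (B.b b)) • π (j b) := by
        simp only [map_sum, map_smul, hππ]

variable (P : Pol H I J U)

include P in
theorem oi : OneInj H U := P.one_inj U le_rfl

/-- Restriction of polarizations. -/
@[reducible] def res {V : S.Aff} (h : V ≤ U) : Pol H I J V where
  n := P.n
  p := P.p
  i a := H.res h (P.i a)
  j a := H.res h (P.j a)
  hi a := I.res_mem h _ (P.hi a)
  hj a := J.res_mem h _ (P.hj a)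
  pi a := (P.pi a).res h
  pj a := (P.pj a).res h
  one_inj W k := P.one_inj W (k.trans h)
  span k x hx := by simp only [H.res_res]; exact P.span _ x hx
  fix a := by
    conv_lhs => rw [P.fix a]
    simp only [map_sum, H.res_smul, map_zsmul, cf_res (P.one_inj V h)]

theorem span' (x : H.C U) (hx : x ∈ I.C U) : x = ∑ a, cf H x (P.j a) • P.i a := by
  have := P.span le_rfl x hx
  simpa only [H.res_id] using this

/-- The projection of `H` to a complement of `c(I)` contained in `J`. -/
def π : H.C U →ₗ[S.O U] H.C U := prj P.p P.i P.j P.oi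

theorem π_apply (x : H.C U) : P.π x = ∑ a, (-sg (P.p a) • cf H x (P.i a)) • P.j a := rfl

theorem π_mem (x : H.C U) : P.π x ∈ J.C U := by
  rw [π_apply]
  exact Submodule.sum_mem _ fun a _ => (J.C U).smul_mem _ (P.hj a)

theorem π_j (a : Fin P.n) : P.π (P.j a) = P.j a := (P.fix a).symm

theorem π_π (x : H.C U) : P.π (P.π x) = P.π x := by
  conv_lhs => rw [P.π_apply x, map_sum]
  simp only [map_smul, π_j]; rfl

theorem π_homog {s : ZMod 2} {x : H.C U} (hx : H.Homog s x) : H.Homog s (P.π x) :=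
  prj_homog P.oi P.pi P.pj hx

theorem π_par (x : H.C U) : P.π (H.par U x) = H.par U (P.π x) := by
  induction x using H.toSMod.homog_ind with
  | hadd a b ha hb => simp only [map_add, ha, hb]
  | h s x hs => rw [hs, P.π_homog hs, map_zsmul]

theorem π_res {V : S.Aff} (h : V ≤ U) (x : H.C U) : (P.res h).π (H.res h x) = H.res h (P.π x) := by
  rw [π_apply, π_apply, map_sum]
  simp only [H.res_smul, map_zsmul, cf_res (P.one_inj V h)]

theorem br_π (x y : H.C U) (hy : y ∈ I.C U) : H.br U (P.π x) y = H.br U x y :=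
  br_prj P.oi P.pi P.pj (P.span' y hy)

theorem br_eq_zero_of (x : H.C U) (h : ∀ a, H.br U x (P.i a) = 0) (y : H.C U) (hy : y ∈ I.C U) :
    H.br U x y = 0 := by
  have h0 : P.π x = 0 := by
    rw [π_apply]
    exact Finset.sum_eq_zero fun a _ => by rw [P.oi.cf_zero_iff.2 (h a), smul_zero, zero_smul]
  rw [← P.br_π x y hy, h0, map_zero, AddMonoidHom.zero_apply]

theorem mem_cent_iff (x : H.C U) : x ∈ (H.cent I).C U ↔ ∀ a, H.br U x (P.i a) = 0 := by
  refine ⟨fun h a => PreHeis.cent_br h (P.hi a), fun h V k y hy => ?_⟩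
  exact (P.res k).br_eq_zero_of _ (fun a => by rw [← H.res_br, h, map_zero]) y hy

theorem π_eq_zero_iff (x : H.C U) : P.π x = 0 ↔ x ∈ (H.cent I).C U := by
  rw [P.mem_cent_iff]
  refine ⟨fun h a => ?_, fun h => ?_⟩
  · rw [← P.br_π x _ (P.hi a), h, map_zero, AddMonoidHom.zero_apply]
  · rw [π_apply]
    exact Finset.sum_eq_zero fun a _ => by rw [P.oi.cf_zero_iff.2 (h a), smul_zero, zero_smul]

theorem sub_π_mem (x : H.C U) : x - P.π x ∈ (H.cent I).C U := by
  rw [← P.π_eq_zero_iff, map_sub, π_π, sub_self]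

include P in
/-- The subbundle `J` meets `I` trivially. -/
theorem disj (hJ : ∀ U, ∀ x ∈ J.C U, ∀ y ∈ J.C U, H.br U x y = 0) (x : H.C U) (hx : x ∈ I.C U)
    (hx' : x ∈ J.C U) : x = 0 := by
  rw [P.span' x hx]
  exact Finset.sum_eq_zero fun a _ => by
    rw [P.oi.cf_zero_iff.2 (hJ U _ hx' _ (P.hj a)), zero_smul]

end Pol

/-! ### Contractions with linear functionals -/

/-- Linear functionals of parity `q` on `H` vanishing on the center. -/
structure Func (H : PreHeis S) (U : S.Aff) (q : ZMod 2) where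
  l : H.C U →+ S.O U
  smul : ∀ f x, l (f • x) = f * l x
  one : l (H.one U) = 0
  homog : ∀ s x, H.Homog s x → S.Homog (s + q) (l x)

namespace Func

open UH

variable {H : PreHeis S} {U : S.Aff} {q : ZMod 2} (l : Func H U q)

theorem tw_one : H.tw q (H.one U) = H.one U := by
  rcases zmod2_cases q with rfl | rfl <;> simp [H.par_one]

/-- The ring homomorphism encoding the right superderivation of `U(H)` extending `l`. -/
def mat : UH H U →+* Matrix (Fin 2) (Fin 2) (UH H U) :=
  lift H (AddMonoidHom.mk' (fun x => !![ι H x, oo H U (l.l x); 0, ι H (H.tw q x)])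
      fun x y => by ext i j; fin_cases i <;> fin_cases j <;> simp)
    (by ext i j; fin_cases i <;> fin_cases j <;> simp [tw_one, l.one, ι_one])
    (fun f x => by
      ext i j
      fin_cases i <;> fin_cases j <;>
        simp [Matrix.mul_apply, Fin.sum_univ_two, SMod.tw_smul, tw_one, ι_smul_one_mul,
          l.smul, l.one, oo_apply, smul_smul])
    (fun a b x y hx hy => by
      have h1 : H.Homog a (H.tw q x) := hx.tw' q
      have h2 : H.Homog b (H.tw q y) := hy.tw' q
      have h3 : H.tw q (H.br U x y) = H.br U (H.tw q x) (H.tw q y) := by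
        rcases zmod2_cases q with rfl | rfl <;> simp [H.par_br]
      have k1 := ι_comm H h1 h2
      have k2 := ι_comm H hx hy
      obtain ⟨f, hf⟩ := H.br_mem U x y
      ext i j
      fin_cases i <;> fin_cases j
      · simpa [Matrix.mul_apply, Fin.sum_univ_two] using k2
      · simp only [Matrix.mul_apply, Fin.sum_univ_two, hf, l.smul, l.one, mul_zero, map_zero,
          Matrix.sub_apply,
          Matrix.smul_apply, AddMonoidHom.mk'_apply, Matrix.of_apply, Matrix.cons_val',
          Matrix.cons_val_zero, Matrix.cons_val_one, Matrix.cons_val_fin_one, Fin.zero_eta,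
          Fin.mk_one]
        rw [mul_oo H (l.homog _ _ hx), mul_oo H (l.homog _ _ hy), tw_ι, tw_ι, hx.tw, hy.tw, hx.tw,
          hy.tw]
        simp only [map_zsmul, mul_smul_comm, smul_add, smul_smul, ← sg_add]
        rw [show a * b + (a + q) * b = q * b by
            rw [add_mul, ← add_assoc, CharTwo.add_self_eq_zero, zero_add],
          show (b + q) * a = a * b + q * a by ring]
        abel
      · simp
      · simpa [Matrix.mul_apply, Fin.sum_univ_two, h3] using k1)

theorem mat_ι (x : H.C U) : l.mat (ι H x) = !![ι H x, oo H U (l.l x); 0, ι H (H.tw q x)] := by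
  simp [mat]

/-- The right superderivation of `U(H)` extending `l`. -/
def der : UH H U →+ UH H U where
  toFun a := l.mat a 0 1
  map_zero' := by simp
  map_add' a b := by simp

theorem der_ι (x : H.C U) : l.der (ι H x) = oo H U (l.l x) := by
  change l.mat (ι H x) 0 1 = _
  rw [mat_ι]; simp

theorem der_mul (a b : UH H U) : l.der (a * b) = a * l.der b + l.der a * (mod H).tw q b := by
  have key : ∀ a : UH H U, l.mat a 0 0 = a ∧ l.mat a 1 0 = 0 ∧
      l.mat a 1 1 = (mod H).tw q a := fun a => by
    induction a using ind with
    | hι x => rw [mat_ι, tw_ι]; simp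
    | hadd a b ha hb => simp [ha, hb]
    | hmul a b ha hb =>
      rw [map_mul, UH.tw_mul]
      simp [Matrix.mul_apply, Fin.sum_univ_two, ha, hb]
  change l.mat (a * b) 0 1 = a * l.mat b 0 1 + l.mat a 0 1 * _
  rw [map_mul]
  simp [Matrix.mul_apply, Fin.sum_univ_two, key a, key b]

theorem der_oo (f : S.O U) : l.der (oo H U f) = 0 := by
  rw [oo_apply, der_ι, l.smul, l.one, mul_zero, map_zero]

theorem der_one : l.der 1 = 0 := by rw [← map_one (oo H U), der_oo]

theorem der_par (a : UH H U) : l.der (par H U a) = sg q • par H U (l.der a) := by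
  induction a using ind with
  | hι x =>
    rw [par_ι, der_ι, der_ι]
    have h1 : ∀ f : S.O U, par H U (oo H U f) = oo H U (S.par U f) := fun f => by
      rw [oo_apply, par_ι, H.par_smul, H.par_one, oo_apply]
    rw [h1, ← map_zsmul]
    congr 1
    induction x using H.toSMod.homog_ind with
    | hadd a b ha hb => simp only [map_add, ha, hb, smul_add]
    | h s x hs =>
      rw [hs, map_zsmul, show S.par U (l.l x) = _ from l.homog s x hs, smul_smul, sg_add, mul_comm,
        mul_assoc, sg_sq, mul_one]
  | hadd a b ha hb => simp only [map_add, ha, hb, smul_add]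
  | hmul a b ha hb =>
    have : (mod H).tw q (par H U b) = par H U ((mod H).tw q b) := ((mod H).par_tw q b).symm
    simp only [map_mul, der_mul, ha, hb, map_add, this, smul_add, smul_mul_assoc, mul_smul_comm]

theorem der_tw (t : ZMod 2) (a : UH H U) :
    l.der ((mod H).tw t a) = sg (t * q) • (mod H).tw t (l.der a) := by
  rcases zmod2_cases t with rfl | rfl
  · simp
  · rw [one_mul]; simpa using l.der_par a

theorem der_comm {t : ZMod 2} (m : Func H U t) (a : UH H U) :
    m.der (l.der a) = sg (q * t) • l.der (m.der a) := by
  induction a using ind with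
  | hι x => rw [der_ι, der_ι, der_oo, der_oo, smul_zero]
  | hadd a b ha hb => simp only [map_add, ha, hb, smul_add]
  | hmul a b ha hb =>
    have e : (mod H).tw t ((mod H).tw q b) = (mod H).tw q ((mod H).tw t b) := by
      rw [← (mod H).tw_add, add_comm, (mod H).tw_add]
    have h1 : ∀ {q t : ZMod 2} (l : Func H U q) (m : Func H U t), m.der (l.der (a * b)) =
        a * m.der (l.der b) + m.der a * (mod H).tw t (l.der b) +
        (l.der a * m.der ((mod H).tw q b) + m.der (l.der a) * (mod H).tw t ((mod H).tw q b)) :=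
      fun l m => by rw [l.der_mul, map_add, m.der_mul, m.der_mul]
    rw [h1 l m, h1 m l, ha, hb, m.der_tw, l.der_tw, e, mul_comm t q]
    simp only [smul_add, mul_smul_comm, smul_mul_assoc, smul_smul, sg_sq, one_smul]
    abel

theorem der_zero (h : ∀ x, l.l x = 0) (a : UH H U) : l.der a = 0 := by
  induction a using ind with
  | hι x => rw [der_ι, h, map_zero]
  | hadd a b ha hb => rw [map_add, ha, hb, add_zero]
  | hmul a b ha hb => rw [der_mul, ha, hb, mul_zero, zero_mul, add_zero]

theorem der_add (m k : Func H U q) (h : ∀ x, l.l x + m.l x = k.l x) (a : UH H U) :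
    l.der a + m.der a = k.der a := by
  induction a using ind with
  | hι x => rw [der_ι, der_ι, der_ι, ← h, map_add]
  | hadd a b ha hb => rw [map_add, map_add, map_add, ← ha, ← hb]; abel
  | hmul a b ha hb => rw [der_mul, der_mul, der_mul, ← ha, ← hb]; noncomm_ring

theorem der_smul {t : ZMod 2} {f : S.O U} (hf : S.Homog t f) (m : Func H U (t + q))
    (h : ∀ x, m.l x = l.l x * S.tw q f) (a : UH H U) :
    m.der a = l.der a * oo H U (S.tw q f) := by
  induction a using ind with
  | hι x => rw [der_ι, der_ι, h, map_mul]
  | hadd a b ha hb => rw [map_add, map_add, ha, hb, add_mul]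
  | hmul a b ha hb =>
    have h1 : (mod H).tw q b * oo H U (S.tw q f) =
        oo H U (S.tw q f) * (mod H).tw (t + q) b := by
      rw [mul_oo H (hf.tw' q), (mod H).tw_add]
    rw [der_mul, der_mul, ha, hb, add_mul, mul_assoc, mul_assoc, mul_assoc, h1]

end Func

/-! ### The projection of `U(H)` to the enveloping algebra of the centralizer -/

/-- The connection on the centralizer. -/
@[reducible] def Conn.cent {H : PreHeis S} (D : Conn H) {I : H.toSMod.Sub} (hI : D.Preserves I) :
    Conn (H.centHeis I) where
  nab := D.centNab hI
  dop v := D.centNab_dop hI v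
  smul f hf v x := Subtype.ext (D.smul f hf v x.1)
  flat v w x := Subtype.ext (D.flat v w x.1)
  res h v x := Subtype.ext (D.res h v x.1)
  br v x y := Subtype.ext ((D.br v x.1 y.1).trans (by rw [← Conn.cent_tw]; rfl))
  one v := Subtype.ext (D.one v)

/-- The inclusion of the centralizer. -/
def centIncl {H : PreHeis S} (D : Conn H) {I : H.toSMod.Sub} (hI : D.Preserves I) :
    HHom (D.cent hI) D :=
  ⟨(H.cent I).incl, fun _ => rfl, fun _ _ _ => rfl, fun _ _ => rfl⟩

/-- The projection of the centralizer. -/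
def centProj {H : PreHeis S} (D : Conn H) {I : H.toSMod.Sub} (hI : D.Preserves I) :
    HHom (D.cent hI) (D.red hI) :=
  ⟨H.toRed I, fun _ => rfl, fun _ _ _ => rfl, fun _ _ => rfl⟩

namespace Pol

open UH

variable {H : PreHeis S} {D : Conn H} {I J : H.toSMod.Sub} {U : S.Aff} (P : Pol H I J U)

/-- The inclusion of the sections of the centralizer. -/
abbrev ic (I : H.toSMod.Sub) (U : S.Aff) : (H.centHeis I).C U →+ H.C U := SMod.ap (H.cent I).incl U

/-- The component of a section in the centralizer. -/
def r : H.C U →+ (H.centHeis I).C U :=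
  AddMonoidHom.mk' (fun x => (H.cent I).el (x - P.π x) (P.sub_π_mem x)) fun a b =>
    SMod.Sub.el_ext (by
      change a + b - P.π (a + b) = a - P.π a + (b - P.π b)
      rw [map_add]; abel)

theorem ic_r (x : H.C U) : ic I U (P.r x) = x - P.π x := rfl

theorem ic_inj {x y : (H.centHeis I).C U} (h : ic I U x = ic I U y) : x = y := SMod.Sub.el_ext h

theorem ic_mem (x : (H.centHeis I).C U) : ic I U x ∈ (H.cent I).C U := x.2

theorem π_ic (x : (H.centHeis I).C U) : P.π (ic I U x) = 0 := (P.π_eq_zero_iff _).2 (ic_mem x)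

theorem r_ic (x : (H.centHeis I).C U) : P.r (ic I U x) = x :=
  ic_inj (by rw [ic_r, π_ic, sub_zero])

theorem r_smul (f : S.O U) (x : H.C U) : P.r (f • x) = f • P.r x :=
  ic_inj (by rw [SMod.ap_smul, ic_r, ic_r, map_smul, smul_sub])

theorem r_homog {q : ZMod 2} {x : H.C U} (hx : H.Homog q x) : (H.centHeis I).Homog q (P.r x) :=
  ic_inj (by
    rw [SMod.ap_par, map_zsmul, ic_r, map_sub, hx, P.π_homog hx, smul_sub])

theorem br_ic (x y : (H.centHeis I).C U) :
    ic I U ((H.centHeis I).br U x y) = H.br U (ic I U x) (ic I U y) := rfl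

/-- The functional `[·, π x]` on the centralizer, for `x` of parity `q`. -/
def fn (q : ZMod 2) (x : H.C U) : Func (H.centHeis I) U q where
  l := AddMonoidHom.mk' (fun c => cf H (ic I U c) (P.π (H.pr q x))) fun a b => by
    rw [map_add, P.oi.add_cf]
  smul f c := by
    simp only [AddMonoidHom.mk'_apply]
    rw [SMod.ap_smul, P.oi.smul_cf]
  one := P.oi.cf_zero_iff.2 (H.one_br U _)
  homog s c hc := P.oi.cf_homog (SMod.ap_homog (H.cent I).incl hc) (P.π_homog (H.pr_homog q x))

theorem fn_apply (q : ZMod 2) (x : H.C U) (c : (H.centHeis I).C U) :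
    (P.fn q x).l c = cf H (ic I U c) (P.π (H.pr q x)) := rfl

/-- The right action of `x ∈ H` on `U(c(I))`. -/
def ract (x : H.C U) : UH (H.centHeis I) U →+ UH (H.centHeis I) U :=
  AddMonoidHom.mulRight (ι _ (P.r x)) + (P.fn 0 x).der + (P.fn 1 x).der

theorem ract_apply (x : H.C U) (w : UH (H.centHeis I) U) :
    P.ract x w = w * ι _ (P.r x) + (P.fn 0 x).der w + (P.fn 1 x).der w := rfl

theorem ract_homog {q : ZMod 2} {x : H.C U} (hx : H.Homog q x) (w : UH (H.centHeis I) U) :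
    P.ract x w = w * ι _ (P.r x) + (P.fn q x).der w := by
  have h0 : ∀ t, t ≠ q → (P.fn t x).der w = 0 := fun t ht => Func.der_zero _ (fun c => by
    rw [fn_apply, hx.pr_eq, if_neg ht, map_zero]
    exact P.oi.cf_zero_iff.2 (map_zero _)) w
  rw [ract_apply]
  rcases zmod2_cases q with rfl | rfl
  · rw [h0 1 (by decide), add_zero]
  · rw [h0 0 (by decide), add_zero]

theorem ract_add (x y : H.C U) (w : UH (H.centHeis I) U) :
    P.ract (x + y) w = P.ract x w + P.ract y w := by
  have h : ∀ q, (P.fn q (x + y)).der w = (P.fn q x).der w + (P.fn q y).der w := fun q =>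
    (Func.der_add _ _ _ (fun c => by
      rw [fn_apply, fn_apply, fn_apply, map_add, map_add, P.oi.cf_add]) w).symm
  simp only [ract_apply, map_add, mul_add, h]
  abel

theorem ract_ic (c : (H.centHeis I).C U) (w : UH (H.centHeis I) U) :
    P.ract (ic I U c) w = w * ι _ c := by
  have h : ∀ q, (P.fn q (ic I U c)).der w = 0 := fun q => Func.der_zero _ (fun c' => by
    rw [fn_apply, ← SMod.ap_pr, π_ic]
    exact P.oi.cf_zero_iff.2 (map_zero _)) w
  rw [ract_apply, h, h, add_zero, add_zero, r_ic]

theorem ract_smul (f : S.O U) (x : H.C U) (w : UH (H.centHeis I) U) :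
    P.ract x (w * oo _ U f) = P.ract (f • x) w := by
  refine O_homog_ind (P := fun f => P.ract x (w * oo _ U f) = P.ract (f • x) w)
    (fun a b ha hb => ?_) (fun t f hf => ?_) f
  · rw [map_add, mul_add, map_add, ha, hb, add_smul, ract_add]
  · induction x using H.toSMod.homog_ind with
    | hadd a b ha hb => rw [ract_add, ha, hb, smul_add, ract_add]
    | h q x hx =>
      rw [P.ract_homog hx, P.ract_homog (SMod.Homog.smul hf hx), Func.der_mul, Func.der_oo, mul_zero,
        zero_add, mul_assoc, oo_mul_ι, r_smul, tw_oo]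
      congr 1
      refine (Func.der_smul (P.fn q x) hf _ (fun c => ?_) w).symm
      rw [fn_apply, fn_apply, (SMod.Homog.smul hf hx).pr_eq, if_pos rfl, hx.pr_eq, if_pos rfl,
        map_smul]
      induction c using SMod.homog_ind with
      | hadd a b ha hb => rw [map_add, P.oi.add_cf, ha, hb, P.oi.add_cf, add_mul]
      | h s c hc =>
        have hc' : H.Homog s (ic I U c) := SMod.ap_homog (H.cent I).incl hc
        rw [P.oi.cf_smul hf, hc'.tw, P.oi.zsmul_cf, SuperScheme.Homog.tw hf,
          mul_smul_comm, mul_smul_comm, S.supercomm U _ _ _ _ hf (P.oi.cf_homog hc' (P.π_homog hx)),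
          smul_smul]
        congr 1
        clear hf hx hc hc'
        revert s t q; decide

theorem ract_comm (hJ : ∀ U, ∀ x ∈ J.C U, ∀ y ∈ J.C U, H.br U x y = 0) {q s : ZMod 2} {x y : H.C U}
    (hx : H.Homog q x) (hy : H.Homog s y) (w : UH (H.centHeis I) U) :
    P.ract y (P.ract x w) - sg (q * s) • P.ract x (P.ract y w) = P.ract (H.br U x y) w := by
  have hb : P.ract (H.br U x y) w = w * oo _ U (cf H x y) := by
    have : H.br U x y = ic I U (cf H x y • (H.centHeis I).one U) := cf_spec x y
    rw [this, ract_ic, oo_apply]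
  have e1 : ∀ {t : ZMod 2} {z : H.C U}, H.Homog t z → ∀ c, (P.fn t z).der (ι _ c) =
      oo _ U (cf H (ic I U c) (P.π z)) := fun hz c => by
    rw [Func.der_ι, fn_apply, hz.pr_eq, if_pos rfl]
  have e2 := ι_comm _ (P.r_homog hx) (P.r_homog hy)
  have e3 : (H.centHeis I).br U (P.r x) (P.r y) =
      cf H (x - P.π x) (y - P.π y) • (H.centHeis I).one U :=
    ic_inj ((br_ic _ _).trans (cf_spec _ _))
  rw [e3, ← oo_apply] at e2
  have e4 : cf H x y = cf H (x - P.π x) (y - P.π y) + cf H (x - P.π x) (P.π y) -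
      sg (q * s) • cf H (y - P.π y) (P.π x) := by
    have hy' : H.Homog s (y - P.π y) := by
      have := P.π_homog hy
      unfold SMod.Homog at *
      rw [map_sub, this, hy, smul_sub]
    rw [P.oi.cf_skew hy' (P.π_homog hx), smul_neg, smul_smul, mul_comm s q, sg_sq, one_smul,
      sub_neg_eq_add]
    have h0 : cf H (P.π x) (P.π y) = 0 :=
      P.oi.cf_zero_iff.2 (hJ U _ (P.π_mem x) _ (P.π_mem y))
    have h1 : cf H (P.π x) y = cf H (P.π x) (y - P.π y) := by
      conv_lhs => rw [← sub_add_cancel y (P.π y), P.oi.cf_add, h0, add_zero]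
    rw [← P.oi.cf_add, sub_add_cancel, ← h1, ← P.oi.add_cf, sub_add_cancel]
  rw [hb, e4, map_sub, map_add, ← e2, map_zsmul, P.ract_homog hx, P.ract_homog hy,
    P.ract_homog hy, P.ract_homog hx]
  have t1 : (mod (H.centHeis I)).tw s (ι _ (P.r x)) = sg (q * s) • ι _ (P.r x) := by
    rw [UH.tw_ι, (P.r_homog hx).tw, map_zsmul, mul_comm s q]
  have t2 : (mod (H.centHeis I)).tw q (ι _ (P.r y)) = sg (q * s) • ι _ (P.r y) := by
    rw [UH.tw_ι, (P.r_homog hy).tw, map_zsmul]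
  rw [map_add, map_add, Func.der_mul, Func.der_mul, e1 hx, e1 hy, t1, t2,
    Func.der_comm (P.fn q x) (P.fn s y), ic_r, ic_r]
  simp only [smul_add, smul_smul, add_mul, mul_smul_comm, sg_sq, one_smul, mul_add, mul_sub,
    ← mul_assoc]
  abel

theorem ract_one (w : UH (H.centHeis I) U) : P.ract (H.one U) w = w := by
  have := P.ract_ic ((H.centHeis I).one U) w
  rwa [ι_one, mul_one] at this

theorem ract_smul_one (f : S.O U) (x : H.C U) (w : UH (H.centHeis I) U) :
    P.ract x (P.ract (f • H.one U) w) = P.ract (f • x) w := by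
  rw [← P.ract_smul f x w]
  exact congrArg (P.ract x) (P.ract_ic (f • (H.centHeis I).one U) w)

/-- The right action of `U(H)` on `U(c(I))`. -/
def rho (hJ : ∀ U, ∀ x ∈ J.C U, ∀ y ∈ J.C U, H.br U x y = 0) :
    UH H U →+* (AddMonoid.End (UH (H.centHeis I) U))ᵐᵒᵖ :=
  lift H (AddMonoidHom.mk'
      (fun x => MulOpposite.op (α := AddMonoid.End (UH (H.centHeis I) U)) (P.ract x)) fun x y =>
        congrArg MulOpposite.op (AddMonoidHom.ext fun w => P.ract_add x y w))
    (congrArg MulOpposite.op (AddMonoidHom.ext P.ract_one))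
    (fun f x => congrArg MulOpposite.op (AddMonoidHom.ext (P.ract_smul_one f x)))
    (fun p q x y hx hy => congrArg MulOpposite.op (AddMonoidHom.ext fun w =>
      P.ract_comm hJ hx hy w))

variable (hJ : ∀ U, ∀ x ∈ J.C U, ∀ y ∈ J.C U, H.br U x y = 0)

/-- The right action of a section of `U(H)` on `U(c(I))`. -/
def rr (u : UH H U) : UH (H.centHeis I) U →+ UH (H.centHeis I) U := (P.rho hJ u).unop

theorem rr_ι (x : H.C U) (w : UH (H.centHeis I) U) : P.rr hJ (ι H x) w = P.ract x w := by
  have h : P.rho hJ (ι H x) = .op (P.ract x) := lift_ι H _ _ _ _ x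
  exact DFunLike.congr_fun (congrArg MulOpposite.unop h) w

theorem rr_mul (u v : UH H U) (w : UH (H.centHeis I) U) :
    P.rr hJ (u * v) w = P.rr hJ v (P.rr hJ u w) := by
  rw [rr, map_mul]; rfl

theorem rr_add (u v : UH H U) (w : UH (H.centHeis I) U) :
    P.rr hJ (u + v) w = P.rr hJ u w + P.rr hJ v w := by
  rw [rr, map_add]; rfl

/-- The projection of `U(H)` to `U(c(I))` along `J₁ U(H)`, for `J₁` the span of the `jₐ`. -/
def pr : UH H U →+ UH (H.centHeis I) U :=
  AddMonoidHom.mk' (fun u => P.rr hJ u 1) fun u v => P.rr_add hJ u v 1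

theorem pr_apply (u : UH H U) : P.pr hJ u = P.rr hJ u 1 := rfl

variable (hI : D.Preserves I)

theorem rr_centIncl (u : UH (H.centHeis I) U) (w : UH (H.centHeis I) U) :
    P.rr hJ ((centIncl D hI).uh U u) w = w * u := by
  revert w
  induction u using UH.ind with
  | hι x => exact fun w => by rw [HHom.uh_ι, rr_ι]; exact P.ract_ic x w
  | hadd a b ha hb => exact fun w => by rw [map_add, rr_add, ha, hb, mul_add]
  | hmul a b ha hb => exact fun w => by rw [map_mul, rr_mul, ha, hb, mul_assoc]

theorem pr_mul (u : UH H U) (v : UH (H.centHeis I) U) :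
    P.pr hJ (u * (centIncl D hI).uh U v) = P.pr hJ u * v := by
  rw [pr_apply, rr_mul, rr_centIncl, pr_apply]

theorem pr_centIncl (v : UH (H.centHeis I) U) : P.pr hJ ((centIncl D hI).uh U v) = v := by
  rw [pr_apply, rr_centIncl, one_mul]

/-- Right multiplication commutes with left multiplication by functions and by sections of `J`. -/
theorem rr_mul_left (c : (H.centHeis I).C U)
    (hc : ∀ x, cf H (ic I U c) (P.π x) = 0) (u : UH H U) (w : UH (H.centHeis I) U) :
    P.rr hJ u (ι _ c * w) = ι _ c * P.rr hJ u w := by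
  revert w
  induction u using UH.ind with
  | hι x =>
    intro w
    have h0 : ∀ q, (P.fn q x).der (ι _ c * w) = ι _ c * (P.fn q x).der w := fun q => by
      rw [Func.der_mul, Func.der_ι, fn_apply, hc, map_zero, zero_mul, add_zero]
    rw [rr_ι, rr_ι, ract_apply, ract_apply, h0, h0, mul_add, mul_add, mul_assoc]
  | hadd a b ha hb => exact fun w => by rw [rr_add, ha, hb, rr_add, mul_add]
  | hmul a b ha hb => exact fun w => by rw [rr_mul, ha, hb, rr_mul]

theorem pr_smul (f : S.O U) (u : UH H U) : P.pr hJ (f • u) = f • P.pr hJ u := by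
  have h : ∀ x, cf H (ic I U (f • (H.centHeis I).one U)) (P.π x) = 0 := fun x =>
    P.oi.cf_zero_iff.2 (by
      refine (H.br_smul U f (H.one U) _).trans ?_
      rw [H.one_br, smul_zero])
  have := P.rr_mul_left hJ _ h u 1
  rw [mul_one] at this
  have e : P.rr hJ (oo H U f) 1 = ι _ (f • (H.centHeis I).one U) := by
    rw [oo_apply, rr_ι]
    refine (P.ract_ic (f • (H.centHeis I).one U) 1).trans (one_mul _)
  rw [smul_def, pr_apply, rr_mul, e, this, smul_def, oo_apply, pr_apply]

theorem pr_j (x : H.C U) (u : UH H U) : P.pr hJ (ι H (P.π x) * u) = 0 := by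
  have h0 : P.r (P.π x) = 0 := ic_inj (by rw [ic_r, π_π, sub_self, map_zero])
  rw [pr_apply, rr_mul, rr_ι, ract_apply, h0, Func.der_one, Func.der_one, map_zero, mul_zero,
    add_zero, add_zero, map_zero]

theorem pr_mul_left (c : (H.centHeis I).C U) (hc : ic I U c ∈ J.C U) (u : UH H U) :
    P.pr hJ (ι H (ic I U c) * u) = ι _ c * P.pr hJ u := by
  rw [pr_apply, rr_mul, rr_ι, ract_ic, one_mul, ← mul_one (ι _ c), rr_mul_left, mul_one, pr_apply]
  exact fun x => P.oi.cf_zero_iff.2 (hJ U _ hc _ (P.π_mem x))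

theorem mul_add_mul_aux {R : Type*} [Ring R] (a b c d e f : R) :
    a * b * d + c * d + e * f = a * (b * d) + (e * f + c * d) := by noncomm_ring

theorem mul_π (x : H.C U) {q : ZMod 2} (hx : H.Homog q x) (v : UH (H.centHeis I) U) :
    (centIncl D hI).uh U v * ι H (P.π x) = ι H (P.π x) * (mod H).tw q ((centIncl D hI).uh U v) +
      (centIncl D hI).uh U ((P.fn q x).der v) := by
  induction v using UH.ind with
  | hι c =>
    rw [Func.der_ι, HHom.uh_ι, HHom.uh_oo, fn_apply, hx.pr_eq, if_pos rfl, tw_ι]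
    change ι H (ic I U c) * _ = _ * ι H (H.tw q (ic I U c)) + _
    generalize ic I U c = c
    induction c using H.toSMod.homog_ind with
    | hadd a b ha hb =>
      rw [map_add, map_add, map_add, P.oi.add_cf, map_add, add_mul, ha, hb, mul_add]; abel
    | h s c hc =>
      have := ι_comm H hc (P.π_homog hx)
      rw [cf_spec, ← oo_apply] at this
      rw [← this, hc.tw, map_zsmul, mul_smul_comm, mul_comm q s, add_sub_cancel]
  | hadd a b ha hb => simp only [map_add, add_mul, mul_add, ha, hb]; abel
  | hmul a b ha hb =>
    rw [map_mul, mul_assoc, hb, mul_add, ← mul_assoc, ha, Func.der_mul, map_add,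
      map_mul ((centIncl D hI).uh U), map_mul ((centIncl D hI).uh U), UH.tw_mul, HHom.uh_tw, add_mul]
    exact mul_add_mul_aux (R := UH H U) _ _ _ _ _ _

/-- Modulo `J U(H)`, every section of `U(H)` comes from the centralizer. -/
theorem mk_mul (u : UH H U) (v : UH (H.centHeis I) U) :
    Mr.mk J ((centIncl D hI).uh U v * u) = Mr.mk J ((centIncl D hI).uh U (P.rr hJ u v)) := by
  revert v
  induction u using UH.ind with
  | hι x =>
    intro v
    rw [rr_ι]
    induction x using H.toSMod.homog_ind with
    | hadd a b ha hb => rw [map_add, mul_add, Mr.mk_add, ha, hb, ract_add, map_add, Mr.mk_add]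
    | h q x hx =>
      have e : ι H x = ι H (P.π x) + (centIncl D hI).uh U (ι _ (P.r x)) := by
        rw [HHom.uh_ι]
        change _ = _ + ι H (x - P.π x)
        rw [map_sub, add_sub_cancel]
      have h0 : ∀ a, Mr.mk J (ι H (P.π x) * a) = 0 := fun a =>
        SMod.proj_zero (rIdeal H J) (Submodule.subset_span ⟨_, P.π_mem x, a, rfl⟩)
      rw [P.ract_homog hx, e, mul_add, P.mul_π hI x hx, map_add, map_mul, Mr.mk_add, Mr.mk_add, h0,
        zero_add, Mr.mk_add, add_comm]
  | hadd a b ha hb => exact fun v => by rw [mul_add, Mr.mk_add, ha, hb, rr_add, map_add, Mr.mk_add]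
  | hmul a b ha hb =>
    intro v
    rw [← mul_assoc, ← Mr.rmul_mk, ha, Mr.rmul_mk, hb, rr_mul]

theorem mk_pr (u : UH H U) : Mr.mk J ((centIncl D hI).uh U (P.pr hJ u)) = Mr.mk J u := by
  have := P.mk_mul hJ hI u 1
  rw [map_one, one_mul] at this
  exact this.symm

end Pol

/-! ### Passing to the centralizer -/

/-- The intersection of `J` with the centralizer of `I`. -/
def centSub {H : PreHeis S} (I J : H.toSMod.Sub) : (H.centHeis I).toSMod.Sub where
  C U := (J.C U).comap ((H.cent I).C U).subtype
  par_mem U m hm := J.par_mem U m.1 hm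
  res_mem h m hm := J.res_mem h m.1 hm

section

variable {H : PreHeis S} {D : Conn H} {I J : H.toSMod.Sub} {U V : S.Aff}

theorem mem_centSub (x : (H.centHeis I).C U) :
    x ∈ (centSub I J).C U ↔ Pol.ic I U x ∈ J.C U := Iff.rfl

theorem centIncl_mem (hI : D.Preserves I) (U : S.Aff) :
    ∀ x ∈ (centSub I J).C U, SMod.ap (centIncl D hI).φ U x ∈ J.C U := fun _ hx => hx

theorem centProj_mem (hI : D.Preserves I) (U : S.Aff) :
    ∀ x ∈ (centSub I J).C U, SMod.ap (centProj D hI).φ U x ∈ (H.redSub I J).C U :=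
  fun x hx => ⟨x, hx, rfl⟩

theorem centSub_abel (hJ : ∀ U, ∀ x ∈ J.C U, ∀ y ∈ J.C U, H.br U x y = 0) :
    ∀ U, ∀ x ∈ (centSub I J).C U, ∀ y ∈ (centSub I J).C U, (H.centHeis I).br U x y = 0 :=
  fun U x hx y hy => Subtype.ext (hJ U _ hx _ hy)

theorem OneInj.cent (h1 : OneInj H U) : OneInj (H.centHeis I) U := fun f hf =>
  h1 f (congrArg (Pol.ic I U) hf)

theorem OneInj.red (h1 : OneInj H U)
    (h : ∀ f : S.O U, f • H.one U ∈ I.C U → f • H.one U = 0) : OneInj (H.red I) U := fun f hf => by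
  refine h1 f (h f ?_)
  have h2 : SMod.ap (H.toRed I) U (f • (H.centHeis I).one U) = 0 := hf
  have h3 : f • (H.centHeis I).one U ∈ (H.inCent I).C U := (Submodule.Quotient.mk_eq_zero _).1 h2
  exact h3

/-- The image of a dual basis. -/
def DualBasis.map {H' : PreHeis S} {D' : Conn H'} {J' : H'.toSMod.Sub} (B : DualBasis H J U)
    (F : HHom D D') (hF : ∀ U, ∀ x ∈ J.C U, SMod.ap F.φ U x ∈ J'.C U)
    (hs : ∀ V, ∀ y ∈ J'.C V, ∃ x ∈ J.C V, SMod.ap F.φ V x = y) : DualBasis H' J' U where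
  n := B.n
  p := B.p
  b a := SMod.ap F.φ U (B.b a)
  l a := SMod.ap F.φ U (B.l a)
  mem a := hF U _ (B.mem a)
  hb a := SMod.ap_homog F.φ (B.hb a)
  hl a := SMod.ap_homog F.φ (B.hl a)
  span {V} h y hy := by
    obtain ⟨x, hx, rfl⟩ := hs V y hy
    obtain ⟨f, hf, e⟩ := B.span h x hx
    refine ⟨f, fun a => ?_, ?_⟩
    · rw [← SMod.ap_res, ← F.br, hf, SMod.ap_smul, F.one]
    · refine (congrArg (SMod.ap F.φ V) e).trans ?_
      rw [map_sum]
      exact Finset.sum_congr rfl fun a _ => by rw [SMod.ap_smul, SMod.ap_res]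

theorem Pol.r_res (P : Pol H I J U) (h : V ≤ U) (x : H.C U) :
    (P.res h).r (H.res h x) = (H.centHeis I).res h (P.r x) :=
  Pol.ic_inj (by rw [Pol.ic_r, Pol.π_res, SMod.ap_res, Pol.ic_r, map_sub])

theorem Pol.r_mem (P : Pol H I J U) {x : H.C U} (hx : x ∈ J.C U) : P.r x ∈ (centSub I J).C U := by
  rw [mem_centSub, Pol.ic_r]
  exact (J.C U).sub_mem hx (P.π_mem x)

/-- The dual basis of `J ∩ c(I)` in `c(I)`. -/
def DualBasis.cent (hJ : ∀ U, ∀ x ∈ J.C U, ∀ y ∈ J.C U, H.br U x y = 0) (B : DualBasis H J U)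
    (P : Pol H I J U) : DualBasis (H.centHeis I) (centSub I J) U where
  n := B.n
  p := B.p
  b a := P.r (B.b a)
  l a := P.r (B.l a)
  mem a := P.r_mem (B.mem a)
  hb a := P.r_homog (B.hb a)
  hl a := P.r_homog (B.hl a)
  span {V} h x hx := by
    rw [mem_centSub] at hx
    obtain ⟨f, hf, e⟩ := B.span h _ hx
    refine ⟨f, fun a => Pol.ic_inj ?_, ?_⟩
    · rw [Pol.br_ic, ← Pol.r_res, Pol.ic_r, map_sub, hJ V _ hx _ ((P.res h).π_mem _), sub_zero,
        SMod.ap_smul]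
      exact hf a
    · have := congrArg (P.res h).r e
      rw [map_sum] at this
      refine ((P.res h).r_ic x).symm.trans (this.trans (Finset.sum_congr rfl fun a _ => ?_))
      rw [Pol.r_smul, Pol.r_res]

theorem redSub_surj (V : S.Aff) : ∀ y ∈ (H.redSub I J).C V,
    ∃ x ∈ (centSub I J).C V, SMod.ap (H.toRed I) V x = y := by
  rintro _ ⟨x, hx, rfl⟩
  exact ⟨x, hx, rfl⟩

variable (hJ : ∀ U, ∀ x ∈ J.C U, ∀ y ∈ J.C U, H.br U x y = 0) (hI : D.Preserves I)

theorem Pol.pr_rIdeal (P : Pol H I J U) : ∀ a ∈ (rIdeal H J).C U,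
    P.pr hJ a ∈ (rIdeal (H.centHeis I) (centSub I J)).C U := fun a ha => by
  refine Submodule.span_induction (p := fun a _ => P.pr hJ a ∈ (rIdeal _ (centSub I J)).C U) ?_ ?_
    (fun a b _ _ ha hb => ?_) (fun f a _ ha => ?_) ha
  · rintro _ ⟨j, hj, u, rfl⟩
    have e : UH.ι H j = UH.ι H (P.π j) + UH.ι H (Pol.ic I U (P.r j)) := by
      rw [Pol.ic_r, map_sub, add_sub_cancel]
    rw [e, add_mul, map_add, Pol.pr_j, zero_add, P.pr_mul_left hJ _ (P.r_mem hj)]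
    exact Submodule.subset_span ⟨_, P.r_mem hj, _, rfl⟩
  · rw [map_zero]; exact zero_mem _
  · rw [map_add]; exact add_mem ha hb
  · rw [Pol.pr_smul]; exact Submodule.smul_mem _ f ha

theorem Mr.mk_eq_zero {a : UH H U} : Mr.mk J a = 0 ↔ a ∈ (rIdeal H J).C U :=
  Submodule.Quotient.mk_eq_zero _

include hJ in
/-- The canonical map from `U(c(I)) / (J ∩ c(I)) U(c(I))` to `U(H) / J U(H)` is bijective. -/
theorem mrHom_bij (P : Pol H I J U) : Function.Bijective
    (SMod.ap (mrHom (J := centSub I J) (J' := J) (centIncl D hI) (centIncl_mem hI)) U) := by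
  refine ⟨(injective_iff_map_eq_zero _).2 fun m hm => ?_, fun m => ?_⟩
  · obtain ⟨a, rfl⟩ := Mr.mk_surj m
    rw [mrHom_mk, Mr.mk_eq_zero] at hm
    have := P.pr_rIdeal hJ _ hm
    rw [Pol.pr_centIncl] at this
    exact Mr.mk_eq_zero.2 this
  · obtain ⟨u, rfl⟩ := Mr.mk_surj m
    exact ⟨Mr.mk _ (P.pr hJ u), by rw [mrHom_mk, P.mk_pr hJ hI]⟩

/-- The inverse of a bijective morphism of supermodules. -/
def SMod.invHom {M N : SMod S} (f : M ⟶ N) (hf : ∀ U, Function.Bijective (SMod.ap f U)) : N ⟶ M :=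
  let e : ∀ U, M.C U ≃+ N.C U := fun U => AddEquiv.ofBijective (SMod.ap f U) (hf U)
  have he : ∀ U m, SMod.ap f U ((e U).symm m) = m := fun U m => (e U).apply_symm_apply m
  ⟨fun U => (e U).symm.toAddMonoidHom, fun U a m => (hf U).1 (by
      change SMod.ap f U ((e U).symm (a • m)) = SMod.ap f U (a • (e U).symm m)
      rw [SMod.ap_smul, he, he]), fun U m => (hf U).1 (by
      change SMod.ap f U ((e U).symm _) = SMod.ap f U (M.par U ((e U).symm m))
      rw [SMod.ap_par, he, he]), fun U V h m => (hf V).1 (by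
      change SMod.ap f V ((e V).symm _) = SMod.ap f V (M.res h ((e U).symm m))
      rw [SMod.ap_res, he, he])⟩

theorem SMod.ap_invHom {M N : SMod S} (f : M ⟶ N) (hf : ∀ U, Function.Bijective (SMod.ap f U))
    (m : N.C U) : SMod.ap f U (SMod.ap (SMod.invHom f hf) U m) = m :=
  (AddEquiv.ofBijective (SMod.ap f U) (hf U)).apply_symm_apply m

theorem SMod.invHom_ap {M N : SMod S} (f : M ⟶ N) (hf : ∀ U, Function.Bijective (SMod.ap f U))
    (m : M.C U) : SMod.ap (SMod.invHom f hf) U (SMod.ap f U m) = m :=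
  (AddEquiv.ofBijective (SMod.ap f U) (hf U)).symm_apply_apply m

/-- Pullback of flat modules. -/
@[reducible] def pullMod {H' : PreHeis S} {D' : Conn H'} (F : HHom D D') (N : FlatMod H' D') :
    FlatMod H D where
  toSMod := N.toSMod
  hact {U} := N.hact.comp (SMod.ap F.φ U)
  hact_par x m := by
    simp only [AddMonoidHom.comp_apply]
    rw [N.hact_par, SMod.ap_par]
  hact_res h x m := by
    simp only [AddMonoidHom.comp_apply]
    rw [N.hact_res, SMod.ap_res]
  hact_smul f x m := by
    simp only [AddMonoidHom.comp_apply]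
    rw [SMod.ap_smul, N.hact_smul]
  hact_one m := by
    simp only [AddMonoidHom.comp_apply]
    rw [F.one, N.hact_one]
  hact_br p q x y m hx hy := by
    simp only [AddMonoidHom.comp_apply]
    rw [F.br, N.hact_br p q _ _ m (SMod.ap_homog F.φ hx) (SMod.ap_homog F.φ hy)]
  conn := N.conn
  conn_dop := N.conn_dop
  conn_smul := N.conn_smul
  conn_br := N.conn_br
  conn_res := N.conn_res
  conn_hact v x m := by
    simp only [AddMonoidHom.comp_apply]
    rw [F.nab, N.conn_hact, SMod.ap_tw]

/-- The identity as a morphism from the pullback. -/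
def pullHom {H' : PreHeis S} {D' : Conn H'} (F : HHom D D') (N : FlatMod H' D') :
    ModHom F (pullMod F N) N := ⟨𝟙 _, fun _ _ => rfl, fun _ _ => rfl⟩

/-- The inclusion of the invariants, as a morphism of modules over the centralizer. -/
def invIncl (M : FlatMod H D) :
    ModHom (centIncl D hI) (pullMod (centProj D hI) (M.invMod hI)) M :=
  ⟨(M.inv I).incl, fun _ _ => rfl, fun _ _ => rfl⟩

end

/-! ### Sections of the Lie algebroid in terms of the generator of `M^r(J)` -/

namespace AA

variable {H : PreHeis S} {D : Conn H} {J : H.toSMod.Sub} {U V : S.Aff} {p q : ZMod 2}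

theorem ap_rmul' (A : AA H D J U p) (h : V ≤ U) (u : UH H V) (m : (Mr H J).C V) :
    A.ap h (Mr.rmul u m) = Mr.rmul u (A.ap h m) +
      Mr.rmul (UH.del D (VF.res h A.anchor) u) ((Mr H J).tw p m) := by
  induction u using UH.ind generalizing m with
  | hι x => rw [A.ap_rmul, UH.del_ι]
  | hadd a b ha hb => rw [Mr.rmul_add, map_add, ha, hb, map_add, Mr.rmul_add, Mr.rmul_add]; abel
  | hmul a b ha hb =>
    rw [Mr.rmul_mul, hb, ha, Mr.rmul_mul, UH.del_mul, Mr.rmul_add, map_add, Mr.tw_rmul, Mr.rmul_mul,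
      Mr.rmul_mul, add_assoc]

theorem tw_one' (p : ZMod 2) : (UH.mod H).tw p (1 : UH H V) = 1 := by
  rcases zmod2_cases p with rfl | rfl
  · simp
  · simp only [SMod.tw, twist]
    exact (by simp : _ = UH.par H V 1).trans (map_one _)

theorem ap_mk (A : AA H D J U p) (h : V ≤ U) (u : UH H V) :
    A.ap h (Mr.mk J u) = Mr.rmul u (A.ap h (Mr.mk J 1)) +
      Mr.mk J (UH.del D (VF.res h A.anchor) u) := by
  have := A.ap_rmul' h u (Mr.mk J 1)
  rwa [Mr.rmul_mk, one_mul, Mr.mk_tw, Mr.rmul_mk, tw_one', one_mul] at this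

theorem ap_mk_one (A : AA H D J U p) (h : V ≤ U) :
    A.ap h (Mr.mk J 1) = (Mr H J).res h (A.top (Mr.mk J 1)) := by
  rw [AA.top, A.res_ap, Mr.mk_res, map_one]

theorem ext_one {A B : AA H D J U p} (h : A.anchor = B.anchor)
    (h' : A.top (Mr.mk J 1) = B.top (Mr.mk J 1)) : A = B :=
  AA.ext h fun V k m => by
    obtain ⟨u, rfl⟩ := Mr.mk_surj m
    rw [A.ap_mk, B.ap_mk, h, A.ap_mk_one, B.ap_mk_one, h']

theorem top_homog (A : AA H D J U p) : (Mr H J).Homog p (A.top (Mr.mk J 1)) := by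
  have h1 : (Mr H J).Homog 0 (Mr.mk (U := U) J 1) := by
    rw [SMod.Homog, Mr.mk_par, map_one]; simp
  have := (A.dop le_rfl).homog h1
  rwa [add_zero] at this

theorem top_J (A : AA H D J U p) (h : V ≤ U) {j : H.C V} (hj : j ∈ J.C V) :
    Mr.rmul (UH.ι H j) ((Mr H J).res h (A.top (Mr.mk J 1))) +
      Mr.mk J (UH.ι H (D.nab (VF.res h A.anchor) j)) = 0 := by
  have := A.ap_mk h (UH.ι H j)
  rw [A.ap_mk_one, UH.del_ι] at this
  rw [← this, ← mul_one (UH.ι H j), Mr.mk_J hj, map_zero]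

theorem top_nrm (A : AA H D J U p) (h : V ≤ U) {x : H.C V} (hx : x ∈ (H.cent J).C V)
    (hq : H.Homog q x) : ∃ y, y ∈ (H.cent J).C V ∧ H.Homog (p + q) y ∧
      Mr.rmul (UH.ι H x) ((Mr H J).res h (A.top (Mr.mk J 1))) +
        Mr.mk J (UH.ι H (D.nab (VF.res h A.anchor) x)) -
        sg (p * q) • Mr.lmul x hx ((Mr H J).res h (A.top (Mr.mk J 1))) = Mr.mk J (UH.ι H y) := by
  obtain ⟨y, hy, h1, h2⟩ := A.nrm h x hx hq
  refine ⟨y, hy, h1, ?_⟩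
  have := h2 (Mr.mk J 1)
  rwa [Mr.lmul_mk, mul_one, Mr.lmul_mk, mul_one, A.ap_mk, UH.del_ι, A.ap_mk_one] at this

section mk

variable (d : (Mr H J).C U) (v : VF S U p)

/-- The operator `u ↦ d u + ∇_v u` on `U(H)`, with values in `M^r(J)`. -/
def pre (h : V ≤ U) : UH H V →+ (Mr H J).C V :=
  AddMonoidHom.mk' (fun u => Mr.rmul u ((Mr H J).res h d) + Mr.mk J (UH.del D (VF.res h v) u))
    fun a b => by rw [Mr.rmul_add, map_add, Mr.mk_add]; abel

theorem pre_apply (h : V ≤ U) (u : UH H V) : pre (D := D) d v h u =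
    Mr.rmul u ((Mr H J).res h d) + Mr.mk J (UH.del D (VF.res h v) u) := rfl

theorem pre_mul (h : V ≤ U) (a b : UH H V) : pre (D := D) d v h (a * b) =
    Mr.rmul b (pre (D := D) d v h a) +
      Mr.mk J ((UH.mod H).tw p a * UH.del D (VF.res h v) b) := by
  rw [pre_apply, pre_apply, map_add, Mr.rmul_mk, Mr.rmul_mul, UH.del_mul, Mr.mk_add, add_assoc]

theorem pre_J_mul (h : V ≤ U) {j : H.C V} (hj : j ∈ J.C V) (b : UH H V) :
    pre (D := D) d v h (UH.ι H j * b) = Mr.rmul b (pre (D := D) d v h (UH.ι H j)) := by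
  rw [pre_mul, UH.tw_ι, Mr.mk_J (J.tw_mem p hj), add_zero]

theorem pre_res (h : V ≤ U) {W : S.Aff} (k : W ≤ V) (u : UH H V) :
    (Mr H J).res k (pre (D := D) d v h u) = pre (D := D) d v (k.trans h) (UH.res H k u) := by
  rw [pre_apply, pre_apply, map_add, Mr.res_rmul, SMod.res_res, Mr.mk_res, UH.del_res]; rfl

variable {d}

theorem pre_smul (hd : (Mr H J).Homog p d) (h : V ≤ U) (f : S.O V) (u : UH H V) :
    pre (D := D) d v h (f • u) = v.ap h f • Mr.mk J u + S.tw p f • pre (D := D) d v h u := by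
  rw [UH.smul_def, pre_mul, UH.tw_oo, pre_apply d v h (UH.oo H V f), map_add, UH.del_oo,
    Mr.rmul_mk, Mr.mk_smul, UH.smul_def, add_assoc, add_comm, add_assoc]
  congr 1
  rw [pre_apply, smul_add, Mr.mk_smul, UH.smul_def]
  rw [add_comm]
  congr 1
  rw [← Mr.rmul_smul]
  congr 1
  have hd' : (Mr H J).Homog p ((Mr H J).res h d) := hd.res h
  generalize (Mr H J).res h d = d' at hd'
  induction f using O_homog_ind with
  | hadd f g hf hg => rw [map_add, Mr.rmul_add, hf, hg, map_add, add_smul]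
  | h q f hf =>
    obtain ⟨a, rfl⟩ := Mr.mk_surj d'
    rw [Mr.rmul_mk, UH.mul_oo H hf, ← UH.smul_def, ← Mr.mk_smul, ← Mr.mk_tw, hd'.tw, hf.tw,
      smul_comm, mul_comm, smul_assoc]

theorem pre_par (hd : (Mr H J).Homog p d) (h : V ≤ U) (u : UH H V) :
    pre (D := D) d v h (UH.par H V u) = sg p • (Mr H J).par V (pre (D := D) d v h u) := by
  have hd' : (Mr H J).Homog p ((Mr H J).res h d) := hd.res h
  rw [pre_apply, pre_apply, map_add, Mr.mk_par, smul_add]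
  congr 1
  · generalize (Mr H J).res h d = d' at hd'
    obtain ⟨a, rfl⟩ := Mr.mk_surj d'
    have : Mr.mk J (UH.par H V a) = sg p • Mr.mk J a := hd'
    rw [Mr.rmul_mk, Mr.rmul_mk, Mr.mk_par, map_mul, ← Mr.rmul_mk _ (UH.par H V a), this, map_zsmul, smul_smul, sg_sq,
      one_smul, Mr.rmul_mk]
  · rw [← Mr.mk_zsmul]
    exact congrArg _ ((UH.del_dop D (VF.res h v)).1 u)

/-- The section of the Lie algebroid with symbol `v` sending the generator to `d`. -/
def mk' (hd : (Mr H J).Homog p d)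
    (hj : ∀ (V : S.Aff) (h : V ≤ U), ∀ j ∈ J.C V, pre (D := D) d v h (UH.ι H j) = 0)
    (hn : ∀ (V : S.Aff) (h : V ≤ U) (q : ZMod 2) (x : H.C V) (hx : x ∈ (H.cent J).C V),
      H.Homog q x → ∃ y, y ∈ (H.cent J).C V ∧ H.Homog (p + q) y ∧
        pre (D := D) d v h (UH.ι H x) - sg (p * q) • Mr.lmul x hx ((Mr H J).res h d) =
          Mr.mk J (UH.ι H y)) : AA H D J U p :=
  have hz : ∀ (V : S.Aff) (h : V ≤ U), ∀ a ∈ (rIdeal H J).C V, pre (D := D) d v h a = 0 :=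
      fun V h a ha => by
    induction ha using Submodule.span_induction with
    | mem a ha =>
      obtain ⟨j, hj', u, rfl⟩ := ha
      rw [pre_J_mul d v h hj', hj V h j hj', map_zero]
    | zero => exact map_zero _
    | add x y _ _ hx hy => exact (map_add _ x y).trans (by rw [hx, hy, add_zero])
    | smul f x hx' hx =>
      refine (pre_smul v hd h f x).trans ?_
      rw [hx, Mr.mk_eq_zero.2 hx', smul_zero, smul_zero, add_zero]
  let A : ∀ V : {V : S.Aff // V ≤ U}, (Mr H J).C V.1 →+ (Mr H J).C V.1 := fun V =>
    SMod.qlift _ (pre (D := D) d v V.2) (hz V.1 V.2)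
  have hA : ∀ (V : S.Aff) (h : V ≤ U) u, A ⟨V, h⟩ (Mr.mk J u) = pre (D := D) d v h u :=
    fun V h u => rfl
  ⟨⟨A, v⟩, fun V h => by
    refine ⟨⟨fun m => ?_, fun f m => ?_⟩, fun x m => ?_, fun q x hx hq => ?_, fun W k m => ?_⟩
    · obtain ⟨u, rfl⟩ := Mr.mk_surj m
      rw [Mr.mk_par, hA, hA, pre_par v hd]
    · obtain ⟨u, rfl⟩ := Mr.mk_surj m
      rw [Mr.mk_smul, hA, hA, pre_smul v hd]
    · obtain ⟨u, rfl⟩ := Mr.mk_surj m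
      rw [Mr.rmul_mk, hA, hA, pre_mul, Mr.mk_tw, Mr.rmul_mk, UH.del_ι]
    · obtain ⟨y, hy, h1, h2⟩ := hn V h q x hx hq
      refine ⟨y, hy, h1, fun m => ?_⟩
      obtain ⟨u, rfl⟩ := Mr.mk_surj m
      rw [Mr.lmul_mk, hA, hA, pre_mul, Mr.lmul_mk, ← Mr.rmul_mk u (UH.ι H y), ← h2, map_sub, map_zsmul,
        UH.tw_ι, hq.tw, map_zsmul, smul_mul_assoc, Mr.mk_zsmul, pre_apply d v h u,
        map_add, Mr.lmul_mk, smul_add]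
      have : ∀ m : (Mr H J).C V, Mr.rmul u (Mr.lmul x hx m) = Mr.lmul x hx (Mr.rmul u m) := fun m => by
        obtain ⟨w, rfl⟩ := Mr.mk_surj m
        rw [Mr.rmul_mk, Mr.lmul_mk, Mr.lmul_mk, Mr.rmul_mk, mul_assoc]
      rw [this]
      abel
    · obtain ⟨u, rfl⟩ := Mr.mk_surj m
      rw [Mr.mk_res, hA, hA, pre_res]⟩

theorem mk'_top (hd : (Mr H J).Homog p d) (hj hn) :
    (mk' (D := D) v hd hj hn).top (Mr.mk J 1) = d := by
  change pre (D := D) d v le_rfl 1 = d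
  rw [pre_apply, ← map_one (UH.oo H U), UH.del_oo, map_one, VF.top,
    show (VF.res le_rfl v).ap le_rfl (1 : S.O U) = 0 by
      simpa using (VF.res le_rfl v).const le_rfl 1, map_zero, Mr.rmul_one,
    SMod.res_id]
  exact (congrArg _ (map_zero _)).trans (add_zero d)

end mk

end AA

/-! ### The splitting of the centralizer and the Euler operator on `M^r(J)` -/

namespace Pol

open UH

variable {H : PreHeis S} {D : Conn H} {I J : H.toSMod.Sub} {U V : S.Aff} (P : Pol H I J U)

/-- The projection of `H` to `I` determined by the sections `jₐ`. -/
def ti : H.C U →ₗ[S.O U] H.C U := prj P.p P.j (fun a => -sg (P.p a) • P.i a) P.oi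

theorem ti_apply (x : H.C U) : P.ti x = ∑ a, cf H x (P.j a) • P.i a := by
  rw [ti, prj_apply]
  refine Finset.sum_congr rfl fun a _ => ?_
  rw [smul_assoc, smul_comm (cf H x (P.j a)), smul_smul, neg_mul_neg, sg_sq, one_smul]

theorem ti_mem (x : H.C U) : P.ti x ∈ I.C U := by
  rw [ti_apply]
  exact sum_mem fun a _ => Submodule.smul_mem _ _ (P.hi a)

theorem ti_of_mem {x : H.C U} (hx : x ∈ I.C U) : P.ti x = x := by
  rw [ti_apply, ← P.span' x hx]

theorem ti_homog {q : ZMod 2} {x : H.C U} (hx : H.Homog q x) : H.Homog q (P.ti x) :=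
  prj_homog P.oi P.pj (fun a => by
    have := P.pi a
    unfold SMod.Homog at *
    rw [map_zsmul, this, smul_comm]) hx

theorem ti_eq_zero {x : H.C U} (hx : ∀ a, H.br U x (P.j a) = 0) : P.ti x = 0 := by
  rw [ti_apply]
  exact Finset.sum_eq_zero fun a _ => by rw [P.oi.cf_zero_iff.2 (hx a), zero_smul]

theorem br_ti (x y : H.C U) : H.br U (P.ti x) (P.π y) = H.br U x (P.π y) := by
  refine br_prj P.oi P.pj (fun a => ?_) ?_
  · have := P.pi a
    unfold SMod.Homog at *
    rw [map_zsmul, this, smul_comm]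
  · conv_lhs => rw [← P.π_π y, π_apply]
    exact Finset.sum_congr rfl fun a _ => by rw [P.oi.cf_zsmul]

/-- The element `∑ jₐ iₐ` of `U(H)`. -/
def eu : UH H U := ∑ a, ι H (P.j a) * ι H (P.i a)

theorem eu_res (h : V ≤ U) : UH.res H h P.eu = (P.res h).eu := by
  rw [eu, map_sum]
  exact Finset.sum_congr rfl fun a _ => by rw [map_mul, res_ι, res_ι]

theorem tw_eu (q : ZMod 2) : (mod H).tw q P.eu = P.eu := by
  rw [eu, map_sum]
  refine Finset.sum_congr rfl fun a _ => ?_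
  rw [UH.tw_mul, UH.tw_ι, UH.tw_ι, (P.pi a).tw, (P.pj a).tw, map_zsmul, map_zsmul, smul_mul_smul_comm,
    sg_sq, one_smul]

theorem ι_eu (x : H.C U) : ι H x * P.eu = P.eu * ι H x + ι H (P.ti x) - ι H (P.π x) := by
  induction x using SMod.homog_ind with
  | hadd a b ha hb => simp only [map_add, add_mul, mul_add, ha, hb]; abel
  | h q x hx =>
    have h1 := ad_apply H q x P.eu
    rw [tw_eu] at h1
    rw [sub_eq_iff_eq_add'.1 h1.symm, add_sub_assoc]
    congr 1
    conv_lhs => rw [eu, map_sum]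
    rw [ti_apply, π_apply, map_sum, map_sum, ← Finset.sum_sub_distrib]
    refine Finset.sum_congr rfl fun a _ => ?_
    rw [ad_mul, ad_ι H hx, ad_ι H hx, cf_spec, ← oo_apply, oo_mul_ι, sub_eq_add_neg]
    congr 1
    rw [cf_spec, ← oo_apply, UH.tw_ι, (P.pj a).tw, map_zsmul, smul_mul_assoc,
      UH.mul_oo H (P.oi.cf_homog hx (P.pi a)), UH.tw_ι, (P.pj a).tw, map_zsmul, mul_smul_comm,
      smul_smul, oo_mul_ι, ← sg_add, smul_assoc, map_zsmul, neg_smul, neg_neg]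
    congr 2
    rcases zmod2_cases q with rfl | rfl <;> rcases zmod2_cases (P.p a) with h | h <;> rw [h] <;>
      decide

variable (hI0 : ∀ U, ∀ x ∈ I.C U, ∀ y ∈ I.C U, H.br U x y = 0)

include hI0 in
theorem le_cent {x : H.C U} (hx : x ∈ I.C U) : x ∈ (H.cent I).C U := fun V h y hy =>
  hI0 V _ (I.res_mem h _ hx) y hy

/-- The complement of `I` in the centralizer determined by the sections `jₐ`. -/
def sc : (H.centHeis I).C U →+ (H.centHeis I).C U :=
  AddMonoidHom.mk' (fun c => c - (H.cent I).el (P.ti (ic I U c)) (le_cent hI0 (P.ti_mem _)))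
    fun a b => SMod.Sub.el_ext (by
      simp only [map_sub, map_add, SMod.Sub.ap_el]
      abel)

theorem ic_sc (c : (H.centHeis I).C U) : ic I U (P.sc hI0 c) = ic I U c - P.ti (ic I U c) := by
  change ic I U (c - _) = _
  rw [map_sub, SMod.Sub.ap_el]

/-- The section `c(I) / I → c(I)` determined by the sections `jₐ`. -/
def s : (H.red I).C U →+ (H.centHeis I).C U :=
  SMod.qlift _ (P.sc hI0) fun c hc => ic_inj (by
    rw [ic_sc, P.ti_of_mem (x := ic I U c) hc, sub_self, map_zero])

theorem s_proj (c : (H.centHeis I).C U) : P.s hI0 (SMod.ap (H.toRed I) U c) = P.sc hI0 c := rfl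

theorem ti_s (x : (H.red I).C U) : P.ti (ic I U (P.s hI0 x)) = 0 := by
  obtain ⟨c, rfl⟩ := SMod.proj_surj _ x
  rw [s_proj, ic_sc, map_sub, P.ti_of_mem (P.ti_mem _), sub_self]

theorem toRed_s (x : (H.red I).C U) : SMod.ap (H.toRed I) U (P.s hI0 x) = x := by
  obtain ⟨c, rfl⟩ := SMod.proj_surj _ x
  rw [s_proj]
  change SMod.ap (H.toRed I) U (c - _) = _
  rw [map_sub, sub_eq_self]
  exact SMod.proj_zero _ (P.ti_mem _)

theorem s_of_ti {c : (H.centHeis I).C U} (hc : P.ti (ic I U c) = 0) :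
    P.s hI0 (SMod.ap (H.toRed I) U c) = c :=
  ic_inj (by rw [s_proj, ic_sc, hc, sub_zero])

theorem s_smul (f : S.O U) (x : (H.red I).C U) : P.s hI0 (f • x) = f • P.s hI0 x := by
  obtain ⟨c, rfl⟩ := SMod.proj_surj _ x
  rw [← SMod.ap_smul, s_proj, s_proj]
  exact ic_inj (by rw [ic_sc, SMod.ap_smul, SMod.ap_smul, ic_sc, map_smul, smul_sub])

theorem s_one : P.s hI0 ((H.red I).one U) = (H.centHeis I).one U :=
  P.s_of_ti hI0 (P.ti_eq_zero fun a => H.one_br U _)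

theorem s_br (x y : (H.red I).C U) :
    P.s hI0 ((H.red I).br U x y) = (H.centHeis I).br U (P.s hI0 x) (P.s hI0 y) := by
  obtain ⟨f, hf⟩ := (H.centHeis I).br_mem U (P.s hI0 x) (P.s hI0 y)
  have h1 : (H.red I).br U x y = f • (H.red I).one U := by
    conv_lhs => rw [← P.toRed_s hI0 x, ← P.toRed_s hI0 y]
    exact congrArg (SMod.ap (H.toRed I) U) hf
  rw [h1, s_smul, s_one, hf]

theorem s_homog {q : ZMod 2} {x : (H.red I).C U} (hx : (H.red I).Homog q x) :
    (H.centHeis I).Homog q (P.s hI0 x) := by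
  obtain ⟨c, hc, rfl⟩ := PreHeis.quot_homog hx
  have h1 : H.Homog q (ic I U c) := SMod.ap_homog (H.cent I).incl hc
  have h2 := P.ti_homog h1
  refine ic_inj ?_
  unfold SMod.Homog at h1 h2
  rw [s_proj, SMod.ap_par, ic_sc, map_sub, h1, h2, map_zsmul, ic_sc, smul_sub]

/-- The homomorphism of enveloping algebras given by the section. -/
def su : UH (H.red I) U →+* UH (H.centHeis I) U :=
  lift _ ((ι _).comp (P.s hI0))
    (by rw [AddMonoidHom.comp_apply, s_one, ι_one])
    (fun f x => by
      simp only [AddMonoidHom.comp_apply]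
      rw [s_smul, s_one, s_smul, ι_smul_one_mul])
    (fun p q x y hx hy => by
      simp only [AddMonoidHom.comp_apply]
      rw [s_br, ← ι_comm _ (P.s_homog hI0 hx) (P.s_homog hI0 hy)])

theorem su_ι (x : (H.red I).C U) : P.su hI0 (ι _ x) = ι _ (P.s hI0 x) := by
  rw [su, lift_ι, AddMonoidHom.comp_apply]

theorem su_oo (f : S.O U) : P.su hI0 (oo _ U f) = oo _ U f := by
  rw [oo_apply, su_ι, s_smul, s_one, oo_apply]

variable (hI : D.Preserves I)

theorem centProj_su (u : UH (H.red I) U) : (centProj D hI).uh U (P.su hI0 u) = u := by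
  induction u using UH.ind with
  | hι x => rw [su_ι, HHom.uh_ι]; exact congrArg _ (P.toRed_s hI0 x)
  | hadd a b ha hb => rw [map_add, map_add, ha, hb]
  | hmul a b ha hb => rw [map_mul, map_mul, ha, hb]

theorem su_eu (u : UH (H.red I) U) : (centIncl D hI).uh U (P.su hI0 u) * P.eu =
    P.eu * (centIncl D hI).uh U (P.su hI0 u) := by
  induction u using UH.ind with
  | hι x =>
    rw [su_ι, HHom.uh_ι]
    have := P.ι_eu (ic I U (P.s hI0 x))
    rwa [ti_s, π_ic, map_zero, add_zero, sub_zero] at this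
  | hadd a b ha hb => rw [map_add, map_add, add_mul, mul_add, ha, hb]
  | hmul a b ha hb => rw [map_mul, map_mul, mul_assoc, hb, ← mul_assoc, ha, mul_assoc]

theorem mk_eu_mul (u : UH H U) : Mr.mk J (P.eu * u) = 0 := by
  rw [eu, Finset.sum_mul]
  refine (map_sum (SMod.ap (SMod.proj _ (rIdeal H J)) U) _ _).trans
    (Finset.sum_eq_zero fun a _ => ?_)
  rw [mul_assoc]
  exact Mr.mk_J (P.hj a) _

variable (hJ : ∀ U, ∀ x ∈ J.C U, ∀ y ∈ J.C U, H.br U x y = 0)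

include hJ in
theorem mk_su_eq_zero : ∀ u ∈ (rIdeal (H.red I) (H.redSub I J)).C U,
    Mr.mk J ((centIncl D hI).uh U (P.su hI0 u)) = 0 := fun u hu => by
  induction hu using Submodule.span_induction with
  | mem a ha =>
    obtain ⟨j, hj, u, rfl⟩ := ha
    obtain ⟨c, hc, rfl⟩ := redSub_surj U j hj
    rw [map_mul, map_mul, su_ι, HHom.uh_ι, P.s_of_ti hI0 (P.ti_eq_zero fun a =>
      hJ U _ hc _ (P.hj a))]
    exact Mr.mk_J (j := ic I U c) hc _
  | zero =>
    refine (congrArg (fun z => Mr.mk J ((centIncl D hI).uh U z)) (map_zero (P.su hI0))).trans ?_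
    rw [map_zero]
    exact map_zero (SMod.ap (SMod.proj _ (rIdeal H J)) U)
  | add x y _ _ hx hy =>
    have := map_add (P.su hI0) x y
    refine (congrArg (fun z => Mr.mk J ((centIncl D hI).uh U z)) this).trans ?_
    rw [map_add, Mr.mk_add, hx, hy, add_zero]
  | smul f x _ hx =>
    have := map_mul (P.su hI0) (oo _ U f) x
    refine (congrArg (fun z => Mr.mk J ((centIncl D hI).uh U z)) this).trans ?_
    rw [map_mul, su_oo, HHom.uh_oo, ← UH.smul_def, ← Mr.mk_smul, hx, smul_zero]

/-- The section of `M^r(J) → M^r(J̄)` determined by the sections `jₐ`. -/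
def sM : (Mr (H.red I) (H.redSub I J)).C U →+ (Mr H J).C U :=
  SMod.qlift _ (AddMonoidHom.mk' (fun u => Mr.mk J ((centIncl D hI).uh U (P.su hI0 u)))
    fun a b => by rw [map_add, map_add, Mr.mk_add]) (P.mk_su_eq_zero hI0 hI hJ)

theorem sM_mk (u : UH (H.red I) U) : P.sM hI0 hI hJ (Mr.mk _ u) =
    Mr.mk J ((centIncl D hI).uh U (P.su hI0 u)) := rfl

theorem sM_rmul (u : UH (H.red I) U) (m : (Mr (H.red I) (H.redSub I J)).C U) :
    P.sM hI0 hI hJ (Mr.rmul u m) = Mr.rmul ((centIncl D hI).uh U (P.su hI0 u))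
      (P.sM hI0 hI hJ m) := by
  obtain ⟨w, rfl⟩ := Mr.mk_surj m
  rw [Mr.rmul_mk, sM_mk, sM_mk, Mr.rmul_mk, map_mul, map_mul]

theorem sM_eu (m : (Mr (H.red I) (H.redSub I J)).C U) :
    Mr.rmul P.eu (P.sM hI0 hI hJ m) = 0 := by
  obtain ⟨w, rfl⟩ := Mr.mk_surj m
  rw [sM_mk, Mr.rmul_mk, su_eu, mk_eu_mul]

end Pol

section red

variable {H : PreHeis S} {D : Conn H} {I J : H.toSMod.Sub} {U V : S.Aff}
  (hJ : ∀ U, ∀ x ∈ J.C U, ∀ y ∈ J.C U, H.br U x y = 0) (hI : D.Preserves I)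
  (hP : ∀ U, Nonempty (Pol H I J U))

/-- The canonical map `M^r(J) → M^r(J̄)`. -/
def redMr : Mr H J ⟶ Mr (H.red I) (H.redSub I J) :=
  SMod.invHom (mrHom (J := centSub I J) (J' := J) (centIncl D hI) (centIncl_mem hI))
    (fun U => mrHom_bij hJ hI (hP U).some) ≫
  mrHom (J := centSub I J) (J' := H.redSub I J) (centProj D hI) (centProj_mem hI)

theorem redMr_mrHom (m : (Mr (H.centHeis I) (centSub I J)).C U) :
    SMod.ap (redMr hJ hI hP) U (SMod.ap (mrHom (centIncl D hI) (centIncl_mem hI)) U m) =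
      SMod.ap (mrHom (centProj D hI) (centProj_mem hI)) U m := by
  refine (congrArg (SMod.ap (mrHom (J := centSub I J) (J' := H.redSub I J) (centProj D hI)
    (centProj_mem hI)) U) (SMod.invHom_ap (mrHom (J := centSub I J) (J' := J) (centIncl D hI)
    (centIncl_mem hI)) (fun U => mrHom_bij hJ hI (hP U).some) m))

theorem redMr_mk (u : UH (H.centHeis I) U) :
    SMod.ap (redMr hJ hI hP) U (Mr.mk J ((centIncl D hI).uh U u)) =
      Mr.mk (H.redSub I J) ((centProj D hI).uh U u) := by
  have := redMr_mrHom hJ hI hP (Mr.mk (centSub I J) u)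
  rwa [mrHom_mk, mrHom_mk] at this

include hP hJ in
theorem mk_centIncl_surj (m : (Mr H J).C U) :
    ∃ u : UH (H.centHeis I) U, m = Mr.mk J ((centIncl D hI).uh U u) := by
  obtain ⟨u, rfl⟩ := Mr.mk_surj m
  exact ⟨(hP U).some.pr hJ u, ((hP U).some.mk_pr hJ hI u).symm⟩

theorem redMr_rmul (u : UH (H.centHeis I) U) (m : (Mr H J).C U) :
    SMod.ap (redMr hJ hI hP) U (Mr.rmul ((centIncl D hI).uh U u) m) =
      Mr.rmul ((centProj D hI).uh U u) (SMod.ap (redMr hJ hI hP) U m) := by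
  obtain ⟨w, rfl⟩ := mk_centIncl_surj hJ hI hP m
  rw [Mr.rmul_mk, ← map_mul, redMr_mk, redMr_mk, Mr.rmul_mk, map_mul]

theorem redMr_rmul_ι (c : (H.centHeis I).C U) (m : (Mr H J).C U) :
    SMod.ap (redMr hJ hI hP) U (Mr.rmul (UH.ι H (Pol.ic I U c)) m) =
      Mr.rmul (UH.ι (H.red I) (SMod.ap (H.toRed I) U c)) (SMod.ap (redMr hJ hI hP) U m) := by
  have := redMr_rmul hJ hI hP (UH.ι _ c) m
  rwa [HHom.uh_ι, HHom.uh_ι] at this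

variable (hI0 : ∀ U, ∀ x ∈ I.C U, ∀ y ∈ I.C U, H.br U x y = 0)

include hI0 in
theorem redMr_rmul_mem {x : H.C U} (hx : x ∈ I.C U) (m : (Mr H J).C U) :
    SMod.ap (redMr hJ hI hP) U (Mr.rmul (UH.ι H x) m) = 0 := by
  have := redMr_rmul_ι hJ hI hP ((H.cent I).el x (Pol.le_cent hI0 hx)) m
  rw [SMod.Sub.ap_el] at this
  rw [this, show SMod.ap (H.toRed I) U ((H.cent I).el x (Pol.le_cent hI0 hx)) = 0 from
    SMod.proj_zero _ hx, map_zero]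
  simpa using Mr.rmul_zsmul 0 (0 : UH (H.red I) U) (SMod.ap (redMr hJ hI hP) U m)

variable (P : Pol H I J U)

theorem redMr_sM (m : (Mr (H.red I) (H.redSub I J)).C U) :
    SMod.ap (redMr hJ hI hP) U (P.sM hI0 hI hJ m) = m := by
  obtain ⟨w, rfl⟩ := Mr.mk_surj m
  rw [Pol.sM_mk, redMr_mk, Pol.centProj_su]

theorem evList_redMr_all (u : UH (H.centHeis I) U) : ∀ w : (Mr H J).C U,
    (∃ l : List ℕ, (∀ k ∈ l, k ≠ 0) ∧ evList (Mr.rmul P.eu) l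
      (w - P.sM hI0 hI hJ (SMod.ap (redMr hJ hI hP) U w)) = 0) →
    ∃ l : List ℕ, (∀ k ∈ l, k ≠ 0) ∧ evList (Mr.rmul P.eu) l
      (Mr.rmul ((centIncl D hI).uh U u) w - P.sM hI0 hI hJ (SMod.ap (redMr hJ hI hP) U
        (Mr.rmul ((centIncl D hI).uh U u) w))) = 0 := by
  have happ : ∀ {l l' : List ℕ}, (∀ k ∈ l, k ≠ 0) → (∀ k ∈ l', k ≠ 0) → ∀ k ∈ l ++ l', k ≠ 0 :=
    fun h h' k hk => (List.mem_append.1 hk).elim (h k) (h' k)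
  induction u using UH.ind with
  | hι c =>
    rintro w ⟨l, hl, hw⟩
    have hc : c = P.sc hI0 c + (H.cent I).el (P.ti (Pol.ic I U c)) (Pol.le_cent hI0 (P.ti_mem _)) :=
      Pol.ic_inj (by rw [map_add, Pol.ic_sc, SMod.Sub.ap_el, sub_add_cancel])
    have e1 : Mr.rmul ((centIncl D hI).uh U (UH.ι _ c)) w =
        Mr.rmul (UH.ι H (Pol.ic I U (P.sc hI0 c))) w +
          Mr.rmul (UH.ι H (P.ti (Pol.ic I U c))) w := by
      rw [HHom.uh_ι, ← Mr.rmul_add, ← map_add]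
      refine congrArg (fun z => Mr.rmul (UH.ι H z) w) ?_
      exact (congrArg (Pol.ic I U) hc).trans (map_add _ _ _)
    rw [e1, map_add, map_add, redMr_rmul_mem hJ hI hP hI0 (P.ti_mem _), map_zero, add_zero]
    have e2 : P.sM hI0 hI hJ (SMod.ap (redMr hJ hI hP) U
        (Mr.rmul (UH.ι H (Pol.ic I U (P.sc hI0 c))) w)) = Mr.rmul (UH.ι H (Pol.ic I U (P.sc hI0 c)))
          (P.sM hI0 hI hJ (SMod.ap (redMr hJ hI hP) U w)) := by
      rw [redMr_rmul_ι, Pol.sM_rmul, Pol.su_ι, P.s_of_ti hI0 (c := P.sc hI0 c) (P.ti_s hI0 (SMod.ap (H.toRed I) U c)),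
        HHom.uh_ι]
      rfl
    rw [e2, add_sub_right_comm, ← map_sub]
    refine ⟨l ++ (0 :: l).map (· + 1), happ hl fun k hk => ?_, evList_append_add ?_ ?_⟩
    · obtain ⟨a, _, rfl⟩ := List.mem_map.1 hk
      exact Nat.succ_ne_zero a
    · rw [← evList_map (Mr.rmul (UH.ι H (Pol.ic I U (P.sc hI0 c)))) (fun w => ?_), hw, map_zero]
      rw [← Mr.rmul_mul, ← Mr.rmul_mul]
      have := P.ι_eu (Pol.ic I U (P.sc hI0 c))
      have h0 : P.ti (Pol.ic I U (P.sc hI0 c)) = 0 := P.ti_s hI0 (SMod.ap (H.toRed I) U c)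
      rw [h0, Pol.π_ic, map_zero, add_zero, sub_zero] at this
      rw [this]
    · rw [evList_raise (E := Mr.rmul P.eu) (Mr.rmul (UH.ι H (P.ti (Pol.ic I U c)))) (fun w => ?_)]
      · rw [evList_cons, zero_smul, sub_zero]
        have e3 : w = (w - P.sM hI0 hI hJ (SMod.ap (redMr hJ hI hP) U w)) +
          P.sM hI0 hI hJ (SMod.ap (redMr hJ hI hP) U w) := by abel
        rw [e3, map_add, hw, zero_add, evList_self, Pol.sM_eu, map_zero, map_zero]
      · rw [← Mr.rmul_mul, ← Mr.rmul_mul, P.ι_eu, P.ti_of_mem (P.ti_mem _),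
          (P.π_eq_zero_iff _).2 (Pol.le_cent hI0 (P.ti_mem _)), map_zero, sub_zero, Mr.rmul_add]
  | hadd a b ha hb =>
    intro w hw
    obtain ⟨l, hl, h1⟩ := ha w hw
    obtain ⟨l', hl', h2⟩ := hb w hw
    refine ⟨l ++ l', happ hl hl', ?_⟩
    rw [map_add, Mr.rmul_add, map_add, map_add, add_sub_add_comm]
    exact evList_append_add h1 h2
  | hmul a b ha hb =>
    intro w hw
    rw [map_mul, Mr.rmul_mul]
    exact hb _ (ha w hw)

theorem exists_evList_redMr (w : (Mr H J).C U) : ∃ l : List ℕ, (∀ k ∈ l, k ≠ 0) ∧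
    evList (Mr.rmul P.eu) l (w - P.sM hI0 hI hJ (SMod.ap (redMr hJ hI hP) U w)) = 0 := by
  obtain ⟨u, rfl⟩ := mk_centIncl_surj hJ hI hP w
  have := evList_redMr_all hJ hI hP hI0 P u (Mr.mk J 1) ⟨[], by simp, by
    rw [evList_nil, ← map_one ((centIncl D hI).uh U), redMr_mk, map_one, Pol.sM_mk, map_one, map_one, map_one,
      sub_self]⟩
  rwa [Mr.rmul_mk, one_mul] at this

include hI0 in
theorem eq_zero_of_redMr {w : (Mr H J).C U} (h : SMod.ap (redMr hJ hI hP) U w = 0)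
    (h' : Mr.rmul P.eu w = 0) : w = 0 := by
  obtain ⟨l, hl, hw⟩ := exists_evList_redMr hJ hI hP hI0 P w
  rw [h, map_zero, sub_zero] at hw
  exact eq_zero_of_evList (c := 0) (fun k hk => by exact_mod_cast (hl k hk).symm) hw
    (by rw [h', zero_smul])

include hI0 in
theorem eq_zero_of_rmul_j {w : (Mr H J).C U} (h : SMod.ap (redMr hJ hI hP) U w = 0)
    (h' : ∀ a, Mr.rmul (UH.ι H (P.j a)) w = 0) : w = 0 := by
  refine eq_zero_of_redMr hJ hI hP hI0 P h ?_
  obtain ⟨u, rfl⟩ := Mr.mk_surj w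
  rw [Mr.rmul_mk, Pol.eu, Finset.mul_sum]
  refine (map_sum (SMod.ap (SMod.proj _ (rIdeal H J)) U) _ _).trans
    (Finset.sum_eq_zero fun a _ => ?_)
  have := congrArg (Mr.rmul (UH.ι H (P.i a))) (h' a)
  rw [Mr.rmul_mk, Mr.rmul_mk, map_zero, mul_assoc] at this
  exact this

include hJ hI hP hI0 in
theorem eq_zero_of_eu_neg {w : (Mr H J).C U} (h : Mr.rmul P.eu w = -w) : w = 0 := by
  obtain ⟨l, hl, hw⟩ := exists_evList_redMr hJ hI hP hI0 P w
  refine eq_zero_of_evList (c := -1) (l := 0 :: l) (fun k hk => by omega) ?_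
    (by rw [h, neg_smul, one_smul])
  rw [evList_cons, zero_smul, sub_zero]
  have e3 : w = (w - P.sM hI0 hI hJ (SMod.ap (redMr hJ hI hP) U w)) +
    P.sM hI0 hI hJ (SMod.ap (redMr hJ hI hP) U w) := by abel
  rw [e3, map_add, hw, zero_add, evList_self, Pol.sM_eu, map_zero]

include hI0 in
theorem exists_eu_eq {w : (Mr H J).C U} (h : SMod.ap (redMr hJ hI hP) U w = 0) :
    ∃ d, Mr.rmul P.eu d = w ∧ SMod.ap (redMr hJ hI hP) U d = 0 := by
  obtain ⟨l, hl, hw⟩ := exists_evList_redMr hJ hI hP hI0 P w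
  rw [h, map_zero, sub_zero] at hw
  obtain ⟨c, hc⟩ := solve_evList hl hw
  generalize c • evQuot (Mr.rmul P.eu) l w = x at hc
  refine ⟨x - P.sM hI0 hI hJ (SMod.ap (redMr hJ hI hP) U x), ?_, ?_⟩
  · rw [map_sub, Pol.sM_eu, sub_zero, hc]
  · rw [map_sub, redMr_sM, sub_self]

end red

/-! ### The isomorphism of Lie algebroids -/

section general

variable {H H' : PreHeis S} {D : Conn H} {D' : Conn H'} {F : HHom D D'} {J : H.toSMod.Sub}
  {J' : H'.toSMod.Sub} {hF : ∀ U, ∀ x ∈ J.C U, SMod.ap F.φ U x ∈ J'.C U} {U V : S.Aff}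
  {p q : ZMod 2}

theorem mrHom_lmul {x : H.C U} (hx : x ∈ (H.cent J).C U)
    (hx' : SMod.ap F.φ U x ∈ (H'.cent J').C U) (m : (Mr H J).C U) :
    SMod.ap (mrHom F hF) U (Mr.lmul x hx m) = Mr.lmul _ hx' (SMod.ap (mrHom F hF) U m) := by
  obtain ⟨a, rfl⟩ := Mr.mk_surj m
  rw [Mr.lmul_mk, mrHom_mk, mrHom_mk, Mr.lmul_mk, map_mul, HHom.uh_ι]

theorem mrHom_pre (d : (Mr H J).C U) (v : VF S U p) (h : V ≤ U) (u : UH H V) :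
    SMod.ap (mrHom F hF) V (AA.pre (D := D) d v h u) =
      AA.pre (D := D') (SMod.ap (mrHom F hF) U d) v h (F.uh V u) := by
  rw [AA.pre_apply, AA.pre_apply, map_add, mrHom_rmul, mrHom_mk, HHom.uh_del, SMod.ap_res]

theorem AA.ap_eq_pre (A : AA H D J U p) (h : V ≤ U) (u : UH H V) :
    A.ap h (Mr.mk J u) = AA.pre (D := D) (A.top (Mr.mk J 1)) A.anchor h u := by
  rw [A.ap_mk, A.ap_mk_one, AA.pre_apply]

theorem Compat.of_one {A : AA H D J U p} {A' : AA H' D' J' U p} (h : A'.anchor = A.anchor)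
    (h' : SMod.ap (mrHom F hF) U (A.top (Mr.mk J 1)) = A'.top (Mr.mk J' 1)) : Compat F hF A A' :=
  ⟨h, fun V k m => by
    obtain ⟨u, rfl⟩ := Mr.mk_surj m
    rw [AA.ap_eq_pre A k u, mrHom_pre, mrHom_mk, AA.ap_eq_pre A' k (F.uh V u), h', h]⟩

end general

/-- The data of an isotropic subbundle `I` and a subbundle `J` such that `c(I) + J = H`. -/
structure RedCtx {H : PreHeis S} (D : Conn H) (I J : H.toSMod.Sub) : Prop where
  hJ : ∀ U, ∀ x ∈ J.C U, ∀ y ∈ J.C U, H.br U x y = 0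
  hI : D.Preserves I
  hP : ∀ U, Nonempty (Pol H I J U)
  hI0 : ∀ U, ∀ x ∈ I.C U, ∀ y ∈ I.C U, H.br U x y = 0
  disj : ∀ (U : S.Aff) (f : S.O U), f • H.one U ∈ I.C U → f • H.one U = 0

namespace RedCtx

open Pol UH

variable {H : PreHeis S} {D : Conn H} {I J : H.toSMod.Sub} (R : RedCtx D I J) {U V W : S.Aff}
  {p q : ZMod 2}

/-- The map `M^r(J ∩ c(I)) → M^r(J)`. -/
abbrev bM (R : RedCtx D I J) : Mr (H.centHeis I) (centSub I J) ⟶ Mr H J :=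
  mrHom (centIncl D R.hI) (centIncl_mem R.hI)

/-- The map `M^r(J ∩ c(I)) → M^r(J̄)`. -/
abbrev aM (R : RedCtx D I J) : Mr (H.centHeis I) (centSub I J) ⟶ Mr (H.red I) (H.redSub I J) :=
  mrHom (centProj D R.hI) (centProj_mem R.hI)

/-- The map `M^r(J) → M^r(J̄)`. -/
abbrev rM (R : RedCtx D I J) : Mr H J ⟶ Mr (H.red I) (H.redSub I J) := redMr R.hJ R.hI R.hP

theorem bM_bij (U : S.Aff) : Function.Bijective (SMod.ap R.bM U) :=
  mrHom_bij R.hJ R.hI (R.hP U).some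

theorem mem_cent_iff (c : (H.centHeis I).C U) :
    c ∈ ((H.centHeis I).cent (centSub I J)).C U ↔ ∀ (V : S.Aff) (h : V ≤ U) (x : (H.centHeis I).C V),
      ic I V x ∈ J.C V → H.br V (H.res h (ic I U c)) (ic I V x) = 0 := by
  have e : ∀ (V : S.Aff) (h : V ≤ U) (x : (H.centHeis I).C V),
      ic I V ((H.centHeis I).br V ((H.centHeis I).res h c) x) =
        H.br V (H.res h (ic I U c)) (ic I V x) := fun V h x => by rw [br_ic, SMod.ap_res]
  refine ⟨fun hc V h x hx => ?_, fun hc V h x hx => ic_inj ?_⟩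
  · rw [← e, hc V h x hx, map_zero]
  · rw [e, hc V h x hx, map_zero]

include R in
theorem mem_cent_red (c : (H.centHeis I).C U) :
    SMod.ap (H.toRed I) U c ∈ ((H.red I).cent (H.redSub I J)).C U ↔
      c ∈ ((H.centHeis I).cent (centSub I J)).C U := by
  have e : ∀ (V : S.Aff) (h : V ≤ U) (x : (H.centHeis I).C V),
      (H.red I).br V ((H.red I).res h (SMod.ap (H.toRed I) U c)) (SMod.ap (H.toRed I) V x) =
        SMod.ap (H.toRed I) V ((H.centHeis I).br V ((H.centHeis I).res h c) x) :=
    fun V h x => rfl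
  refine ⟨fun hc V h x hx => ?_, fun hc V h y hy => ?_⟩
  · have h1 := hc V h _ ((centProj_mem R.hI V x hx))
    have h2 := (e V h x).symm.trans h1
    have h3 : (H.centHeis I).br V ((H.centHeis I).res h c) x ∈ (H.inCent I).C V :=
      (Submodule.Quotient.mk_eq_zero _).1 h2
    refine ic_inj ?_
    have h4 : ic I V ((H.centHeis I).br V ((H.centHeis I).res h c) x) ∈ I.C V := h3
    rw [br_ic, cf_spec] at h4 ⊢
    rw [R.disj V _ h4, map_zero]
  · obtain ⟨x, hx, rfl⟩ := redSub_surj V y hy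
    exact (e V h x).trans ((congrArg _ (hc V h x hx)).trans (map_zero _))

/-- Sections of `I` are central in the centralizer. -/
theorem mul_ι_I {c : (H.centHeis I).C U} (hc : ic I U c ∈ I.C U) (hq : (H.centHeis I).Homog q c)
    (u : UH (H.centHeis I) U) : ι _ c * u = (mod _).tw q u * ι _ c := by
  have : ad _ q c u = 0 := by
    induction u using UH.ind with
    | hι x =>
      rw [ad_ι _ hq, show (H.centHeis I).br U c x = 0 from H.centBr_left I c x hc, map_zero]
    | hadd a b ha hb => rw [map_add, ha, hb, add_zero]
    | hmul a b ha hb => rw [ad_mul, ha, hb, zero_mul, mul_zero, add_zero]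
  rwa [ad_apply, sub_eq_zero] at this

/-- The element of `M^r(J ∩ c(I))` defining the section of the Lie algebroid of `c(I)`. -/
def dC (R : RedCtx D I J) (A : AA H D J U p) : (Mr (H.centHeis I) (centSub I J)).C U :=
  SMod.ap (SMod.invHom R.bM R.bM_bij) U (A.top (Mr.mk J 1))

theorem bM_dC (A : AA H D J U p) : SMod.ap R.bM U (R.dC A) = A.top (Mr.mk J 1) :=
  SMod.ap_invHom R.bM R.bM_bij _

theorem dC_homog (A : AA H D J U p) : (Mr _ (centSub I J)).Homog p (R.dC A) :=
  SMod.ap_homog _ A.top_homog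

theorem cent_nrm (P : Pol H I J V) (A : AA H D J U p) (h : V ≤ U) (x : (H.centHeis I).C V)
    (hx : x ∈ ((H.centHeis I).cent (centSub I J)).C V) (hq : (H.centHeis I).Homog q x) :
    ∃ y, y ∈ ((H.centHeis I).cent (centSub I J)).C V ∧ (H.centHeis I).Homog (p + q) y ∧
      AA.pre (D := D.cent R.hI) (R.dC A) A.anchor h (ι _ x) -
        sg (p * q) • Mr.lmul x hx ((Mr _ (centSub I J)).res h (R.dC A)) =
          Mr.mk (centSub I J) (ι _ y) := by
  have hq' : H.Homog q (ic I V x) := SMod.ap_homog (H.cent I).incl hq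
  obtain ⟨i, hi⟩ : ∃ i : (H.centHeis I).C V, ic I V i = P.ti (ic I V x) :=
    ⟨(H.cent I).el _ (le_cent R.hI0 (P.ti_mem _)), rfl⟩
  have hiI : ic I V i ∈ I.C V := hi ▸ P.ti_mem _
  have hiq : (H.centHeis I).Homog q i := ic_inj (by
    have := P.ti_homog hq'
    unfold SMod.Homog at this
    rw [SMod.ap_par, hi, this, map_zsmul, hi])
  have hic : i ∈ ((H.centHeis I).cent (centSub I J)).C V := fun W k y hy =>
    H.centBr_left I _ _ ((H.inCent I).res_mem k i hiI)
  obtain ⟨x', hx'⟩ : ∃ x', x = x' + i := ⟨x - i, (sub_add_cancel x i).symm⟩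
  have hxc : x' ∈ ((H.centHeis I).cent (centSub I J)).C V := by
    rw [eq_sub_of_add_eq hx'.symm]
    exact sub_mem hx hic
  have hxq : (H.centHeis I).Homog q x' := by
    have := hq
    unfold SMod.Homog at *
    rw [eq_sub_of_add_eq hx'.symm, map_sub, this, hiq, smul_sub]
  have hti : P.ti (ic I V x') = 0 := by
    rw [eq_sub_of_add_eq hx'.symm, map_sub, hi, map_sub, P.ti_of_mem (P.ti_mem _), sub_self]
  have hxJ : ic I V x' ∈ (H.cent J).C V := fun W k j hj => by
    obtain ⟨a, ha⟩ : ∃ a, a = ic I V x' := ⟨_, rfl⟩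
    rw [← ha]
    have e1 : j = (P.res k).π j + ic I W ((P.res k).r j) := by rw [ic_r]; abel
    have e2 : (P.res k).ti (H.res k a) = 0 := by
      have := congrArg (H.res k) hti
      rw [ti_apply, map_sum, map_zero] at this
      rw [ti_apply, ← this]
      refine Finset.sum_congr rfl fun b _ => ?_
      rw [H.res_smul, ← cf_res (P.one_inj W k), ha]
    rw [e1, map_add, ← br_ti, e2, map_zero, AddMonoidHom.zero_apply, zero_add, ha]
    exact (mem_cent_iff x').1 hxc W k _ ((P.res k).r_mem hj)
  obtain ⟨z, hz, z1, z2⟩ := A.top_nrm h hxJ (SMod.ap_homog (H.cent I).incl hxq)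
  refine ⟨P.r z + (D.cent R.hI).nab (VF.res h A.anchor) i, add_mem ?_ ?_, ?_, ?_⟩
  · rw [mem_cent_iff]
    intro W k y hy
    rw [ic_r, map_sub, map_sub, AddMonoidHom.sub_apply, hz W k _ hy,
      R.hJ W _ (J.res_mem k _ (P.π_mem z)) _ hy, sub_zero]
  · exact fun W k y hy => H.centBr_left I _ _ ((H.inCent I).res_mem k _
      (D.centNab_mem R.hI _ i hiI))
  · have h1 := P.r_homog z1
    have h2 := ((D.cent R.hI).dop (VF.res h A.anchor)).homog hiq
    unfold SMod.Homog at *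
    rw [map_add, h1, h2, smul_add]
  · have hd : (Mr _ (centSub I J)).Homog p ((Mr _ (centSub I J)).res h (R.dC A)) :=
      (R.dC_homog A).res h
    have k1 : sg (p * q) • Mr.lmul i hic ((Mr _ (centSub I J)).res h (R.dC A)) =
        Mr.rmul (ι _ i) ((Mr _ (centSub I J)).res h (R.dC A)) := by
      generalize (Mr _ (centSub I J)).res h (R.dC A) = d at hd
      obtain ⟨u, rfl⟩ := Mr.mk_surj d
      rw [Mr.lmul_mk, mul_ι_I hiI hiq, ← Mr.rmul_mk, ← Mr.mk_tw, hd.tw, map_zsmul, smul_smul,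
        mul_comm q p, sg_sq, one_smul]
    have k2 : AA.pre (D := D.cent R.hI) (R.dC A) A.anchor h (ι _ x') -
        sg (p * q) • Mr.lmul x' hxc ((Mr _ (centSub I J)).res h (R.dC A)) =
          Mr.mk (centSub I J) (ι _ (P.r z)) := by
      refine (R.bM_bij V).1 ?_
      rw [map_sub, map_zsmul, mrHom_pre, mrHom_mk, HHom.uh_ι, HHom.uh_ι,
        mrHom_lmul (F := centIncl D R.hI) hxc hxJ, SMod.ap_res, R.bM_dC, AA.pre_apply, del_ι]
      refine z2.trans ?_
      have e3 : z = P.π z + ic I V (P.r z) := by rw [ic_r]; abel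
      conv_lhs => rw [e3, map_add, Mr.mk_add, ← mul_one (ι H (P.π z)), Mr.mk_J (P.π_mem z), zero_add]
      rfl
    have k3 : Mr.lmul x hx ((Mr _ (centSub I J)).res h (R.dC A)) =
        Mr.lmul x' hxc ((Mr _ (centSub I J)).res h (R.dC A)) +
        Mr.lmul i hic ((Mr _ (centSub I J)).res h (R.dC A)) := by
      subst hx'
      exact Mr.lmul_add _ _ _ _ _ _
    rw [k3, smul_add, k1, hx', map_add, map_add, map_add, Mr.mk_add, ← k2,
      AA.pre_apply _ _ _ (ι _ i), del_ι]
    abel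

/-- The section of the Lie algebroid of the centralizer. -/
def toCent (R : RedCtx D I J) (A : AA H D J U p) :
    AA (H.centHeis I) (D.cent R.hI) (centSub I J) U p :=
  AA.mk' (d := R.dC A) A.anchor (R.dC_homog A)
    (fun V h j hj => (R.bM_bij V).1 (by
      rw [mrHom_pre, R.bM_dC, HHom.uh_ι, map_zero, AA.pre_apply, del_ι]
      exact A.top_J h hj))
    (fun V h q x hx hq => R.cent_nrm (R.hP V).some A h x hx hq)

theorem toCent_compat (A : AA H D J U p) :
    Compat (centIncl D R.hI) (centIncl_mem R.hI) (R.toCent A) A :=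
  Compat.of_one rfl (by
    rw [toCent, AA.mk'_top]
    exact R.bM_dC A)

/-- The section of the Lie algebroid of `c(I) / I` induced by a section of the Lie algebroid of the
centralizer. -/
def toRed (R : RedCtx D I J) (A : AA (H.centHeis I) (D.cent R.hI) (centSub I J) U p) :
    AA (H.red I) (D.red R.hI) (H.redSub I J) U p :=
  AA.mk' (d := SMod.ap R.aM U (A.top (Mr.mk _ 1))) A.anchor
    (SMod.ap_homog _ A.top_homog)
    (fun V h j hj => by
      obtain ⟨x, hx, rfl⟩ := redSub_surj V j hj
      have := mrHom_pre (F := centProj D R.hI) (hF := centProj_mem R.hI) (A.top (Mr.mk _ 1))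
        A.anchor h (ι _ x)
      rw [HHom.uh_ι] at this
      refine this.symm.trans ?_
      rw [AA.pre_apply, del_ι, A.top_J h hx, map_zero])
    (fun V h q x hx hq => by
      obtain ⟨c, hc, rfl⟩ := PreHeis.quot_homog hq
      have hcc := (R.mem_cent_red c).1 hx
      obtain ⟨y, hy, y1, y2⟩ := A.top_nrm h hcc hc
      refine ⟨SMod.ap (H.toRed I) V y, (R.mem_cent_red y).2 hy,
        SMod.ap_homog (H.toRed I) y1, ?_⟩
      have := congrArg (SMod.ap R.aM V) y2
      rw [map_sub, map_zsmul, mrHom_mk, HHom.uh_ι, mrHom_lmul (F := centProj D R.hI) hcc hx,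
        SMod.ap_res] at this
      refine Eq.trans ?_ this
      have h3 := mrHom_pre (F := centProj D R.hI) (hF := centProj_mem R.hI) (A.top (Mr.mk _ 1))
        A.anchor h (ι _ c)
      rw [HHom.uh_ι, AA.pre_apply (A.top (Mr.mk _ 1)) A.anchor h (ι (H.centHeis I) c), del_ι] at h3
      rw [h3]
      rfl)

theorem toRed_compat (A : AA (H.centHeis I) (D.cent R.hI) (centSub I J) U p) :
    Compat (centProj D R.hI) (centProj_mem R.hI) A (R.toRed A) :=
  Compat.of_one rfl (by rw [toRed, AA.mk'_top])

/-- The map of Lie algebroids. -/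
def toFun (R : RedCtx D I J) (A : AA H D J U p) : AA (H.red I) (D.red R.hI) (H.redSub I J) U p :=
  R.toRed (R.toCent A)

theorem toFun_anchor (A : AA H D J U p) : (R.toFun A).anchor = A.anchor := rfl

theorem toFun_ap (A : AA H D J U p) (h : V ≤ U) (m : (Mr H J).C V) :
    (R.toFun A).ap h (SMod.ap R.rM V m) = SMod.ap R.rM V (A.ap h m) := by
  obtain ⟨w, rfl⟩ := (R.bM_bij V).2 m
  rw [redMr_mrHom, ← (R.toCent_compat A).2, redMr_mrHom]
  exact ((R.toRed_compat (R.toCent A)).2 V h w).symm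

theorem rM_surj (m : (Mr (H.red I) (H.redSub I J)).C U) : ∃ w, SMod.ap R.rM U w = m :=
  ⟨_, redMr_sM R.hJ R.hI R.hP R.hI0 (R.hP U).some m⟩

theorem rM_one : SMod.ap R.rM U (Mr.mk J 1) = Mr.mk (H.redSub I J) 1 := by
  have := redMr_mk R.hJ R.hI R.hP (1 : UH (H.centHeis I) U)
  rwa [map_one, map_one] at this

theorem toFun_ext {A : AA H D J U p} {B : AA (H.red I) (D.red R.hI) (H.redSub I J) U p}
    (h : B.anchor = A.anchor)
    (h' : ∀ (V : S.Aff) (h : V ≤ U) (m : (Mr H J).C V),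
      B.ap h (SMod.ap R.rM V m) = SMod.ap R.rM V (A.ap h m)) : R.toFun A = B :=
  AA.ext h.symm fun V k m => by
    obtain ⟨w, rfl⟩ := R.rM_surj m
    rw [toFun_ap, h']

theorem toFun_inj {A B : AA H D J U p} (h : R.toFun A = R.toFun B) : A = B := by
  have ha : A.anchor = B.anchor := by
    rw [← R.toFun_anchor A, h, R.toFun_anchor]
  refine AA.ext_one ha (sub_eq_zero.1 ?_)
  refine eq_zero_of_rmul_j R.hJ R.hI R.hP R.hI0 (R.hP U).some ?_ fun a => ?_
  · rw [map_sub, AA.top, ← R.toFun_ap A le_rfl, h, R.toFun_ap B le_rfl, sub_self]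
  · have h1 := A.top_J le_rfl ((R.hP U).some.hj a)
    have h2 := B.top_J le_rfl ((R.hP U).some.hj a)
    rw [SMod.res_id] at h1 h2
    rw [ha] at h1
    rw [map_sub, eq_neg_of_add_eq_zero_left h1, eq_neg_of_add_eq_zero_left h2, sub_self]

end RedCtx

namespace RedCtx

open Pol UH

variable {H : PreHeis S} {D : Conn H} {I J : H.toSMod.Sub} (R : RedCtx D I J) {U V W : S.Aff}
  {p q : ZMod 2}

theorem rmul_eu_pr (P : Pol H I J U) (d : (Mr H J).C U) :
    Mr.rmul P.eu ((Mr H J).pr p d) = (Mr H J).pr p (Mr.rmul P.eu d) := by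
  have h1 : Mr.rmul P.eu ((Mr H J).par U d) = (Mr H J).par U (Mr.rmul P.eu d) := by
    have := Mr.tw_rmul 1 P.eu d
    rw [tw_eu] at this
    simpa using this.symm
  rw [SMod.pr_apply, SMod.pr_apply, Mr.rmul_smul, map_add, map_zsmul, h1]

theorem eu_homog (P : Pol H I J U) : (mod H).Homog 0 P.eu := by
  have := P.tw_eu 1
  rw [SMod.Homog]
  simpa using this

theorem mk_del_eu (P : Pol H I J U) (v : VF S U p) : SMod.ap R.rM U (Mr.mk J (del D v P.eu)) = 0 := by
  rw [eu, map_sum]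
  refine (congrArg _ (map_sum (SMod.ap (SMod.proj _ (rIdeal H J)) U) _ _)).trans ?_
  rw [map_sum]
  refine Finset.sum_eq_zero fun a _ => ?_
  change SMod.ap R.rM U (Mr.mk J _) = 0
  rw [del_mul, Mr.mk_add, UH.tw_ι, Mr.mk_J (J.tw_mem p (P.hj a)), add_zero, ← Mr.rmul_mk]
  exact redMr_rmul_mem R.hJ R.hI R.hP R.hI0 (P.hi a) _

/-- Lifting the generator of a section of the Lie algebroid of `c(I) / I`. -/
theorem exists_lift (P : Pol H I J U) (v : VF S U p) {m : (Mr (H.red I) (H.redSub I J)).C U}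
    (hm : (Mr (H.red I) (H.redSub I J)).Homog p m) : ∃ d : (Mr H J).C U, (Mr H J).Homog p d ∧
      SMod.ap R.rM U d = m ∧ AA.pre (D := D) d v le_rfl P.eu = 0 := by
  have hG : SMod.ap R.rM U (-Mr.mk J (del D v P.eu)) = 0 := by rw [map_neg, R.mk_del_eu, neg_zero]
  obtain ⟨δ, h1, h2⟩ := exists_eu_eq R.hJ R.hI R.hP R.hI0 P hG
  have hh : (Mr H J).Homog p (-Mr.mk J (del D v P.eu)) := by
    have := (del_dop D v).homog (eu_homog P)
    rw [add_zero] at this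
    have := SMod.ap_homog (SMod.proj _ (rIdeal H J)) this
    unfold SMod.Homog at *
    rw [map_neg, smul_neg]
    exact congrArg _ this
  refine ⟨(Mr H J).pr p (δ + P.sM R.hI0 R.hI R.hJ m), (Mr H J).pr_homog _ _, ?_, ?_⟩
  · rw [SMod.ap_pr, map_add, h2, redMr_sM, zero_add, hm.pr_eq, if_pos rfl]
  · rw [AA.pre_apply, SMod.res_id, rmul_eu_pr, map_add, h1, sM_eu, add_zero, hh.pr_eq, if_pos rfl]
    exact neg_add_cancel _

section lift

variable {v : VF S U p} {d : (Mr H J).C U} {P : Pol H I J U}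
  (hd : AA.pre (D := D) d v le_rfl P.eu = 0)

include R hd

theorem pre_π (h : V ≤ U) (x : H.C V) :
    AA.pre (D := D) d v h (ι H ((P.res h).π x)) = 0 := by
  refine eq_zero_of_eu_neg R.hJ R.hI R.hP R.hI0 (P.res h) ?_
  have h1 : AA.pre (D := D) d v h (P.res h).eu = 0 := by
    rw [← eu_res, ← AA.pre_res d v le_rfl h, hd, map_zero]
  rw [← AA.pre_J_mul d v h ((P.res h).π_mem x), ι_eu, π_π, (P.res h).ti_eq_zero fun a =>
    R.hJ V _ ((P.res h).π_mem x) _ ((P.res h).hj a), map_zero, add_zero, map_sub, AA.pre_mul, h1,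
    map_zero, zero_add, tw_eu, mk_eu_mul, zero_sub]

theorem pre_j (h : V ≤ U) (a : Fin P.n) : AA.pre (D := D) d v h (ι H ((P.res h).j a)) = 0 := by
  have := R.pre_π hd h ((P.res h).j a)
  rwa [π_j] at this

omit R hd in
theorem ι_mul_of_br {x y : H.C U} (hy : H.Homog q y) (h : H.br U y (H.tw q x) = 0) :
    ι H x * ι H y = ι H y * ι H (H.tw q x) := by
  have := ad_ι H hy (H.tw q x)
  rw [h, map_zero, ad_apply, sub_eq_zero, UH.tw_ι, SMod.tw_tw] at this
  exact this.symm

omit hd in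
theorem rM_pre (h : V ≤ U) (c : (H.centHeis I).C V) :
    SMod.ap R.rM V (AA.pre (D := D) d v h (ι H (ic I V c))) =
      AA.pre (D := D.red R.hI) (SMod.ap R.rM U d) v h (ι _ (SMod.ap (H.toRed I) V c)) := by
  rw [AA.pre_apply, AA.pre_apply, map_add, redMr_rmul_ι, del_ι, del_ι, SMod.ap_res]
  congr 1
  have := redMr_mk R.hJ R.hI R.hP (ι _ ((D.cent R.hI).nab (VF.res h v) c))
  rw [HHom.uh_ι, HHom.uh_ι] at this
  exact this

theorem pre_J {B : AA (H.red I) (D.red R.hI) (H.redSub I J) U p} (hv : B.anchor = v)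
    (hB : SMod.ap R.rM U d = B.top (Mr.mk _ 1)) (h : V ≤ U) (j : H.C V) (hj : j ∈ J.C V) :
    AA.pre (D := D) d v h (ι H j) = 0 := by
  have e1 : j = (P.res h).π j + ic I V ((P.res h).r j) := by rw [ic_r]; abel
  have hr : ic I V ((P.res h).r j) ∈ J.C V := (P.res h).r_mem hj
  rw [e1, map_add, map_add, R.pre_π hd, zero_add]
  refine eq_zero_of_rmul_j R.hJ R.hI R.hP R.hI0 (P.res h) ?_ fun a => ?_
  · rw [R.rM_pre, hB, AA.pre_apply, del_ι, ← hv]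
    exact B.top_J h (centProj_mem R.hI V _ hr)
  · rw [← AA.pre_J_mul d v h hr, ι_mul_of_br ((P.res h).pj a)
      (R.hJ V _ ((P.res h).hj a) _ (J.tw_mem _ hr)), AA.pre_J_mul d v h ((P.res h).hj a),
      R.pre_j hd, map_zero]

omit hd in
theorem rM_lmul {c : (H.centHeis I).C V} (hc : ic I V c ∈ (H.cent J).C V)
    (hc' : SMod.ap (H.toRed I) V c ∈ ((H.red I).cent (H.redSub I J)).C V) (m : (Mr H J).C V) :
    SMod.ap R.rM V (Mr.lmul _ hc m) = Mr.lmul _ hc' (SMod.ap R.rM V m) := by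
  obtain ⟨u, rfl⟩ := mk_centIncl_surj R.hJ R.hI R.hP m
  rw [Mr.lmul_mk]
  have := redMr_mk R.hJ R.hI R.hP (ι _ c * u)
  rw [map_mul, map_mul, HHom.uh_ι, HHom.uh_ι] at this
  refine this.trans ?_
  rw [redMr_mk, Mr.lmul_mk]
  rfl

omit hd in
theorem s_mem_cent (P : Pol H I J V) {y : (H.red I).C V}
    (hy : y ∈ ((H.red I).cent (H.redSub I J)).C V) : ic I V (P.s R.hI0 y) ∈ (H.cent J).C V :=
  fun W k j hj => by
    have e1 : j = (P.res k).π j + ic I W ((P.res k).r j) := by rw [ic_r]; abel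
    have e2 : (P.res k).ti (H.res k (ic I V (P.s R.hI0 y))) = 0 := by
      have := congrArg (H.res k) (P.ti_s R.hI0 y)
      rw [ti_apply, map_sum, map_zero] at this
      rw [ti_apply, ← this]
      refine Finset.sum_congr rfl fun b _ => ?_
      rw [H.res_smul, ← cf_res (P.one_inj W k)]
    rw [e1, map_add, ← br_ti, e2, map_zero, AddMonoidHom.zero_apply, zero_add]
    refine (mem_cent_iff _).1 ((R.mem_cent_red _).1 ?_) W k _ ((P.res k).r_mem hj)
    rw [P.toRed_s R.hI0]
    exact hy

theorem pre_nrm {B : AA (H.red I) (D.red R.hI) (H.redSub I J) U p} (hv : B.anchor = v)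
    (hB : SMod.ap R.rM U d = B.top (Mr.mk _ 1)) (h : V ≤ U) (q : ZMod 2) (x : H.C V)
    (hx : x ∈ (H.cent J).C V) (hq : H.Homog q x) :
    ∃ y, y ∈ (H.cent J).C V ∧ H.Homog (p + q) y ∧
        AA.pre (D := D) d v h (UH.ι H x) - sg (p * q) • Mr.lmul x hx ((Mr H J).res h d) =
          Mr.mk J (UH.ι H y) := by
  have e1 : x = (P.res h).π x + ic I V ((P.res h).r x) := by rw [ic_r]; abel
  obtain ⟨c, hcr⟩ : ∃ c, c = (P.res h).r x := ⟨_, rfl⟩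
  rw [← hcr] at e1
  have hπ : (P.res h).π x ∈ (H.cent J).C V := fun W k j hj =>
    R.hJ W _ (J.res_mem k _ ((P.res h).π_mem x)) j hj
  have hc : ic I V c ∈ (H.cent J).C V := by
    rw [hcr, ic_r]
    exact sub_mem hx hπ
  have hcq : (H.centHeis I).Homog q c := hcr ▸ (P.res h).r_homog hq
  have hc' : SMod.ap (H.toRed I) V c ∈ ((H.red I).cent (H.redSub I J)).C V :=
    (R.mem_cent_red c).2 ((mem_cent_iff c).2 fun W k y hy => hc W k _ hy)
  obtain ⟨y, hy, y1, y2⟩ := B.top_nrm h hc' (SMod.ap_homog (H.toRed I) hcq)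
  have hyc : ic I V ((P.res h).s R.hI0 y) ∈ (H.cent J).C V := R.s_mem_cent _ hy
  refine ⟨ic I V ((P.res h).s R.hI0 y), hyc,
    SMod.ap_homog (H.cent I).incl ((P.res h).s_homog R.hI0 y1), ?_⟩
  have k1 : Mr.lmul x hx ((Mr H J).res h d) = Mr.lmul (ic I V c) hc ((Mr H J).res h d) := by
    generalize (Mr H J).res h d = m
    obtain ⟨u, rfl⟩ := Mr.mk_surj m
    rw [Mr.lmul_mk, Mr.lmul_mk]
    conv_lhs => rw [e1, map_add, add_mul, Mr.mk_add, Mr.mk_J ((P.res h).π_mem x), zero_add]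
  have k2 : AA.pre (D := D) d v h (ι H x) = AA.pre (D := D) d v h (ι H (ic I V c)) := by
    conv_lhs => rw [e1, map_add, map_add, R.pre_π hd, zero_add]
  rw [k1, k2]
  refine sub_eq_zero.1 (eq_zero_of_rmul_j R.hJ R.hI R.hP R.hI0 (P.res h) ?_ fun a => ?_)
  · have h4 := redMr_mk R.hJ R.hI R.hP (ι _ ((P.res h).s R.hI0 y))
    rw [HHom.uh_ι, HHom.uh_ι] at h4
    have h5 : SMod.ap R.rM V (Mr.mk J (ι H (ic I V ((P.res h).s R.hI0 y)))) =
        Mr.mk _ (ι (H.red I) y) := h4.trans (congrArg (fun z => Mr.mk _ (ι (H.red I) z))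
          ((P.res h).toRed_s R.hI0 y))
    rw [map_sub, map_sub, map_zsmul, R.rM_pre, R.rM_lmul hc hc', h5, SMod.ap_res, hB, ← y2,
      AA.pre_apply, del_ι, hv, sub_self]
  · obtain ⟨j, hj⟩ : ∃ j, j = (P.res h).j a := ⟨_, rfl⟩
    have hjJ : j ∈ J.C V := hj ▸ (P.res h).hj a
    have hjp : H.Homog (P.p a) j := hj ▸ (P.res h).pj a
    have hjd : AA.pre (D := D) d v h (ι H j) = 0 := hj ▸ R.pre_j hd h a
    rw [← hj]
    have z1 : Mr.rmul (ι H j) (Mr.mk J (ι H (ic I V ((P.res h).s R.hI0 y)))) = 0 := by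
      rw [Mr.rmul_mk, ι_mul_of_br hjp (br_cent hjJ ((H.cent J).tw_mem _ hyc)), Mr.mk_J hjJ]
    have z2 : Mr.rmul (ι H j) (AA.pre (D := D) d v h (ι H (ic I V c))) =
        -(sg (p * q) • Mr.mk J (ι H (ic I V c) * ι H (D.nab (VF.res h v) j))) := by
      have h6 := AA.pre_mul (D := D) d v h (ι H (ic I V c)) (ι H j)
      rw [ι_mul_of_br hjp (br_cent hjJ ((H.cent J).tw_mem _ hc)), AA.pre_J_mul d v h hjJ, hjd,
        map_zero, UH.tw_ι, (SMod.ap_homog (H.cent I).incl hcq).tw, map_zsmul, smul_mul_assoc,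
        Mr.mk_zsmul, del_ι] at h6
      exact eq_neg_of_add_eq_zero_left h6.symm
    have z3 : Mr.rmul (ι H j) (Mr.lmul (ic I V c) hc ((Mr H J).res h d)) =
        -Mr.mk J (ι H (ic I V c) * ι H (D.nab (VF.res h v) j)) := by
      rw [AA.pre_apply, del_ι] at hjd
      have h7 := eq_neg_of_add_eq_zero_left hjd
      have h8 : Mr.rmul (ι H j) (Mr.lmul (ic I V c) hc ((Mr H J).res h d)) =
          Mr.lmul (ic I V c) hc (Mr.rmul (ι H j) ((Mr H J).res h d)) := by
        generalize (Mr H J).res h d = m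
        obtain ⟨u, rfl⟩ := Mr.mk_surj m
        rw [Mr.lmul_mk, Mr.rmul_mk, Mr.rmul_mk, Mr.lmul_mk, mul_assoc]
      rw [h8, h7, map_neg, Mr.lmul_mk]
    rw [map_sub, map_sub, map_zsmul, z1, z2, z3, smul_neg, sub_zero, sub_self]

end lift

theorem toFun_surj (B : AA (H.red I) (D.red R.hI) (H.redSub I J) U p) : ∃ A, R.toFun A = B := by
  obtain ⟨d, h1, h2, h3⟩ := R.exists_lift (R.hP U).some B.anchor B.top_homog
  let A : AA H D J U p := AA.mk' (d := d) B.anchor h1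
    (fun V h j hj => R.pre_J h3 rfl h2 h j hj) (fun V h q x hx hq => R.pre_nrm h3 rfl h2 h q x hx hq)
  have hA : A.top (Mr.mk J 1) = d := AA.mk'_top _ _ _ _
  refine ⟨A, AA.ext_one rfl ?_⟩
  rw [← h2, ← hA, ← R.rM_one]
  exact R.toFun_ap A le_rfl _

theorem toFun_add (A B : AA H D J U p) : R.toFun (A + B) = R.toFun A + R.toFun B :=
  R.toFun_ext (by rw [map_add, map_add, toFun_anchor, toFun_anchor]) fun V h m => by
    change (R.toFun A).ap h _ + (R.toFun B).ap h _ = SMod.ap R.rM V (A.ap h m + B.ap h m)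
    rw [map_add, toFun_ap, toFun_ap]

/-- The isomorphism of Lie algebroids `A_{H, ∇, J} ≅ A_{c(I) / I, ∇, J̄}`. -/
def algIso (R : RedCtx D I J) : AlgIso H D J (H.red I) (D.red R.hI) (H.redSub I J) where
  eqv := AddEquiv.ofBijective (AddMonoidHom.mk' R.toFun R.toFun_add)
    ⟨fun _ _ h => R.toFun_inj h, R.toFun_surj⟩
  anchor _ := rfl
  smul f hf A := R.toFun_ext rfl fun V h m => by
    change S.res h f • (R.toFun A).ap h _ = SMod.ap R.rM V (S.res h f • A.ap h m)
    rw [SMod.ap_smul, toFun_ap]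
  br {U p q} A B := R.toFun_ext rfl fun V h m => by
    change (R.toFun A).ap h ((R.toFun B).ap h _) - sg (p * q) • (R.toFun B).ap h ((R.toFun A).ap h _)
      = SMod.ap R.rM V (A.ap h (B.ap h m) - sg (p * q) • B.ap h (A.ap h m))
    rw [map_sub, map_zsmul]
    simp only [toFun_ap]
  res h A := R.toFun_ext rfl fun W k m => R.toFun_ap A (k.trans h) m

theorem algIso_eqv (A : AA H D J U p) : R.algIso.eqv A = R.toFun A := rfl

end RedCtx

/-! ### The isomorphism of `M^r(J̄)` with the tensor product -/

section rt

variable (H : PreHeis S) (I J : H.toSMod.Sub) {U V : S.Aff}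

theorem rt_add (m : (Mr H J).C U) (u u' : UH (H.red I) U) :
    rt H I J m (u + u') = rt H I J m u + rt H I J m u' := by
  rw [rt, rt, rt, ← map_add]
  exact congrArg _ (SMod.zt_add (Q := UH.mod (H.red I)) m u u')

theorem add_rt (m m' : (Mr H J).C U) (u : UH (H.red I) U) :
    rt H I J (m + m') u = rt H I J m u + rt H I J m' u := by
  rw [rt, rt, rt, ← map_add]
  exact congrArg _ (SMod.add_zt (Q := UH.mod (H.red I)) m m' u)

theorem smul_rt (f : S.O U) (m : (Mr H J).C U) (u : UH (H.red I) U) :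
    rt H I J (f • m) u = f • rt H I J m u := by
  rw [rt, rt, ← SMod.ap_smul, SMod.smul_zt]

theorem zero_rt (u : UH (H.red I) U) : rt H I J 0 u = 0 := by
  simpa using add_rt H I J 0 0 u

theorem par_rt (m : (Mr H J).C U) (u : UH (H.red I) U) :
    (redTens H I J).par U (rt H I J m u) = rt H I J ((Mr H J).par U m) (UH.par _ U u) := by
  rw [rt, ← SMod.ap_par, SMod.par_zt]; rfl

theorem res_rt (h : V ≤ U) (m : (Mr H J).C U) (u : UH (H.red I) U) :
    (redTens H I J).res h (rt H I J m u) = rt H I J ((Mr H J).res h m) (UH.res _ h u) := by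
  rw [rt, ← SMod.ap_res, SMod.res_zt]; rfl

theorem rt_ind {R : (redTens H I J).C U → Prop} (h : ∀ m u, R (rt H I J m u))
    (hadd : ∀ a b, R a → R b → R (a + b)) (z) : R z := by
  obtain ⟨z, rfl⟩ := SMod.proj_surj _ z
  induction z using SMod.zt_ind with
  | h0 => rw [map_zero, ← zero_rt H I J 0]; exact h _ _
  | h m u => exact h m u
  | hadd a b ha hb => rw [map_add]; exact hadd _ _ ha hb

theorem rt_bal_ι (x : (H.centHeis I).C U) (m : (Mr H J).C U) (u : UH (H.red I) U) :
    rt H I J (Mr.rmul (UH.ι H (Pol.ic I U x)) m) u =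
      rt H I J m (UH.ι (H.red I) (SMod.ap (H.toRed I) U x) * u) := by
  rw [← sub_eq_zero, rt, rt, ← map_sub]
  exact SMod.proj_zero _ (Submodule.subset_span ⟨x, m, u, rfl⟩)

theorem rt_bal {D : Conn H} (hI : D.Preserves I) (w : UH (H.centHeis I) U) :
    ∀ (m : (Mr H J).C U) (u : UH (H.red I) U),
    rt H I J (Mr.rmul ((centIncl D hI).uh U w) m) u = rt H I J m ((centProj D hI).uh U w * u) := by
  induction w using UH.ind with
  | hι x =>
    intro m u
    rw [HHom.uh_ι, HHom.uh_ι]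
    exact rt_bal_ι H I J x m u
  | hadd a b ha hb =>
    intro m u
    rw [map_add, Mr.rmul_add, add_rt, ha, hb, map_add, add_mul, rt_add]
  | hmul a b ha hb =>
    intro m u
    rw [map_mul, Mr.rmul_mul, hb, ha, map_mul, mul_assoc]

end rt

namespace RedCtx

open Pol UH

variable {H : PreHeis S} {D : Conn H} {I J : H.toSMod.Sub} (R : RedCtx D I J) {U V W : S.Aff}
  {p q : ZMod 2}

/-- The map `m ⊗ u ↦ m u` on sections. -/
def thetaZ (R : RedCtx D I J) (U : S.Aff) : (SMod.ztens (Mr H J) (UH.mod (H.red I))).C U →+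
    (Mr (H.red I) (H.redSub I J)).C U :=
  SMod.zlift (AddMonoidHom.mk' (fun m => AddMonoidHom.mk' (fun u : UH (H.red I) U =>
      Mr.rmul u (SMod.ap R.rM U m)) fun a b => Mr.rmul_add a b _)
    fun a b => AddMonoidHom.ext fun u => by
      change Mr.rmul u (SMod.ap R.rM U (a + b)) = Mr.rmul u _ + Mr.rmul u _
      rw [map_add, map_add])

theorem thetaZ_zt (m : (Mr H J).C U) (u : UH (H.red I) U) :
    R.thetaZ U (SMod.zt (Q := UH.mod (H.red I)) m u) = Mr.rmul u (SMod.ap R.rM U m) := rfl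

theorem thetaZ_smul (f : S.O U) (z) : R.thetaZ U (f • z) = f • R.thetaZ U z := by
  induction z using SMod.zt_ind with
  | h0 => rw [smul_zero, map_zero, smul_zero]
  | h m u =>
    rw [← SMod.smul_zt]
    refine (R.thetaZ_zt (f • m) u).trans ?_
    rw [SMod.ap_smul, Mr.rmul_smul]
    rfl
  | hadd a b ha hb => rw [smul_add, map_add, ha, hb, map_add, smul_add]

theorem thetaZ_rel : ∀ z ∈ (redRel H I J).C U, R.thetaZ U z = 0 := fun z hz => by
  induction hz using Submodule.span_induction with
  | mem z hz =>
    obtain ⟨x, m, u, rfl⟩ := hz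
    rw [map_sub, sub_eq_zero]
    refine (R.thetaZ_zt _ u).trans (Eq.trans ?_ (R.thetaZ_zt m _).symm)
    have := redMr_rmul_ι R.hJ R.hI R.hP x m
    rw [Mr.rmul_mul, ← this]
    rfl
  | zero => exact map_zero _
  | add x y _ _ hx hy => exact (map_add _ x y).trans (by rw [hx, hy, add_zero])
  | smul f x _ hx => rw [thetaZ_smul, hx, smul_zero]

/-- The map `m ⊗ u ↦ m u` on sections of the tensor product. -/
def thetaAp (R : RedCtx D I J) (U : S.Aff) : (redTens H I J).C U →+
    (Mr (H.red I) (H.redSub I J)).C U := SMod.qlift _ (R.thetaZ U) R.thetaZ_rel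

/-- The map `m ⊗ u ↦ m u` from the tensor product to `M^r(J̄)`. -/
def thetaInv (R : RedCtx D I J) : redTens H I J ⟶ Mr (H.red I) (H.redSub I J) :=
  have e : ∀ (U : S.Aff) (m : (Mr H J).C U) (u : UH (H.red I) U),
      R.thetaAp U (rt H I J m u) = Mr.rmul u (SMod.ap R.rM U m) := fun U m u => rfl
  ⟨R.thetaAp, by
    refine ⟨fun U f z => ?_, fun U z => ?_, fun U V h z => ?_⟩
    · obtain ⟨z, rfl⟩ := SMod.proj_surj _ z
      exact R.thetaZ_smul f z
    · induction z using rt_ind with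
      | h m u =>
        rw [par_rt, e, e, SMod.ap_par]
        have := Mr.tw_rmul 1 u (SMod.ap R.rM U m)
        simpa using this.symm
      | hadd a b ha hb => rw [map_add, map_add, ha, hb, map_add, map_add]
    · induction z using rt_ind with
      | h m u => rw [res_rt, e, e, SMod.ap_res, Mr.res_rmul]
      | hadd a b ha hb => rw [map_add, map_add, ha, hb, map_add, map_add]⟩

theorem thetaInv_rt (m : (Mr H J).C U) (u : UH (H.red I) U) :
    SMod.ap R.thetaInv U (rt H I J m u) = Mr.rmul u (SMod.ap R.rM U m) := rfl

include R in
theorem rt_surj (z : (redTens H I J).C U) : ∃ u, z = rt H I J (Mr.mk J 1) u := by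
  induction z using rt_ind with
  | h m u =>
    obtain ⟨w, rfl⟩ := mk_centIncl_surj R.hJ R.hI R.hP m
    refine ⟨(centProj D R.hI).uh U w * u, ?_⟩
    rw [← rt_bal H I J R.hI, Mr.rmul_mk, one_mul]
  | hadd a b ha hb =>
    obtain ⟨u, rfl⟩ := ha
    obtain ⟨u', rfl⟩ := hb
    exact ⟨u + u', by rw [rt_add]⟩

include R in
theorem smul_rt_one (f : S.O U) (u : UH (H.red I) U) :
    f • rt H I J (Mr.mk J 1) u = rt H I J (Mr.mk J 1) (f • u) := by
  have := rt_bal H I J R.hI (oo _ U f) (Mr.mk J 1) u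
  rw [HHom.uh_oo, HHom.uh_oo, Mr.rmul_mk, one_mul, ← UH.smul_def, ← mul_one (oo H U f),
    ← UH.smul_def, ← Mr.mk_smul, smul_rt] at this
  exact this

include R in
theorem rt_one_rel : ∀ u ∈ (rIdeal (H.red I) (H.redSub I J)).C U,
    rt H I J (Mr.mk J 1) u = 0 := fun u hu => by
  induction hu using Submodule.span_induction with
  | mem z hz =>
    obtain ⟨j, hj, u, rfl⟩ := hz
    obtain ⟨x, hx, rfl⟩ := redSub_surj U j hj
    rw [← rt_bal_ι, Mr.rmul_mk, one_mul, ← mul_one (ι H (ic I U x)), Mr.mk_J (j := ic I U x) hx, zero_rt]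
  | zero => simpa using rt_add H I J (Mr.mk (U := U) J 1) 0 0
  | add x y _ _ hx hy => exact (rt_add H I J _ x y).trans (by rw [hx, hy, add_zero])
  | smul f x _ hx => exact (R.smul_rt_one f x).symm.trans (by rw [hx, smul_zero])

theorem thetaInv_bij (U : S.Aff) : Function.Bijective (SMod.ap R.thetaInv U) := by
  refine ⟨(injective_iff_map_eq_zero _).2 fun z hz => ?_, fun m => ?_⟩
  · obtain ⟨u, rfl⟩ := R.rt_surj z
    rw [thetaInv_rt, R.rM_one, Mr.rmul_mk, one_mul, Mr.mk_eq_zero] at hz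
    exact R.rt_one_rel u hz
  · obtain ⟨u, rfl⟩ := Mr.mk_surj m
    exact ⟨rt H I J (Mr.mk J 1) u, by rw [thetaInv_rt, R.rM_one, Mr.rmul_mk, one_mul]⟩

/-- The isomorphism of `M^r(J̄)` with `M^r(J) ⊗ U(c(I) / I)`. -/
def theta (R : RedCtx D I J) : Mr (H.red I) (H.redSub I J) ≅ redTens H I J where
  hom := SMod.invHom R.thetaInv R.thetaInv_bij
  inv := R.thetaInv
  hom_inv_id := SMod.hom_ext fun U m => SMod.ap_invHom R.thetaInv R.thetaInv_bij m
  inv_hom_id := SMod.hom_ext fun U m => SMod.invHom_ap R.thetaInv R.thetaInv_bij m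

theorem theta_mk (u : UH (H.red I) U) :
    SMod.ap R.theta.hom U (Mr.mk (H.redSub I J) u) = rt H I J (Mr.mk J 1) u := by
  refine (R.thetaInv_bij U).1 ((SMod.ap_invHom R.thetaInv R.thetaInv_bij _).trans ?_)
  rw [thetaInv_rt, R.rM_one, Mr.rmul_mk, one_mul]

theorem theta_algIso (A : AA H D J U p) (h : V ≤ U) (m : (Mr H J).C V) (u : UH (H.red I) V) :
    SMod.ap R.theta.hom V ((R.algIso.eqv A).ap h (SMod.ap R.theta.inv V (rt H I J m u))) =
      rt H I J (A.ap h m) u +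
        rt H I J ((Mr H J).tw p m) (UH.del (D.red R.hI) (VF.res h A.anchor) u) := by
  refine (R.thetaInv_bij V).1 ((SMod.ap_invHom R.thetaInv R.thetaInv_bij _).trans ?_)
  rw [map_add, thetaInv_rt, thetaInv_rt]
  refine (AA.ap_rmul' (R.toFun A) h u (SMod.ap R.rM V m)).trans ?_
  rw [toFun_ap, SMod.ap_tw, toFun_anchor]

end RedCtx

/-! ### Modules on which `I` acts locally nilpotently -/

namespace Pol

open UH

variable {H : PreHeis S} {D : Conn H} {I J : H.toSMod.Sub} {U V : S.Aff} (P : Pol H I J U)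
  (M : FlatMod H D)

/-- The Euler operator `∑ jₐ iₐ` of a module. -/
def eM : M.C U →+ M.C U := M.uact P.eu

theorem eM_apply (m : M.C U) : P.eM M m = ∑ a, M.hact (P.j a) (M.hact (P.i a) m) := by
  rw [eM, eu]
  refine (DFunLike.congr_fun (map_sum (M.uring U) _ _) m).trans ?_
  refine (AddMonoidHom.finsetSum_apply _ _ _).trans (Finset.sum_congr rfl fun a _ => ?_)
  exact (M.uact_mul _ _ m).trans (by rw [M.uact_ι, M.uact_ι])

theorem hact_eM (x : H.C U) (m : M.C U) : M.hact x (P.eM M m) =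
    P.eM M (M.hact x m) + M.hact (P.ti x) m - M.hact (P.π x) m := by
  have h : ι H x * P.eu + ι H (P.π x) = P.eu * ι H x + ι H (P.ti x) := by rw [P.ι_eu]; abel
  have := congrArg (fun u => M.uact u m) h
  simp only [M.uact_add, M.uact_mul, M.uact_ι] at this
  rw [eM, eq_sub_iff_add_eq, this]

theorem eM_smul (f : S.O U) (m : M.C U) : P.eM M (f • m) = f • P.eM M m := by
  induction f using O_homog_ind with
  | hadd f g hf hg => rw [add_smul, map_add, hf, hg, add_smul]
  | h q f hf => rw [eM, M.smul_uact hf, tw_eu, M.uact_smul]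

variable {M}

theorem mem_inv_of {m : M.C U} (h : ∀ a, M.hact (P.i a) m = 0) : m ∈ (M.inv I).C U :=
  fun V k y hy => by
    rw [P.span k y hy, map_sum, AddMonoidHom.finsetSum_apply]
    refine Finset.sum_eq_zero fun a _ => ?_
    rw [M.hact_smul, ← M.hact_res, h, map_zero, smul_zero]

theorem eM_inv {m : M.C U} (h : m ∈ (M.inv I).C U) : P.eM M m = 0 := by
  rw [eM_apply]
  exact Finset.sum_eq_zero fun a _ => by rw [FlatMod.inv_hact h (P.hi a), map_zero]

variable (hI0 : ∀ U, ∀ x ∈ I.C U, ∀ y ∈ I.C U, H.br U x y = 0)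

include hI0 in
theorem hact_I_eM {x : H.C U} (hx : x ∈ I.C U) (m : M.C U) :
    M.hact x (P.eM M m) = P.eM M (M.hact x m) + M.hact x m := by
  rw [hact_eM, P.ti_of_mem hx, (P.π_eq_zero_iff x).2 (le_cent hI0 hx), map_zero,
    AddMonoidHom.zero_apply, sub_zero]

variable (hM : M.LocNilp I)

include hI0 hM in
theorem exists_evList_eM (m : M.C U) : ∃ n, evList (P.eM M) (List.range n) m = 0 := by
  obtain ⟨n, hn⟩ := hM U m
  refine ⟨n, evList_of_nilp (𝒜 := {α | ∃ x ∈ I.C U, α = M.hact x}) ?_ ?_ n m fun l hl hα => ?_⟩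
  · rintro _ ⟨x, hx, rfl⟩ w
    exact P.hact_I_eM hI0 hx w
  · exact fun w hw => P.eM_inv (P.mem_inv_of fun a => hw _ ⟨_, P.hi a, rfl⟩)
  · obtain ⟨l', h1, h2⟩ : ∃ l' : List (H.C U), l = l'.map M.hact ∧ ∀ x ∈ l', x ∈ I.C U := by
      clear hl
      induction l with
      | nil => exact ⟨[], rfl, by simp⟩
      | cons α l ih =>
        obtain ⟨l', rfl, h2⟩ := ih fun α h => hα α (List.mem_cons_of_mem _ h)
        obtain ⟨x, hx, rfl⟩ := hα α List.mem_cons_self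
        exact ⟨x :: l', rfl, by simpa using ⟨hx, h2⟩⟩
    subst h1
    rw [List.foldr_map]
    exact hn l' (by simpa using hl) h2

include hI0 hM in
theorem mem_inv_of_eM {m : M.C U} (h : P.eM M m = 0) : m ∈ (M.inv I).C U :=
  P.mem_inv_of fun a => by
    obtain ⟨n, hn⟩ := P.exists_evList_eM hI0 hM (M.hact (P.i a) m)
    refine eq_zero_of_evList (c := -1) (fun k _ => by omega) hn ?_
    have := P.hact_I_eM hI0 (P.hi a) m
    rw [h, map_zero] at this
    rw [neg_smul, one_smul]
    exact eq_neg_of_add_eq_zero_left this.symm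

/-- `m₀` is the component of `m` in the kernel of the Euler operator. -/
def IsInvPart (m m₀ : M.C U) : Prop :=
  m₀ ∈ (M.inv I).C U ∧ ∃ l : List ℕ, (∀ k ∈ l, k ≠ 0) ∧ evList (P.eM M) l (m - m₀) = 0

theorem append_ne {l l' : List ℕ} (h : ∀ k ∈ l, k ≠ 0) (h' : ∀ k ∈ l', k ≠ 0) :
    ∀ k ∈ l ++ l', k ≠ 0 := fun k hk => (List.mem_append.1 hk).elim (h k) (h' k)

namespace IsInvPart

variable {P}

theorem add {m n m₀ n₀ : M.C U} (h : P.IsInvPart m m₀) (h' : P.IsInvPart n n₀) :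
    P.IsInvPart (m + n) (m₀ + n₀) := by
  obtain ⟨h1, l, hl, h2⟩ := h
  obtain ⟨h1', l', hl', h2'⟩ := h'
  refine ⟨add_mem h1 h1', l ++ l', append_ne hl hl', ?_⟩
  rw [add_sub_add_comm]
  exact evList_append_add h2 h2'

theorem smul {m m₀ : M.C U} (h : P.IsInvPart m m₀) (f : S.O U) : P.IsInvPart (f • m) (f • m₀) := by
  obtain ⟨h1, l, hl, h2⟩ := h
  refine ⟨Submodule.smul_mem _ f h1, l, hl, ?_⟩
  have := evList_map (E := P.eM M) (E' := P.eM M) (DistribSMul.toAddMonoidHom _ f)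
    (fun w => (P.eM_smul M f w).symm) l (m - m₀)
  rw [h2, map_zero] at this
  rw [← smul_sub]
  exact this.symm

theorem eq {m m₀ m₁ : M.C U} (h : P.IsInvPart m m₀) (h' : P.IsInvPart m m₁) : m₀ = m₁ := by
  obtain ⟨h1, l, hl, h2⟩ := h
  obtain ⟨h1', l', hl', h2'⟩ := h'
  refine sub_eq_zero.1 (eq_zero_of_evList (E := P.eM M) (c := 0) (l := l' ++ l)
    (fun k hk => by exact_mod_cast (append_ne hl' hl k hk).symm) ?_ ?_)
  · have : m₀ - m₁ = (m - m₁) + -(m - m₀) := by abel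
    rw [this]
    exact evList_append_add h2' (by rw [map_neg, h2, neg_zero])
  · rw [P.eM_inv (sub_mem h1 h1'), zero_smul]

theorem of_mem {m : M.C U} (h : m ∈ (M.inv I).C U) : P.IsInvPart m m :=
  ⟨h, [], by simp, by rw [evList_nil, sub_self]⟩

theorem map {m m₀ : M.C U} (h : P.IsInvPart m m₀) (T : M.C U →+ M.C U)
    (hT : ∀ w, T (P.eM M w) = P.eM M (T w)) (hT' : ∀ w ∈ (M.inv I).C U, T w ∈ (M.inv I).C U) :
    P.IsInvPart (T m) (T m₀) := by
  obtain ⟨h1, l, hl, h2⟩ := h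
  refine ⟨hT' _ h1, l, hl, ?_⟩
  rw [← map_sub, ← evList_map T hT, h2, map_zero]

theorem raise {m m₀ : M.C U} (h : P.IsInvPart m m₀) (T : M.C U →+ M.C U)
    (hT : ∀ w, P.eM M (T w) = T (P.eM M w) + T w) : P.IsInvPart (T m) 0 := by
  obtain ⟨h1, l, hl, h2⟩ := h
  refine ⟨zero_mem _, (0 :: l).map (· + 1), fun k hk => ?_, ?_⟩
  · obtain ⟨a, _, rfl⟩ := List.mem_map.1 hk
    exact Nat.succ_ne_zero a
  · have e3 : m = (m - m₀) + m₀ := by abel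
    rw [sub_zero, evList_raise T hT, evList_cons, zero_smul, sub_zero, e3, map_add, h2, zero_add,
      evList_self, P.eM_inv h1, map_zero, map_zero]

end IsInvPart

include hI0 hM in
theorem exists_invPart (m : M.C U) : ∃ m₀, P.IsInvPart m m₀ := by
  obtain ⟨n, hn⟩ := P.exists_evList_eM hI0 hM m
  obtain ⟨w, l, hl, h1, h2⟩ := exists_kernel_part hn
  exact ⟨w, P.mem_inv_of_eM hI0 hM h1, l, hl, h2⟩

/-- The projection to the invariants. -/
def p0 : M.C U →ₗ[S.O U] (M.inv I).toSMod.C U :=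
  have h := fun m => (P.exists_invPart hI0 hM m).choose_spec
  { toFun := fun m => (M.inv I).el _ (h m).1
    map_add' := fun a b => SMod.Sub.el_ext (by
      rw [map_add, SMod.Sub.ap_el, SMod.Sub.ap_el, SMod.Sub.ap_el]
      exact (h (a + b)).eq ((h a).add (h b)))
    map_smul' := fun f a => SMod.Sub.el_ext (by
      rw [RingHom.id_apply, SMod.ap_smul, SMod.Sub.ap_el, SMod.Sub.ap_el]
      exact (h (f • a)).eq ((h a).smul f)) }

theorem p0_spec (m : M.C U) : P.IsInvPart m (SMod.ap (M.inv I).incl U (P.p0 hI0 hM m)) :=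
  (P.exists_invPart hI0 hM m).choose_spec

theorem p0_eq {m : M.C U} {m₀ : (M.inv I).toSMod.C U}
    (h : P.IsInvPart m (SMod.ap (M.inv I).incl U m₀)) : P.p0 hI0 hM m = m₀ :=
  SMod.Sub.el_ext ((P.p0_spec hI0 hM m).eq h)

theorem p0_incl (m : (M.inv I).toSMod.C U) : P.p0 hI0 hM (SMod.ap (M.inv I).incl U m) = m :=
  P.p0_eq hI0 hM (IsInvPart.of_mem m.2)

variable (hJ : ∀ U, ∀ x ∈ J.C U, ∀ y ∈ J.C U, H.br U x y = 0)

include hJ in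
theorem eM_hact_π (x : H.C U) (m : M.C U) :
    P.eM M (M.hact (P.π x) m) = M.hact (P.π x) (P.eM M m) + M.hact (P.π x) m := by
  rw [hact_eM, π_π, P.ti_eq_zero fun a => hJ U _ (P.π_mem x) _ (P.hj a), map_zero,
    AddMonoidHom.zero_apply, add_zero, sub_add_cancel]

include hJ in
theorem p0_π (x : H.C U) (m : M.C U) : P.p0 hI0 hM (M.hact (P.π x) m) = 0 :=
  P.p0_eq hI0 hM (by
    rw [map_zero]
    exact (P.p0_spec hI0 hM m).raise (M.hact (P.π x)) (P.eM_hact_π hJ x))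

include hJ in
theorem p0_J {x : H.C U} (hx : x ∈ J.C U) (m : M.C U) :
    SMod.ap (M.inv I).incl U (P.p0 hI0 hM (M.hact x m)) =
      M.hact (ic I U (P.r x)) (SMod.ap (M.inv I).incl U (P.p0 hI0 hM m)) := by
  have e1 : x = P.π x + ic I U (P.r x) := by rw [ic_r]; abel
  have h1 : P.IsInvPart (M.hact (ic I U (P.r x)) m)
      (M.hact (ic I U (P.r x)) (SMod.ap (M.inv I).incl U (P.p0 hI0 hM m))) :=
    (P.p0_spec hI0 hM m).map _ (fun w => by
      rw [hact_eM, π_ic, P.ti_eq_zero (x := ic I U (P.r x)) fun a => hJ U _ (P.r_mem hx) _ (P.hj a), map_zero,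
        AddMonoidHom.zero_apply, add_zero, sub_zero]) fun w hw => FlatMod.hact_mem (ic_mem _) hw
  have h2 := (P.p0_spec hI0 hM m).raise (M.hact (P.π x)) (P.eM_hact_π hJ x)
  have h3 := h2.add h1
  rw [zero_add, ← AddMonoidHom.add_apply, ← map_add, ← e1] at h3
  exact (P.p0_spec hI0 hM _).eq h3

/-! ### The map of Koszul complexes -/

open Kosz SMod

/-- The homotopy of the Koszul complex of `J` given by the action of the sections `iₐ`. -/
@[reducible] def htpy (M : FlatMod H D) : KoszHtpy (koszAct hJ M) U where
  n := P.n
  p := P.p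
  j a := J.el (P.j a) (P.hj a)
  hj a := SMod.Sub.el_ext (P.pj a)
  lam a := M.hact (P.i a)
  lam_smul a f m := by
    induction f using O_homog_ind with
    | hadd f g hf hg => rw [add_smul, map_add, hf, hg, map_add, add_smul]
    | h q f hf =>
      rw [M.smul_hact hf, (P.pi a).tw, map_zsmul, AddMonoidHom.smul_apply, hf.tw, smul_assoc,
        smul_comm f, mul_comm]
  c a := AddMonoidHom.mk' (fun x => cf H (P.i a) (ap J.incl U x)) fun x y => by
    rw [map_add, P.oi.cf_add]
  hc a r x hx := P.oi.cf_homog (P.pi a) (ap_homog J.incl hx)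
  lam_act a x m := by
    change M.hact (P.i a) (M.hact (ap J.incl U x) m) = cf H (P.i a) (ap J.incl U x) • m +
      M.hact (ap J.incl U (J.toSMod.tw (P.p a) x)) (M.hact (P.i a) m)
    rw [ap_tw, ← M.hact_smul_one, ← cf_spec]
    generalize ap J.incl U x = y
    induction y using SMod.homog_ind with
    | hadd y z hy hz => simp only [map_add, AddMonoidHom.add_apply, hy, hz]; abel
    | h q y hy =>
      rw [← M.hact_br _ _ _ _ m (P.pi a) hy, hy.tw, map_zsmul, AddMonoidHom.smul_apply,
        sub_add_cancel]
  π := AddMonoidHom.mk' (fun x => J.el (P.π (ap J.incl U x)) (P.π_mem _)) fun x y =>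
    SMod.Sub.el_ext (by simp only [map_add, SMod.Sub.ap_el])
  hπ r x hx := SMod.Sub.el_ext (by
    change P.π (ap J.incl U x) = ap J.incl U (∑ a, cf H (P.i a) (ap J.incl U x) •
      J.toSMod.tw (P.p a + r) (J.el (P.j a) (P.hj a)))
    rw [π_apply, map_sum]
    refine Finset.sum_congr rfl fun a _ => ?_
    rw [ap_smul, ap_tw, SMod.Sub.ap_el, (P.pj a).tw,
      P.oi.cf_skew (ap_homog J.incl hx) (P.pi a), smul_neg, neg_smul, neg_smul, neg_smul, neg_neg, smul_smul, smul_assoc,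
      smul_comm (cf _ _ _)]
    congr 1
    rw [← sg_add]
    congr 1
    rcases zmod2_cases r with rfl | rfl <;> rcases zmod2_cases (P.p a) with h | h <;> rw [h] <;>
      decide)

theorem htpy_π (x : J.toSMod.C U) : ap J.incl U ((P.htpy hJ M).π x) = P.π (ap J.incl U x) := rfl

theorem htpy_lapM (m : M.C U) : (P.htpy hJ M).lapM m = P.eM M m := by
  rw [KoszHtpy.lapM_apply, eM_apply]
  rfl

variable (hI : D.Preserves I)

/-- The projection of `J` to `J ∩ c(I)`. -/
def rJ : J.toSMod.C U →ₗ[S.O U] (centSub I J).toSMod.C U where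
  toFun x := (centSub I J).el (P.r (ap J.incl U x)) (P.r_mem x.2)
  map_add' x y := SMod.Sub.el_ext (by simp only [map_add, SMod.Sub.ap_el])
  map_smul' f x := SMod.Sub.el_ext (by
    exact (congrArg P.r (ap_smul J.incl f x)).trans (P.r_smul _ _))

theorem incl_rJ (x : J.toSMod.C U) : ap (centSub I J).incl U (P.rJ x) = P.r (ap J.incl U x) := rfl

theorem rJ_par (x : J.toSMod.C U) :
    P.rJ (J.toSMod.par U x) = (centSub I J).toSMod.par U (P.rJ x) :=
  SMod.Sub.el_ext (ic_inj (by
    rw [incl_rJ, ic_r, ap_par, ap_par, incl_rJ, ap_par, ic_r, π_par, map_sub]))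

theorem subHom_rJ (x : J.toSMod.C U) :
    ap J.incl U (ap (subHom (centIncl_mem (J := J) hI)) U (P.rJ x)) =
      ap J.incl U x - P.π (ap J.incl U x) := by
  rw [subHom_incl, incl_rJ]
  exact P.ic_r _

theorem rJ_subHom (x : (centSub I J).toSMod.C U) :
    P.rJ (ap (subHom (centIncl_mem (J := J) hI)) U x) = x :=
  SMod.Sub.el_ext (by
    rw [incl_rJ, subHom_incl]
    exact P.r_ic _)

/-- The retraction of the Koszul complex. -/
def ret (n : ℕ) : (K (koszAct hJ M) n).C U →+
    (K (koszAct (centSub_abel (I := I) hJ) (pullMod (centProj D hI) (M.invMod hI))) n).C U :=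
  kmap (koszAct hJ M) (koszAct (centSub_abel (I := I) hJ) (pullMod (centProj D hI) (M.invMod hI)))
    P.rJ P.rJ_par (P.p0 hI0 hM) n

/-- The inclusion of Koszul complexes. -/
abbrev inc (M : FlatMod H D) (U : S.Aff) (n : ℕ) :
    (K (koszAct (centSub_abel (I := I) hJ) (pullMod (centProj D hI) (M.invMod hI))) n).C U →+
      (K (koszAct hJ M) n).C U :=
  kAp (centIncl_mem hI) (invIncl hI M) (centSub_abel hJ) hJ U n

theorem ret_kd (n : ℕ) (z : (K (koszAct hJ M) (n + 1)).C U) :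
    P.ret hI0 hM hJ hI n (ap (kd _ n) U z) = ap (kd _ n) U (P.ret hI0 hM hJ hI (n + 1) z) :=
  kmap_kd _ _ _ _ _ (fun (x : J.toSMod.C U) m => SMod.Sub.el_ext (K := M.inv I)
    (P.p0_J hI0 hM hJ (x := ap J.incl U x) x.2 m)) n z

theorem ret_inc : ∀ n z, P.ret hI0 hM hJ hI n (inc hJ hI M U n z) = z
  | 0, z => by
    obtain ⟨m, rfl⟩ := kz_surj _ z
    rw [inc, kAp_kz, ret, kmap_kz]
    exact congrArg _ (P.p0_incl hI0 hM m)
  | n + 1, z => by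
    induction z using k_ind with
    | h x z =>
      have ih := ret_inc n z
      rw [ret] at ih
      rw [inc, kAp_otk, ret, kmap_otk, rJ_subHom, ih]
    | hadd a b ha hb => rw [map_add, map_add, ha, hb]

theorem lap_inc : ∀ n z, (P.htpy hJ M).lap n (inc hJ hI M U n z) = 0
  | 0, z => by
    obtain ⟨m, rfl⟩ := kz_surj _ z
    rw [inc, kAp_kz, KoszHtpy.lap_zero, htpy_lapM]
    exact (congrArg _ (P.eM_inv m.2)).trans (map_zero _)
  | n + 1, z => by
    induction z using k_ind with
    | h x z =>
      rw [inc, kAp_otk, KoszHtpy.lap_otk, lap_inc n z, map_zero, add_zero]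
      have : (P.htpy hJ M).π (ap (subHom (centIncl_mem hI)) U x) = 0 := SMod.Sub.el_ext (by
        rw [htpy_π, subHom_incl, map_zero]
        exact P.π_ic _)
      rw [this, map_zero, AddMonoidHom.zero_apply]
    | hadd a b ha hb => rw [map_add, map_add, ha, hb, add_zero]

theorem evList_ret : ∀ n (z : (K (koszAct hJ M) n).C U), ∃ l : List ℕ, (∀ k ∈ l, k ≠ 0) ∧
    evList ((P.htpy hJ M).lap n) l (z - inc hJ hI M U n (P.ret hI0 hM hJ hI n z)) = 0
  | 0, z => by
    obtain ⟨m, rfl⟩ := kz_surj _ z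
    obtain ⟨_, l, hl, h⟩ := P.p0_spec hI0 hM m
    refine ⟨l, hl, ?_⟩
    rw [ret, kmap_kz, inc, kAp_kz, ← map_sub, ← evList_map (E := P.eM M) (kz _) fun w => by
      rw [KoszHtpy.lap_zero, htpy_lapM]]
    exact (congrArg _ h).trans (map_zero _)
  | n + 1, z => by
    induction z using k_ind with
    | h x z =>
      obtain ⟨l, hl, h⟩ := evList_ret n z
      have hs : x = (P.htpy hJ M).π x + ap (subHom (centIncl_mem (J := J) hI)) U (P.rJ x) :=
        SMod.Sub.el_ext (by rw [map_add, subHom_rJ, htpy_π]; abel)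
      have e1 : otk _ n x z - inc hJ hI M U (n + 1) (P.ret hI0 hM hJ hI (n + 1) (otk _ n x z)) =
          otk _ n ((P.htpy hJ M).π x) z + otk _ n (ap (subHom (centIncl_mem (J := J) hI)) U (P.rJ x))
            (z - inc hJ hI M U n (P.ret hI0 hM hJ hI n z)) := by
        rw [ret, kmap_otk, inc, kAp_otk, map_sub, ← add_sub_assoc, ← AddMonoidHom.add_apply,
          ← map_add, ← hs]
        rfl
      refine ⟨(0 :: l).map (· + 1) ++ l, append_ne (fun k hk => ?_) hl, ?_⟩
      · obtain ⟨a, _, rfl⟩ := List.mem_map.1 hk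
        exact Nat.succ_ne_zero a
      rw [e1]
      refine evList_append_add ?_ ?_
      · rw [evList_raise (E := (P.htpy hJ M).lap n) (otk _ n ((P.htpy hJ M).π x)) fun w => ?_]
        · have e3 : z = (z - inc hJ hI M U n (P.ret hI0 hM hJ hI n z)) +
            inc hJ hI M U n (P.ret hI0 hM hJ hI n z) := by abel
          rw [evList_cons, zero_smul, sub_zero, e3, map_add, h, zero_add, evList_self, lap_inc,
            map_zero, map_zero]
        · rw [KoszHtpy.lap_otk, show (P.htpy hJ M).π ((P.htpy hJ M).π x) = (P.htpy hJ M).π x from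
            SMod.Sub.el_ext (P.π_π _)]
          exact add_comm _ _
      · rw [← evList_map (E := (P.htpy hJ M).lap n)
          (otk _ n (ap (subHom (centIncl_mem (J := J) hI)) U (P.rJ x))) (fun w => ?_), h, map_zero]
        have : (P.htpy hJ M).π (ap (subHom (centIncl_mem (J := J) hI)) U (P.rJ x)) = 0 :=
          SMod.Sub.el_ext (by rw [htpy_π, subHom_rJ, map_sub, π_π, sub_self, map_zero])
        rw [KoszHtpy.lap_otk, this, map_zero, AddMonoidHom.zero_apply, zero_add]
    | hadd a b ha hb =>
      obtain ⟨l, hl, h⟩ := ha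
      obtain ⟨l', hl', h'⟩ := hb
      refine ⟨l ++ l', append_ne hl hl', ?_⟩
      rw [map_add, map_add, add_sub_add_comm]
      exact evList_append_add h h'

include P hI0 hM in
/-- The inclusion of Koszul complexes is a quasi-isomorphism. -/
theorem inc_qis : (kSecMap (centIncl_mem hI) (invIncl hI M) (centSub_abel hJ) hJ U).Qis := fun n => by
  refine ⟨fun z _ hz => ?_, fun z hz => ?_⟩
  · obtain ⟨w, hw⟩ := hz
    refine ⟨P.ret hI0 hM hJ hI (n + 1) w, ?_⟩
    rw [← P.ret_inc hI0 hM hJ hI n z]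
    exact (congrArg _ hw).trans (P.ret_kd hI0 hM hJ hI n w)
  · let ρ : Cpx.Hom (sec (koszAct hJ M) U) (sec (koszAct (centSub_abel (I := I) hJ)
      (pullMod (centProj D hI) (M.invMod hI))) U) := ⟨P.ret hI0 hM hJ hI, P.ret_kd hI0 hM hJ hI⟩
    have h1 := ρ.cyc hz
    obtain ⟨l, hl, h⟩ := P.evList_ret hI0 hM hJ hI n z
    obtain ⟨w, hw⟩ := (P.htpy hJ M).exact (hz.sub (Cpx.Hom.cyc
      (kSecMap (centIncl_mem hI) (invIncl hI M) (centSub_abel hJ) hJ U) h1)) hl h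
    exact ⟨_, h1, w, sub_eq_iff_eq_add'.1 hw⟩

end Pol

/-! ### Fock modules -/

/-- The isomorphism of flat modules given by a bijective morphism. -/
def FlatMod.isoOfBij {H : PreHeis S} {D : Conn H} {M N : FlatMod H D} (f : M ⟶ N)
    (hf : ∀ U, Function.Bijective (SMod.ap (FlatMod.toHom f) U)) : M ≅ N where
  hom := f
  inv := ⟨SMod.invHom (FlatMod.toHom f) hf, fun U x m => (hf U).1 (by
    rw [SMod.ap_invHom, FlatMod.toHom_hact, SMod.ap_invHom]), fun U p v m => (hf U).1 (by
    rw [SMod.ap_invHom, FlatMod.toHom_conn, SMod.ap_invHom])⟩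
  hom_inv_id := FlatMod.hom_ext (SMod.hom_ext fun U m =>
    SMod.invHom_ap (FlatMod.toHom f) hf m)
  inv_hom_id := FlatMod.hom_ext (SMod.hom_ext fun U m =>
    SMod.ap_invHom (FlatMod.toHom f) hf m)

section

open UH

variable {H : PreHeis S} {D : Conn H} {J : H.toSMod.Sub} {U : S.Aff}

theorem fmk_eq_zero {a : UH H U} : fmk J a = 0 ↔ a ∈ (lIdeal H J).C U :=
  Submodule.Quotient.mk_eq_zero _

theorem fmk_mul_ι (u : UH H U) {x : H.C U} (hx : x ∈ J.C U) : fmk J (u * ι H x) = 0 :=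
  fmk_eq_zero.2 (Submodule.subset_span ⟨x, hx, u, rfl⟩)

theorem hact_fmk (hJ : D.Preserves J) (x : H.C U) (u : UH H U) :
    (fock hJ).hact x (fmk J u) = fmk J (ι H x * u) := rfl

theorem uact_fmk (hJ : D.Preserves J) (a u : UH H U) :
    (fock hJ).uact a (fmk J u) = fmk J (a * u) := by
  induction a using UH.ind generalizing u with
  | hι x => exact ((fock hJ).uact_ι x _).trans (hact_fmk hJ x u)
  | hadd a b ha hb => exact ((fock hJ).uact_add a b _).trans (by rw [ha, hb, add_mul, fmk_add])
  | hmul a b ha hb => exact ((fock hJ).uact_mul a b _).trans (by rw [hb, ha, mul_assoc])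

theorem hact_fmk_fil (hJ : D.Preserves J) {x : H.C U} (hx : x ∈ J.C U) (v : UH H U) :
    (fock hJ).hact x (fmk J v) = fmk J (ad H 0 (H.pr 0 x) v + ad H 1 (H.pr 1 x) v) := by
  have key : ∀ q, fmk J (ι H (H.pr q x) * v) = fmk J (ad H q (H.pr q x) v) := fun q => by
    rw [ad_apply, fmk_sub, fmk_mul_ι _ (J.pr_mem q hx), sub_zero]
  rw [hact_fmk, fmk_add, ← key, ← key, ← fmk_add, ← add_mul, ← map_add, H.pr_add_pr]

theorem del_one (D : Conn H) {p : ZMod 2} (v : VF S U p) : UH.del D v 1 = 0 := by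
  rw [← UH.ι_one, UH.del_ι, D.one, map_zero]

/-- Submodules of `J` act locally nilpotently on the Fock module of `J`. -/
theorem fock_locNilp (hJ : D.Preserves J) {I : H.toSMod.Sub} (hIJ : ∀ U, I.C U ≤ J.C U) :
    (fock hJ).LocNilp I := fun U m => by
  obtain ⟨u, rfl⟩ := fmk_surj m
  obtain ⟨n, hn⟩ := exists_mem_fil u
  refine ⟨n + 1, ?_⟩
  induction n generalizing u with
  | zero =>
    intro l hl hI
    obtain ⟨x, rfl⟩ := List.length_eq_one_iff.1 hl
    refine (hact_fmk_fil hJ (hIJ U (hI x List.mem_cons_self)) u).trans ?_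
    rw [(ad_fil (H.pr_homog 0 x)).1 u hn, (ad_fil (H.pr_homog 1 x)).1 u hn, add_zero]
    exact map_zero _
  | succ n ih =>
    intro l hl hI
    obtain rfl | ⟨l, x, rfl⟩ := List.eq_nil_or_concat' l
    · cases hl
    rw [List.foldr_append]
    refine (congrArg (fun m => List.foldr _ m l) (hact_fmk_fil hJ (hIJ U (hI x (by simp))) u)).trans
      (ih _ (add_mem ((ad_fil (H.pr_homog 0 x)).2 n u hn) ((ad_fil (H.pr_homog 1 x)).2 n u hn)) l
        (by simpa using hl) fun y hy => hI y (by simp [hy]))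

/-- The morphism from a Fock module determined by the image of the vacuum vector. -/
def fockHom (hJ : D.Preserves J) (N : FlatMod H D) (w : ∀ U, N.C U)
    (hr : ∀ {U V : S.Aff} (h : V ≤ U), N.res h (w U) = w V) (hp : ∀ U, N.par U (w U) = w U)
    (hw : ∀ U, ∀ x ∈ J.C U, N.hact x (w U) = 0)
    (hc : ∀ {U : S.Aff} {p : ZMod 2} (v : VF S U p), N.conn v (w U) = 0) : fock hJ ⟶ N :=
  ⟨SMod.desc (lIdeal H J) (⟨fun U => AddMonoidHom.mk' (fun a : UH H U => N.uact a (w U))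
      fun a b => N.uact_add a b _, fun U f a => N.uact_smul f a _,
      fun U a => ((N.uact_par a _).trans (by rw [hp]; rfl)).symm,
      fun U V h a => ((N.uact_res h a _).trans (by rw [hr]; rfl)).symm⟩ : UH.mod H ⟶ N.toSMod)
    fun U a ha => by
      change N.uact a (w U) = 0
      induction ha using Submodule.span_induction with
      | mem a ha =>
        obtain ⟨j, hj, u, rfl⟩ := ha
        rw [N.uact_mul, N.uact_ι, hw U j hj, map_zero]
      | zero => exact DFunLike.congr_fun (map_zero (N.uring U)) _
      | add x y _ _ hx hy => exact (N.uact_add x y _).trans (by rw [hx, hy, add_zero])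
      | smul f x _ hx => exact (N.uact_smul f x _).trans (by rw [hx, smul_zero]),
    fun U x m => by
      obtain ⟨u, rfl⟩ := fmk_surj m
      exact (N.uact_mul (ι H x) u _).trans (N.uact_ι x _),
    fun U p v m => by
      obtain ⟨u, rfl⟩ := fmk_surj m
      refine Eq.trans ?_ (N.uact_conn v u _).symm
      rw [hc, map_zero, add_zero]
      rfl⟩

end

namespace Pol

open UH

variable {H : PreHeis S} {D : Conn H} {I J : H.toSMod.Sub} {U : S.Aff} (P : Pol H I J U)
  {M : FlatMod H D} (hI0 : ∀ U, ∀ x ∈ I.C U, ∀ y ∈ I.C U, H.br U x y = 0)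
  (hM : M.LocNilp I) (hJ : ∀ U, ∀ x ∈ J.C U, ∀ y ∈ J.C U, H.br U x y = 0) (hI : D.Preserves I)

theorem p0_rr (u : UH H U) : ∀ (v : UH (H.centHeis I) U) (m : M.C U),
    P.p0 hI0 hM (M.uact ((centIncl D hI).uh U v * u) m) =
      P.p0 hI0 hM (M.uact ((centIncl D hI).uh U (P.rr hJ u v)) m) := by
  induction u using UH.ind with
  | hι x =>
    intro v m
    rw [rr_ι]
    induction x using H.toSMod.homog_ind with
    | hadd a b ha hb =>
      rw [map_add, mul_add, M.uact_add, map_add, ha, hb, ract_add, map_add, M.uact_add, map_add]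
    | h q x hx =>
      have e : ι H x = ι H (P.π x) + (centIncl D hI).uh U (ι _ (P.r x)) := by
        rw [HHom.uh_ι]
        change _ = _ + ι H (x - P.π x)
        rw [map_sub, add_sub_cancel]
      rw [P.ract_homog hx, e, mul_add, P.mul_π hI x hx, map_add, map_mul, M.uact_add, M.uact_add,
        M.uact_mul (ι H (P.π x)), M.uact_ι, map_add, map_add, P.p0_π hI0 hM hJ, zero_add, add_comm,
        M.uact_add, map_add]
  | hadd a b ha hb =>
    exact fun v m => by rw [mul_add, M.uact_add, map_add, ha, hb, rr_add, map_add, M.uact_add, map_add]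
  | hmul a b ha hb =>
    intro v m
    rw [← mul_assoc, M.uact_mul, ha, ← M.uact_mul, hb, rr_mul]

theorem p0_pr (u : UH H U) (m : M.C U) : P.p0 hI0 hM (M.uact u m) =
    P.p0 hI0 hM (M.uact ((centIncl D hI).uh U (P.pr hJ u)) m) := by
  have := P.p0_rr hI0 hM hJ hI u 1 m
  rwa [map_one, one_mul] at this

end Pol

section

open UH Pol

variable {H : PreHeis S} {D : Conn H} {I J J' : H.toSMod.Sub} (hI : D.Preserves I)
  (hJ' : D.Preserves J') (hIJ' : ∀ U, I.C U ≤ J'.C U) {U : S.Aff}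
  (hJ0 : ∀ U, ∀ x ∈ J'.C U, ∀ y ∈ J'.C U, H.br U x y = 0)

include hIJ' hJ0 in
theorem le_cent_of_le {x : H.C U} (hx : x ∈ J'.C U) : x ∈ (H.cent I).C U := fun V h y hy =>
  hJ0 V _ (J'.res_mem h _ hx) y (hIJ' V hy)

include hIJ' in
theorem fmk_one_mem (U : S.Aff) : fmk J' 1 ∈ ((fock hJ').inv I).C U := fun V h y hy => by
  change fmk J' (ι H y * UH.res H h 1) = 0
  rw [map_one, ← one_mul (ι H y * 1), mul_one]
  exact fmk_mul_ι 1 (hIJ' V hy)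

/-- The action of `U(c(I))` on invariants. -/
theorem incl_uact (M : FlatMod H D) (w : UH (H.centHeis I) U) (m : (M.inv I).toSMod.C U) :
    SMod.ap (M.inv I).incl U ((M.invMod hI).uact ((centProj D hI).uh U w) m) =
      M.uact ((centIncl D hI).uh U w) (SMod.ap (M.inv I).incl U m) :=
  Eq.trans (congrArg _ ((pullHom (centProj D hI) (M.invMod hI)).uact w m).symm)
    ((invIncl hI M).uact w m)

/-- The canonical morphism from the Fock module of `J' / I`. -/
def fockRed : fock (hI.redSub hJ') ⟶ (fock hJ').invMod hI :=
  fockHom (hI.redSub hJ') ((fock hJ').invMod hI)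
    (fun U => ((fock hJ').inv I).el (fmk J' 1) (fmk_one_mem hJ' hIJ' U))
    (fun {U V} h => SMod.Sub.el_ext (congrArg (fmk J') (map_one (UH.res H h))))
    (fun U => SMod.Sub.el_ext (congrArg (fmk J') (map_one (UH.par H U))))
    (fun U y hy => by
      obtain ⟨x, hx, rfl⟩ := redSub_surj U y hy
      refine SMod.Sub.el_ext (K := (fock hJ').inv I) ?_
      change fmk J' (ι H (ic I U x) * 1) = 0
      rw [mul_one, ← one_mul (ι H _)]
      exact fmk_mul_ι 1 hx)
    (fun v => SMod.Sub.el_ext (K := (fock hJ').inv I)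
      ((congrArg (fmk J') (del_one D v)).trans (map_zero _)))

theorem fockRed_uh (w : UH (H.centHeis I) U) :
    SMod.ap ((fock hJ').inv I).incl U (SMod.ap (FlatMod.toHom (fockRed hI hJ' hIJ')) U
      (fmk (H.redSub I J') ((centProj D hI).uh U w))) = fmk J' ((centIncl D hI).uh U w) :=
  (incl_uact hI (fock hJ') w _).trans ((uact_fmk hJ' _ 1).trans (by rw [mul_one]))

variable (hJ : ∀ U, ∀ x ∈ J.C U, ∀ y ∈ J.C U, H.br U x y = 0)

include hIJ' hJ0 hI in
theorem pr_lIdeal (P : Pol H I J U) : ∀ a ∈ (lIdeal H J').C U,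
    P.pr hJ a ∈ (lIdeal (H.centHeis I) (centSub I J')).C U := fun a ha => by
  induction ha using Submodule.span_induction with
  | mem a ha =>
    obtain ⟨j, hj, u, rfl⟩ := ha
    have h := P.pr_mul hJ hI u (ι _ ((H.cent I).el j (le_cent_of_le hIJ' hJ0 hj)))
    rw [HHom.uh_ι] at h
    exact h.symm ▸ Submodule.subset_span ⟨_, hj, _, rfl⟩
  | zero => rw [map_zero]; exact zero_mem _
  | add x y _ _ hx hy => exact (map_add (P.pr hJ) x y).symm ▸ add_mem hx hy
  | smul f x _ hx => exact (P.pr_smul hJ f x).symm ▸ Submodule.smul_mem _ f hx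

theorem uh_lIdeal {H' : PreHeis S} {D' : Conn H'} (F : HHom D D') {J' : H'.toSMod.Sub}
    (hF : ∀ U, ∀ x ∈ J.C U, SMod.ap F.φ U x ∈ J'.C U) :
    ∀ a ∈ (lIdeal H J).C U, F.uh U a ∈ (lIdeal H' J').C U := fun a ha => by
  induction ha using Submodule.span_induction with
  | mem a ha =>
    obtain ⟨j, hj, u, rfl⟩ := ha
    rw [map_mul, HHom.uh_ι]
    exact Submodule.subset_span ⟨_, hF U j hj, _, rfl⟩
  | zero => rw [map_zero]; exact zero_mem _
  | add x y _ _ hx hy => exact (map_add (F.uh U) x y).symm ▸ add_mem hx hy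
  | smul f x _ hx =>
    have := SMod.ap_smul F.uhHom f x
    exact this.symm ▸ Submodule.smul_mem _ f hx

include hJ0 hJ in
theorem fockRed_bij (P : Pol H I J U) :
    Function.Bijective (SMod.ap (FlatMod.toHom (fockRed hI hJ' hIJ')) U) := by
  have hI0 : ∀ U, ∀ x ∈ I.C U, ∀ y ∈ I.C U, H.br U x y = 0 := fun U x hx y hy =>
    hJ0 U x (hIJ' U hx) y (hIJ' U hy)
  refine ⟨(injective_iff_map_eq_zero _).2 fun m hm => ?_, fun m => ?_⟩
  · obtain ⟨u, rfl⟩ := fmk_surj m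
    obtain ⟨w, hw⟩ : ∃ w, w = P.su hI0 u := ⟨_, rfl⟩
    have hu : u = (centProj D hI).uh U w := by rw [hw, P.centProj_su hI0 hI]
    subst hu
    have h1 := fockRed_uh hI hJ' hIJ' w
    rw [hm, map_zero] at h1
    have h2 := pr_lIdeal hI hIJ' hJ0 hJ P _ (fmk_eq_zero.1 h1.symm)
    rw [P.pr_centIncl hJ hI] at h2
    exact fmk_eq_zero.2 (uh_lIdeal (centProj D hI) (centProj_mem hI) _ h2)
  · obtain ⟨u, hu⟩ := fmk_surj (SMod.ap ((fock hJ').inv I).incl U m)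
    have hN := fock_locNilp hJ' hIJ'
    refine ⟨fmk _ ((centProj D hI).uh U (P.pr hJ u)), ?_⟩
    have h1 := P.p0_pr hI0 hN hJ hI u (fmk J' 1)
    rw [uact_fmk, uact_fmk, mul_one, mul_one, hu, P.p0_incl hI0 hN, ← fockRed_uh hI hJ' hIJ',
      P.p0_incl hI0 hN] at h1
    exact h1.symm

end

/-! ### Morphisms of Koszul complexes -/

namespace Kosz

open SMod

section

variable {P M P' M' P'' M'' : SMod S} (A : Act P M) (A' : Act P' M') (A'' : Act P'' M'') {U : S.Aff}

theorem kmap_kmap (f : P.C U →ₗ[S.O U] P'.C U) (hf) (g : M.C U →ₗ[S.O U] M'.C U)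
    (f' : P'.C U →ₗ[S.O U] P''.C U) (hf') (g' : M'.C U →ₗ[S.O U] M''.C U)
    (f'' : P.C U →ₗ[S.O U] P''.C U) (hf'') (g'' : M.C U →ₗ[S.O U] M''.C U)
    (h : ∀ x, f' (f x) = f'' x) (h' : ∀ m, g' (g m) = g'' m) : ∀ n (z : (K A n).C U),
    kmap A' A'' f' hf' g' n (kmap A A' f hf g n z) = kmap A A'' f'' hf'' g'' n z
  | 0, z => by
    obtain ⟨m, rfl⟩ := kz_surj A z
    rw [kmap_kz, kmap_kz, kmap_kz, h']
  | n + 1, z => by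
    induction z using k_ind with
    | h x z =>
      rw [kmap_otk, kmap_otk, kmap_otk, h,
        kmap_kmap f hf g f' hf' g' f'' hf'' g'' h h' n]
    | hadd a b ha hb => simp only [map_add, ha, hb]

theorem kmap_id (f : P.C U →ₗ[S.O U] P.C U) (hf) (g : M.C U →ₗ[S.O U] M.C U)
    (h : ∀ x, f x = x) (h' : ∀ m, g m = m) : ∀ n (z : (K A n).C U), kmap A A f hf g n z = z
  | 0, z => by
    obtain ⟨m, rfl⟩ := kz_surj A z
    rw [kmap_kz, h']
  | n + 1, z => by
    induction z using k_ind with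
    | h x z => rw [kmap_otk, h, kmap_id f hf g h h' n]
    | hadd a b ha hb => simp only [map_add, ha, hb]

end

variable {P M P' M' : SMod S} (A : Act P M) (A' : Act P' M') {U V : S.Aff} (f : P ⟶ P') (g : M ⟶ M')

/-- The map of exterior powers over an affine open. -/
abbrev kmapU (U : S.Aff) (n : ℕ) : (K A n).C U →+ (K A' n).C U :=
  kmap A A' (SMod.lin f U) (SMod.ap_par f) (SMod.lin g U) n

theorem kmapU_otk (n : ℕ) (x : P.C U) (z : (K A n).C U) :
    kmapU A A' f g U (n + 1) (otk A n x z) = otk A' n (ap f U x) (kmapU A A' f g U n z) :=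
  kmap_otk A A' _ _ _ n x z

theorem kmapU_smul (n : ℕ) (a : S.O U) (z : (K A n).C U) :
    kmapU A A' f g U n (a • z) = a • kmapU A A' f g U n z := by
  have := klift_smul A (mapTow A' (SMod.lin f U) (SMod.ap_par f)) ((kz A').comp
    (SMod.lin g U).toAddMonoidHom) (fun a m => by
      change kz A' (SMod.lin g U (a • m)) = _
      rw [map_smul]; rfl) n a z
  rwa [show S.tw 0 a = a by simp] at this

theorem kmapU_par : ∀ n (z : (K A n).C U),
    kmapU A A' f g U n ((K A n).par U z) = (K A' n).par U (kmapU A A' f g U n z)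
  | 0, z => by
    obtain ⟨m, rfl⟩ := kz_surj A z
    exact (congrArg (kz A') (ap_par g m)).trans rfl
  | n + 1, z => by
    induction z using k_ind with
    | h x z => rw [par_otk, kmapU_otk, kmapU_otk, par_otk, kmapU_par n, ap_par]
    | hadd a b ha hb => simp only [map_add, ha, hb]

theorem kmapU_res (k : V ≤ U) : ∀ n (z : (K A n).C U),
    kmapU A A' f g V n ((K A n).res k z) = (K A' n).res k (kmapU A A' f g U n z)
  | 0, z => by
    obtain ⟨m, rfl⟩ := kz_surj A z
    exact (congrArg (kz A') (ap_res g k m)).trans rfl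
  | n + 1, z => by
    induction z using k_ind with
    | h x z => rw [res_otk, kmapU_otk, kmapU_otk, res_otk, kmapU_res k n, ap_res]
    | hadd a b ha hb => simp only [map_add, ha, hb]

/-- The morphism of exterior powers. -/
def kmapHom (n : ℕ) : K A n ⟶ K A' n :=
  ⟨fun U => kmapU A A' f g U n, fun _ => kmapU_smul A A' f g n, fun _ => kmapU_par A A' f g n,
    fun _ _ k => kmapU_res A A' f g k n⟩

variable (h : ∀ (U : S.Aff) (x : P.C U) (m : M.C U), ap g U (A.a x m) = A'.a (ap f U x) (ap g U m))

/-- The morphism of Koszul complexes. -/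
def kChain : cx A ⟶ cx A' :=
  mkChainMap (fun n => kmapHom A A' f g n) fun n => by
    rw [cx_d, cx_d]
    exact SMod.hom_ext fun U z => (kmap_kd A A' _ _ _ (h U) n z).symm

/-- The map of Koszul complexes over an affine open. -/
abbrev kChainSec (U : S.Aff) : Cpx.Hom (sec A U) (sec A' U) :=
  secMap A A' (SMod.lin f U) (SMod.ap_par f) (SMod.lin g U) (h U)

theorem kChain_isQis (hq : ∀ U, (kChainSec A A' f g h U).Qis) : IsQis (kChain A A' f g h) :=
  isQis_of _ (fun U n => ap (kd _ n) U) (fun U n => ap (kd _ n) U)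
    (fun U n z => by rw [cx_d]) (fun U n z => by rw [cx_d])
    (fun U => kChainSec A A' f g h U) (fun U n z => rfl) hq

/-- The morphism of tensor powers. -/
def tmap : ∀ n, T A n ⟶ T A' n
  | 0 => g
  | n + 1 => otHom (Q := T A n) (Q' := T A' n) f (tmap n)

theorem kmapU_kp : ∀ n (t : (T A n).C U),
    kmapU A A' f g U n (ap (kp A n) U t) = ap (kp A' n) U (ap (tmap A A' f g n) U t)
  | 0, t => rfl
  | n + 1, t => by
    induction t using ot_ind (P := P) (Q := T A n) with
    | h x t =>
      refine (congrArg _ (otk_kp A n x t).symm).trans ?_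
      rw [kmapU_otk, kmapU_kp n t, otk_kp]
      rfl
    | hadd a b ha hb =>
      refine ((congrArg _ (map_add (ap (kp A (n + 1)) U) a b)).trans (map_add _ _ _)).trans
        ((congrArg₂ (· + ·) ha hb).trans ?_)
      exact (((congrArg _ (map_add (ap (tmap A A' f g (n + 1)) U) a b)).trans (map_add _ _ _))).symm

end Kosz

section

open Kosz SMod

variable {H : PreHeis S} {D : Conn H} {I J : H.toSMod.Sub} (R : RedCtx D I J) {U : S.Aff}

namespace RedCtx

/-- The identification of `J ∩ c(I)` with `J̄`. -/
abbrev subProj (R : RedCtx D I J) : (centSub I J).toSMod ⟶ (H.redSub I J).toSMod :=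
  subHom (centProj_mem (J := J) R.hI)

theorem subProj_bij (U : S.Aff) : Function.Bijective (ap R.subProj U) := by
  refine ⟨(injective_iff_map_eq_zero _).2 fun x hx => ?_, fun y => ?_⟩
  · have h1 : ap (H.toRed I) U (ap (centSub I J).incl U x) = 0 :=
      (subHom_incl (centProj_mem R.hI) x).symm.trans (by rw [hx, map_zero])
    have h2 : Pol.ic I U (ap (centSub I J).incl U x) ∈ I.C U :=
      (Submodule.Quotient.mk_eq_zero ((H.inCent I).C U)).1 h1
    refine SMod.Sub.el_ext (Pol.ic_inj ?_)
    rw [map_zero, map_zero]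
    exact (R.hP U).some.disj R.hJ _ h2 x.2
  · obtain ⟨x, hx, h⟩ := redSub_surj U y.1 y.2
    exact ⟨(centSub I J).el x hx, SMod.Sub.el_ext h⟩

/-- The inclusion of `J̄` in `J`. -/
def subIncl (R : RedCtx D I J) : (H.redSub I J).toSMod ⟶ J.toSMod :=
  SMod.invHom R.subProj R.subProj_bij ≫ subHom (centIncl_mem (J := J) R.hI)

theorem subIncl_subProj (x : (centSub I J).toSMod.C U) :
    ap R.subIncl U (ap R.subProj U x) = ap (subHom (centIncl_mem (J := J) R.hI)) U x :=
  congrArg (ap (subHom (centIncl_mem (J := J) R.hI)) U) (SMod.invHom_ap R.subProj R.subProj_bij x)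

variable (M : FlatMod H D)

/-- The invariants as a module over the centralizer. -/
abbrev cMod : FlatMod (H.centHeis I) (D.cent R.hI) := pullMod (centProj D R.hI) (M.invMod R.hI)

theorem subIncl_act (x : (H.redSub I J).toSMod.C U) (m : (M.inv I).toSMod.C U) :
    ap (M.inv I).incl U ((koszAct (redSub_abel R.hJ) (M.invMod R.hI)).a x m) =
      (koszAct R.hJ M).a (ap R.subIncl U x) (ap (M.inv I).incl U m) := by
  obtain ⟨x, rfl⟩ := (R.subProj_bij U).2 x
  rw [subIncl_subProj]
  rfl

/-- The map of Koszul complexes induced by the inclusions. -/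
def kIncl : Kosz.cx (koszAct (redSub_abel (I := I) R.hJ) (M.invMod R.hI)) ⟶
    Kosz.cx (koszAct R.hJ M) :=
  kChain _ _ R.subIncl (M.inv I).incl fun _ => R.subIncl_act M

theorem kIncl_isInclusion : IsInclusion R.hI R.hJ M (R.kIncl M) :=
  ⟨fun n U => ap (tmap (koszAct (redSub_abel R.hJ) (M.invMod R.hI)) (koszAct R.hJ M) R.subIncl
      (M.inv I).incl n) U, fun U m => rfl, fun n U x hx t => by
      refine (otAp_ot _ _ _ _).trans ?_
      congr 1
      exact R.subIncl_subProj ((centSub I J).el x hx),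
    fun n U t => kmapU_kp _ _ _ _ n t⟩

/-- The inverse of the identification of Koszul complexes. -/
def kInv : Kosz.cx (koszAct (redSub_abel (I := I) R.hJ) (M.invMod R.hI)) ⟶
    Kosz.cx (koszAct (centSub_abel (I := I) R.hJ) (R.cMod M)) :=
  kChain _ _ (SMod.invHom R.subProj R.subProj_bij) (𝟙 _) fun U x m => by
    obtain ⟨x, rfl⟩ := (R.subProj_bij U).2 x
    rw [SMod.invHom_ap]
    rfl

theorem kAp_proj_kInv (n : ℕ) (z) :
    kAp (centProj_mem R.hI) (pullHom (centProj D R.hI) (M.invMod R.hI)) (centSub_abel R.hJ)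
      (redSub_abel R.hJ) U n (ap ((R.kInv M).f n) U z) = z := by
  refine (kmap_kmap _ _ _ _ _ _ _ _ _ LinearMap.id (fun _ => rfl) LinearMap.id
    (fun x => SMod.ap_invHom R.subProj R.subProj_bij x) (fun _ => rfl) n z).trans ?_
  exact kmap_id _ _ _ _ (fun _ => rfl) (fun _ => rfl) n z

theorem kInv_kAp_proj (n : ℕ) (z) : ap ((R.kInv M).f n) U
    (kAp (centProj_mem R.hI) (pullHom (centProj D R.hI) (M.invMod R.hI)) (centSub_abel R.hJ)
      (redSub_abel R.hJ) U n z) = z := by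
  refine (kmap_kmap _ _ _ _ _ _ _ _ _ LinearMap.id (fun _ => rfl) LinearMap.id
    (fun x => SMod.invHom_ap R.subProj R.subProj_bij x) (fun _ => rfl) n z).trans ?_
  exact kmap_id _ _ _ _ (fun _ => rfl) (fun _ => rfl) n z

theorem kAp_incl_kInv (n : ℕ) (z) :
    kAp (centIncl_mem R.hI) (invIncl R.hI M) (centSub_abel R.hJ) R.hJ U n
      (ap ((R.kInv M).f n) U z) = ap ((R.kIncl M).f n) U z :=
  kmap_kmap _ _ _ _ _ _ _ _ _ _ _ _ (fun _ => rfl) (fun _ => rfl) n z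

theorem kSecMap_proj_qis (U : S.Aff) :
    (kSecMap (centProj_mem R.hI) (pullHom (centProj D R.hI) (M.invMod R.hI)) (centSub_abel R.hJ)
      (redSub_abel R.hJ) U).Qis :=
  .of_bijective fun n => Function.bijective_iff_has_inverse.2
    ⟨ap ((R.kInv M).f n) U, R.kInv_kAp_proj M n, R.kAp_proj_kInv M n⟩

variable {M} in
theorem kIncl_isQis (hM : M.LocNilp I) : IsQis (R.kIncl M) :=
  kChain_isQis _ _ _ _ _ fun U => .of_comp (R.kSecMap_proj_qis M U)
    ((R.hP U).some.inc_qis R.hI0 hM R.hJ R.hI) fun n z => by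
      have := R.kAp_incl_kInv M n (kAp (centProj_mem R.hI) (pullHom (centProj D R.hI)
        (M.invMod R.hI)) (centSub_abel R.hJ) (redSub_abel R.hJ) U n z)
      rw [kInv_kAp_proj] at this
      exact this

end RedCtx

end

/-! ### The isomorphism of derived coinvariants -/

section

variable {H H' : PreHeis S} {D : Conn H} {D' : Conn H'} {F : HHom D D'} {J : H.toSMod.Sub}
  {J' : H'.toSMod.Sub} (hF : ∀ U, ∀ x ∈ J.C U, SMod.ap F.φ U x ∈ J'.C U) {M : FlatMod H D}
  {M' : FlatMod H' D'} (G : ModHom F M M') {U : S.Aff}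
  (hJ : ∀ U, ∀ x ∈ J.C U, ∀ y ∈ J.C U, H.br U x y = 0)
  (hJ' : ∀ U, ∀ x ∈ J'.C U, ∀ y ∈ J'.C U, H'.br U x y = 0)

/-- The map of Koszul complexes followed by the comparison map. -/
def kCompSec (U : S.Aff) : Cpx.Hom (Kosz.sec (koszAct hJ M) U) (barSec J' M' U) :=
  ⟨fun n => (compAp hJ' M' U n).comp (kAp hF G hJ hJ' U n), fun n z =>
    (congrArg _ (kAp_kd hF G hJ hJ' n z)).trans (compAp_comm hJ' M' n _)⟩

theorem barSecMap_qis (h : (compSec hJ M U).Qis) (h' : (compSec hJ' M' U).Qis)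
    (hk : (kSecMap hF G hJ hJ' U).Qis) : (barSecMap hF G U).Qis :=
  h.of_comp (hk.comp h' (χ := kCompSec hF G hJ hJ' U) fun _ _ => rfl) fun n z =>
    (compAp_nat hF G hJ hJ' n z).symm

end

namespace RedCtx

open Kosz SMod Bar

variable {H : PreHeis S} {D : Conn H} {I J : H.toSMod.Sub} (R : RedCtx D I J) {U V : S.Aff}
  {p q : ZMod 2}

theorem toCent_eq {A : AA H D J U p} {B : AA (H.centHeis I) (D.cent R.hI) (centSub I J) U p}
    (h : Compat (centIncl D R.hI) (centIncl_mem R.hI) B A) : R.toCent A = B :=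
  AA.ext ((R.toCent_compat A).1.symm.trans h.1) fun V k m => (R.bM_bij V).1
    (((R.toCent_compat A).2 V k m).trans (h.2 V k m).symm)

/-- Restriction of scalars from the Lie algebroid of the centralizer. -/
@[reducible] def centPull (R : RedCtx D I J) :
    AMod (H.centHeis I) (D.cent R.hI) (centSub I J) ⥤ AMod H D J where
  obj M :=
    { toSMod := M.toSMod
      act := fun {U p} => M.act.comp (AddMonoidHom.mk' R.toCent fun A B =>
        R.toCent_eq ((R.toCent_compat A).add (R.toCent_compat B)))
      act_dop := fun A => by
        have := M.act_dop (R.toCent A)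
        rwa [← (R.toCent_compat A).1] at this
      act_smul := fun f hf A m => by
        have := M.act_smul f hf (R.toCent A) m
        rwa [← R.toCent_eq ((R.toCent_compat A).smul f hf)] at this
      act_br := fun A B m => by
        have := M.act_br (R.toCent A) (R.toCent B) m
        rwa [← R.toCent_eq ((R.toCent_compat A).br (R.toCent_compat B))] at this
      act_res := fun h A m => by
        have := M.act_res h (R.toCent A) m
        rwa [← R.toCent_eq ((R.toCent_compat A).res h)] at this }
  map f := ⟨f.1, fun U p A m => f.2 U p (R.toCent A) m⟩

instance : R.centPull.Additive where
  map_add := rfl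

variable (M : FlatMod H D)

/-- The derived coinvariants of `M^I` over the centralizer. -/
abbrev centBar : ChainComplex (AMod H D J) ℕ :=
  (R.centPull.mapHomologicalComplex _).obj (barCx (centSub I J) (R.cMod M))

theorem centBar_d (n : ℕ) : (R.centBar M).d (n + 1) n =
    R.centPull.map ((coinv (centSub I J)).map (e (R.cMod M) (n + 1))) :=
  congrArg R.centPull.map (barCx_d (centSub I J) (R.cMod M) n)

/-- The derived coinvariants of `M^I` over `c(I) / I`. -/
abbrev redBar : ChainComplex (AMod H D J) ℕ :=
  ((AMod.pull R.algIso).mapHomologicalComplex _).obj (barCx (H.redSub I J) (M.invMod R.hI))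

theorem redBar_d (n : ℕ) : (R.redBar M).d (n + 1) n =
    (AMod.pull R.algIso).map ((coinv (H.redSub I J)).map (e (M.invMod R.hI) (n + 1))) :=
  congrArg (AMod.pull R.algIso).map (barCx_d (H.redSub I J) (M.invMod R.hI) n)

/-- The map of derived coinvariants induced by the projection of the centralizer. -/
def toRedBar : R.centBar M ⟶ R.redBar M :=
  mkChainMap (fun n => ⟨cHom (centProj D R.hI) (centProj_mem R.hI)
      ((pullHom (centProj D R.hI) (M.invMod R.hI)).pw (n + 1)), fun U p A z => by
        refine ((R.toRed_compat (R.toCent A)).cAp _ z).trans ?_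
        change _ = (Cobj _ _).act (R.algIso.eqv A) _
        rw [R.algIso_eqv]
        rfl⟩) fun n => by
    rw [centBar_d, redBar_d]
    exact Subtype.ext (SMod.hom_ext fun U z => (cAp_comm (centProj_mem R.hI)
      (pullHom (centProj D R.hI) (M.invMod R.hI)) n z).symm)

/-- The map of derived coinvariants induced by the inclusion of the centralizer. -/
def toBar : R.centBar M ⟶ barCx J M :=
  mkChainMap (fun n => ⟨cHom (centIncl D R.hI) (centIncl_mem R.hI)
      ((invIncl R.hI M).pw (n + 1)), fun U p A z => (R.toCent_compat A).cAp _ z⟩) fun n => by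
    rw [centBar_d, barCx_d]
    exact Subtype.ext (SMod.hom_ext fun U z => (cAp_comm (centIncl_mem R.hI)
      (invIncl R.hI M) n z).symm)

/-- The comparison map for the centralizer. -/
def centComp : Kosz.cx (koszAct (centSub_abel (I := I) R.hJ) (R.cMod M)) ⟶
    (und H D J).obj (R.centBar M) :=
  mkChainMap (fun n => compHom (centSub_abel R.hJ) (R.cMod M) n) fun n => by
    have h := congrArg AMod.forget.map (R.centBar_d M n)
    rw [cx_d]
    refine (congrArg _ h).trans ?_
    exact SMod.hom_ext fun U z => (compAp_comm (centSub_abel R.hJ) (R.cMod M) n z).symm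

theorem kInv_toRedBar : R.kInv M ≫ R.centComp M ≫ (und H D J).map (R.toRedBar M) =
    comp (redSub_abel R.hJ) (M.invMod R.hI) :=
  HomologicalComplex.hom_ext _ _ fun n => SMod.hom_ext fun U z =>
    (compAp_nat (centProj_mem R.hI) (pullHom (centProj D R.hI) (M.invMod R.hI))
      (centSub_abel R.hJ) (redSub_abel R.hJ) n (ap ((R.kInv M).f n) U z)).trans
      (congrArg _ (R.kAp_proj_kInv M n z))

theorem kInv_toBar : R.kInv M ≫ R.centComp M ≫ (und H D J).map (R.toBar M) =
    R.kIncl M ≫ comp R.hJ M :=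
  HomologicalComplex.hom_ext _ _ fun n => SMod.hom_ext fun U z =>
    (compAp_nat (centIncl_mem R.hI) (invIncl R.hI M)
      (centSub_abel R.hJ) R.hJ n (ap ((R.kInv M).f n) U z)).trans
      (congrArg _ (R.kAp_incl_kInv M n z))

variable (hB : ∀ U, Nonempty (DualBasis H J U))

include hB in
theorem compSec_cent_qis (U : S.Aff) : (compSec (centSub_abel (I := I) R.hJ) (R.cMod M) U).Qis :=
  compSec_qis (centSub_abel R.hJ) (R.hP U).some.oi.cent
    ((hB U).some.cent R.hJ (R.hP U).some) (R.cMod M)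

include hB in
theorem compSec_red_qis (U : S.Aff) :
    (compSec (redSub_abel (I := I) R.hJ) (M.invMod R.hI) U).Qis :=
  compSec_qis (redSub_abel R.hJ) ((R.hP U).some.oi.red (R.disj U))
    (((hB U).some.cent R.hJ (R.hP U).some).map (centProj D R.hI) (centProj_mem R.hI) redSub_surj)
    (M.invMod R.hI)

include hB in
theorem barSecMap_proj_qis (U : S.Aff) :
    (barSecMap (centProj_mem (J := J) R.hI) (pullHom (centProj D R.hI) (M.invMod R.hI)) U).Qis :=
  barSecMap_qis _ _ (centSub_abel R.hJ) (redSub_abel R.hJ) (R.compSec_cent_qis M hB U)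
    (R.compSec_red_qis M hB U) (R.kSecMap_proj_qis M U)

variable {M} in
include hB in
theorem barSecMap_incl_qis (hM : M.LocNilp I) (U : S.Aff) :
    (barSecMap (centIncl_mem (J := J) R.hI) (invIncl R.hI M) U).Qis :=
  barSecMap_qis _ _ (centSub_abel R.hJ) R.hJ (R.compSec_cent_qis M hB U)
    (compSec_qis R.hJ (R.hP U).some.oi (hB U).some M)
    ((R.hP U).some.inc_qis R.hI0 hM R.hJ R.hI)

include hB in
theorem toRedBar_qis : aqis H D J (R.toRedBar M) :=
  isQis_of ((und H D J).map (R.toRedBar M))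
    (fun U n => cmap (centSub I J) (e (R.cMod M) (n + 1)) U)
    (fun U n => cmap (H.redSub I J) (e (M.invMod R.hI) (n + 1)) U)
    (fun U n z => (DFunLike.congr_fun (congrArg (fun f => ap (AMod.forget.map f) U)
      (R.centBar_d M n)) z).symm)
    (fun U n z => (DFunLike.congr_fun (congrArg (fun f => ap (AMod.forget.map f) U)
      (R.redBar_d M n)) z).symm)
    (fun U => barSecMap (centProj_mem R.hI) (pullHom (centProj D R.hI) (M.invMod R.hI)) U)
    (fun _ _ _ => rfl) (R.barSecMap_proj_qis M hB)

variable {M} in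
include hB in
theorem toBar_qis (hM : M.LocNilp I) : aqis H D J (R.toBar M) :=
  isQis_of ((und H D J).map (R.toBar M))
    (fun U n => cmap (centSub I J) (e (R.cMod M) (n + 1)) U)
    (fun U n => cmap J (e M (n + 1)) U)
    (fun U n z => (DFunLike.congr_fun (congrArg (fun f => ap (AMod.forget.map f) U)
      (R.centBar_d M n)) z).symm)
    (fun U n z => (DFunLike.congr_fun (congrArg (fun f => ap (AMod.forget.map f) U)
      (barCx_d J M n)) z).symm)
    (fun U => barSecMap (centIncl_mem R.hI) (invIncl R.hI M) U)
    (fun _ _ _ => rfl) (R.barSecMap_incl_qis hB hM)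

end RedCtx

section

variable {H : PreHeis S} {D : Conn H} {J : H.toSMod.Sub} {X Y Z : ChainComplex (AMod H D J) ℕ}

theorem dForget_Q (f : X ⟶ Y) :
    (dForget H D J).map ((aqis H D J).Q.map f) = (qis S).Q.map ((und H D J).map f) := by
  have := Functor.congr_hom (Localization.Construction.fac (W := aqis H D J)
    (und H D J ⋙ (qis S).Q) fun _ _ _ hf => MorphismProperty.Q_inverts (qis S) _ hf) f
  exact this.trans ((Category.id_comp _).trans (Category.comp_id _))

theorem comp_comp_eq {𝒞 : Type*} [Category 𝒞] {C X Y Z : 𝒞} {a : C ⟶ X} {f : X ⟶ Y} {i : Y ⟶ X}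
    {g : X ⟶ Z} (hi : f ≫ i = 𝟙 X) : (a ≫ f) ≫ (i ≫ g) = a ≫ g := by
  rw [Category.assoc, reassoc_of% hi]

theorem exists_iso_of_qis (f : X ⟶ Y) (g : X ⟶ Z) (hf : aqis H D J f) (hg : aqis H D J g)
    {C : ChainComplex (SMod S) ℕ} (κ : C ⟶ (und H D J).obj X) (κ' : C ⟶ (und H D J).obj Y)
    (m : C ⟶ (und H D J).obj Z) (h : κ ≫ (und H D J).map f = κ')
    (h' : κ ≫ (und H D J).map g = m) :
    ∃ φ : (aqis H D J).Q.obj Y ≅ (aqis H D J).Q.obj Z,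
      (qis S).Q.map κ' ≫ (dForget H D J).map φ.hom = (qis S).Q.map m := by
  have h1 : IsIso ((aqis H D J).Q.map f) := MorphismProperty.Q_inverts _ _ hf
  have h2 : IsIso ((aqis H D J).Q.map g) := MorphismProperty.Q_inverts _ _ hg
  refine ⟨(asIso ((aqis H D J).Q.map f)).symm ≪≫ asIso ((aqis H D J).Q.map g), ?_⟩
  have e : (qis S).Q.map ((und H D J).map f) ≫
      (dForget H D J).map (inv ((aqis H D J).Q.map f)) = 𝟙 _ :=
    (congrArg (· ≫ (dForget H D J).map (inv ((aqis H D J).Q.map f))) (dForget_Q f).symm).trans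
      (((dForget H D J).map_comp _ _).symm.trans
        ((congrArg (dForget H D J).map (IsIso.hom_inv_id ((aqis H D J).Q.map f))).trans
          ((dForget H D J).map_id _)))
  have e' : (dForget H D J).map (inv ((aqis H D J).Q.map f) ≫ (aqis H D J).Q.map g) =
      (dForget H D J).map (inv ((aqis H D J).Q.map f)) ≫ (qis S).Q.map ((und H D J).map g) :=
    ((dForget H D J).map_comp _ _).trans (congrArg (_ ≫ ·) (dForget_Q g))
  subst h h'
  exact (congrArg₂ (· ≫ ·) ((qis S).Q.map_comp _ _) e').trans
    ((comp_comp_eq e).trans ((qis S).Q.map_comp _ _).symm)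

end

/-- The derived coinvariants of `M^I` and of `M` are isomorphic, compatibly with the map of Koszul
complexes. -/
theorem RedCtx.exists_iso {H : PreHeis S} {D : Conn H} {I J : H.toSMod.Sub} (R : RedCtx D I J)
    (hB : ∀ U, Nonempty (DualBasis H J U)) {M : FlatMod H D} (hM : M.LocNilp I) :
    ∃ φ : (aqis H D J).Q.obj (((AMod.pull R.algIso).mapHomologicalComplex _).obj
        (barCx (H.redSub I J) (M.invMod R.hI))) ≅ (aqis H D J).Q.obj (barCx J M),
      (qis S).Q.map (comp (redSub_abel R.hJ) (M.invMod R.hI)) ≫ (dForget H D J).map φ.hom =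
        (qis S).Q.map (R.kIncl M) ≫ (qis S).Q.map (comp R.hJ M) := by
  rw [← Functor.map_comp]
  exact exists_iso_of_qis (R.toRedBar M) (R.toBar M) (R.toRedBar_qis M hB) (R.toBar_qis hB hM)
    (R.kInv M ≫ R.centComp M) _ _ ((Category.assoc _ _ _).trans (R.kInv_toRedBar M))
    ((Category.assoc _ _ _).trans (R.kInv_toBar M))

/-- The comparison maps, the map of Koszul complexes, and the isomorphism of derived coinvariants
which they induce. -/
theorem RedCtx.exists_derived_iso {H : PreHeis S} {D : Conn H} {I J : H.toSMod.Sub}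
    (R : RedCtx D I J) (hB : ∀ U, Nonempty (DualBasis H J U)) (hI : D.Preserves I)
    (hJ : ∀ U, ∀ x ∈ J.C U, ∀ y ∈ J.C U, H.br U x y = 0) (M : FlatMod H D) (hM : M.LocNilp I) :
    ∃ (κ : Kosz.cx (koszAct hJ M) ⟶ (und H D J).obj (barCx J M))
      (κ' : Kosz.cx (koszAct (redSub_abel hJ) (M.invMod hI)) ⟶
        (und (H.red I) (D.red hI) (H.redSub I J)).obj (barCx (H.redSub I J) (M.invMod hI)))
      (k : Kosz.cx (koszAct (redSub_abel hJ) (M.invMod hI)) ⟶ Kosz.cx (koszAct hJ M)),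
      IsComparison hJ M κ ∧
      IsComparison (redSub_abel hJ) (M.invMod hI) κ' ∧
      IsInclusion hI hJ M k ∧
      IsIso ((qis S).Q.map κ) ∧ IsIso ((qis S).Q.map κ') ∧ IsIso ((qis S).Q.map k) ∧
      ∃ φ : (aqis H D J).Q.obj (((AMod.pull (D' := D.red hI) R.algIso).mapHomologicalComplex _).obj
            (barCx (H.redSub I J) (M.invMod hI))) ≅ (aqis H D J).Q.obj (barCx J M),
        (qis S).Q.map κ' ≫ (dForget H D J).map φ.hom =
          (qis S).Q.map k ≫ (qis S).Q.map κ := by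
  have e : hI = R.hI := rfl
  subst e
  have e : hJ = R.hJ := rfl
  subst e
  have h1 : IsQis (comp R.hJ M) := comp_isQis _ _ fun U =>
    compSec_qis R.hJ (R.hP U).some.oi (hB U).some M
  have h2 : IsQis (comp (redSub_abel (I := I) R.hJ) (M.invMod R.hI)) := comp_isQis _ _
    (R.compSec_red_qis M hB)
  exact ⟨comp R.hJ M, comp (redSub_abel R.hJ) (M.invMod R.hI), R.kIncl M,
    comp_isComparison _ _, comp_isComparison _ _, R.kIncl_isInclusion M,
    MorphismProperty.Q_inverts (qis S) _ h1, MorphismProperty.Q_inverts (qis S) _ h2,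
    MorphismProperty.Q_inverts (qis S) _ (R.kIncl_isQis hM), R.exists_iso hB hM⟩

end SuperHeis

end

theorem proposition3p13 (S : SuperScheme.{u}) (H : PreHeis S) (hH : H.IsHeisenberg)
    (D : Conn H) (I J : H.toSMod.Sub) (hI : H.IsIsotropic I) (hIp : D.Preserves I)
    (hJ : H.IsIsotropic J) (hIJ : ∀ U, (H.cent I).C U ⊔ J.C U = ⊤) :
    ∃ Φ : AlgIso H D J (H.red I) (D.red hIp) (H.redSub I J),
      (∃ θ : Mr (H.red I) (H.redSub I J) ≅ redTens H I J,
        (∀ (U : S.Aff) (u : UH (H.red I) U),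
          SMod.ap θ.hom U (Mr.mk (H.redSub I J) u) = rt H I J (Mr.mk J 1) u) ∧
        ∀ (U : S.Aff) (p : ZMod 2) (A : AA H D J U p) (V : S.Aff) (h : V ≤ U)
          (m : (Mr H J).C V) (u : UH (H.red I) V),
          SMod.ap θ.hom V ((Φ.eqv A).ap h (SMod.ap θ.inv V (rt H I J m u))) =
            rt H I J (A.ap h m) u +
              rt H I J ((Mr H J).tw p m) (UH.del (D.red hIp) (VF.res h A.anchor) u)) ∧
      (∀ M : FlatMod H D, M.LocNilp I →
        ∃ (κ : Kosz.cx (koszAct hJ.br_zero M) ⟶ (und H D J).obj (barCx J M))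
          (κ' : Kosz.cx (koszAct (redSub_abel hJ.br_zero) (M.invMod hIp)) ⟶
            (und (H.red I) (D.red hIp) (H.redSub I J)).obj
              (barCx (H.redSub I J) (M.invMod hIp)))
          (k : Kosz.cx (koszAct (redSub_abel hJ.br_zero) (M.invMod hIp)) ⟶
            Kosz.cx (koszAct hJ.br_zero M)),
          IsComparison hJ.br_zero M κ ∧
          IsComparison (redSub_abel hJ.br_zero) (M.invMod hIp) κ' ∧
          IsInclusion hIp hJ.br_zero M k ∧
          IsIso ((qis S).Q.map κ) ∧ IsIso ((qis S).Q.map κ') ∧ IsIso ((qis S).Q.map k) ∧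
          ∃ φ : (aqis H D J).Q.obj (((AMod.pull Φ).mapHomologicalComplex _).obj
                (barCx (H.redSub I J) (M.invMod hIp))) ≅ (aqis H D J).Q.obj (barCx J M),
            (qis S).Q.map κ' ≫ (dForget H D J).map φ.hom =
              (qis S).Q.map k ≫ (qis S).Q.map κ) ∧
      (∀ (J' : H.toSMod.Sub) (hJ' : D.Preserves J'), H.IsIsotropic J' →
        (∀ U, I.C U ≤ J'.C U) → (fock hJ').LocNilp I ∧
        ∃ ψ : fock (hIp.redSub hJ') ≅ (fock hJ').invMod hIp,
          ∀ U : S.Aff, (SMod.ap (FlatMod.toHom ψ.hom) U (fmk (H.redSub I J') 1)).1 = fmk J' 1) := by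
  have hB := exists_dualBasis hH hJ
  have R : RedCtx D I J := ⟨hJ.br_zero, hIp, Pol.exists_pol hH hI hIJ, hI.br_zero, fun U f hf =>
    (Submodule.mem_bot _).1 ((hI.disj U).le ⟨hf, Submodule.smul_mem _ f
      (Submodule.mem_span_singleton_self _)⟩)⟩
  refine ⟨R.algIso, ⟨R.theta, fun U u => R.theta_mk u, fun U p A V h m u => R.theta_algIso A h m u⟩,
    R.exists_derived_iso hB hIp hJ.br_zero, fun J' hJ' hJ'i hIJ' => ?_⟩
  refine ⟨fock_locNilp hJ' hIJ', FlatMod.isoOfBij (fockRed hIp hJ' hIJ') fun U =>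
    fockRed_bij hIp hJ' hIJ' hJ'i.br_zero hJ.br_zero (R.hP U).some, fun U => ?_⟩
  have h := fockRed_uh hIp hJ' hIJ' (U := U) 1
  rw [map_one, map_one] at h
  exact h
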